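/- **Setting.** Let $n^*,m^*\ge 1$. The target is an open set $U\subset\mathbb R^{4(n^*+m^*)}$ with four real coordinates for each of $n^*$ ordinary multiplets (flavour $a$) and $m^*$ mirror multiplets (flavour $\alpha$), combined into complex coordinates $v^1_a=x^3_a-ix^4_a$, $v^2_a=x^1_a-ix^2_a$ and $w^1_\alpha=x^3_\alpha+ix^4_\alpha$, $w^2_\alpha=x^1_\alpha+ix^2_\alpha$. Let $\epsilon_{12}=-\epsilon_{21}=1$, $\epsilon^{mn}=-\epsilon_{mn}$. With $D=\partial_\theta-i\bar\theta\partial_t$, $\bar D=-\partial_{\bar\theta}+i\theta\partial_t$ and $V^m=v^m+\sqrt2\,\theta\psi^m-i\theta\bar\theta\dot v^m$, $W^\mu=w^\mu+\sqrt2\,\theta\chi^\mu-i\theta\bar\theta\dot w^\mu$, the ordinary and mirror linear $(4,4,0)$ superfields are $$\mathcal V^m=V^m+\eta\,\epsilon^{mn}\bar D\bar V^{\bar n}-i\eta\bar\eta\,\dot V^m,\qquad \mathcal W^\mu=W^\mu+\bar\eta\,\epsilon^{\mu\nu}\bar D\bar W^{\bar\nu}+i\eta\bar\eta\,\dot W^\mu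 .$$ Let $\mathcal L$ be a smooth real function on $U$ (the prepotential) and consider the action $$\tfrac14\int dt\,d\theta\,d\bar\theta\,d\eta\,d\bar\eta\;\mathcal L(\mathcal V,\bar{\mathcal V},\mathcal W,\bar{\mathcal W}).$$ Put $$h^{ab}_{m\bar n}=\bigl(\partial^a_m\bar\partial^b_{\bar n}+\epsilon_{mk}\epsilon_{\bar n\bar l}\,\bar\partial^a_{\bar k}\partial^b_l\bigr)\mathcal L,\qquad h^{\alpha\beta}_{\mu\bar\nu}=-\bigl(\partial^\alpha_\mu\bar\partial^\beta_{\bar\nu}+\epsilon_{\mu\lambda}\epsilon_{\bar\nu\bar\rho}\,\bar\partial^\alpha_{\bar\lambda}\partial^\beta_\rho\bigr)\mathcal L,$$ and assume that the metric $g_{MN}dx^Mdx^N=2h^{ab}_{m\bar n}dv^m_ad\bar v^{\bar n}_b+2h^{\alpha\beta}_{\mu\bar\nu}dw^\mu_\alpha d\bar w^{\bar\nu}_\beta$ is positive definite on $U$. Let $e^A_M$ be any smooth vielbein of $g$ on $U$. Phase space has coordinates $x^M$, momenta $P_M$ (taken at fixed $\Psi^A$) and real odd variables $\Psi^A$, with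 the graded Poisson bracket $\{x^M,P_N\}=\delta^M_N$, $\{\Psi^A,\Psi^B\}=-i\delta^{AB}$. Put $\Psi^M=e^M_A\Psi^A$ and $\Pi_M=P_M+\frac i2e^A_N(\partial_Me^A_K)\Psi^N\Psi^K$ (the momenta at fixed $\Psi^M$); $\psi^m_a,\chi^\mu_\alpha,\bar\psi^{\bar m}_a,\bar\chi^{\bar\mu}_\alpha$ and $\Pi^a_m,\Pi^\alpha_\mu,\bar\Pi^a_{\bar m},\bar\Pi^\alpha_{\bar\mu}$ are the complex components of $\Psi^M$ and $\Pi_M$. The complex supercharges are $$\begin{aligned}S=\ &\sqrt2\,\psi^m_a\Bigl(\Pi^a_m-\tfrac i2\partial^a_mh^{bc}_{k\bar l}\psi^k_b\bar\psi^{\bar l}_c-\tfrac i2\partial^a_mh^{\beta\gamma}_{\nu\bar\lambda}\chi^\nu_\beta\bar\chi^{\bar\lambda}_\gamma+\tfrac i2\epsilon_{mn}\epsilon_{\nu\lambda}\bar\partial^a_{\bar n}h^{\alpha\beta}_{\mu\bar\lambda}\chi^\mu_\alpha\chi^\nu_\beta\Bigr)\\&+\sqrt2\,\chi^\mu_\alpha\Bigl(\Pi^\alpha_\mu-\tfrac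 i2\partial^\alpha_\mu h^{\beta\gamma}_{\nu\bar\lambda}\chi^\nu_\beta\bar\chi^{\bar\lambda}_\gamma-\tfrac i2\partial^\alpha_\mu h^{bc}_{k\bar l}\psi^k_b\bar\psi^{\bar l}_c+\tfrac i2\epsilon_{\mu\nu}\epsilon_{nk}\bar\partial^\alpha_{\bar\nu}h^{ab}_{m\bar k}\psi^m_a\psi^n_b\Bigr),\\ R=\ &\sqrt2\,\psi^n_a\epsilon_{nm}\Bigl(\bar\Pi^a_{\bar m}-\tfrac i2\bar\partial^a_{\bar m}h^{bc}_{k\bar l}\psi^k_b\bar\psi^{\bar l}_c+\tfrac i2\bar\partial^a_{\bar m}h^{\beta\gamma}_{\nu\bar\lambda}\chi^\nu_\beta\bar\chi^{\bar\lambda}_\gamma-\tfrac i2\epsilon_{\bar m\bar k}\epsilon_{\bar\mu\bar\lambda}\partial^a_kh^{\alpha\beta}_{\lambda\bar\nu}\bar\chi^{\bar\mu}_\alpha\bar\chi^{\bar\nu}_\beta\Bigr)\\&-\sqrt2\,\bar\chi^{\bar\nu}_\alpha\epsilon_{\bar\nu\bar\mu}\Bigl(\Pi^\alpha_\mu+\tfrac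 i2\partial^\alpha_\mu h^{\beta\gamma}_{\nu\bar\lambda}\chi^\nu_\beta\bar\chi^{\bar\lambda}_\gamma-\tfrac i2\partial^\alpha_\mu h^{bc}_{k\bar l}\psi^k_b\bar\psi^{\bar l}_c+\tfrac i2\epsilon_{\mu\lambda}\epsilon_{nk}\bar\partial^\alpha_{\bar\lambda}h^{ab}_{m\bar k}\psi^m_a\psi^n_b\Bigr),\end{aligned}$$ together with their complex conjugates $\bar S,\bar R$. Finally let $I^p=\mathrm{diag}(\mathcal I_p,\dots,\mathcal I_p,-\mathcal I_p,\dots,-\mathcal I_p)$, $p=1,2,3$ ($n^*$ blocks $\mathcal I_p$, $m^*$ blocks $-\mathcal I_p$), where $(I^p)_M{}^N$ has row index $M$ and $$\mathcal I_1=\begin{pmatrix}0&-1&0&0\\1&0&0&0\\0&0&0&-1\\0&0&1&0\end{pmatrix},\quad \mathcal I_2=\begin{pmatrix}0&0&1&0\\0&0&0&-1\\-1&0&0&0\\0&1&0&0\end{pmatrix},\quad \mathcal I_3=\begin{pmatrix}0&0&0&1\\0&0&1&0\\0&-1&0&0\\-1&0&0&0\end{pmatrix}.$$ **Theorem 1.**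 There are a totally antisymmetric smooth tensor $C_{MNL}$ and totally antisymmetric tensors $H^p_{MNL}$ ($p=1,2,3$) on $U$, independent of the vielbein, such that: 1. $(U,g)$ with $I^p$, $C$, $H^p$ is a CKT (bi-HKT) manifold. That is: each $I^p$ is an integrable complex structure with $I^p_{MN}=-I^p_{NM}$; $\{I^p,I^q\}=-2\delta^{pq}$, while neither $(I^p)$ nor $(-I^p)$ satisfies the quaternion algebra; for every $p$, $C=B^p+H^p$, where $B^p_{MNK}=I_M{}^PI_N{}^QI_K{}^R(\nabla_PI_{QR}+\nabla_QI_{RP}+\nabla_RI_{PQ})$, with $I=I^p$ and $\nabla$ the Levi-Civita connection, is the Bismut torsion of $I^p$; and $H^p=\partial\beta^p+\overline{\partial\beta^p}$ for a smooth $(2,0)$-form $\beta^p$, where types and the exterior holomorphic derivative $\partial$ refer to $I^p$ (an exact $(3,0)$-form plus its $(0,3)$ conjugate). 2. Let $\Omega_{MNL}=e^A_Ne^B_Le_{AS}(\partial_Me^S_B+\Gamma^S_{MK}e^K_B)$ be the spin connection. The supercharges $$\begin{aligned}Q&=\Psi^M\bigl(P_M-\tfrac i2\Omega_{MNL}\Psi^N\Psi^L+\tfrac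 i{12}C_{MNL}\Psi^N\Psi^L\bigr),\\Q^p&=\Psi^S(I^p)_S{}^M\bigl(P_M-\tfrac i2\Omega_{MNL}\Psi^N\Psi^L-\tfrac i4B^p_{MNL}\Psi^N\Psi^L+\tfrac i{12}H^p_{MNL}\Psi^N\Psi^L\bigr)\end{aligned}$$ are real and equivalent to $S,\bar S,R,\bar R$: $\sqrt2\,S=Q-iQ^1$, $\sqrt2\,\bar S=Q+iQ^1$, $\sqrt2\,R=-Q^2+iQ^3$, $\sqrt2\,\bar R=-Q^2-iQ^3$. 3. The superfield Lagrangian equals, up to a total time derivative, $\frac12g_{MN}\dot x^M\dot x^N+\frac i2g_{MN}\Psi^M\dot\Psi^N+\dot x^MA_{MNK}\Psi^N\Psi^K-F_{MNKL}\Psi^M\Psi^N\Psi^K\Psi^L$ for some coefficient functions $A,F$ on $U$, and with the resulting Hamiltonian $$\mathsf H=\tfrac12g^{MN}(\Pi_M-A_{MKL}\Psi^K\Psi^L)(\Pi_N-A_{NKL}\Psi^K\Psi^L)+F_{MNKL}\Psi^M\Psi^N\Psi^K\Psi^L$$ the four supercharges $(Q_0,Q_1,Q_2,Q_3)=(Q,Q^1,Q^2,Q^3)$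 satisfy the $N=4$ supersymmetry algebra, which for the above Poisson bracket and normalization reads $\{Q_a,Q_b\}=-2i\,\delta_{ab}\,\mathsf H$. -/

import Mathlib

open scoped ContDiff

noncomputable section

namespace BiHKT

/-! ### Grassmann algebra -/

/-- The complex Grassmann algebra with one odd generator for each `k : κ`. -/
abbrev Gr (κ : Type) : Type := ExteriorAlgebra ℂ (κ → ℂ)

section Grassmann

variable {κ : Type} [Fintype κ] [DecidableEq κ]

/-- The odd generator labelled by `k`. -/
def gen (k : κ) : Gr κ := ExteriorAlgebra.ι ℂ (Pi.single k (1 : ℂ))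

/-- Left derivative with respect to the generator labelled by `k`. -/
def leftD (k : κ) : Gr κ →ₗ[ℂ] Gr κ :=
  CliffordAlgebra.contractLeft (Q := (0 : QuadraticForm ℂ (κ → ℂ))) (LinearMap.proj k)

/-- Right derivative with respect to the generator labelled by `k`. -/
def rightD (k : κ) (F : Gr κ) : Gr κ :=
  CliffordAlgebra.contractRight (Q := (0 : QuadraticForm ℂ (κ → ℂ))) F (LinearMap.proj k)

/-- The basis of ordered monomials in the generators. -/
def grBasis (κ : Type) [Fintype κ] [DecidableEq κ] :
    Module.Basis (Finset (Fin (Fintype.card κ))) ℂ (Gr κ) :=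
  ((Pi.basisFun ℂ κ).reindex (Fintype.equivFin κ)).ExteriorAlgebra

/-- Derivative at `0` of a curve in the (finite-dimensional) Grassmann algebra. -/
def grDeriv (F : ℝ → Gr κ) : Gr κ :=
  ∑ s, deriv (fun t => (grBasis κ).repr (F t) s) 0 • grBasis κ s

/-- The conjugation of the Grassmann algebra: antilinear, reversing the order of factors, and
fixing the generators. -/
def grConj (F : Gr κ) : Gr κ :=
  CliffordAlgebra.reverse (Q := (0 : QuadraticForm ℂ (κ → ℂ)))
    (∑ s, (starRingEnd ℂ) ((grBasis κ).repr F s) • grBasis κ s)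

end Grassmann

/-! ### Riemannian geometry in a coordinate domain of `ι → ℝ`

A tensor field of type `(1,1)` is a matrix-valued function `I` with `I x M N = I_M{}^N`. -/

section Geometry

variable {ι : Type} [Fintype ι] [DecidableEq ι]

/-- Partial derivative `∂_M f`. -/
def pd {E : Type} [NormedAddCommGroup E] [NormedSpace ℝ E] (f : (ι → ℝ) → E) (M : ι)
    (x : ι → ℝ) : E :=
  fderiv ℝ f x (Pi.single M 1)

/-- Christoffel symbols `Γ^S_{PQ}` of the Levi-Civita connection of `g`. -/
def christoffel (g : (ι → ℝ) → Matrix ι ι ℝ) (x : ι → ℝ) (S P Q : ι) : ℝ :=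
  (1 / 2) * ∑ T, (g x)⁻¹ S T *
    (pd (fun y => g y T Q) P x + pd (fun y => g y T P) Q x - pd (fun y => g y P Q) T x)

/-- `I_{MN} = I_M{}^K g_{KN}`. -/
def lowered (g I : (ι → ℝ) → Matrix ι ι ℝ) (x : ι → ℝ) (M N : ι) : ℝ :=
  ∑ K, I x M K * g x K N

/-- The Levi-Civita covariant derivative `∇_P I_{MN}`. -/
def nablaI (g I : (ι → ℝ) → Matrix ι ι ℝ) (x : ι → ℝ) (P M N : ι) : ℝ :=
  pd (fun y => lowered g I y M N) P x
    - ∑ Q, christoffel g x Q P M * lowered g I x Q N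
    - ∑ Q, christoffel g x Q P N * lowered g I x M Q

/-- The torsion of the Bismut connection of `I`:
`I_M{}^P I_N{}^Q I_K{}^R (∇_P I_{QR} + ∇_Q I_{RP} + ∇_R I_{PQ})`. -/
def bismut (g I : (ι → ℝ) → Matrix ι ι ℝ) (x : ι → ℝ) (M N K : ι) : ℝ :=
  ∑ P, ∑ Q, ∑ R, I x M P * I x N Q * I x K R *
    (nablaI g I x P Q R + nablaI g I x Q R P + nablaI g I x R P Q)

/-- `e x A M = e^A_M` is an orthonormal coframe (vielbein) for `g` on `U`. The inverse vielbein
`e^M_A` is the matrix `(e x)⁻¹ M A`. -/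
structure IsVielbein (U : Set (ι → ℝ)) (g e : (ι → ℝ) → Matrix ι ι ℝ) : Prop where
  smooth : ∀ A M, ContDiffOn ℝ ∞ (fun x => e x A M) U
  orthonormal : ∀ x ∈ U, (e x).transpose * e x = g x

/-- The spin connection
`Ω_{MNL} = e^A_N e^B_L e_{AS} (∂_M e^S_B + Γ^S_{MK} e^K_B)`. -/
def spinConnection (g e : (ι → ℝ) → Matrix ι ι ℝ) (x : ι → ℝ) (M N L : ι) : ℝ :=
  ∑ A, ∑ B, e x A N * e x B L * ∑ S, e x A S *
    (pd (fun y => (e y)⁻¹ S B) M x + ∑ K, christoffel g x S M K * (e x)⁻¹ K B)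

/-- A `g`-antisymmetric, integrable complex structure on `U`. -/
structure IsComplexStructure (U : Set (ι → ℝ)) (g I : (ι → ℝ) → Matrix ι ι ℝ) : Prop where
  smooth : ∀ M N, ContDiffOn ℝ ∞ (fun x => I x M N) U
  antisymm : ∀ x ∈ U, ∀ M N, lowered g I x M N = -lowered g I x N M
  square : ∀ x ∈ U, I x * I x = -1
  integrable : ∀ x ∈ U, ∀ M N P,
    pd (fun y => I y N P) M x - pd (fun y => I y M P) N x
      = ∑ Q, ∑ S, I x M Q * I x N S * (pd (fun y => I y S P) Q x - pd (fun y => I y Q P) S x)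

/-- The quaternion algebra `I^p I^q = -δ^{pq} + ε^{pqr} I^r`. -/
def IsQuaternionic (J : Fin 3 → Matrix ι ι ℝ) : Prop :=
  ∀ p, J p * J p = -1 ∧ J p * J (p + 1) = J (p + 2) ∧ J (p + 1) * J p = -J (p + 2)

/-- Total antisymmetry of a 3-index array. -/
def IsAlternating3 (T : ι → ι → ι → ℝ) : Prop :=
  ∀ M N K, T M N K = -T N M K ∧ T M N K = -T M K N

/-- The 2-form `β` has type `(2,0)` with respect to `J`; the `(1,0)` covectors are those with
`J_M{}^N a_N = -i a_M`, so that `dz` is of type `(1,0)` when `J_z{}^z = -i`. -/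
def IsTypeTwoZero (J : Matrix ι ι ℝ) (β : ι → ι → ℂ) : Prop :=
  (∀ M N, β M N = -β N M) ∧ ∀ M N, ∑ K, (J M K : ℂ) * β K N = -Complex.I * β M N

/-- The projector onto `(1,0)` covectors. -/
def projHol (J : Matrix ι ι ℝ) : Matrix ι ι ℂ :=
  (1 / 2 : ℂ) • (1 + Complex.I • J.map (fun r : ℝ => (r : ℂ)))

/-- Exterior derivative of a 2-form, in components. -/
def extD (β : (ι → ℝ) → ι → ι → ℂ) (x : ι → ℝ) (M N L : ι) : ℂ :=
  pd (fun y => β y N L) M x + pd (fun y => β y L M) N x + pd (fun y => β y M N) L x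

/-- The `(3,0)` part of `dβ`; for `β` of type `(2,0)` this is the holomorphic exterior
derivative `∂β`. -/
def delHol (I : (ι → ℝ) → Matrix ι ι ℝ) (β : (ι → ℝ) → ι → ι → ℂ) (x : ι → ℝ)
    (M N L : ι) : ℂ :=
  ∑ P, ∑ Q, ∑ R, projHol (I x) M P * projHol (I x) N Q * projHol (I x) L R * extD β x P Q R

/-- `H = ∂β + c.c.` on `U` for a smooth `(2,0)`-form `β`: the sum of an exact form of type `(3,0)`
and the conjugate form of type `(0,3)`. -/
def IsExactHolomorphicPlusConj (U : Set (ι → ℝ)) (I : (ι → ℝ) → Matrix ι ι ℝ)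
    (H : (ι → ℝ) → ι → ι → ι → ℝ) : Prop :=
  ∃ β : (ι → ℝ) → ι → ι → ℂ,
    (∀ M N, ContDiffOn ℝ ∞ (fun x => β x M N) U) ∧
    (∀ x ∈ U, IsTypeTwoZero (I x) (β x)) ∧
    ∀ x ∈ U, ∀ M N L,
      (H x M N L : ℂ) = delHol I β x M N L + (starRingEnd ℂ) (delHol I β x M N L)

/-- Bi-HKT (CKT) geometry on `U`, with complex structures `I^p`, full torsion `C` and holomorphic
torsions `H^p`. Both sectors of the Clifford algebra are required to be present: neither the triple
`I^p` nor the triple `-I^p` is quaternionic. -/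
structure IsBiHKT (U : Set (ι → ℝ)) (g : (ι → ℝ) → Matrix ι ι ℝ)
    (I : Fin 3 → (ι → ℝ) → Matrix ι ι ℝ) (C : (ι → ℝ) → ι → ι → ι → ℝ)
    (H : Fin 3 → (ι → ℝ) → ι → ι → ι → ℝ) : Prop where
  metric_smooth : ∀ M N, ContDiffOn ℝ ∞ (fun x => g x M N) U
  metric_posDef : ∀ x ∈ U, (g x).PosDef
  complexStructure : ∀ p, IsComplexStructure U g (I p)
  clifford : ∀ x ∈ U, ∀ p q, I p x * I q x + I q x * I p x = if p = q then -2 else 0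
  not_quaternionic : ∀ x ∈ U,
    ¬ IsQuaternionic (fun p => I p x) ∧ ¬ IsQuaternionic (fun p => -I p x)
  torsion_smooth : ∀ M N K, ContDiffOn ℝ ∞ (fun x => C x M N K) U
  torsion_alternating : ∀ x ∈ U, IsAlternating3 (C x)
  hol_alternating : ∀ p, ∀ x ∈ U, IsAlternating3 (H p x)
  decomposition : ∀ p, ∀ x ∈ U, ∀ M N K, bismut g (I p) x M N K + H p x M N K = C x M N K
  hol_exact : ∀ p, IsExactHolomorphicPlusConj U (I p) (H p)

end Geometry

/-! ### Coordinates of `n` ordinary and `m` mirror multiplets -/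

/-- Flavours: `inl a` is an ordinary multiplet, `inr α` a mirror one. -/
abbrev Flavor (n m : ℕ) : Type := Fin n ⊕ Fin m

/-- Real coordinate indices `M`: a flavour and one of four components. -/
abbrev RIdx (n m : ℕ) : Type := Flavor n m × Fin 4

/-- Complex coordinate indices: a flavour and one of two components. -/
abbrev CIdx (n m : ℕ) : Type := Flavor n m × Fin 2

/-- Points of the target space. -/
abbrev Pt (n m : ℕ) : Type := RIdx n m → ℝ

section Coordinates

variable {n m : ℕ}

/-- `+1` in the ordinary sector, `-1` in the mirror sector. -/
def sector : Flavor n m → ℝ := Sum.elim (fun _ => 1) (fun _ => -1)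

/-- The real coordinate that is the real part of a complex one. -/
def reSlot (K : CIdx n m) : RIdx n m := (K.1, ![2, 0] K.2)

/-- The real coordinate that is, up to sign, the imaginary part of a complex one. -/
def imSlot (K : CIdx n m) : RIdx n m := (K.1, ![3, 1] K.2)

section Components

variable {A : Type} [AddCommGroup A] [Module ℂ A]

/-- Holomorphic components of a vector with real components `y`:
`v¹ = y³ - i y⁴`, `v² = y¹ - i y²` in the ordinary sector and
`w¹ = y³ + i y⁴`, `w² = y¹ + i y²` in the mirror sector. -/
def holo (y : RIdx n m → A) (K : CIdx n m) : A :=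
  y (reSlot K) - ((sector K.1 : ℂ) * Complex.I) • y (imSlot K)

/-- Antiholomorphic components of a vector. -/
def antiholo (y : RIdx n m → A) (K : CIdx n m) : A :=
  y (reSlot K) + ((sector K.1 : ℂ) * Complex.I) • y (imSlot K)

/-- Holomorphic components of a covector (derivatives, momenta). -/
def coholo (y : RIdx n m → A) (K : CIdx n m) : A :=
  (1 / 2 : ℂ) • (y (reSlot K) + ((sector K.1 : ℂ) * Complex.I) • y (imSlot K))

/-- Antiholomorphic components of a covector. -/
def coantiholo (y : RIdx n m → A) (K : CIdx n m) : A :=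
  (1 / 2 : ℂ) • (y (reSlot K) - ((sector K.1 : ℂ) * Complex.I) • y (imSlot K))

end Components

/-- The derivative with respect to a complex coordinate. -/
def dC (K : CIdx n m) (f : Pt n m → ℂ) (x : Pt n m) : ℂ := coholo (fun M => pd f M x) K

/-- The derivative with respect to the conjugate of a complex coordinate. -/
def dCbar (K : CIdx n m) (f : Pt n m → ℂ) (x : Pt n m) : ℂ := coantiholo (fun M => pd f M x) K

/-- `ε_{mn}`, with `ε_{12} = 1`; the symbol `ε^{mn}` with upper indices is `-ε_{mn}`. -/
def eps (i j : Fin 2) : ℂ := !![0, 1; -1, 0] i j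

/-- `Δ_{m n̄} L = ∂_m ∂̄_{n̄} L + ε_{mk} ε_{n̄l̄} ∂̄_{k̄} ∂_l L` for flavours `F`, `G`. -/
def lap (L : Pt n m → ℝ) (F G : Flavor n m) (i j : Fin 2) (x : Pt n m) : ℂ :=
  dC (F, i) (dCbar (G, j) fun y => (L y : ℂ)) x
    + ∑ k, ∑ l, eps i k * eps j l * dCbar (F, k) (dC (G, l) fun y => (L y : ℂ)) x

/-- The Hermitian metric `h^{ab}_{m n̄} = Δ L` of the ordinary sector. -/
def hOrd (L : Pt n m → ℝ) (a b : Fin n) (i j : Fin 2) (x : Pt n m) : ℂ :=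
  lap L (Sum.inl a) (Sum.inl b) i j x

/-- The Hermitian metric `h^{αβ}_{μ ν̄} = -Δ L` of the mirror sector. -/
def hMir (L : Pt n m → ℝ) (a b : Fin m) (i j : Fin 2) (x : Pt n m) : ℂ :=
  -lap L (Sum.inr a) (Sum.inr b) i j x

/-- The block-diagonal Hermitian metric. -/
def hermMetric (L : Pt n m → ℝ) (K N : CIdx n m) (x : Pt n m) : ℂ :=
  match K, N with
  | (Sum.inl a, i), (Sum.inl b, j) => hOrd L a b i j x
  | (Sum.inr a, i), (Sum.inr b, j) => hMir L a b i j x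
  | _, _ => 0

/-- The real metric `g_{MN} dx^M dx^N = 2 h_{K N̄} dz^K dz̄^N`. -/
def metric (L : Pt n m → ℝ) (x : Pt n m) : Matrix (RIdx n m) (RIdx n m) ℝ :=
  fun M N => (∑ K, ∑ K', hermMetric L K K' x *
    (holo (Pi.single M (1 : ℂ)) K * antiholo (Pi.single N (1 : ℂ)) K'
      + holo (Pi.single N (1 : ℂ)) K * antiholo (Pi.single M (1 : ℂ)) K')).re

/-- The three canonical quaternionic `4 × 4` matrices. -/
def quat : Fin 3 → Matrix (Fin 4) (Fin 4) ℝ :=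
  ![!![0, -1, 0, 0; 1, 0, 0, 0; 0, 0, 0, -1; 0, 0, 1, 0],
    !![0, 0, 1, 0; 0, 0, 0, -1; -1, 0, 0, 0; 0, 1, 0, 0],
    !![0, 0, 0, 1; 0, 0, 1, 0; 0, -1, 0, 0; -1, 0, 0, 0]]

/-- The Clifford triple: block diagonal, with blocks `quat p` for the ordinary multiplets and
`-quat p` for the mirror ones. -/
def cliffordTriple (p : Fin 3) (_x : Pt n m) : Matrix (RIdx n m) (RIdx n m) ℝ :=
  fun M N => if M.1 = N.1 then sector M.1 * quat p M.2 N.2 else 0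

end Coordinates

/-! ### The superfield action and its component form -/

section Superspace

variable {n m : ℕ}

/-- Grassmann algebra of superspace and of the component fermions: the odd generators are
`θ, θ̄, η, η̄`, the fermions `ξ^M` and their velocities. -/
abbrev SGr (n m : ℕ) : Type := Gr (Fin 4 ⊕ (RIdx n m ⊕ RIdx n m))

def theta : SGr n m := gen (Sum.inl 0)
def thetaBar : SGr n m := gen (Sum.inl 1)
def eta : SGr n m := gen (Sum.inl 2)
def etaBar : SGr n m := gen (Sum.inl 3)

/-- Real components of the fermions with world indices. -/
def xi (M : RIdx n m) : SGr n m := gen (Sum.inr (Sum.inl M))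

/-- Time derivatives of the fermions. -/
def xiDot (M : RIdx n m) : SGr n m := gen (Sum.inr (Sum.inr M))

/-- The chiral `N = 2` superfield `z + √2 θ ψ - i θ θ̄ ż`. -/
def chiral (z : ℂ) (ψ : SGr n m) (zdot : ℂ) : SGr n m :=
  algebraMap ℂ _ z + (Real.sqrt 2 : ℂ) • (theta * ψ) - (Complex.I * zdot) • (theta * thetaBar)

/-- The conjugate superfield `z̄ - √2 θ̄ ψ̄ + i θ θ̄ z̄˙`. -/
def antichiral (z : ℂ) (ψ : SGr n m) (zdot : ℂ) : SGr n m :=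
  algebraMap ℂ _ z - (Real.sqrt 2 : ℂ) • (thetaBar * ψ)
    + (Complex.I * zdot) • (theta * thetaBar)

/-- Complexification of a real vector. -/
def cplx (x : Pt n m) : RIdx n m → ℂ := fun M => (x M : ℂ)

/-- The `N = 2` superfields `V^m_a`, `W^μ_α`. Here and below `x`, `v`, `w` are the values of the
real bosonic coordinates, of their velocities and of their accelerations. -/
def sfV (x v : Pt n m) (K : CIdx n m) : SGr n m :=
  chiral (holo (cplx x) K) (holo xi K) (holo (cplx v) K)

def sfVbar (x v : Pt n m) (K : CIdx n m) : SGr n m :=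
  antichiral (antiholo (cplx x) K) (antiholo xi K) (antiholo (cplx v) K)

/-- Time derivatives of the `N = 2` superfields. -/
def sfVdot (v w : Pt n m) (K : CIdx n m) : SGr n m :=
  chiral (holo (cplx v) K) (holo xiDot K) (holo (cplx w) K)

def sfVbarDot (v w : Pt n m) (K : CIdx n m) : SGr n m :=
  antichiral (antiholo (cplx v) K) (antiholo xiDot K) (antiholo (cplx w) K)

/-- `D V`, with `D = ∂_θ - i θ̄ ∂_t`. -/
def sfDV (x v w : Pt n m) (K : CIdx n m) : SGr n m :=
  leftD (Sum.inl 0) (sfV x v K) - Complex.I • (thetaBar * sfVdot v w K)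

/-- `D̄ V̄`, with `D̄ = -∂_θ̄ + i θ ∂_t`. -/
def sfDbarVbar (x v w : Pt n m) (K : CIdx n m) : SGr n m :=
  -leftD (Sum.inl 1) (sfVbar x v K) + Complex.I • (theta * sfVbarDot v w K)

/-- The linear `(4,4,0)` superfields: `V^m + η ε^{mn} D̄ V̄^n - i η η̄ V̇^m` for an ordinary
multiplet and `W^μ + η̄ ε^{μν} D̄ W̄^ν + i η η̄ Ẇ^μ` for a mirror one. -/
def sfZ (x v w : Pt n m) (K : CIdx n m) : SGr n m :=
  match K with
  | (Sum.inl a, i) => sfV x v (Sum.inl a, i)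
      + eta * (∑ j, (-eps i j) • sfDbarVbar x v w (Sum.inl a, j))
      - Complex.I • (eta * etaBar * sfVdot v w (Sum.inl a, i))
  | (Sum.inr a, i) => sfV x v (Sum.inr a, i)
      + etaBar * (∑ j, (-eps i j) • sfDbarVbar x v w (Sum.inr a, j))
      + Complex.I • (eta * etaBar * sfVdot v w (Sum.inr a, i))

/-- The conjugate superfields. -/
def sfZbar (x v w : Pt n m) (K : CIdx n m) : SGr n m :=
  match K with
  | (Sum.inl a, i) => sfVbar x v (Sum.inl a, i)
      - etaBar * (∑ j, (-eps i j) • sfDV x v w (Sum.inl a, j))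
      + Complex.I • (eta * etaBar * sfVbarDot v w (Sum.inl a, i))
  | (Sum.inr a, i) => sfVbar x v (Sum.inr a, i)
      - eta * (∑ j, (-eps i j) • sfDV x v w (Sum.inr a, j))
      - Complex.I • (eta * etaBar * sfVbarDot v w (Sum.inr a, i))

/-- The real components of the superfields: the inverse of `holo`, `antiholo`. -/
def sfReal (x v w : Pt n m) (M : RIdx n m) : SGr n m :=
  let re (i : Fin 2) : SGr n m :=
    (1 / 2 : ℂ) • (sfZ x v w (M.1, i) + sfZbar x v w (M.1, i))
  let im (i : Fin 2) : SGr n m :=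
    ((sector M.1 : ℂ) * Complex.I / 2) • (sfZ x v w (M.1, i) - sfZbar x v w (M.1, i))
  ![re 1, im 1, re 0, im 0] M.2

/-- The function `L` of the superfields, by Taylor expansion around their body `x`. The expansion
stops at order four, since each `sfReal - x` lies in the ideal generated by `θ, θ̄, η, η̄`. -/
def superPrepotential (L : Pt n m → ℝ) (x v w : Pt n m) : SGr n m :=
  ∑ k ∈ Finset.range 5, (1 / (k.factorial : ℂ)) • ∑ s : Fin k → RIdx n m,
    ((iteratedFDeriv ℝ k L x (fun j => Pi.single (s j) 1) : ℝ) : ℂ) •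
      (List.ofFn fun j => sfReal x v w (s j) - algebraMap ℂ _ (x (s j) : ℂ)).prod

/-- The Berezin integral `∫ dθ dθ̄ dη dη̄`. -/
def berezin (F : SGr n m) : SGr n m :=
  leftD (Sum.inl 0) (leftD (Sum.inl 1) (leftD (Sum.inl 2) (leftD (Sum.inl 3) F)))

/-- The integrand `¼ ∫ dθ dθ̄ dη dη̄ L` of the action `S = ¼ ∫ dt dθ dθ̄ dη dη̄ L`. -/
def superLagrangian (L : Pt n m → ℝ) (x v w : Pt n m) : SGr n m :=
  (1 / 4 : ℂ) • berezin (superPrepotential L x v w)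

/-- A component Lagrangian
`½ g_{MN} ẋ^M ẋ^N + (i/2) g_{MN} ξ^M ξ̇^N + ẋ^M A_{MNK} ξ^N ξ^K - F_{MNKL} ξ^M ξ^N ξ^K ξ^L`. -/
def componentLagrangian (g : Pt n m → Matrix (RIdx n m) (RIdx n m) ℝ)
    (A : Pt n m → RIdx n m → RIdx n m → RIdx n m → ℂ)
    (F : Pt n m → RIdx n m → RIdx n m → RIdx n m → RIdx n m → ℂ) (x v : Pt n m) : SGr n m :=
  algebraMap ℂ _ (1 / 2 * ∑ M, ∑ N, (g x M N * v M * v N : ℂ))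
    + (Complex.I / 2) • ∑ M, ∑ N, (g x M N : ℂ) • (xi M * xiDot N)
    + ∑ M, ∑ N, ∑ K, ((v M : ℂ) * A x M N K) • (xi N * xi K)
    - ∑ M, ∑ N, ∑ K, ∑ L, F x M N K L • (xi M * xi N * xi K * xi L)

/-- The total time derivative of `k_M(x) ẋ^M + b_{MN}(x) ξ^M ξ^N`. -/
def totalDerivative (k : Pt n m → RIdx n m → ℂ) (b : Pt n m → RIdx n m → RIdx n m → ℂ)
    (x v w : Pt n m) : SGr n m :=
  algebraMap ℂ _ (∑ M, ∑ N, pd (fun y => k y M) N x * v N * v M + ∑ M, k x M * w M)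
    + ∑ M, ∑ N, (∑ K, pd (fun y => b y M N) K x * v K) • (xi M * xi N)
    + ∑ M, ∑ N, b x M N • (xiDot M * xi N + xi M * xiDot N)

/-- The superfield Lagrangian with prepotential `L` reduces on `U`, up to a total time derivative,
to the component Lagrangian with coefficients `A`, `F`. -/
def HasComponentForm (U : Set (Pt n m)) (L : Pt n m → ℝ)
    (A : Pt n m → RIdx n m → RIdx n m → RIdx n m → ℂ)
    (F : Pt n m → RIdx n m → RIdx n m → RIdx n m → RIdx n m → ℂ) : Prop :=
  ∃ (k : Pt n m → RIdx n m → ℂ) (b : Pt n m → RIdx n m → RIdx n m → ℂ),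
    (∀ M, ContDiffOn ℝ ∞ (fun x => k x M) U) ∧
    (∀ M N, ContDiffOn ℝ ∞ (fun x => b x M N) U) ∧
    ∀ x ∈ U, ∀ v w, superLagrangian L x v w
      = componentLagrangian (metric L) A F x v + totalDerivative k b x v w

end Superspace

/-! ### Phase space -/

section PhaseSpace

variable {n m : ℕ}

/-- Bosonic phase space: coordinates and canonical momenta `(x, P)`. -/
abbrev Phase (n m : ℕ) : Type := Pt n m × Pt n m

/-- Grassmann-valued functions on phase space; the odd generators are the fermions `Ψ^A` with flat
indices. -/
abbrev Obs (n m : ℕ) : Type := Phase n m → Gr (RIdx n m)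

/-- `∂F/∂x^M`, at fixed momenta and fixed `Ψ^A`. -/
def dX (F : Obs n m) (M : RIdx n m) (z : Phase n m) : Gr (RIdx n m) :=
  grDeriv fun t => F (z.1 + t • Pi.single M 1, z.2)

/-- `∂F/∂P_M`. -/
def dP (F : Obs n m) (M : RIdx n m) (z : Phase n m) : Gr (RIdx n m) :=
  grDeriv fun t => F (z.1, z.2 + t • Pi.single M 1)

/-- The graded Poisson bracket, with `{x^M, P_N} = δ^M_N` and `{Ψ^A, Ψ^B} = -i δ^{AB}`. -/
def bracket (F G : Obs n m) : Obs n m := fun z =>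
  ∑ M, (dX F M z * dP G M z - dP F M z * dX G M z)
    - Complex.I • ∑ A, rightD A (F z) * leftD A (G z)

/-- The fermions with world indices, `Ψ^M = e^M_A Ψ^A`. -/
def fermion (e : Pt n m → Matrix (RIdx n m) (RIdx n m) ℝ) (z : Phase n m) (M : RIdx n m) :
    Gr (RIdx n m) :=
  ∑ A, ((e z.1)⁻¹ M A : ℂ) • gen A

/-- The canonical momenta `P_M`, taken at fixed `Ψ^A`. -/
def momP (z : Phase n m) (M : RIdx n m) : Gr (RIdx n m) := algebraMap ℂ _ (z.2 M : ℂ)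

/-- The momenta `Π_M`, taken at fixed `Ψ^M`. Since
`(i/2) Ψ^A Ψ̇^A = (i/2) g_{NK} Ψ^N Ψ̇^K + (i/2) ẋ^M e^A_N (∂_M e^A_K) Ψ^N Ψ^K`,
one has `Π_M = P_M + (i/2) e^A_N (∂_M e^A_K) Ψ^N Ψ^K`. -/
def momPi (e : Pt n m → Matrix (RIdx n m) (RIdx n m) ℝ) (z : Phase n m) (M : RIdx n m) :
    Gr (RIdx n m) :=
  momP z M + (Complex.I / 2) • ∑ N, ∑ K,
    ((∑ A, e z.1 A N * pd (fun y => e y A K) M z.1 : ℝ) : ℂ) • (fermion e z N * fermion e z K)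

/-- The Hamiltonian of a component Lagrangian,
`½ g^{MN} (Π_M - A_{MKL} Ψ^K Ψ^L) (Π_N - A_{NKL} Ψ^K Ψ^L) + F_{MNKL} Ψ^M Ψ^N Ψ^K Ψ^L`. -/
def hamiltonian (g : Pt n m → Matrix (RIdx n m) (RIdx n m) ℝ)
    (A : Pt n m → RIdx n m → RIdx n m → RIdx n m → ℂ)
    (F : Pt n m → RIdx n m → RIdx n m → RIdx n m → RIdx n m → ℂ)
    (e : Pt n m → Matrix (RIdx n m) (RIdx n m) ℝ) : Obs n m := fun z =>
  let Ψ := fermion e z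
  let kin (M : RIdx n m) : Gr (RIdx n m) :=
    momPi e z M - ∑ K, ∑ L, A z.1 M K L • (Ψ K * Ψ L)
  (1 / 2 : ℂ) • ∑ M, ∑ N, ((g z.1)⁻¹ M N : ℂ) • (kin M * kin N)
    + ∑ M, ∑ N, ∑ K, ∑ L, F z.1 M N K L • (Ψ M * Ψ N * Ψ K * Ψ L)

/-! ### Complex supercharges

In the three auxiliary sums `D` stands for a first derivative at a point. -/

section Auxiliary

variable {φ : Type} [Fintype φ] {G : Type} [Ring G] [Module ℂ G] {X : Type}

/-- `D(h^{bc}_{k l̄}) ψ_b^k ψ̄_c^l`. -/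
def mixedTerm (h : φ → φ → Fin 2 → Fin 2 → X) (ψ ψbar : φ → Fin 2 → G) (D : X → ℂ) : G :=
  ∑ b, ∑ c, ∑ k, ∑ l, D (h b c k l) • (ψ b k * ψbar c l)

/-- `ε_{nk} D(h^{ab}_{m k̄}) ψ_a^m ψ_b^n`. -/
def holTerm (h : φ → φ → Fin 2 → Fin 2 → X) (ψ : φ → Fin 2 → G) (D : X → ℂ) : G :=
  ∑ a, ∑ b, ∑ i, ∑ j, ∑ k, (eps j k * D (h a b i k)) • (ψ a i * ψ b j)

/-- `ε_{m̄k̄} D(h^{ab}_{k n̄}) ψ̄_a^m ψ̄_b^n`. -/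
def antiholTerm (h : φ → φ → Fin 2 → Fin 2 → X) (ψbar : φ → Fin 2 → G) (D : X → ℂ) : G :=
  ∑ a, ∑ b, ∑ i, ∑ j, ∑ k, (eps i k * D (h a b k j)) • (ψbar a i * ψbar b j)

end Auxiliary

variable (L : Pt n m → ℝ) (e : Pt n m → Matrix (RIdx n m) (RIdx n m) ℝ)

/-- The fermions `ψ_a^m` of the ordinary sector, and below their conjugates, and the fermions
`χ_α^μ` of the mirror sector with their conjugates. -/
def psi (z : Phase n m) (a : Fin n) (i : Fin 2) : Gr (RIdx n m) :=
  holo (fermion e z) (Sum.inl a, i)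
def psiBar (z : Phase n m) (a : Fin n) (i : Fin 2) : Gr (RIdx n m) :=
  antiholo (fermion e z) (Sum.inl a, i)
def chi (z : Phase n m) (a : Fin m) (i : Fin 2) : Gr (RIdx n m) :=
  holo (fermion e z) (Sum.inr a, i)
def chiBar (z : Phase n m) (a : Fin m) (i : Fin 2) : Gr (RIdx n m) :=
  antiholo (fermion e z) (Sum.inr a, i)

/-- `∂_K h_{k l̄} ψ^k ψ̄^l` for the two sectors, with `D` the derivative of index `K`. -/
def ordMixed (z : Phase n m) (D : (Pt n m → ℂ) → Pt n m → ℂ) : Gr (RIdx n m) :=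
  mixedTerm (hOrd L) (psi e z) (psiBar e z) fun f => D f z.1
def mirMixed (z : Phase n m) (D : (Pt n m → ℂ) → Pt n m → ℂ) : Gr (RIdx n m) :=
  mixedTerm (hMir L) (chi e z) (chiBar e z) fun f => D f z.1
def ordHol (z : Phase n m) (D : (Pt n m → ℂ) → Pt n m → ℂ) : Gr (RIdx n m) :=
  holTerm (hOrd L) (psi e z) fun f => D f z.1
def mirHol (z : Phase n m) (D : (Pt n m → ℂ) → Pt n m → ℂ) : Gr (RIdx n m) :=
  holTerm (hMir L) (chi e z) fun f => D f z.1
def ordAntihol (z : Phase n m) (D : (Pt n m → ℂ) → Pt n m → ℂ) : Gr (RIdx n m) :=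
  antiholTerm (hOrd L) (psiBar e z) fun f => D f z.1
def mirAntihol (z : Phase n m) (D : (Pt n m → ℂ) → Pt n m → ℂ) : Gr (RIdx n m) :=
  antiholTerm (hMir L) (chiBar e z) fun f => D f z.1

/-- The supercharge `S`. -/
def chargeS : Obs n m := fun z =>
  (Real.sqrt 2 : ℂ) • (∑ a : Fin n, ∑ i, psi e z a i *
      (coholo (momPi e z) (Sum.inl a, i)
        - (Complex.I / 2) • ordMixed L e z (dC (Sum.inl a, i))
        - (Complex.I / 2) • mirMixed L e z (dC (Sum.inl a, i))
        + (Complex.I / 2) • ∑ j, eps i j • mirHol L e z (dCbar (Sum.inl a, j))))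
  + (Real.sqrt 2 : ℂ) • (∑ a : Fin m, ∑ i, chi e z a i *
      (coholo (momPi e z) (Sum.inr a, i)
        - (Complex.I / 2) • mirMixed L e z (dC (Sum.inr a, i))
        - (Complex.I / 2) • ordMixed L e z (dC (Sum.inr a, i))
        + (Complex.I / 2) • ∑ j, eps i j • ordHol L e z (dCbar (Sum.inr a, j))))

/-- The conjugate supercharge `S̄`. -/
def chargeSbar : Obs n m := fun z =>
  (Real.sqrt 2 : ℂ) • (∑ a : Fin n, ∑ i, psiBar e z a i *
      (coantiholo (momPi e z) (Sum.inl a, i)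
        + (Complex.I / 2) • ordMixed L e z (dCbar (Sum.inl a, i))
        + (Complex.I / 2) • mirMixed L e z (dCbar (Sum.inl a, i))
        - (Complex.I / 2) • ∑ j, eps i j • mirAntihol L e z (dC (Sum.inl a, j))))
  + (Real.sqrt 2 : ℂ) • (∑ a : Fin m, ∑ i, chiBar e z a i *
      (coantiholo (momPi e z) (Sum.inr a, i)
        + (Complex.I / 2) • mirMixed L e z (dCbar (Sum.inr a, i))
        + (Complex.I / 2) • ordMixed L e z (dCbar (Sum.inr a, i))
        - (Complex.I / 2) • ∑ j, eps i j • ordAntihol L e z (dC (Sum.inr a, j))))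

/-- The supercharge `R`. -/
def chargeR : Obs n m := fun z =>
  (Real.sqrt 2 : ℂ) • (∑ a : Fin n, ∑ l, ∑ i, eps l i • (psi e z a l *
      (coantiholo (momPi e z) (Sum.inl a, i)
        - (Complex.I / 2) • ordMixed L e z (dCbar (Sum.inl a, i))
        + (Complex.I / 2) • mirMixed L e z (dCbar (Sum.inl a, i))
        - (Complex.I / 2) • ∑ j, eps i j • mirAntihol L e z (dC (Sum.inl a, j)))))
  - (Real.sqrt 2 : ℂ) • (∑ a : Fin m, ∑ l, ∑ i, eps l i • (chiBar e z a l *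
      (coholo (momPi e z) (Sum.inr a, i)
        + (Complex.I / 2) • mirMixed L e z (dC (Sum.inr a, i))
        - (Complex.I / 2) • ordMixed L e z (dC (Sum.inr a, i))
        + (Complex.I / 2) • ∑ j, eps i j • ordHol L e z (dCbar (Sum.inr a, j)))))

/-- The conjugate supercharge `R̄`. -/
def chargeRbar : Obs n m := fun z =>
  (Real.sqrt 2 : ℂ) • (∑ a : Fin n, ∑ l, ∑ i, eps l i • (psiBar e z a l *
      (coholo (momPi e z) (Sum.inl a, i)
        + (Complex.I / 2) • ordMixed L e z (dC (Sum.inl a, i))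
        - (Complex.I / 2) • mirMixed L e z (dC (Sum.inl a, i))
        + (Complex.I / 2) • ∑ j, eps i j • mirHol L e z (dCbar (Sum.inl a, j)))))
  - (Real.sqrt 2 : ℂ) • (∑ a : Fin m, ∑ l, ∑ i, eps l i • (chi e z a l *
      (coantiholo (momPi e z) (Sum.inr a, i)
        - (Complex.I / 2) • mirMixed L e z (dCbar (Sum.inr a, i))
        + (Complex.I / 2) • ordMixed L e z (dCbar (Sum.inr a, i))
        - (Complex.I / 2) • ∑ j, eps i j • ordAntihol L e z (dC (Sum.inr a, j)))))

/-! ### Real supercharges -/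

/-- `T_{MNL} Ψ^N Ψ^L`. -/
def quadratic (z : Phase n m) (T : RIdx n m → RIdx n m → ℝ) : Gr (RIdx n m) :=
  ∑ N, ∑ K, (T N K : ℂ) • (fermion e z N * fermion e z K)

/-- `Q = Ψ^M (P_M - (i/2) Ω_{MNL} Ψ^N Ψ^L + (i/12) C_{MNL} Ψ^N Ψ^L)`. -/
def chargeQ (g : Pt n m → Matrix (RIdx n m) (RIdx n m) ℝ)
    (C : Pt n m → RIdx n m → RIdx n m → RIdx n m → ℝ) : Obs n m := fun z =>
  ∑ M, fermion e z M * (momP z M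
    - (Complex.I / 2) • quadratic e z (spinConnection g e z.1 M)
    + (Complex.I / 12) • quadratic e z (C z.1 M))

/-- `Q^p = Ψ^S (I^p)_S{}^M
(P_M - (i/2) Ω_{MNL} Ψ^N Ψ^L - (i/4) B^p_{MNL} Ψ^N Ψ^L + (i/12) H^p_{MNL} Ψ^N Ψ^L)`, with `B^p`
the Bismut torsion of `I^p`. -/
def chargeQI (g I : Pt n m → Matrix (RIdx n m) (RIdx n m) ℝ)
    (H : Pt n m → RIdx n m → RIdx n m → RIdx n m → ℝ) : Obs n m := fun z =>
  ∑ S, ∑ M, (I z.1 S M : ℂ) • (fermion e z S * (momP z M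
    - (Complex.I / 2) • quadratic e z (spinConnection g e z.1 M)
    - (Complex.I / 4) • quadratic e z (bismut g I z.1 M)
    + (Complex.I / 12) • quadratic e z (H z.1 M)))

/-- The four real supercharges `Q, Q^1, Q^2, Q^3`. -/
def realCharges (C : Pt n m → RIdx n m → RIdx n m → RIdx n m → ℝ)
    (H : Fin 3 → Pt n m → RIdx n m → RIdx n m → RIdx n m → ℝ) : Fin 4 → Obs n m :=
  Fin.cons (chargeQ e (metric L) C)
    fun p => chargeQI e (metric L) (cliffordTriple p) (H p)

end PhaseSpace

end BiHKT

end

set_option linter.unusedSectionVars false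
set_option linter.unusedSimpArgs false

noncomputable section

namespace BiHKT

/-! ### Parity and derivations of the Grassmann algebra -/

section GrassmannParity

variable {κ : Type}

/-! Every tensor of the model can be written as a contraction of the symmetric array of second,
third or fourth partial derivatives of `L` with vectors rotated by constant matrices: the unit and
the three `I^p`, each restricted to the ordinary or to the mirror sector. These eight matrices `JB`
are closed under multiplication up to sign, and products across the sectors vanish. A symmetric
array contracted with rotations of one odd vector `Ψ` is antisymmetric in the labels of the
rotations. An identity between such contractions is therefore a linear relation between increasing
tuples of labels, and it can be checked by sorting labels and comparing coefficients.

In this language `g` is half the sum, over the four units of each sector, of the rotated Hessian of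
`L`, with a minus sign in the mirror sector (`metric_eq`). Hence the `I^p` are `g`-antisymmetric,
and being constant they are integrable. The spin connection and torsion terms of the supercharges
collapse (`realCharges_eq`) to `Q_a = (J_a Ψ)^M Π_M - S_a / 2`, where `J_0 = 1`, `J_p = I^p` and
`S_a` is `cubicForm`, built from third derivatives. This dictates `C`, the antisymmetric part of
`S_0` up to a factor. With `H^p = C - B^p` the geometric content is that `H^p` is `∂β^p` plus its
conjugate; here `β^p` is the Hessian of `L` with one index in each sector, rotated by matrices whose
rows are `(1,0)` covectors (`holTorsion_exact`). The complex supercharges reduce to the same `Q_a`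
once complex components are replaced by projectors.

For the algebra, `gaugeForm_self` and `cubicForm_derivative` combine to show that the derivative of
`Q_a` along `Ψ^A` is the kinetic momentum `Π - AΨΨ` paired with a rotated frame vector, plus a term
with derivatives of the vielbein (`leftD_superCharge`). The derivative along the target, taken at
fixed `Ψ^A`, moves `Ψ^M` through the vielbein (`dX_superCharge`). All derivatives of the vielbein
cancel in the bracket (`bracket_sum`). What remains is a square of kinetic momenta, which the
Clifford relations reduce to `δ_ab` times the inverse metric (`sum_kinetic`), and a term in fourth
derivatives, which is `δ_ab` times the quartic contraction with `J_0 Ψ, J_1 Ψ, J_2 Ψ, J_3 Ψ`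
(`cubicForm_anticomm`). These are the two terms of the Hamiltonian.

For the component form, the prepotential of the superfields is a Taylor polynomial of degree four in
their nilpotent part. The Berezin integral is a fourth derivative of this composite and may be
evaluated at vanishing odd coordinates (`berezin_superPrepotential`). Sorting labels in the result
produces the Lagrangian with the same `A` and `F`, up to the time derivative of an explicit boundary
function (`hasComponentForm`). -/

theorem ι_mul_ι_swap (v w : κ → ℂ) :
    ExteriorAlgebra.ι ℂ v * ExteriorAlgebra.ι ℂ w
      = -(ExteriorAlgebra.ι ℂ w * ExteriorAlgebra.ι ℂ v) :=
  eq_neg_of_add_eq_zero_left (ExteriorAlgebra.ι_add_mul_swap v w)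

/-- An element that commutes with the odd generators is central. -/
theorem mul_comm_of_ι {x : Gr κ}
    (h : ∀ v : κ → ℂ, ExteriorAlgebra.ι ℂ v * x = x * ExteriorAlgebra.ι ℂ v) (y : Gr κ) :
    y * x = x * y := by
  induction y using ExteriorAlgebra.induction with
  | algebraMap r => exact Algebra.commutes r x
  | ι v => exact h v
  | mul a b ha hb => rw [mul_assoc, hb, ← mul_assoc, ha, mul_assoc]
  | add a b ha hb => rw [add_mul, ha, hb, mul_add]

theorem ι_mul_ι_central (v w : κ → ℂ) (y : Gr κ) :
    y * (ExteriorAlgebra.ι ℂ v * ExteriorAlgebra.ι ℂ w)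
      = ExteriorAlgebra.ι ℂ v * ExteriorAlgebra.ι ℂ w * y := by
  refine mul_comm_of_ι (fun u => ?_) y
  rw [← mul_assoc, ι_mul_ι_swap u v, neg_mul, mul_assoc, ι_mul_ι_swap u w, mul_neg, neg_neg,
    mul_assoc]

end GrassmannParity

section GrassmannDerivative

variable {κ : Type} [Fintype κ] [DecidableEq κ]

theorem leftD_ι_mul (k : κ) (v : κ → ℂ) (y : Gr κ) :
    leftD k (ExteriorAlgebra.ι ℂ v * y) = v k • y - ExteriorAlgebra.ι ℂ v * leftD k y :=
  CliffordAlgebra.contractLeft_ι_mul (Q := (0 : QuadraticForm ℂ (κ → ℂ))) (LinearMap.proj k) v y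

theorem leftD_ι (k : κ) (v : κ → ℂ) :
    leftD k (ExteriorAlgebra.ι ℂ v) = algebraMap ℂ (Gr κ) (v k) :=
  CliffordAlgebra.contractLeft_ι (Q := (0 : QuadraticForm ℂ (κ → ℂ))) (LinearMap.proj k) v

theorem leftD_algebraMap (k : κ) (r : ℂ) : leftD k (algebraMap ℂ (Gr κ) r) = 0 :=
  CliffordAlgebra.contractLeft_algebraMap (Q := (0 : QuadraticForm ℂ (κ → ℂ)))
    (LinearMap.proj k) r

theorem leftD_leftD (k : κ) (x : Gr κ) : leftD k (leftD k x) = 0 :=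
  CliffordAlgebra.contractLeft_contractLeft (Q := (0 : QuadraticForm ℂ (κ → ℂ)))
    (LinearMap.proj k) x

/-- The right derivative as a linear map. -/
def rightDLin (k : κ) : Gr κ →ₗ[ℂ] Gr κ :=
  (CliffordAlgebra.contractRight (Q := (0 : QuadraticForm ℂ (κ → ℂ)))).flip (LinearMap.proj k)

theorem rightDLin_apply (k : κ) (x : Gr κ) : rightDLin k x = rightD k x := rfl

theorem rightD_mul_ι (k : κ) (x : Gr κ) (v : κ → ℂ) :
    rightD k (x * ExteriorAlgebra.ι ℂ v) = v k • x - rightD k x * ExteriorAlgebra.ι ℂ v :=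
  CliffordAlgebra.contractRight_mul_ι (Q := (0 : QuadraticForm ℂ (κ → ℂ))) (LinearMap.proj k) v x

theorem rightD_ι (k : κ) (v : κ → ℂ) :
    rightD k (ExteriorAlgebra.ι ℂ v) = leftD k (ExteriorAlgebra.ι ℂ v) :=
  (CliffordAlgebra.contractRight_ι (Q := (0 : QuadraticForm ℂ (κ → ℂ)))
    (LinearMap.proj k) v).trans (leftD_ι k v).symm

/-- On cubic elements the left and right derivatives agree. -/
theorem rightD_cubic (k : κ) (u v w : κ → ℂ) :
    rightD k (ExteriorAlgebra.ι ℂ u * (ExteriorAlgebra.ι ℂ v * ExteriorAlgebra.ι ℂ w))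
      = leftD k (ExteriorAlgebra.ι ℂ u * (ExteriorAlgebra.ι ℂ v * ExteriorAlgebra.ι ℂ w)) := by
  rw [← mul_assoc, rightD_mul_ι, rightD_mul_ι, rightD_ι, mul_assoc, leftD_ι_mul, leftD_ι_mul,
    leftD_ι, leftD_ι]
  simp only [Algebra.algebraMap_eq_smul_one, mul_sub, sub_mul, smul_mul_assoc, mul_smul_comm,
    mul_one, one_mul]
  abel

theorem gen_eq (k : κ) : gen k = ExteriorAlgebra.ι ℂ (Pi.single k (1 : ℂ)) := rfl

theorem ι_eq_sum_gen (v : κ → ℂ) : ExteriorAlgebra.ι ℂ v = ∑ k, v k • gen k := by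
  conv_lhs => rw [pi_eq_sum_univ' v]
  simp only [map_sum, map_smul, gen]

/-! ### Differentiation of curves in the Grassmann algebra -/

/-- The curve `F` in the Grassmann algebra has derivative `F'` at `0`. -/
def HasGrDeriv (F : ℝ → Gr κ) (F' : Gr κ) : Prop :=
  ∀ s, HasDerivAt (fun t => (grBasis κ).repr (F t) s) ((grBasis κ).repr F' s) 0

theorem HasGrDeriv.grDeriv {F : ℝ → Gr κ} {F' : Gr κ} (h : HasGrDeriv F F') :
    grDeriv F = F' := by
  rw [BiHKT.grDeriv, ← (grBasis κ).sum_repr F']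
  exact Finset.sum_congr rfl fun s _ => by rw [(h s).deriv]

theorem hasGrDeriv_const (x : Gr κ) : HasGrDeriv (fun _ => x) 0 := fun s => by
  simpa using hasDerivAt_const (0 : ℝ) ((grBasis κ).repr x s)

theorem HasGrDeriv.add {F G : ℝ → Gr κ} {F' G' : Gr κ} (hF : HasGrDeriv F F')
    (hG : HasGrDeriv G G') : HasGrDeriv (fun t => F t + G t) (F' + G') := fun s => by
  simpa using (hF s).fun_add (hG s)

theorem HasGrDeriv.sum {α : Type} (A : Finset α) {F : α → ℝ → Gr κ} {F' : α → Gr κ}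
    (h : ∀ a ∈ A, HasGrDeriv (F a) (F' a)) :
    HasGrDeriv (fun t => ∑ a ∈ A, F a t) (∑ a ∈ A, F' a) := fun s => by
  simpa using HasDerivAt.fun_sum fun a ha => h a ha s

theorem HasGrDeriv.smul {c : ℝ → ℂ} {c' : ℂ} {F : ℝ → Gr κ} {F' : Gr κ}
    (hc : HasDerivAt c c' 0) (hF : HasGrDeriv F F') :
    HasGrDeriv (fun t => c t • F t) (c' • F 0 + c 0 • F') := fun s => by
  simpa using hc.fun_mul (hF s)

/-- In coordinates the product is a fixed bilinear map given by structure constants, so this is the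
product rule for complex functions; the order of the factors is preserved. -/
theorem HasGrDeriv.mul {F G : ℝ → Gr κ} {F' G' : Gr κ} (hF : HasGrDeriv F F')
    (hG : HasGrDeriv G G') : HasGrDeriv (fun t => F t * G t) (F' * G 0 + F 0 * G') := by
  obtain ⟨c, key⟩ : ∃ c : _ → _ → _ → ℂ, ∀ (x y : Gr κ) (s), (grBasis κ).repr (x * y) s
      = ∑ a, ∑ b, (grBasis κ).repr x a * (grBasis κ).repr y b * c a b s := by
    refine ⟨fun a b s => (grBasis κ).repr (grBasis κ a * grBasis κ b) s, fun x y s => ?_⟩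
    conv_lhs => rw [← (grBasis κ).sum_repr x, ← (grBasis κ).sum_repr y]
    simp only [Finset.sum_mul_sum, smul_mul_smul_comm, map_sum, map_smul, Finsupp.coe_finsetSum,
      Finset.sum_apply, Finsupp.smul_apply, smul_eq_mul]
  intro s
  simp only [map_add, Finsupp.add_apply, key, ← Finset.sum_add_distrib, ← add_mul]
  exact HasDerivAt.fun_sum fun a _ => HasDerivAt.fun_sum fun b _ =>
    ((hF a).fun_mul (hG b)).mul_const _

theorem HasGrDeriv.congr {F G : ℝ → Gr κ} {F' : Gr κ} (hF : HasGrDeriv F F')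
    (h : ∀ᶠ t in nhds 0, G t = F t) : HasGrDeriv G F' := fun s =>
  (hF s).congr_of_eventuallyEq (h.mono fun t ht => by simp only [ht])

end GrassmannDerivative

/-! ### Conjugation of the Grassmann algebra -/

section GrassmannConj

variable {κ : Type} [Fintype κ] [DecidableEq κ]

/-- The antilinear ring homomorphism that fixes the generators. -/
def grStar (F : Gr κ) : Gr κ := ∑ s, (starRingEnd ℂ) ((grBasis κ).repr F s) • grBasis κ s

theorem grConj_eq (F : Gr κ) :
    grConj F = CliffordAlgebra.reverse (Q := (0 : QuadraticForm ℂ (κ → ℂ))) (grStar F) := rfl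

theorem grStar_add (x y : Gr κ) : grStar (x + y) = grStar x + grStar y := by
  simp [grStar, add_smul, Finset.sum_add_distrib]

theorem grStar_smul (c : ℂ) (x : Gr κ) : grStar (c • x) = (starRingEnd ℂ) c • grStar x := by
  simp [grStar, Finset.smul_sum, mul_smul]

theorem grStar_sum {α : Type} (A : Finset α) (f : α → Gr κ) :
    grStar (∑ a ∈ A, f a) = ∑ a ∈ A, grStar (f a) := by
  classical
  induction A using Finset.induction_on with
  | empty => simp [grStar]
  | insert a A ha ih => rw [Finset.sum_insert ha, Finset.sum_insert ha, grStar_add, ih]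

theorem grStar_basis (s) : grStar (grBasis κ s) = grBasis κ s := by
  rw [grStar, Finset.sum_eq_single s]
  · simp
  · intro t _ ht
    simp [ht.symm]
  · simp

/-- The structure constants in the monomial basis are `0` and `±1`, hence real. This is what makes
coefficientwise conjugation multiplicative. -/
theorem grStar_basis_mul_basis (s t) :
    grStar (grBasis κ s * grBasis κ t) = grBasis κ s * grBasis κ t := by
  set b := (Pi.basisFun ℂ κ).reindex (Fintype.equivFin κ) with hb
  let s' : Set.powersetCard (Fin (Fintype.card κ)) s.card := ⟨s, rfl⟩
  let t' : Set.powersetCard (Fin (Fintype.card κ)) t.card := ⟨t, rfl⟩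
  by_cases h : Disjoint s'.val t'.val
  · have := ExteriorAlgebra.basis_mul_of_disjoint b s' t' h
    change grBasis κ s * grBasis κ t = _ at this
    rw [this]
    rcases Int.units_eq_one_or (Set.powersetCard.permOfDisjoint h).sign with h1 | h1
    · rw [h1, one_smul]
      exact grStar_basis _
    · rw [h1, Units.neg_smul, one_smul, ← neg_one_smul ℂ, grStar_smul]
      rw [map_neg, map_one]
      congr 1
      exact grStar_basis _
  · have := ExteriorAlgebra.basis_mul_of_not_disjoint b s' t' h
    change grBasis κ s * grBasis κ t = _ at this
    rw [this]
    simp [grStar]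

theorem grStar_mul (x y : Gr κ) : grStar (x * y) = grStar x * grStar y := by
  conv_lhs => rw [← (grBasis κ).sum_repr x, ← (grBasis κ).sum_repr y]
  rw [Finset.sum_mul_sum, grStar_sum]
  simp only [grStar_sum, smul_mul_smul_comm, grStar_smul, grStar_basis_mul_basis]
  conv_rhs => rw [grStar, grStar, Finset.sum_mul_sum]
  simp only [map_mul, smul_mul_smul_comm]

theorem grBasis_singleton (i) : grBasis κ {i} = gen ((Fintype.equivFin κ).symm i) := by
  rw [grBasis, ExteriorAlgebra.basis_apply_ofCard (n := 1) _ (Finset.card_singleton i)]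
  have h := Finset.orderEmbOfFin_mem {i} (Finset.card_singleton i) 0
  rw [Finset.mem_singleton] at h
  simp [ExteriorAlgebra.ιMulti_family, gen, ExteriorAlgebra.ιMulti_apply,
    Set.powersetCard.ofFinEmbEquiv_symm_apply, h]

theorem grStar_gen (k : κ) : grStar (gen k) = gen k := by
  have := grBasis_singleton (κ := κ) (Fintype.equivFin κ k)
  rw [Equiv.symm_apply_apply] at this
  rw [← this, grStar_basis]

theorem grConj_add (x y : Gr κ) : grConj (x + y) = grConj x + grConj y := by
  rw [grConj_eq, grStar_add, map_add, ← grConj_eq, ← grConj_eq]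

theorem grConj_smul (c : ℂ) (x : Gr κ) : grConj (c • x) = (starRingEnd ℂ) c • grConj x := by
  rw [grConj_eq, grStar_smul, map_smul, ← grConj_eq]

theorem grConj_sum {α : Type} (A : Finset α) (f : α → Gr κ) :
    grConj (∑ a ∈ A, f a) = ∑ a ∈ A, grConj (f a) := by
  simp only [grConj_eq, grStar_sum, map_sum]

/-- `x` is a real linear combination of the generators. -/
def IsRealLinear (x : Gr κ) : Prop := ∃ v : κ → ℝ, x = ∑ k, (v k : ℂ) • gen k

theorem IsRealLinear.exists_ι {x : Gr κ} (h : IsRealLinear x) :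
    ∃ v : κ → ℂ, x = ExteriorAlgebra.ι ℂ v := by
  obtain ⟨v, rfl⟩ := h
  exact ⟨fun k => (v k : ℂ), (ι_eq_sum_gen _).symm⟩

theorem IsRealLinear.grStar {x : Gr κ} (h : IsRealLinear x) : grStar x = x := by
  obtain ⟨v, rfl⟩ := h
  simp only [grStar_sum, grStar_smul, grStar_gen, Complex.conj_ofReal]

theorem reverse_ι' (v : κ → ℂ) :
    CliffordAlgebra.reverse (Q := (0 : QuadraticForm ℂ (κ → ℂ))) (ExteriorAlgebra.ι ℂ v)
      = ExteriorAlgebra.ι ℂ v :=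
  CliffordAlgebra.reverse_ι (Q := (0 : QuadraticForm ℂ (κ → ℂ))) v

theorem IsRealLinear.grConj {x : Gr κ} (h : IsRealLinear x) : grConj x = x := by
  rw [grConj_eq, h.grStar]
  obtain ⟨v, rfl⟩ := h.exists_ι
  exact reverse_ι' v

/-- Conjugation reverses the order of three real odd factors, which costs a sign. -/
theorem grConj_cubic {x y z : Gr κ} (hx : IsRealLinear x) (hy : IsRealLinear y)
    (hz : IsRealLinear z) : BiHKT.grConj (x * (y * z)) = -(x * (y * z)) := by
  rw [grConj_eq, grStar_mul, grStar_mul, hx.grStar, hy.grStar, hz.grStar]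
  obtain ⟨u, rfl⟩ := hx.exists_ι
  obtain ⟨v, rfl⟩ := hy.exists_ι
  obtain ⟨w, rfl⟩ := hz.exists_ι
  rw [CliffordAlgebra.reverse.map_mul, CliffordAlgebra.reverse.map_mul, reverse_ι', reverse_ι',
    reverse_ι', ι_mul_ι_swap w v, neg_mul, ← ι_mul_ι_central]

end GrassmannConj

/-! ### Contraction of tensors with algebra-valued vectors -/

section Contraction

variable {ι : Type} [Fintype ι] [DecidableEq ι] {G : Type} [Ring G] [Algebra ℂ G]

/-- `T_{MN} X^M Y^N`. -/
def con2 (T : ι → ι → ℂ) : (ι → G) →ₗ[ℂ] (ι → G) →ₗ[ℂ] G :=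
  LinearMap.mk₂ ℂ (fun X Y => ∑ M, ∑ N, T M N • (X M * Y N))
    (fun X X' Y => by simp [add_mul, Finset.sum_add_distrib])
    (fun c X Y => by simp [Finset.smul_sum, smul_comm c])
    (fun X Y Y' => by simp [mul_add, Finset.sum_add_distrib])
    (fun c X Y => by simp [Finset.smul_sum, smul_comm c])

theorem con2_apply (T : ι → ι → ℂ) (X Y : ι → G) :
    con2 T X Y = ∑ M, ∑ N, T M N • (X M * Y N) := rfl

/-- `T_{MNK} X^M Y^N Z^K`. -/
def con3 (T : ι → ι → ι → ℂ) : (ι → G) →ₗ[ℂ] (ι → G) →ₗ[ℂ] (ι → G) →ₗ[ℂ] G :=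
  LinearMap.mk₂ ℂ (fun X Y => ∑ M, LinearMap.mulLeft ℂ (X M) ∘ₗ con2 (T M) Y)
    (fun X X' Y => by ext; simp [add_mul, Finset.sum_add_distrib])
    (fun c X Y => by ext; simp [Finset.smul_sum])
    (fun X Y Y' => by ext; simp [mul_add, Finset.sum_add_distrib])
    (fun c X Y => by ext; simp [Finset.smul_sum])

theorem con3_eq_mul_con2 (T : ι → ι → ι → ℂ) (X Y Z : ι → G) :
    con3 T X Y Z = ∑ M, X M * con2 (T M) Y Z := by simp [con3]

theorem con3_apply (T : ι → ι → ι → ℂ) (X Y Z : ι → G) :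
    con3 T X Y Z = ∑ M, ∑ N, ∑ K, T M N K • (X M * (Y N * Z K)) := by
  simp [con3_eq_mul_con2, con2_apply, Finset.mul_sum]

/-- `T_{MNKL} X^M Y^N Z^K W^L`. -/
def con4 (T : ι → ι → ι → ι → ℂ) :
    (ι → G) →ₗ[ℂ] (ι → G) →ₗ[ℂ] (ι → G) →ₗ[ℂ] (ι → G) →ₗ[ℂ] G :=
  LinearMap.mk₂ ℂ (fun X Y => ∑ M, (con3 (T M) Y).compr₂ (LinearMap.mulLeft ℂ (X M)))
    (fun X X' Y => by ext; simp [add_mul, Finset.sum_add_distrib])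
    (fun c X Y => by ext; simp [Finset.smul_sum])
    (fun X Y Y' => by ext; simp [mul_add, Finset.sum_add_distrib])
    (fun c X Y => by ext; simp [Finset.smul_sum])

theorem con4_eq_mul_con3 (T : ι → ι → ι → ι → ℂ) (X Y Z W : ι → G) :
    con4 T X Y Z W = ∑ M, X M * con3 (T M) Y Z W := by simp [con4]

theorem con4_apply (T : ι → ι → ι → ι → ℂ) (X Y Z W : ι → G) :
    con4 T X Y Z W
      = ∑ M, ∑ N, ∑ K, ∑ L, T M N K L • (X M * (Y N * (Z K * W L))) := by
  simp [con4_eq_mul_con3, con3_apply, Finset.mul_sum]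

/-- The components of `X` anticommute with those of `Y`. -/
def AntiComm (X Y : ι → G) : Prop := ∀ M N, X M * Y N = -(Y N * X M)

/-- The components of `X` are central. -/
def Central (X : ι → G) : Prop := ∀ M y, X M * y = y * X M

/-- Symmetry of the tensor exchanges the slots, and anticommutation of the components costs the
sign. This rule and its analogues for three and four slots make contractions of derivatives of `L`
with odd vectors behave as antisymmetric arrays. -/
theorem con2_swap {T : ι → ι → ℂ} (hT : ∀ M N, T M N = T N M) {X Y : ι → G}
    (h : AntiComm X Y) : con2 T X Y = -con2 T Y X := by
  rw [con2_apply, con2_apply, Finset.sum_comm, ← Finset.sum_neg_distrib]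
  refine Finset.sum_congr rfl fun M _ => ?_
  rw [← Finset.sum_neg_distrib]
  exact Finset.sum_congr rfl fun N _ => by rw [h, hT, smul_neg]

theorem con2_comm {T : ι → ι → ℂ} (hT : ∀ M N, T M N = T N M) {X Y : ι → G}
    (h : Central X) : con2 T X Y = con2 T Y X := by
  rw [con2_apply, con2_apply, Finset.sum_comm]
  exact Finset.sum_congr rfl fun M _ => Finset.sum_congr rfl fun N _ => by rw [h, hT]

theorem con3_swap23 {T : ι → ι → ι → ℂ} (hT : ∀ M N K, T M N K = T M K N) {Y Z : ι → G}
    (h : AntiComm Y Z) (X : ι → G) : con3 T X Y Z = -con3 T X Z Y := by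
  rw [con3_eq_mul_con2, con3_eq_mul_con2, ← Finset.sum_neg_distrib]
  exact Finset.sum_congr rfl fun M _ => by rw [con2_swap (hT M) h, mul_neg]

theorem con3_comm23 {T : ι → ι → ι → ℂ} (hT : ∀ M N K, T M N K = T M K N) {Y : ι → G}
    (h : Central Y) (X Z : ι → G) : con3 T X Y Z = con3 T X Z Y := by
  rw [con3_eq_mul_con2, con3_eq_mul_con2]
  exact Finset.sum_congr rfl fun M _ => by rw [con2_comm (hT M) h]

theorem con3_swap12 {T : ι → ι → ι → ℂ} (hT : ∀ M N K, T M N K = T N M K) {X Y : ι → G}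
    (h : AntiComm X Y) (Z : ι → G) : con3 T X Y Z = -con3 T Y X Z := by
  rw [con3_apply, con3_apply, Finset.sum_comm, ← Finset.sum_neg_distrib]
  refine Finset.sum_congr rfl fun N _ => ?_
  rw [← Finset.sum_neg_distrib]
  refine Finset.sum_congr rfl fun M _ => ?_
  rw [← Finset.sum_neg_distrib]
  refine Finset.sum_congr rfl fun K _ => ?_
  rw [← mul_assoc, h, neg_mul, mul_assoc, hT, smul_neg]

theorem con3_comm12 {T : ι → ι → ι → ℂ} (hT : ∀ M N K, T M N K = T N M K) {X : ι → G}
    (h : Central X) (Y Z : ι → G) : con3 T X Y Z = con3 T Y X Z := by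
  rw [con3_apply, con3_apply, Finset.sum_comm]
  refine Finset.sum_congr rfl fun N _ => Finset.sum_congr rfl fun M _ =>
    Finset.sum_congr rfl fun K _ => ?_
  rw [← mul_assoc, h, mul_assoc, hT]

theorem con4_swap12 {T : ι → ι → ι → ι → ℂ} (hT : ∀ M N K L, T M N K L = T N M K L)
    {X Y : ι → G} (h : AntiComm X Y) (Z W : ι → G) : con4 T X Y Z W = -con4 T Y X Z W := by
  rw [con4_apply, con4_apply, Finset.sum_comm, ← Finset.sum_neg_distrib]
  refine Finset.sum_congr rfl fun N _ => ?_
  rw [← Finset.sum_neg_distrib]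
  refine Finset.sum_congr rfl fun M _ => ?_
  rw [← Finset.sum_neg_distrib]
  refine Finset.sum_congr rfl fun K _ => ?_
  rw [← Finset.sum_neg_distrib]
  refine Finset.sum_congr rfl fun L _ => ?_
  rw [← mul_assoc, h, neg_mul, mul_assoc, hT, smul_neg]

theorem con4_swap23 {T : ι → ι → ι → ι → ℂ} (hT : ∀ M N K L, T M N K L = T M K N L)
    {Y Z : ι → G} (h : AntiComm Y Z) (X W : ι → G) : con4 T X Y Z W = -con4 T X Z Y W := by
  rw [con4_eq_mul_con3, con4_eq_mul_con3, ← Finset.sum_neg_distrib]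
  exact Finset.sum_congr rfl fun M _ => by rw [con3_swap12 (hT M) h, mul_neg]

theorem con4_swap34 {T : ι → ι → ι → ι → ℂ} (hT : ∀ M N K L, T M N K L = T M N L K)
    {Z W : ι → G} (h : AntiComm Z W) (X Y : ι → G) : con4 T X Y Z W = -con4 T X Y W Z := by
  rw [con4_eq_mul_con3, con4_eq_mul_con3, ← Finset.sum_neg_distrib]
  exact Finset.sum_congr rfl fun M _ => by rw [con3_swap23 (hT M) h, mul_neg]

/-- The action `X ↦ X^S J_S{}^M` of a matrix on vectors. -/
def act (J : Matrix ι ι ℂ) : (ι → G) →ₗ[ℂ] (ι → G) where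
  toFun X M := ∑ S, J S M • X S
  map_add' X Y := by ext M; simp [Finset.sum_add_distrib]
  map_smul' c X := by ext M; simp [Finset.smul_sum, smul_comm c]

theorem act_apply (J : Matrix ι ι ℂ) (X : ι → G) (M : ι) : act J X M = ∑ S, J S M • X S := rfl

theorem act_add_left (J K : Matrix ι ι ℂ) (X : ι → G) : act (J + K) X = act J X + act K X := by
  ext M; simp [act_apply, add_smul, Finset.sum_add_distrib]

theorem act_sub_left (J K : Matrix ι ι ℂ) (X : ι → G) : act (J - K) X = act J X - act K X := by
  ext M; simp [act_apply, sub_smul]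

theorem act_neg_left (J : Matrix ι ι ℂ) (X : ι → G) : act (-J) X = -act J X := by
  ext M; simp [act_apply]

theorem act_smul_left (c : ℂ) (J : Matrix ι ι ℂ) (X : ι → G) : act (c • J) X = c • act J X := by
  ext M; simp [act_apply, mul_smul, Finset.smul_sum]

theorem act_one (X : ι → G) : act (1 : Matrix ι ι ℂ) X = X := by
  ext M
  rw [act_apply, Finset.sum_eq_single M]
  · simp
  · intro S _ h
    rw [Matrix.one_apply_ne h, zero_smul]
  · simp

theorem act_act (J K : Matrix ι ι ℂ) (X : ι → G) : act J (act K X) = act (K * J) X := by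
  ext M
  simp only [act_apply, Finset.smul_sum, Matrix.mul_apply, Finset.sum_smul]
  rw [Finset.sum_comm]
  exact Finset.sum_congr rfl fun S _ => Finset.sum_congr rfl fun R _ => by
    rw [smul_smul, mul_comm]

theorem AntiComm.act {X Y : ι → G} (h : AntiComm X Y) (J K : Matrix ι ι ℂ) :
    AntiComm (act J X) (act K Y) := by
  intro M N
  simp only [act_apply, Finset.sum_mul_sum, ← Finset.sum_neg_distrib]
  rw [Finset.sum_comm]
  refine Finset.sum_congr rfl fun S _ => Finset.sum_congr rfl fun R _ => ?_
  rw [smul_mul_smul_comm, smul_mul_smul_comm, h, smul_neg, mul_comm]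

theorem Central.act {X : ι → G} (h : Central X) (J : Matrix ι ι ℂ) : Central (act J X) := by
  intro M y
  simp only [act_apply, Finset.sum_mul, Finset.mul_sum]
  refine Finset.sum_congr rfl fun S _ => ?_
  rw [smul_mul_assoc, h, mul_smul_comm]

/-- The matrices move from the vectors onto the tensor. The new components are the same contraction
over `ℂ`, taken with rows of the matrices; in this way a form on algebra-valued vectors is
identified with its array of components. -/
theorem con2_act (T : ι → ι → ℂ) (J K : Matrix ι ι ℂ) (X Y : ι → G) :
    con2 T (act J X) (act K Y) = con2 (fun M N => con2 T (J M) (K N)) X Y := by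
  conv_lhs => rw [con2_apply]
  conv_rhs => rw [con2_apply]
  simp only [con2_apply, act_apply, Finset.sum_mul_sum, Finset.smul_sum, Finset.sum_smul]
  conv_lhs => enter [2, M]; rw [Finset.sum_comm]
  rw [Finset.sum_comm]
  refine Finset.sum_congr rfl fun S _ => ?_
  conv_lhs => enter [2, M]; rw [Finset.sum_comm]
  rw [Finset.sum_comm]
  refine Finset.sum_congr rfl fun R _ => Finset.sum_congr rfl fun M _ =>
    Finset.sum_congr rfl fun N _ => ?_
  rw [smul_mul_smul_comm, smul_smul, smul_eq_mul]

theorem con2_sum_tensor {α : Type} (A : Finset α) (c : α → ℂ) (t : α → ι → ι → ℂ)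
    (X Y : ι → G) :
    con2 (fun M N => ∑ a ∈ A, c a * t a M N) X Y = ∑ a ∈ A, c a • con2 (t a) X Y := by
  simp only [con2_apply, Finset.sum_smul, Finset.smul_sum, smul_smul]
  conv_lhs => enter [2, M]; rw [Finset.sum_comm]
  rw [Finset.sum_comm]

theorem con3_sum_tensor {α : Type} (A : Finset α) (c : α → ℂ) (t : α → ι → ι → ι → ℂ)
    (X Y Z : ι → G) :
    con3 (fun M N K => ∑ a ∈ A, c a * t a M N K) X Y Z = ∑ a ∈ A, c a • con3 (t a) X Y Z := by
  simp only [con3_eq_mul_con2, con2_sum_tensor, Finset.mul_sum, Finset.smul_sum, mul_smul_comm]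
  rw [Finset.sum_comm]

theorem con3_act (T : ι → ι → ι → ℂ) (J K L : Matrix ι ι ℂ) (X Y Z : ι → G) :
    con3 T (act J X) (act K Y) (act L Z)
      = con3 (fun M N P => con3 T (J M) (K N) (L P)) X Y Z := by
  have h : ∀ M N P, con3 T (J M) (K N) (L P) = ∑ S, J M S * con2 (T S) (K N) (L P) :=
    fun M N P => con3_eq_mul_con2 _ _ _ _
  simp only [con3_eq_mul_con2, h, con2_sum_tensor, con2_act, act_apply, Finset.sum_mul,
    Finset.mul_sum, mul_smul_comm, smul_mul_assoc]
  rw [Finset.sum_comm]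

theorem con4_act (T : ι → ι → ι → ι → ℂ) (J K L R : Matrix ι ι ℂ) (X Y Z W : ι → G) :
    con4 T (act J X) (act K Y) (act L Z) (act R W)
      = con4 (fun M N P Q => con4 T (J M) (K N) (L P) (R Q)) X Y Z W := by
  have h : ∀ M N P Q, con4 T (J M) (K N) (L P) (R Q)
      = ∑ S, J M S * con3 (T S) (K N) (L P) (R Q) := fun M N P Q => con4_eq_mul_con3 _ _ _ _ _
  simp only [con4_eq_mul_con3, h, con3_sum_tensor, con3_act, act_apply, Finset.sum_mul,
    Finset.mul_sum, mul_smul_comm, smul_mul_assoc]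
  rw [Finset.sum_comm]

end Contraction

/-! ### Block matrices acting on the multiplets -/

section Blocks

variable {n m : ℕ}

/-- The block-diagonal matrix with block `c F • q` for the flavour `F`. -/
def blk (c : Flavor n m → ℂ) (q : Matrix (Fin 4) (Fin 4) ℂ) :
    Matrix (RIdx n m) (RIdx n m) ℂ :=
  fun M N => if M.1 = N.1 then c M.1 * q M.2 N.2 else 0

theorem blk_mul_blk (c c' : Flavor n m → ℂ) (q q' : Matrix (Fin 4) (Fin 4) ℂ) :
    blk c q * blk c' q' = blk (c * c') (q * q') := by
  ext ⟨F, i⟩ ⟨H, j⟩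
  simp only [Matrix.mul_apply, blk, Fintype.sum_prod_type, Pi.mul_apply]
  rw [Finset.sum_eq_single F]
  · rcases eq_or_ne F H with rfl | h
    · simp only [if_true, Finset.mul_sum]
      exact Finset.sum_congr rfl fun k _ => by ring
    · simp [h]
  · intro K _ hK
    simp [hK.symm]
  · simp

theorem act_blk_apply {G : Type} [Ring G] [Algebra ℂ G] (c : Flavor n m → ℂ)
    (q : Matrix (Fin 4) (Fin 4) ℂ) (X : RIdx n m → G) (F : Flavor n m) (j : Fin 4) :
    act (blk c q) X (F, j) = c F • ∑ k, q k j • X (F, k) := by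
  simp only [act_apply, blk, Fintype.sum_prod_type]
  rw [Finset.sum_eq_single F]
  · simp [Finset.smul_sum, mul_smul]
  · intro K _ hK
    simp [hK]
  · simp

/-- The unit matrix and the three canonical quaternionic matrices. -/
def quatC : Fin 4 → Matrix (Fin 4) (Fin 4) ℂ :=
  ![!![1, 0, 0, 0; 0, 1, 0, 0; 0, 0, 1, 0; 0, 0, 0, 1],
    !![0, -1, 0, 0; 1, 0, 0, 0; 0, 0, 0, -1; 0, 0, 1, 0],
    !![0, 0, 1, 0; 0, 0, 0, -1; -1, 0, 0, 0; 0, 1, 0, 0],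
    !![0, 0, 0, 1; 0, 0, 1, 0; 0, -1, 0, 0; -1, 0, 0, 0]]

theorem quatC_succ (p : Fin 3) (i j : Fin 4) : quatC p.succ i j = (quat p i j : ℂ) := by
  fin_cases p <;> fin_cases i <;> fin_cases j <;> simp [quatC, quat]

theorem quatC_zero : quatC 0 = 1 := by
  ext i j; fin_cases i <;> fin_cases j <;> simp [quatC]

/-- The index of the product of two canonical quaternionic matrices. -/
def quatIdx : Fin 4 → Fin 4 → Fin 4 :=
  ![![0, 1, 2, 3], ![1, 0, 3, 2], ![2, 3, 0, 1], ![3, 2, 1, 0]]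

/-- The sign of the product of two canonical quaternionic matrices. -/
def quatSgn : Fin 4 → Fin 4 → ℂ :=
  ![![1, 1, 1, 1], ![1, -1, 1, -1], ![1, -1, -1, 1], ![1, 1, -1, -1]]

theorem quatC_mul_quatC (a b : Fin 4) :
    quatC a * quatC b = quatSgn a b • quatC (quatIdx a b) := by
  fin_cases a <;> fin_cases b <;> simp [quatC, quatSgn, quatIdx]

/-- The ordinary multiplets. -/
def ordInd : Flavor n m → ℂ := Sum.elim (fun _ => 1) (fun _ => 0)

/-- The mirror multiplets. -/
def mirInd : Flavor n m → ℂ := Sum.elim (fun _ => 0) (fun _ => 1)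

/-- The restrictions of the unit matrix and of the Clifford triple to the ordinary sector (the
indices `0, …, 3`) and to the mirror sector (the indices `4, …, 7`). -/
def JB : Fin 8 → Matrix (RIdx n m) (RIdx n m) ℂ :=
  ![blk ordInd (quatC 0), blk ordInd (quatC 1), blk ordInd (quatC 2), blk ordInd (quatC 3),
    blk mirInd (quatC 0), -blk mirInd (quatC 1), -blk mirInd (quatC 2), -blk mirInd (quatC 3)]

/-- The index of a product of two of the matrices `JB`. -/
def JBIdx : Fin 8 → Fin 8 → Fin 8 :=
  ![![0, 1, 2, 3, 0, 0, 0, 0],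
    ![1, 0, 3, 2, 0, 0, 0, 0],
    ![2, 3, 0, 1, 0, 0, 0, 0],
    ![3, 2, 1, 0, 0, 0, 0, 0],
    ![0, 0, 0, 0, 4, 5, 6, 7],
    ![0, 0, 0, 0, 5, 4, 7, 6],
    ![0, 0, 0, 0, 6, 7, 4, 5],
    ![0, 0, 0, 0, 7, 6, 5, 4]]

/-- The sign of a product of two of the matrices `JB`. -/
def JBSgn : Fin 8 → Fin 8 → ℂ :=
  ![![1, 1, 1, 1, 0, 0, 0, 0],
    ![1, -1, 1, -1, 0, 0, 0, 0],
    ![1, -1, -1, 1, 0, 0, 0, 0],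
    ![1, 1, -1, -1, 0, 0, 0, 0],
    ![0, 0, 0, 0, 1, 1, 1, 1],
    ![0, 0, 0, 0, 1, -1, -1, 1],
    ![0, 0, 0, 0, 1, 1, -1, -1],
    ![0, 0, 0, 0, 1, -1, 1, -1]]

theorem blk_neg (c : Flavor n m → ℂ) (q : Matrix (Fin 4) (Fin 4) ℂ) :
    blk c (-q) = -blk c q := by
  ext M N
  simp only [blk, Matrix.neg_apply]
  split_ifs <;> simp

theorem blk_zero (q : Matrix (Fin 4) (Fin 4) ℂ) : blk (0 : Flavor n m → ℂ) q = 0 := by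
  ext M N
  simp [blk]

theorem ordInd_mul_ordInd : (ordInd * ordInd : Flavor n m → ℂ) = ordInd := by
  ext F; rcases F with a | a <;> simp [ordInd]

theorem mirInd_mul_mirInd : (mirInd * mirInd : Flavor n m → ℂ) = mirInd := by
  ext F; rcases F with a | a <;> simp [mirInd]

theorem ordInd_mul_mirInd : (ordInd * mirInd : Flavor n m → ℂ) = 0 := by
  ext F; rcases F with a | a <;> simp [ordInd, mirInd]

theorem mirInd_mul_ordInd : (mirInd * ordInd : Flavor n m → ℂ) = 0 := by
  ext F; rcases F with a | a <;> simp [ordInd, mirInd]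

/-- Products across the sectors vanish: there the sign is `0` and the index `0` is a placeholder.
The mirror matrices are minus the canonical ones, so `JB 5 * JB 6 = -JB 7` while `JB 1 * JB 2 = JB
3`. This opposite orientation separates the Clifford relations from the quaternion algebra. -/
theorem JB_mul_JB (i j : Fin 8) :
    (JB i * JB j : Matrix (RIdx n m) (RIdx n m) ℂ) = JBSgn i j • JB (JBIdx i j) := by
  fin_cases i <;> fin_cases j <;>
    simp [JB, JBSgn, JBIdx, blk_mul_blk, quatC_mul_quatC, quatSgn, quatIdx, ordInd_mul_ordInd,
      mirInd_mul_mirInd, ordInd_mul_mirInd, mirInd_mul_ordInd, blk_neg, blk_zero]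

theorem JB_zero_add_JB_four : (JB 0 + JB 4 : Matrix (RIdx n m) (RIdx n m) ℂ) = 1 := by
  ext ⟨F, i⟩ ⟨H, j⟩
  rcases F with a | a <;> rcases H with b | b <;>
    simp [JB, blk, ordInd, mirInd, quatC_zero, Matrix.one_apply, Prod.ext_iff, ite_and]

theorem JB_add_JB_eq_clifford (p : Fin 3) (x : Pt n m) :
    (JB (![1, 2, 3] p) + JB (![5, 6, 7] p) : Matrix (RIdx n m) (RIdx n m) ℂ)
      = (cliffordTriple p x).map (fun r : ℝ => (r : ℂ)) := by
  ext ⟨F, i⟩ ⟨H, j⟩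
  have h := quatC_succ p i j
  fin_cases p <;> rcases F with a | a <;> rcases H with b | b <;>
    simp_all [JB, blk, ordInd, mirInd, cliffordTriple, sector, apply_ite]

end Blocks

/-! ### Cubic and quartic forms built from the Clifford triple -/

section Forms

variable {n m : ℕ} {G : Type} [Ring G] [Algebra ℂ G]

/-- The unit matrix and the Clifford triple. -/
def JT : Fin 4 → Matrix (RIdx n m) (RIdx n m) ℂ :=
  ![JB 0 + JB 4, JB 1 + JB 5, JB 2 + JB 6, JB 3 + JB 7]

/-- Symmetry of a tensor with three indices. -/
structure IsSym3 {ι : Type} (T : ι → ι → ι → ℂ) : Prop where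
  swap12 : ∀ M N K, T M N K = T N M K
  swap23 : ∀ M N K, T M N K = T M K N

/-- The trilinear form whose value on odd vectors is the coefficient function `T_3` of the
fermion-cubic part `S_a` of a supercharge. -/
def cubicForm (T : RIdx n m → RIdx n m → RIdx n m → ℂ) (a : Fin 4) (X Y Z : RIdx n m → G) : G :=
  (Complex.I / 2) •
    ((![1, -1, -1, -1] a : ℂ) • con3 T (act (JT (![1, 0, 0, 0] a)) X)
        (act (JT (![2, 2, 3, 1] a)) Y) (act (JT (![3, 3, 1, 2] a)) Z)
      + (con3 T (act (JT a) X) (act (JB 0) Y) (act (JB 4) Z)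
        + con3 T (act (JT a) X) (act (JB 1) Y) (act (JB 5) Z)
        + con3 T (act (JT a) X) (act (JB 2) Y) (act (JB 6) Z)
        + con3 T (act (JT a) X) (act (JB 3) Y) (act (JB 7) Z)))

/-- The trilinear form of the coefficients `A_{MNK}` of the Lagrangian. -/
def gaugeForm (T : RIdx n m → RIdx n m → RIdx n m → ℂ) (v X Y : RIdx n m → G) : G :=
  (Complex.I / 4) •
    (con3 T (act (JT 1) v) (act (JT 2) X) (act (JT 3) Y)
      + con3 T (act (JT 2) v) (act (JT 3) X) (act (JT 1) Y)
      + con3 T (act (JT 3) v) (act (JT 1) X) (act (JT 2) Y)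
      - con3 T (act (JB 1 - JB 5) v) (act (JT 0) X) (act (JT 1) Y)
      - con3 T (act (JB 2 - JB 6) v) (act (JT 0) X) (act (JT 2) Y)
      - con3 T (act (JB 3 - JB 7) v) (act (JT 0) X) (act (JT 3) Y)
      + con3 T (act (JT 0) v) (act (JB 0) X) (act (JB 4) Y)
      + con3 T (act (JT 0) v) (act (JB 1) X) (act (JB 5) Y)
      + con3 T (act (JT 0) v) (act (JB 2) X) (act (JB 6) Y)
      + con3 T (act (JT 0) v) (act (JB 3) X) (act (JB 7) Y))

/-- The trilinear form of the derivative of the metric. -/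
def metricForm (T : RIdx n m → RIdx n m → RIdx n m → ℂ) (v X Y : RIdx n m → G) : G :=
  (1 / 2 : ℂ) •
    (con3 T v (act (JB 0) X) (act (JB 0) Y) + con3 T v (act (JB 1) X) (act (JB 1) Y)
      + con3 T v (act (JB 2) X) (act (JB 2) Y) + con3 T v (act (JB 3) X) (act (JB 3) Y)
      - con3 T v (act (JB 4) X) (act (JB 4) Y) - con3 T v (act (JB 5) X) (act (JB 5) Y)
      - con3 T v (act (JB 6) X) (act (JB 6) Y) - con3 T v (act (JB 7) X) (act (JB 7) Y))

section Sorting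

variable {T : RIdx n m → RIdx n m → RIdx n m → ℂ} {Ψ y : RIdx n m → G}

theorem eq_zero_of_eq_neg {x : G} (h : x = -x) : x = 0 := by
  have h2 : (2 : ℂ) • x = 0 := by
    rw [two_smul]
    nth_rewrite 1 [h]
    exact neg_add_cancel x
  simpa using h2

/-- The order condition directs the rewriting: labels only move towards increasing order, so `simp`
with `decide` sorts them and stops. -/
theorem con3_JB_sort12 (hT : IsSym3 T) (hΨ : AntiComm Ψ Ψ) {i j : Fin 8} (_h : j < i)
    (Z : RIdx n m → G) :
    con3 T (act (JB i) Ψ) (act (JB j) Ψ) Z = -con3 T (act (JB j) Ψ) (act (JB i) Ψ) Z :=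
  con3_swap12 hT.swap12 (hΨ.act _ _) Z

theorem con3_JB_sort23 (hT : IsSym3 T) (hΨ : AntiComm Ψ Ψ) {i j : Fin 8} (_h : j < i)
    (X : RIdx n m → G) :
    con3 T X (act (JB i) Ψ) (act (JB j) Ψ) = -con3 T X (act (JB j) Ψ) (act (JB i) Ψ) :=
  con3_swap23 hT.swap23 (hΨ.act _ _) X

theorem con3_JB_self12 (hT : IsSym3 T) (hΨ : AntiComm Ψ Ψ) (i : Fin 8) (Z : RIdx n m → G) :
    con3 T (act (JB i) Ψ) (act (JB i) Ψ) Z = 0 :=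
  eq_zero_of_eq_neg (con3_swap12 hT.swap12 (hΨ.act _ _) Z)

theorem con3_JB_self23 (hT : IsSym3 T) (hΨ : AntiComm Ψ Ψ) (i : Fin 8) (X : RIdx n m → G) :
    con3 T X (act (JB i) Ψ) (act (JB i) Ψ) = 0 :=
  eq_zero_of_eq_neg (con3_swap23 hT.swap23 (hΨ.act _ _) X)

theorem con3_JB_front2 (hT : IsSym3 T) (hy : Central y) (i : Fin 8) (X Z : RIdx n m → G) :
    con3 T X (act (JB i) y) Z = con3 T (act (JB i) y) X Z :=
  (con3_comm12 hT.swap12 (hy.act _) X Z).symm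

theorem con3_JB_front3 (hT : IsSym3 T) (hy : Central y) (i : Fin 8) (X Z : RIdx n m → G) :
    con3 T X Z (act (JB i) y) = con3 T (act (JB i) y) X Z := by
  rw [con3_comm12 hT.swap12 (hy.act _), con3_comm23 hT.swap23 (hy.act _)]

theorem act_JB_act_JB (i j : Fin 8) (X : RIdx n m → G) :
    act (JB i) (act (JB j) X) = JBSgn j i • act (JB (JBIdx j i)) X := by
  rw [act_act, JB_mul_JB, act_smul_left]

/-- The cubic part of a supercharge is the gauge potential along `J_a Ψ` up to a factor.
Differentiating this relation is one of the two steps that turn `Π` into the kinetic momentum. -/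
theorem gaugeForm_self (hT : IsSym3 T) (hΨ : AntiComm Ψ Ψ) (a : Fin 4) :
    gaugeForm T (act (JT a) Ψ) Ψ Ψ = (3 / 2 : ℂ) • cubicForm T a Ψ Ψ Ψ := by
  fin_cases a <;>
  · simp [gaugeForm, cubicForm, JT, act_add_left, act_sub_left, act_JB_act_JB, JBSgn, JBIdx]
    -- After sorting, only triples of increasing labels survive, and the claim is linear in them.
    simp (discharger := decide) only [con3_JB_sort12 hT hΨ, con3_JB_sort23 hT hΨ,
      con3_JB_self12 hT hΨ, con3_JB_self23 hT hΨ, neg_neg]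
    module

/-- Contractions with one even and two odd vectors, as an array that is antisymmetric in its last
two indices. -/
theorem exists_array_even (hT : IsSym3 T) (hΨ : AntiComm Ψ Ψ) (y : RIdx n m → G) :
    ∃ u : ℕ → ℕ → ℕ → G,
      (∀ i j k : Fin 8, con3 T (act (JB i) y) (act (JB j) Ψ) (act (JB k) Ψ) = u i j k) ∧
      (∀ i j k, k < j → u i j k = -u i k j) ∧ ∀ i j, u i j j = 0 :=
  -- An opaque array turns the contractions into atoms. Its labels are natural numbers, so that
  -- comparisons of labels are closed numeral facts.
  ⟨fun i j k => con3 T (act (JB (Fin.ofNat 8 i)) y) (act (JB (Fin.ofNat 8 j)) Ψ)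
      (act (JB (Fin.ofNat 8 k)) Ψ), fun i j k => by simp,
    fun _ _ _ _ => con3_swap23 hT.swap23 (hΨ.act _ _) _, fun _ _ => con3_JB_self23 hT hΨ _ _⟩

set_option maxHeartbeats 1600000 in
/-- The derivative of the fermion-cubic part of a supercharge in the direction of an even vector
`y` is compensated by the gauge and metric terms. -/
theorem cubicForm_derivative (hT : IsSym3 T) (hΨ : AntiComm Ψ Ψ) (hy : Central y) (a : Fin 4) :
    cubicForm T a y Ψ Ψ - cubicForm T a Ψ y Ψ + cubicForm T a Ψ Ψ y
      + gaugeForm T (act (JT a) Ψ) y Ψ - gaugeForm T (act (JT a) Ψ) Ψ y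
      + (Complex.I / 2) • metricForm T (act (JT a) Ψ) y Ψ = 0 := by
  obtain ⟨u, hu, sort, self⟩ := exists_array_even hT hΨ y
  fin_cases a <;>
  · simp [gaugeForm, cubicForm, metricForm, JT, act_add_left, act_sub_left, act_JB_act_JB, JBSgn,
      JBIdx]
    -- The even vector commutes with everything, so it is brought to the first slot from wherever it
    -- stands; only the two odd slots need sorting.
    simp only [con3_JB_front2 hT hy, con3_JB_front3 hT hy, hu]
    simp (discharger := decide) only [Fin.isValue, Fin.coe_ofNat_eq_mod, Nat.reduceMod, sort, self]
    module

end Sorting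

section Quartic

variable {T : RIdx n m → RIdx n m → RIdx n m → RIdx n m → ℂ} {Ψ : RIdx n m → G}

/-- Symmetry of a tensor with four indices. -/
structure IsSym4 {ι : Type} (T : ι → ι → ι → ι → ℂ) : Prop where
  swap12 : ∀ M N K L, T M N K L = T N M K L
  swap23 : ∀ M N K L, T M N K L = T M K N L
  swap34 : ∀ M N K L, T M N K L = T M N L K

theorem IsSym4.isSym3 {ι : Type} {T : ι → ι → ι → ι → ℂ} (h : IsSym4 T) (M : ι) :
    IsSym3 (T M) :=
  ⟨h.swap23 M, h.swap34 M⟩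

/-- Contractions with four odd vectors, as an antisymmetric array. -/
theorem exists_array_quartic (hT : IsSym4 T) (hΨ : AntiComm Ψ Ψ) :
    ∃ u : ℕ → ℕ → ℕ → ℕ → G,
      (∀ i j k l : Fin 8, con4 T (act (JB i) Ψ) (act (JB j) Ψ) (act (JB k) Ψ) (act (JB l) Ψ)
        = u i j k l) ∧
      (∀ i j k l, j < i → u i j k l = -u j i k l) ∧ (∀ i j k l, k < j → u i j k l = -u i k j l) ∧
      (∀ i j k l, l < k → u i j k l = -u i j l k) ∧ (∀ i k l, u i i k l = 0) ∧
      (∀ i j l, u i j j l = 0) ∧ ∀ i j k, u i j k k = 0 :=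
  ⟨fun i j k l => con4 T (act (JB (Fin.ofNat 8 i)) Ψ) (act (JB (Fin.ofNat 8 j)) Ψ)
      (act (JB (Fin.ofNat 8 k)) Ψ) (act (JB (Fin.ofNat 8 l)) Ψ), fun i j k l => by simp,
    fun _ _ _ _ _ => con4_swap12 hT.swap12 (hΨ.act _ _) _ _,
    fun _ _ _ _ _ => con4_swap23 hT.swap23 (hΨ.act _ _) _ _,
    fun _ _ _ _ _ => con4_swap34 hT.swap34 (hΨ.act _ _) _ _,
    fun _ _ _ => eq_zero_of_eq_neg (con4_swap12 hT.swap12 (hΨ.act _ _) _ _),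
    fun _ _ _ => eq_zero_of_eq_neg (con4_swap23 hT.swap23 (hΨ.act _ _) _ _),
    fun _ _ _ => eq_zero_of_eq_neg (con4_swap34 hT.swap34 (hΨ.act _ _) _ _)⟩

/-- The derivative of `cubicForm` along the vector `Y`, as a form in the fourth derivatives. -/
theorem sum_mul_cubicForm (a : Fin 4) (X Y : RIdx n m → G) :
    ∑ M, Y M * cubicForm (T M) a X X X = (Complex.I / 2) •
    ((![1, -1, -1, -1] a : ℂ) • con4 T Y (act (JT (![1, 0, 0, 0] a)) X)
        (act (JT (![2, 2, 3, 1] a)) X) (act (JT (![3, 3, 1, 2] a)) X)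
      + (con4 T Y (act (JT a) X) (act (JB 0) X) (act (JB 4) X)
        + con4 T Y (act (JT a) X) (act (JB 1) X) (act (JB 5) X)
        + con4 T Y (act (JT a) X) (act (JB 2) X) (act (JB 6) X)
        + con4 T Y (act (JT a) X) (act (JB 3) X) (act (JB 7) X))) := by
  simp only [cubicForm, con4_eq_mul_con3, mul_smul_comm, mul_add, Finset.sum_add_distrib,
    ← Finset.smul_sum]

set_option maxHeartbeats 1600000 in
-- On the diagonal, the intersectoral terms contain `J_a Ψ` twice and vanish, while the first term
-- of `S_a` supplies the three missing rotations; the signs in `cubicForm` make all four cases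
-- equal, and the factor `i / 2` is doubled. Off the diagonal, the first term of `S_b` already
-- contains `J_a Ψ`, and the other terms cancel because `J_a Ψ` and `J_b Ψ` are exchanged. The left
-- side is symmetric in `a` and `b`, so ordered pairs suffice.
theorem cubicForm_anticomm_of_le (hT : IsSym4 T) (hΨ : AntiComm Ψ Ψ) (a b : Fin 4) (h : a ≤ b) :
    ∑ M, act (JT a) Ψ M * cubicForm (T M) b Ψ Ψ Ψ
      + ∑ M, act (JT b) Ψ M * cubicForm (T M) a Ψ Ψ Ψ
      = if a = b then Complex.I • con4 T (act (JT 0) Ψ) (act (JT 1) Ψ) (act (JT 2) Ψ)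
          (act (JT 3) Ψ) else 0 := by
  obtain ⟨u, hu, s12, s23, s34, z12, z23, z34⟩ := exists_array_quartic hT hΨ
  rw [sum_mul_cubicForm, sum_mul_cubicForm]
  fin_cases a <;> fin_cases b <;> first
  | exact absurd h (by decide)
  | (simp [JT, act_add_left]
     simp only [hu]
     simp (discharger := decide) only [Fin.isValue, Fin.coe_ofNat_eq_mod, Nat.reduceMod, s12, s23,
      s34, z12, z23, z34, neg_zero, neg_neg]
     module)

/-- The supercharges' fermion-cubic parts anticommute up to the quartic form of the Lagrangian. -/
theorem cubicForm_anticomm (hT : IsSym4 T) (hΨ : AntiComm Ψ Ψ) (a b : Fin 4) :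
    ∑ M, act (JT a) Ψ M * cubicForm (T M) b Ψ Ψ Ψ
      + ∑ M, act (JT b) Ψ M * cubicForm (T M) a Ψ Ψ Ψ
      = if a = b then Complex.I • con4 T (act (JT 0) Ψ) (act (JT 1) Ψ) (act (JT 2) Ψ)
          (act (JT 3) Ψ) else 0 := by
  rcases le_total a b with h | h
  · exact cubicForm_anticomm_of_le hT hΨ a b h
  · rw [add_comm, cubicForm_anticomm_of_le hT hΨ b a h]
    simp only [eq_comm]

end Quartic

end Forms

/-! ### Iterated partial derivatives -/

section PartialDerivatives

variable {ι : Type} [Fintype ι] [DecidableEq ι] {E : Type} [NormedAddCommGroup E]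
  [NormedSpace ℝ E] {U : Set (ι → ℝ)}

theorem contDiffOn_pd (hU : IsOpen U) {f : (ι → ℝ) → E} (hf : ContDiffOn ℝ ∞ f U) (M : ι) :
    ContDiffOn ℝ ∞ (fun y => pd f M y) U :=
  (hf.fderiv_of_isOpen hU (by exact_mod_cast le_top)).clm_apply contDiffOn_const

theorem differentiableAt_of_contDiffOn (hU : IsOpen U) {f : (ι → ℝ) → E}
    (hf : ContDiffOn ℝ ∞ f U) {x : ι → ℝ} (hx : x ∈ U) : DifferentiableAt ℝ f x :=
  (hf.contDiffAt (hU.mem_nhds hx)).differentiableAt (by simp)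

theorem pd_congr {f h : (ι → ℝ) → E} {x : ι → ℝ} (hU : IsOpen U) (hx : x ∈ U)
    (hfh : ∀ y ∈ U, f y = h y) (M : ι) : pd f M x = pd h M x := by
  have : f =ᶠ[nhds x] h := Filter.eventually_of_mem (hU.mem_nhds hx) hfh
  rw [pd, pd, this.fderiv_eq]

theorem two_le_infty : (2 : WithTop ℕ∞) ≤ ∞ := by
  exact WithTop.coe_le_coe.2 (le_top : (2 : ℕ∞) ≤ ⊤)

theorem pd_comm (hU : IsOpen U) {f : (ι → ℝ) → E} (hf : ContDiffOn ℝ ∞ f U) {x : ι → ℝ}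
    (hx : x ∈ U) (M N : ι) :
    pd (fun y => pd f M y) N x = pd (fun y => pd f N y) M x := by
  have h := hf.contDiffAt (hU.mem_nhds hx)
  have hd : DifferentiableAt ℝ (fderiv ℝ f) x :=
    (h.fderiv_right (m := ∞) (by exact_mod_cast le_top)).differentiableAt (by simp)
  have key : ∀ P Q : ι, pd (fun y => pd f P y) Q x
      = fderiv ℝ (fderiv ℝ f) x (Pi.single Q 1) (Pi.single P 1) := by
    intro P Q
    simp only [pd]
    rw [fderiv_clm_apply hd (differentiableAt_const _)]
    simp
  rw [key, key]
  exact (h.isSymmSndFDerivAt (by simpa using two_le_infty)).eq _ _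

theorem pd_add {f h : (ι → ℝ) → E} {x : ι → ℝ} (hf : DifferentiableAt ℝ f x)
    (hh : DifferentiableAt ℝ h x) (M : ι) :
    pd (fun y => f y + h y) M x = pd f M x + pd h M x := by
  simp only [pd, fderiv_fun_add hf hh, add_apply]

theorem pd_sum {α : Type} (A : Finset α) {f : α → (ι → ℝ) → E} {x : ι → ℝ}
    (hf : ∀ a ∈ A, DifferentiableAt ℝ (f a) x) (M : ι) :
    pd (fun y => ∑ a ∈ A, f a y) M x = ∑ a ∈ A, pd (f a) M x := by
  simp only [pd, fderiv_fun_sum hf, sum_apply]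

theorem pd_const_smul {f : (ι → ℝ) → ℂ} {x : ι → ℝ} (hf : DifferentiableAt ℝ f x) (c : ℂ)
    (M : ι) : pd (fun y => c * f y) M x = c * pd f M x := by
  simp only [pd, fderiv_const_mul hf, smul_apply, smul_eq_mul]

theorem pd_ofReal {f : (ι → ℝ) → ℝ} {x : ι → ℝ} (hf : DifferentiableAt ℝ f x) (M : ι) :
    pd (fun y => (f y : ℂ)) M x = ((pd f M x : ℝ) : ℂ) := by
  have h : HasFDerivAt (fun y => (f y : ℂ)) (Complex.ofRealCLM.comp (fderiv ℝ f x)) x :=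
    Complex.ofRealCLM.hasFDerivAt.comp x hf.hasFDerivAt
  rw [pd, h.fderiv]
  rfl

/-- The components of the first four derivatives of `L`. -/
def tens1 (L : (ι → ℝ) → ℝ) (x : ι → ℝ) (M : ι) : ℂ := ((pd L M x : ℝ) : ℂ)
def tens2 (L : (ι → ℝ) → ℝ) (x : ι → ℝ) (M N : ι) : ℂ :=
  ((pd (fun y => pd L N y) M x : ℝ) : ℂ)
def tens3 (L : (ι → ℝ) → ℝ) (x : ι → ℝ) (M N K : ι) : ℂ :=
  ((pd (fun y => pd (fun y => pd L K y) N y) M x : ℝ) : ℂ)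
def tens4 (L : (ι → ℝ) → ℝ) (x : ι → ℝ) (M N K P : ι) : ℂ :=
  ((pd (fun y => pd (fun y => pd (fun y => pd L P y) K y) N y) M x : ℝ) : ℂ)

section Smooth

variable {L : (ι → ℝ) → ℝ} {x : ι → ℝ}

theorem contDiffOn_tens1 (hU : IsOpen U) (hL : ContDiffOn ℝ ∞ L U) (M : ι) :
    ContDiffOn ℝ ∞ (fun y => tens1 L y M) U :=
  Complex.ofRealCLM.contDiff.comp_contDiffOn (contDiffOn_pd hU hL M)

theorem contDiffOn_tens2 (hU : IsOpen U) (hL : ContDiffOn ℝ ∞ L U) (M N : ι) :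
    ContDiffOn ℝ ∞ (fun y => tens2 L y M N) U :=
  Complex.ofRealCLM.contDiff.comp_contDiffOn (contDiffOn_pd hU (contDiffOn_pd hU hL N) M)

theorem contDiffOn_tens3 (hU : IsOpen U) (hL : ContDiffOn ℝ ∞ L U) (M N K : ι) :
    ContDiffOn ℝ ∞ (fun y => tens3 L y M N K) U :=
  Complex.ofRealCLM.contDiff.comp_contDiffOn
    (contDiffOn_pd hU (contDiffOn_pd hU (contDiffOn_pd hU hL K) N) M)

theorem pd_ofReal_eq_tens1 (hU : IsOpen U) (hL : ContDiffOn ℝ ∞ L U) (hx : x ∈ U) (M : ι) :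
    pd (fun y => (L y : ℂ)) M x = tens1 L x M :=
  pd_ofReal (differentiableAt_of_contDiffOn hU hL hx) M

theorem pd_tens1 (hU : IsOpen U) (hL : ContDiffOn ℝ ∞ L U) (hx : x ∈ U) (M N : ι) :
    pd (fun y => tens1 L y N) M x = tens2 L x M N :=
  pd_ofReal (differentiableAt_of_contDiffOn hU (contDiffOn_pd hU hL N) hx) M

theorem pd_tens2 (hU : IsOpen U) (hL : ContDiffOn ℝ ∞ L U) (hx : x ∈ U) (M N K : ι) :
    pd (fun y => tens2 L y N K) M x = tens3 L x M N K :=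
  pd_ofReal (differentiableAt_of_contDiffOn hU
    (contDiffOn_pd hU (contDiffOn_pd hU hL K) N) hx) M

theorem pd_tens3 (hU : IsOpen U) (hL : ContDiffOn ℝ ∞ L U) (hx : x ∈ U) (M N K P : ι) :
    pd (fun y => tens3 L y N K P) M x = tens4 L x M N K P :=
  pd_ofReal (differentiableAt_of_contDiffOn hU
    (contDiffOn_pd hU (contDiffOn_pd hU (contDiffOn_pd hU hL P) K) N) hx) M

theorem tens2_comm (hU : IsOpen U) (hL : ContDiffOn ℝ ∞ L U) (hx : x ∈ U) (M N : ι) :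
    tens2 L x M N = tens2 L x N M :=
  congrArg Complex.ofReal (pd_comm hU hL hx N M)

theorem isSym3_tens3 (hU : IsOpen U) (hL : ContDiffOn ℝ ∞ L U) (hx : x ∈ U) :
    IsSym3 (tens3 L x) where
  swap12 M N K := congrArg Complex.ofReal (pd_comm hU (contDiffOn_pd hU hL K) hx N M)
  swap23 M N K := congrArg Complex.ofReal (pd_congr hU hx (fun _ hy => pd_comm hU hL hy K N) M)

theorem isSym4_tens4 (hU : IsOpen U) (hL : ContDiffOn ℝ ∞ L U) (hx : x ∈ U) :
    IsSym4 (tens4 L x) where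
  swap12 M N K P :=
    congrArg Complex.ofReal (pd_comm hU (contDiffOn_pd hU (contDiffOn_pd hU hL P) K) hx N M)
  swap23 M N K P := congrArg Complex.ofReal
    (pd_congr hU hx (fun _ hy => pd_comm hU (contDiffOn_pd hU hL P) hy K N) M)
  swap34 M N K P := congrArg Complex.ofReal (pd_congr hU hx (fun _ hy =>
    pd_congr hU hy (fun _ hy' => pd_comm hU hL hy' P K) N) M)

theorem tens2_real (M N : ι) : (starRingEnd ℂ) (tens2 L x M N) = tens2 L x M N :=
  Complex.conj_ofReal _
theorem tens3_real (M N K : ι) : (starRingEnd ℂ) (tens3 L x M N K) = tens3 L x M N K :=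
  Complex.conj_ofReal _

end Smooth

end PartialDerivatives

/-! ### Complex components -/

section ComplexComponents

variable {n m : ℕ} {G : Type} [Ring G] [Algebra ℂ G]

/-- The projectors onto the holomorphic and antiholomorphic components (`0`, `1` in the ordinary and
`4`, `5` in the mirror sector), and these projectors followed by the antisymmetric symbol (`2`, `3`
and `6`, `7`). -/
def CB : Fin 8 → Matrix (RIdx n m) (RIdx n m) ℂ :=
  ![(1 / 2 : ℂ) • JB 0 - (Complex.I / 2) • JB 1, (1 / 2 : ℂ) • JB 0 + (Complex.I / 2) • JB 1,
    (1 / 2 : ℂ) • JB 2 + (Complex.I / 2) • JB 3, (1 / 2 : ℂ) • JB 2 - (Complex.I / 2) • JB 3,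
    (1 / 2 : ℂ) • JB 4 - (Complex.I / 2) • JB 5, (1 / 2 : ℂ) • JB 4 + (Complex.I / 2) • JB 5,
    (1 / 2 : ℂ) • JB 6 + (Complex.I / 2) • JB 7, (1 / 2 : ℂ) • JB 6 - (Complex.I / 2) • JB 7]

/-- The pairing of complex components of vectors and covectors in the ordinary sector. -/
theorem ord_pairing (X W : RIdx n m → G) :
    (∑ a : Fin n, ∑ i, holo X (Sum.inl a, i) * coholo W (Sum.inl a, i)
      = ∑ M, act (CB 0) X M * W M) ∧
    (∑ a : Fin n, ∑ i, antiholo X (Sum.inl a, i) * coantiholo W (Sum.inl a, i)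
      = ∑ M, act (CB 1) X M * W M) ∧
    (∑ a : Fin n, ∑ i, ∑ j, eps i j • (holo X (Sum.inl a, i) * coantiholo W (Sum.inl a, j))
      = ∑ M, act (-CB 3) X M * W M) ∧
    ∑ a : Fin n, ∑ i, ∑ j, eps i j • (antiholo X (Sum.inl a, i) * coholo W (Sum.inl a, j))
      = ∑ M, act (-CB 2) X M * W M := by
  refine ⟨?_, ?_, ?_, ?_⟩ <;>
  · simp only [Fintype.sum_prod_type, Fintype.sum_sum_type, Fin.sum_univ_two, Fin.sum_univ_four]
    simp [CB, JB, act_add_left, act_sub_left, act_neg_left, act_smul_left, act_blk_apply, ordInd,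
      mirInd, Fin.sum_univ_four, quatC, holo, coholo, antiholo, coantiholo, reSlot, imSlot, sector,
      eps]
    refine Finset.sum_congr rfl fun a _ => ?_
    simp only [mul_add, add_mul, mul_sub, sub_mul, smul_add, smul_sub, smul_neg, neg_mul, mul_neg,
      smul_mul_assoc, mul_smul_comm, smul_smul]
    match_scalars <;> ring_nf <;> simp <;> norm_num

/-- The pairing of complex components of vectors and covectors in the mirror sector. -/
theorem mir_pairing (X W : RIdx n m → G) :
    (∑ a : Fin m, ∑ i, holo X (Sum.inr a, i) * coholo W (Sum.inr a, i)
      = ∑ M, act (CB 4) X M * W M) ∧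
    (∑ a : Fin m, ∑ i, antiholo X (Sum.inr a, i) * coantiholo W (Sum.inr a, i)
      = ∑ M, act (CB 5) X M * W M) ∧
    (∑ a : Fin m, ∑ i, ∑ j, eps i j • (holo X (Sum.inr a, i) * coantiholo W (Sum.inr a, j))
      = ∑ M, act (CB 6) X M * W M) ∧
    ∑ a : Fin m, ∑ i, ∑ j, eps i j • (antiholo X (Sum.inr a, i) * coholo W (Sum.inr a, j))
      = ∑ M, act (CB 7) X M * W M := by
  refine ⟨?_, ?_, ?_, ?_⟩ <;>
  · simp only [Fintype.sum_prod_type, Fintype.sum_sum_type, Fin.sum_univ_two, Fin.sum_univ_four]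
    simp [CB, JB, act_add_left, act_sub_left, act_neg_left, act_smul_left, act_blk_apply, ordInd,
      mirInd, Fin.sum_univ_four, quatC, holo, coholo, antiholo, coantiholo, reSlot, imSlot, sector,
      eps]
    refine Finset.sum_congr rfl fun a _ => ?_
    simp only [mul_add, add_mul, mul_sub, sub_mul, smul_add, smul_sub, smul_neg, neg_mul, mul_neg,
      smul_mul_assoc, mul_smul_comm, smul_smul]
    match_scalars <;> ring_nf <;> simp <;> norm_num

/-- The functionals `ℓ` with coefficients `u` have the resolution `V`. -/
def Resolves {ι α : Type} [Fintype ι] [Fintype α] (ℓ : α → (ι → ℂ) → ℂ) (u : α → G)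
    (V : ι → G) : Prop :=
  ∀ y : ι → ℂ, ∑ a, ℓ a y • u a = ∑ M, y M • V M

/-- A double sum over complex components collapses to a contraction over real indices by using the
resolution of one index after the other. -/
theorem Resolves.con2 {ι α β : Type} [Fintype ι] [DecidableEq ι] [Fintype α] [Fintype β]
    {ℓ : α → (ι → ℂ) → ℂ} {u : α → G} {V : ι → G} {ℓ' : β → (ι → ℂ) → ℂ} {u' : β → G}
    {V' : ι → G} (h : Resolves ℓ u V) (h' : Resolves ℓ' u' V') (t : ι → ι → ℂ) :
    ∑ a, ∑ b, ℓ a (fun M => ℓ' b (t M)) • (u a * u' b) = con2 t V V' := by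
  rw [Finset.sum_comm]
  simp only [← smul_mul_assoc, ← Finset.sum_mul, h _]
  simp only [Finset.sum_mul]
  rw [Finset.sum_comm]
  simp only [smul_mul_assoc, ← mul_smul_comm, ← Finset.mul_sum, h' _]
  simp only [con2_apply, Finset.mul_sum, mul_smul_comm]

variable (X : RIdx n m → G)

theorem coholo_mul_algebraMap (y : RIdx n m → ℂ) (K : CIdx n m) (g : G) :
    g * coholo (fun M => algebraMap ℂ G (y M)) K = coholo y K • g := by
  simp only [coholo, Algebra.algebraMap_eq_smul_one, mul_smul_comm, mul_add, mul_one, smul_eq_mul,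
    smul_add, smul_smul, add_smul]

theorem coantiholo_mul_algebraMap (y : RIdx n m → ℂ) (K : CIdx n m) (g : G) :
    g * coantiholo (fun M => algebraMap ℂ G (y M)) K = coantiholo y K • g := by
  simp only [coantiholo, Algebra.algebraMap_eq_smul_one, mul_smul_comm, mul_sub, mul_one,
    smul_eq_mul, smul_sub, smul_smul, sub_smul]

/-- This is the pairing with a covector of scalars. It and its seven analogues replace sums over
flavours and complex components by the constant matrices `CB`. -/
theorem ord_resolves_holo :
    Resolves (fun (p : Fin n × Fin 2) (y : RIdx n m → ℂ) => coholo y (Sum.inl p.1, p.2))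
    (fun p => holo X (Sum.inl p.1, p.2)) (act (CB 0) X) := fun y => by
  have h := (ord_pairing X fun M => algebraMap ℂ G (y M)).1
  simp only [coholo_mul_algebraMap, coantiholo_mul_algebraMap] at h
  simpa only [Fintype.sum_prod_type, Finset.sum_smul, mul_smul, Algebra.algebraMap_eq_smul_one,
    mul_smul_comm, mul_one] using h

theorem ord_resolves_antiholo :
    Resolves (fun (p : Fin n × Fin 2) (y : RIdx n m → ℂ) => coantiholo y (Sum.inl p.1, p.2))
    (fun p => antiholo X (Sum.inl p.1, p.2)) (act (CB 1) X) := fun y => by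
  have h := (ord_pairing X fun M => algebraMap ℂ G (y M)).2.1
  simp only [coholo_mul_algebraMap, coantiholo_mul_algebraMap] at h
  simpa only [Fintype.sum_prod_type, Finset.sum_smul, mul_smul, Algebra.algebraMap_eq_smul_one,
    mul_smul_comm, mul_one] using h

theorem ord_resolves_eps_holo : Resolves (fun (p : Fin n × Fin 2) (y : RIdx n m → ℂ) =>
    ∑ j, eps p.2 j * coantiholo y (Sum.inl p.1, j))
    (fun p => holo X (Sum.inl p.1, p.2)) (act (-CB 3) X) := fun y => by
  have h := (ord_pairing X fun M => algebraMap ℂ G (y M)).2.2.1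
  simp only [coholo_mul_algebraMap, coantiholo_mul_algebraMap] at h
  simpa only [Fintype.sum_prod_type, Finset.sum_smul, mul_smul, Algebra.algebraMap_eq_smul_one,
    mul_smul_comm, mul_one] using h

theorem ord_resolves_eps_antiholo : Resolves (fun (p : Fin n × Fin 2) (y : RIdx n m → ℂ) =>
    ∑ j, eps p.2 j * coholo y (Sum.inl p.1, j))
    (fun p => antiholo X (Sum.inl p.1, p.2)) (act (-CB 2) X) := fun y => by
  have h := (ord_pairing X fun M => algebraMap ℂ G (y M)).2.2.2
  simp only [coholo_mul_algebraMap, coantiholo_mul_algebraMap] at h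
  simpa only [Fintype.sum_prod_type, Finset.sum_smul, mul_smul, Algebra.algebraMap_eq_smul_one,
    mul_smul_comm, mul_one] using h

theorem mir_resolves_holo :
    Resolves (fun (p : Fin m × Fin 2) (y : RIdx n m → ℂ) => coholo y (Sum.inr p.1, p.2))
    (fun p => holo X (Sum.inr p.1, p.2)) (act (CB 4) X) := fun y => by
  have h := (mir_pairing X fun M => algebraMap ℂ G (y M)).1
  simp only [coholo_mul_algebraMap, coantiholo_mul_algebraMap] at h
  simpa only [Fintype.sum_prod_type, Finset.sum_smul, mul_smul, Algebra.algebraMap_eq_smul_one,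
    mul_smul_comm, mul_one] using h

theorem mir_resolves_antiholo :
    Resolves (fun (p : Fin m × Fin 2) (y : RIdx n m → ℂ) => coantiholo y (Sum.inr p.1, p.2))
    (fun p => antiholo X (Sum.inr p.1, p.2)) (act (CB 5) X) := fun y => by
  have h := (mir_pairing X fun M => algebraMap ℂ G (y M)).2.1
  simp only [coholo_mul_algebraMap, coantiholo_mul_algebraMap] at h
  simpa only [Fintype.sum_prod_type, Finset.sum_smul, mul_smul, Algebra.algebraMap_eq_smul_one,
    mul_smul_comm, mul_one] using h

theorem mir_resolves_eps_holo : Resolves (fun (p : Fin m × Fin 2) (y : RIdx n m → ℂ) =>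
    ∑ j, eps p.2 j * coantiholo y (Sum.inr p.1, j))
    (fun p => holo X (Sum.inr p.1, p.2)) (act (CB 6) X) := fun y => by
  have h := (mir_pairing X fun M => algebraMap ℂ G (y M)).2.2.1
  simp only [coholo_mul_algebraMap, coantiholo_mul_algebraMap] at h
  simpa only [Fintype.sum_prod_type, Finset.sum_smul, mul_smul, Algebra.algebraMap_eq_smul_one,
    mul_smul_comm, mul_one] using h

theorem mir_resolves_eps_antiholo : Resolves (fun (p : Fin m × Fin 2) (y : RIdx n m → ℂ) =>
    ∑ j, eps p.2 j * coholo y (Sum.inr p.1, j))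
    (fun p => antiholo X (Sum.inr p.1, p.2)) (act (CB 7) X) := fun y => by
  have h := (mir_pairing X fun M => algebraMap ℂ G (y M)).2.2.2
  simp only [coholo_mul_algebraMap, coantiholo_mul_algebraMap] at h
  simpa only [Fintype.sum_prod_type, Finset.sum_smul, mul_smul, Algebra.algebraMap_eq_smul_one,
    mul_smul_comm, mul_one] using h

/-- The components of `Δ` for a tensor of second derivatives. -/
def lapT (t : RIdx n m → RIdx n m → ℂ) (F H : Flavor n m) (i j : Fin 2) : ℂ :=
  coholo (fun M => coantiholo (t M) (H, j)) (F, i)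
    + ∑ k, ∑ l, eps i k * eps j l * coantiholo (fun M => coholo (t M) (H, l)) (F, k)

/-- Since `ε² = -1`, contracting with `ε` removes one of the two symbols in the second term of `Δ`.
Both terms then have the iterated form to which `Resolves.con2` applies. -/
theorem eps_lapT (t : RIdx n m → RIdx n m → ℂ) (F H : Flavor n m) (i j : Fin 2) :
    ∑ k, eps j k * lapT t F H i k
      = coholo (fun M => ∑ k, eps j k * coantiholo (t M) (H, k)) (F, i)
        - ∑ k, eps i k * coantiholo (fun M => coholo (t M) (H, j)) (F, k) := by
  fin_cases i <;> fin_cases j <;>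
    simp [lapT, eps, coholo, coantiholo] <;> ring

theorem eps_lapT' (t : RIdx n m → RIdx n m → ℂ) (F H : Flavor n m) (i j : Fin 2) :
    ∑ k, eps i k * lapT t F H k j
      = (∑ k, eps i k * coholo (fun M => coantiholo (t M) (H, j)) (F, k))
        - coantiholo (fun M => ∑ k, eps j k * coholo (t M) (H, k)) (F, i) := by
  fin_cases i <;> fin_cases j <;>
    simp [lapT, eps, coholo, coantiholo] <;> ring

theorem lapT_eq (t : RIdx n m → RIdx n m → ℂ) (F H : Flavor n m) (i j : Fin 2) :
    lapT t F H i j = coholo (fun M => coantiholo (t M) (H, j)) (F, i)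
      + ∑ k, eps i k * coantiholo (fun M => ∑ l, eps j l * coholo (t M) (H, l)) (F, k) := by
  fin_cases i <;> fin_cases j <;>
    simp [lapT, eps, coholo, coantiholo] <;> ring

section Terms

variable {φ : Type} [Fintype φ] {Y : Type}

theorem mixedTerm_eq (h : φ → φ → Fin 2 → Fin 2 → Y) (u w : φ → Fin 2 → G) (D : Y → ℂ) :
    mixedTerm h u w D = ∑ p : φ × Fin 2, ∑ q : φ × Fin 2,
      D (h p.1 q.1 p.2 q.2) • (u p.1 p.2 * w q.1 q.2) := by
  simp only [Fintype.sum_prod_type, mixedTerm]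
  exact Finset.sum_congr rfl fun b _ => Finset.sum_comm

theorem holTerm_eq (h : φ → φ → Fin 2 → Fin 2 → Y) (u : φ → Fin 2 → G) (D : Y → ℂ) :
    holTerm h u D = ∑ p : φ × Fin 2, ∑ q : φ × Fin 2,
      (∑ k, eps q.2 k * D (h p.1 q.1 p.2 k)) • (u p.1 p.2 * u q.1 q.2) := by
  simp only [Fintype.sum_prod_type, holTerm, Finset.sum_smul]
  exact Finset.sum_congr rfl fun b _ => Finset.sum_comm

theorem antiholTerm_eq (h : φ → φ → Fin 2 → Fin 2 → Y) (u : φ → Fin 2 → G) (D : Y → ℂ) :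
    antiholTerm h u D = ∑ p : φ × Fin 2, ∑ q : φ × Fin 2,
      (∑ k, eps p.2 k * D (h p.1 q.1 k q.2)) • (u p.1 p.2 * u q.1 q.2) := by
  simp only [Fintype.sum_prod_type, antiholTerm, Finset.sum_smul]
  exact Finset.sum_congr rfl fun b _ => Finset.sum_comm

end Terms

section Sectors

variable {Y : Type} (t : RIdx n m → RIdx n m → ℂ) {D : Y → ℂ}

section Ordinary

variable {h : Fin n → Fin n → Fin 2 → Fin 2 → Y}

/-- The two terms of `Δ` are resolved by `CB 0, CB 1` and by `-CB 3, -CB 2`, whose signs cancel. The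
functional `D` is left general so that one statement covers both evaluation of the metric and its
complex derivatives. -/
theorem ord_mixedTerm (hD : ∀ b c k l, D (h b c k l) = lapT t (Sum.inl b) (Sum.inl c) k l)
    (Z : RIdx n m → G) :
    mixedTerm h (fun (a : Fin n) i => holo X (Sum.inl a, i))
        (fun a i => antiholo Z (Sum.inl a, i)) D
      = con2 t (act (CB 0) X) (act (CB 1) Z) + con2 t (act (CB 3) X) (act (CB 2) Z) := by
  have h1 := (ord_resolves_holo X).con2 (ord_resolves_antiholo Z) t
  have h2 := (ord_resolves_eps_holo X).con2 (ord_resolves_eps_antiholo Z) t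
  simp only [act_neg_left, map_neg, LinearMap.neg_apply, neg_neg] at h2
  rw [← h1, ← h2, mixedTerm_eq]
  simp only [hD, lapT_eq, add_smul, Finset.sum_add_distrib]

theorem ord_holTerm (hD : ∀ b c k l, D (h b c k l) = lapT t (Sum.inl b) (Sum.inl c) k l) :
    holTerm h (fun (a : Fin n) i => holo X (Sum.inl a, i)) D
      = con2 t (act (CB 3) X) (act (CB 0) X) - con2 t (act (CB 0) X) (act (CB 3) X) := by
  have h1 := (ord_resolves_holo X).con2 (ord_resolves_eps_holo X) t
  have h2 := (ord_resolves_eps_holo X).con2 (ord_resolves_holo X) t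
  simp only [act_neg_left, map_neg, LinearMap.neg_apply] at h1 h2
  rw [sub_eq_neg_add, ← h1, ← neg_eq_iff_eq_neg.2 h2, ← sub_eq_add_neg, holTerm_eq]
  simp only [hD, eps_lapT, sub_smul, Finset.sum_sub_distrib]

theorem ord_antiholTerm (hD : ∀ b c k l, D (h b c k l) = lapT t (Sum.inl b) (Sum.inl c) k l) :
    antiholTerm h (fun (a : Fin n) i => antiholo X (Sum.inl a, i)) D
      = con2 t (act (CB 1) X) (act (CB 2) X) - con2 t (act (CB 2) X) (act (CB 1) X) := by
  have h1 := (ord_resolves_eps_antiholo X).con2 (ord_resolves_antiholo X) t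
  have h2 := (ord_resolves_antiholo X).con2 (ord_resolves_eps_antiholo X) t
  simp only [act_neg_left, map_neg, LinearMap.neg_apply] at h1 h2
  rw [sub_eq_neg_add, ← h1, ← neg_eq_iff_eq_neg.2 h2, ← sub_eq_add_neg, antiholTerm_eq]
  simp only [hD, eps_lapT', sub_smul, Finset.sum_sub_distrib]

end Ordinary

section Mirror

variable {h : Fin m → Fin m → Fin 2 → Fin 2 → Y}

/-- Here the overall sign is that of `h = -Δ`; the resolutions themselves carry no sign in the
mirror sector. -/
theorem mir_mixedTerm (hD : ∀ b c k l, D (h b c k l) = -lapT t (Sum.inr b) (Sum.inr c) k l)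
    (Z : RIdx n m → G) :
    mixedTerm h (fun (a : Fin m) i => holo X (Sum.inr a, i))
        (fun a i => antiholo Z (Sum.inr a, i)) D
      = -con2 t (act (CB 4) X) (act (CB 5) Z) - con2 t (act (CB 6) X) (act (CB 7) Z) := by
  have h1 := (mir_resolves_holo X).con2 (mir_resolves_antiholo Z) t
  have h2 := (mir_resolves_eps_holo X).con2 (mir_resolves_eps_antiholo Z) t
  rw [← h1, ← h2, mixedTerm_eq]
  simp only [hD, lapT_eq, add_smul, neg_smul, Finset.sum_neg_distrib, Finset.sum_add_distrib]
  abel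

theorem mir_holTerm (hD : ∀ b c k l, D (h b c k l) = -lapT t (Sum.inr b) (Sum.inr c) k l) :
    holTerm h (fun (a : Fin m) i => holo X (Sum.inr a, i)) D
      = con2 t (act (CB 6) X) (act (CB 4) X) - con2 t (act (CB 4) X) (act (CB 6) X) := by
  have h1 := (mir_resolves_holo X).con2 (mir_resolves_eps_holo X) t
  have h2 := (mir_resolves_eps_holo X).con2 (mir_resolves_holo X) t
  rw [← h1, ← h2, holTerm_eq]
  simp only [hD, mul_neg, Finset.sum_neg_distrib, eps_lapT, sub_smul, neg_smul,
    Finset.sum_sub_distrib]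
  abel

theorem mir_antiholTerm (hD : ∀ b c k l, D (h b c k l) = -lapT t (Sum.inr b) (Sum.inr c) k l) :
    antiholTerm h (fun (a : Fin m) i => antiholo X (Sum.inr a, i)) D
      = con2 t (act (CB 5) X) (act (CB 7) X) - con2 t (act (CB 7) X) (act (CB 5) X) := by
  have h1 := (mir_resolves_eps_antiholo X).con2 (mir_resolves_antiholo X) t
  have h2 := (mir_resolves_antiholo X).con2 (mir_resolves_eps_antiholo X) t
  rw [← h1, ← h2, antiholTerm_eq]
  simp only [hD, mul_neg, Finset.sum_neg_distrib, eps_lapT', sub_smul, neg_smul,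
    Finset.sum_sub_distrib]
  abel

end Mirror

end Sectors

end ComplexComponents

/-! ### The metric in terms of the derivatives of the prepotential -/

section TensorLinearity

variable {ι : Type} [Fintype ι] [DecidableEq ι] {G : Type} [Ring G] [Algebra ℂ G]

theorem con2_add_tensor (s t : ι → ι → ℂ) (X Y : ι → G) :
    con2 (fun M N => s M N + t M N) X Y = con2 s X Y + con2 t X Y := by
  simp only [con2_apply, add_smul, Finset.sum_add_distrib]

theorem con2_sub_tensor (s t : ι → ι → ℂ) (X Y : ι → G) :
    con2 (fun M N => s M N - t M N) X Y = con2 s X Y - con2 t X Y := by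
  simp only [con2_apply, sub_smul, Finset.sum_sub_distrib]

theorem con2_smul_tensor (c : ℂ) (t : ι → ι → ℂ) (X Y : ι → G) :
    con2 (fun M N => c * t M N) X Y = c • con2 t X Y := by
  simp only [con2_apply, Finset.smul_sum, mul_smul]

theorem con3_add_tensor (s t : ι → ι → ι → ℂ) (X Y Z : ι → G) :
    con3 (fun M N K => s M N K + t M N K) X Y Z = con3 s X Y Z + con3 t X Y Z := by
  simp only [con3_eq_mul_con2, con2_add_tensor, mul_add, Finset.sum_add_distrib]

theorem con3_sub_tensor (s t : ι → ι → ι → ℂ) (X Y Z : ι → G) :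
    con3 (fun M N K => s M N K - t M N K) X Y Z = con3 s X Y Z - con3 t X Y Z := by
  simp only [con3_eq_mul_con2, con2_sub_tensor, mul_sub, Finset.sum_sub_distrib]

theorem con3_smul_tensor (c : ℂ) (t : ι → ι → ι → ℂ) (X Y Z : ι → G) :
    con3 (fun M N K => c * t M N K) X Y Z = c • con3 t X Y Z := by
  simp only [con3_eq_mul_con2, con2_smul_tensor, mul_smul_comm, Finset.smul_sum]

theorem act_single (J : Matrix ι ι ℂ) (M : ι) : act J (Pi.single M (1 : ℂ)) = J M := by
  ext N
  rw [act_apply, Finset.sum_eq_single M]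
  · simp
  · intro S _ h
    simp [h]
  · simp

theorem star_con2 {t : ι → ι → ℂ} (ht : ∀ M N, (starRingEnd ℂ) (t M N) = t M N) (X Y : ι → ℂ) :
    (starRingEnd ℂ) (con2 t X Y)
      = con2 t (fun M => (starRingEnd ℂ) (X M)) fun M => (starRingEnd ℂ) (Y M) := by
  simp [con2_apply, ht]

theorem star_con3 {t : ι → ι → ι → ℂ} (ht : ∀ M N K, (starRingEnd ℂ) (t M N K) = t M N K)
    (X Y Z : ι → ℂ) :
    (starRingEnd ℂ) (con3 t X Y Z)
      = con3 t (fun M => (starRingEnd ℂ) (X M)) (fun M => (starRingEnd ℂ) (Y M))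
        fun M => (starRingEnd ℂ) (Z M) := by
  simp [con3_apply, ht]

variable {U : Set (ι → ℝ)}

theorem contDiffOn_con2 {t : (ι → ℝ) → ι → ι → ℂ}
    (ht : ∀ M N, ContDiffOn ℝ ∞ (fun y => t y M N) U) (X Y : ι → ℂ) :
    ContDiffOn ℝ ∞ (fun y => con2 (t y) X Y) U := by
  simp only [con2_apply, smul_eq_mul]
  exact ContDiffOn.sum fun M _ => ContDiffOn.sum fun N _ => (ht M N).mul contDiffOn_const

theorem contDiffOn_con3 {t : (ι → ℝ) → ι → ι → ι → ℂ}
    (ht : ∀ M N K, ContDiffOn ℝ ∞ (fun y => t y M N K) U) (X Y Z : ι → ℂ) :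
    ContDiffOn ℝ ∞ (fun y => con3 (t y) X Y Z) U := by
  simp only [con3_apply, smul_eq_mul]
  exact ContDiffOn.sum fun M _ => ContDiffOn.sum fun N _ => ContDiffOn.sum fun K _ =>
    (ht M N K).mul contDiffOn_const

theorem pd_con2 {t : (ι → ℝ) → ι → ι → ℂ} {x : ι → ℝ}
    (ht : ∀ M N, DifferentiableAt ℝ (fun y => t y M N) x) (X Y : ι → ℂ) (P : ι) :
    pd (fun y => con2 (t y) X Y) P x = con2 (fun M N => pd (fun y => t y M N) P x) X Y := by
  have h : ∀ M N, DifferentiableAt ℝ (fun y => X M * Y N * t y M N) x := fun M N =>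
    (ht M N).const_mul _
  simp only [con2_apply, smul_eq_mul, mul_comm _ (X _ * Y _)]
  rw [pd_sum _ fun M _ => DifferentiableAt.fun_sum fun N _ => h M N]
  refine Finset.sum_congr rfl fun M _ => ?_
  rw [pd_sum _ fun N _ => h M N]
  exact Finset.sum_congr rfl fun N _ => pd_const_smul (ht M N) _ _

end TensorLinearity

/-! ### The metric as a sum of rotated Hessians of the prepotential. -/

section MetricFormula

variable {n m : ℕ} {G : Type} [Ring G] [Algebra ℂ G] {U : Set (Pt n m)} {L : Pt n m → ℝ}
  {x : Pt n m}

theorem pd_coholo {f : RIdx n m → Pt n m → ℂ} (hf : ∀ M, DifferentiableAt ℝ (f M) x)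
    (K : CIdx n m) (P : RIdx n m) :
    pd (fun y => coholo (fun M => f M y) K) P x = coholo (fun M => pd (f M) P x) K := by
  simp only [coholo, smul_eq_mul]
  rw [pd_const_smul ((hf _).fun_add ((hf _).const_mul _)), pd_add (hf _) ((hf _).const_mul _),
    pd_const_smul (hf _)]

theorem pd_coantiholo {f : RIdx n m → Pt n m → ℂ} (hf : ∀ M, DifferentiableAt ℝ (f M) x)
    (K : CIdx n m) (P : RIdx n m) :
    pd (fun y => coantiholo (fun M => f M y) K) P x = coantiholo (fun M => pd (f M) P x) K := by
  simp only [coantiholo, smul_eq_mul, sub_eq_add_neg, ← neg_mul]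
  rw [pd_const_smul ((hf _).fun_add ((hf _).const_mul _)), pd_add (hf _) ((hf _).const_mul _),
    pd_const_smul (hf _)]

theorem lap_eq_lapT (hU : IsOpen U) (hL : ContDiffOn ℝ ∞ L U) (hx : x ∈ U) (F H : Flavor n m)
    (i j : Fin 2) : lap L F H i j x = lapT (tens2 L x) F H i j := by
  have hd : ∀ M, DifferentiableAt ℝ (fun y => tens1 L y M) x := fun M =>
    differentiableAt_of_contDiffOn hU (contDiffOn_tens1 hU hL M) hx
  have h1 : ∀ (K : CIdx n m) P, pd (dCbar K fun y => (L y : ℂ)) P x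
      = coantiholo (tens2 L x P) K := by
    intro K P
    rw [pd_congr (h := fun y => coantiholo (tens1 L y) K) hU hx fun y hy => by
      simp only [dCbar, pd_ofReal_eq_tens1 hU hL hy], pd_coantiholo hd]
    simp only [pd_tens1 hU hL hx]
  have h2 : ∀ (K : CIdx n m) P, pd (dC K fun y => (L y : ℂ)) P x
      = coholo (tens2 L x P) K := by
    intro K P
    rw [pd_congr (h := fun y => coholo (tens1 L y) K) hU hx fun y hy => by
      simp only [dC, pd_ofReal_eq_tens1 hU hL hy], pd_coholo hd]
    simp only [pd_tens1 hU hL hx]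
  simp only [lap, lapT, dC, dCbar] at h1 h2 ⊢
  simp only [h1, h2]

theorem pd_lapT {t : Pt n m → RIdx n m → RIdx n m → ℂ}
    (ht : ∀ M N, DifferentiableAt ℝ (fun y => t y M N) x) (F H : Flavor n m) (i j : Fin 2)
    (P : RIdx n m) :
    pd (fun y => lapT (t y) F H i j) P x = lapT (fun M N => pd (fun y => t y M N) P x) F H i j := by
  have hc : ∀ K M, DifferentiableAt ℝ (fun y => coholo (t y M) K) x := fun K M => by
    simp only [coholo, smul_eq_mul]
    exact ((ht _ _).add ((ht _ _).const_mul _)).const_mul _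
  have ha : ∀ K M, DifferentiableAt ℝ (fun y => coantiholo (t y M) K) x := fun K M => by
    simp only [coantiholo, smul_eq_mul]
    exact ((ht _ _).sub ((ht _ _).const_mul _)).const_mul _
  have hca : ∀ K K', DifferentiableAt ℝ (fun y => coholo (fun M => coantiholo (t y M) K) K') x :=
    fun K K' => by
    simp only [coholo, smul_eq_mul]
    exact ((ha _ _).add ((ha _ _).const_mul _)).const_mul _
  have hac : ∀ K K', DifferentiableAt ℝ (fun y => coantiholo (fun M => coholo (t y M) K) K') x :=
    fun K K' => by
    simp only [coantiholo, smul_eq_mul]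
    exact ((hc _ _).sub ((hc _ _).const_mul _)).const_mul _
  simp only [lapT]
  rw [pd_add (hca _ _) (DifferentiableAt.fun_sum fun k _ => DifferentiableAt.fun_sum fun l _ =>
    (hac _ _).const_mul _), pd_coholo (ha _), pd_sum _ fun k _ =>
    DifferentiableAt.fun_sum fun l _ => (hac _ _).const_mul _]
  congr 1
  · congr 1
    ext M
    exact pd_coantiholo (ht M) _ _
  · refine Finset.sum_congr rfl fun k _ => ?_
    rw [pd_sum _ fun l _ => (hac _ _).const_mul _]
    refine Finset.sum_congr rfl fun l _ => ?_
    rw [pd_const_smul (hac _ _), pd_coantiholo (hc _)]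
    congr 2
    ext M
    exact pd_coholo (ht M) _ _

theorem pd_lap (hU : IsOpen U) (hL : ContDiffOn ℝ ∞ L U) (hx : x ∈ U) (F H : Flavor n m)
    (i j : Fin 2) (P : RIdx n m) : pd (lap L F H i j) P x = lapT (tens3 L x P) F H i j := by
  rw [pd_congr (f := lap L F H i j) hU hx (fun y hy => lap_eq_lapT hU hL hy F H i j), pd_lapT]
  · simp only [pd_tens2 hU hL hx]
  · exact fun M N => differentiableAt_of_contDiffOn hU (contDiffOn_tens2 hU hL M N) hx

/-- The bilinear form of the metric. -/
def bilinForm (t : RIdx n m → RIdx n m → ℂ) (X Y : RIdx n m → G) : G :=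
  (1 / 2 : ℂ) •
    (con2 t (act (JB 0) X) (act (JB 0) Y) + con2 t (act (JB 1) X) (act (JB 1) Y)
      + con2 t (act (JB 2) X) (act (JB 2) Y) + con2 t (act (JB 3) X) (act (JB 3) Y)
      - con2 t (act (JB 4) X) (act (JB 4) Y) - con2 t (act (JB 5) X) (act (JB 5) Y)
      - con2 t (act (JB 6) X) (act (JB 6) Y) - con2 t (act (JB 7) X) (act (JB 7) Y))

theorem metricForm_eq (T : RIdx n m → RIdx n m → RIdx n m → ℂ) (v X Y : RIdx n m → G) :
    metricForm T v X Y = ∑ P, v P * bilinForm (T P) X Y := by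
  simp only [metricForm, bilinForm, con3_eq_mul_con2, mul_smul_comm, mul_add, mul_sub,
    Finset.sum_add_distrib, Finset.sum_sub_distrib, ← Finset.smul_sum]

/-- The form on algebra-valued vectors is recovered from its complex components, so identities known
for components of the metric extend to odd vectors. -/
theorem con2_bilinForm_single (t : RIdx n m → RIdx n m → ℂ) (X Y : RIdx n m → G) :
    con2 (fun M N => bilinForm t (Pi.single M (1 : ℂ)) (Pi.single N (1 : ℂ))) X Y
      = bilinForm t X Y := by
  simp only [bilinForm, act_single, con2_act, smul_eq_mul, con2_smul_tensor, con2_add_tensor,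
    con2_sub_tensor]

theorem blk_real {c : Flavor n m → ℂ} (hc : ∀ F, (starRingEnd ℂ) (c F) = c F) (a : Fin 4)
    (M N : RIdx n m) : (starRingEnd ℂ) (blk c (quatC a) M N) = blk c (quatC a) M N := by
  have hq : ∀ k l, (starRingEnd ℂ) (quatC a k l) = quatC a k l := by
    intro k l
    fin_cases a <;> fin_cases k <;> fin_cases l <;> simp [quatC]
  simp only [blk]
  split_ifs
  · rw [map_mul, hc, hq]
  · simp

theorem JB_real (i : Fin 8) (M N : RIdx n m) : (starRingEnd ℂ) (JB i M N) = JB i M N := by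
  have ho : ∀ F : Flavor n m, (starRingEnd ℂ) (ordInd F) = ordInd F := by
    rintro (a | a) <;> simp [ordInd]
  have hm : ∀ F : Flavor n m, (starRingEnd ℂ) (mirInd F) = mirInd F := by
    rintro (a | a) <;> simp [mirInd]
  have hn := fun a => (map_neg (starRingEnd ℂ) _).trans (congrArg Neg.neg (blk_real hm a M N))
  fin_cases i
  exacts [blk_real ho 0 M N, blk_real ho 1 M N, blk_real ho 2 M N, blk_real ho 3 M N,
    blk_real hm 0 M N, hn 1, hn 2, hn 3]

theorem bilinForm_single_real {t : RIdx n m → RIdx n m → ℂ}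
    (ht : ∀ M N, (starRingEnd ℂ) (t M N) = t M N) (M N : RIdx n m) :
    (starRingEnd ℂ) (bilinForm t (Pi.single M (1 : ℂ)) (Pi.single N (1 : ℂ)))
      = bilinForm t (Pi.single M (1 : ℂ)) (Pi.single N (1 : ℂ)) := by
  simp only [bilinForm, act_single, smul_eq_mul, map_mul, map_add, map_sub, star_con2 ht, JB_real,
    map_div₀, map_one, map_ofNat]

theorem central_of_comm {ι : Type} (X : ι → ℂ) : Central X := fun _ _ => mul_comm _ _

/-- Expanding the projectors, the cross terms proportional to `i` cancel when `X` and `Y` are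
exchanged, by symmetry of `t`. Only terms with the same rotation in both slots remain. -/
theorem bilinForm_eq_complex {t : RIdx n m → RIdx n m → ℂ} (ht : ∀ M N, t M N = t N M)
    (X Y : RIdx n m → ℂ) :
    con2 t (act (CB 0) X) (act (CB 1) Y) + con2 t (act (CB 3) X) (act (CB 2) Y)
      + (-con2 t (act (CB 4) X) (act (CB 5) Y) - con2 t (act (CB 6) X) (act (CB 7) Y))
      + (con2 t (act (CB 0) Y) (act (CB 1) X) + con2 t (act (CB 3) Y) (act (CB 2) X)
      + (-con2 t (act (CB 4) Y) (act (CB 5) X) - con2 t (act (CB 6) Y) (act (CB 7) X)))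
      = bilinForm t X Y := by
  have h : ∀ i j : Fin 8, con2 t (act (JB i) Y) (act (JB j) X)
      = con2 t (act (JB j) X) (act (JB i) Y) := fun i j => con2_comm ht (central_of_comm _)
  simp [CB, bilinForm, act_add_left, act_sub_left, act_smul_left, h]
  ring_nf
  simp
  ring

/-- With this formula the metric and all its derivatives become contractions with the matrices `JB`,
and its behaviour under the Clifford triple can be read off. -/
theorem metric_eq (hU : IsOpen U) (hL : ContDiffOn ℝ ∞ L U) (hx : x ∈ U) (M N : RIdx n m) :
    (metric L x M N : ℂ)
      = bilinForm (tens2 L x) (Pi.single M (1 : ℂ)) (Pi.single N (1 : ℂ)) := by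
  have key : ∀ X Y : RIdx n m → ℂ, ∑ K, ∑ K', hermMetric L K K' x * (holo X K * antiholo Y K')
      = con2 (tens2 L x) (act (CB 0) X) (act (CB 1) Y)
        + con2 (tens2 L x) (act (CB 3) X) (act (CB 2) Y)
        + (-con2 (tens2 L x) (act (CB 4) X) (act (CB 5) Y)
          - con2 (tens2 L x) (act (CB 6) X) (act (CB 7) Y)) := by
    intro X Y
    rw [← ord_mixedTerm X (tens2 L x) (h := hOrd L) (D := fun f => f x)
        (fun b c k l => lap_eq_lapT hU hL hx _ _ k l) Y,
      ← mir_mixedTerm X (tens2 L x) (h := hMir L) (D := fun f => f x)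
        (fun b c k l => by rw [hMir, lap_eq_lapT hU hL hx]) Y, mixedTerm_eq, mixedTerm_eq]
    simp [Fintype.sum_prod_type, Fintype.sum_sum_type, hermMetric, Finset.sum_add_distrib]
    ring
  have h : (∑ K, ∑ K', hermMetric L K K' x *
    (holo (Pi.single M (1 : ℂ)) K * antiholo (Pi.single N (1 : ℂ)) K'
      + holo (Pi.single N (1 : ℂ)) K * antiholo (Pi.single M (1 : ℂ)) K'))
      = bilinForm (tens2 L x) (Pi.single M (1 : ℂ)) (Pi.single N (1 : ℂ)) := by
    simp only [mul_add, Finset.sum_add_distrib, key]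
    exact bilinForm_eq_complex (tens2_comm hU hL hx) _ _
  rw [metric, h]
  -- The form has real components, so nothing is lost by the real part in the definition of the
  -- metric.
  exact Complex.conj_eq_iff_re.1 (bilinForm_single_real tens2_real M N)

theorem contDiffOn_bilinForm {t : Pt n m → RIdx n m → RIdx n m → ℂ}
    (ht : ∀ M N, ContDiffOn ℝ ∞ (fun y => t y M N) U) (X Y : RIdx n m → ℂ) :
    ContDiffOn ℝ ∞ (fun y => bilinForm (t y) X Y) U := by
  have h := fun i : Fin 8 => contDiffOn_con2 ht (act (JB i) X) (act (JB i) Y)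
  exact (((((((((h 0).add (h 1)).add (h 2)).add (h 3)).sub (h 4)).sub (h 5)).sub (h 6)).sub
    (h 7)).const_smul (1 / 2 : ℂ))

theorem pd_bilinForm {t : Pt n m → RIdx n m → RIdx n m → ℂ}
    (ht : ∀ M N, DifferentiableAt ℝ (fun y => t y M N) x) (X Y : RIdx n m → ℂ) (P : RIdx n m) :
    pd (fun y => bilinForm (t y) X Y) P x
      = bilinForm (fun M N => pd (fun y => t y M N) P x) X Y := by
  have h : ∀ y, bilinForm (t y) X Y
      = con2 (t y) ((1 / 2 : ℂ) • act (JB 0) X) (act (JB 0) Y)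
        + con2 (t y) ((1 / 2 : ℂ) • act (JB 1) X) (act (JB 1) Y)
        + con2 (t y) ((1 / 2 : ℂ) • act (JB 2) X) (act (JB 2) Y)
        + con2 (t y) ((1 / 2 : ℂ) • act (JB 3) X) (act (JB 3) Y)
        + con2 (t y) ((-1 / 2 : ℂ) • act (JB 4) X) (act (JB 4) Y)
        + con2 (t y) ((-1 / 2 : ℂ) • act (JB 5) X) (act (JB 5) Y)
        + con2 (t y) ((-1 / 2 : ℂ) • act (JB 6) X) (act (JB 6) Y)
        + con2 (t y) ((-1 / 2 : ℂ) • act (JB 7) X) (act (JB 7) Y) := fun y => by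
    simp only [bilinForm, map_smul, LinearMap.smul_apply, smul_eq_mul]
    ring
  have hd : ∀ Z W : RIdx n m → ℂ, DifferentiableAt ℝ (fun y => con2 (t y) Z W) x := fun Z W => by
    simp only [con2_apply, smul_eq_mul]
    exact DifferentiableAt.fun_sum fun M _ => DifferentiableAt.fun_sum fun N _ =>
      (ht M N).mul_const _
  simp only [h]
  have h8 := fun (i : Fin 8) (c : ℂ) => hd (c • act (JB i) X) (act (JB i) Y)
  rw [pd_add (by fun_prop) (by fun_prop), pd_add (by fun_prop) (by fun_prop),
    pd_add (by fun_prop) (by fun_prop), pd_add (by fun_prop) (by fun_prop),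
    pd_add (by fun_prop) (by fun_prop), pd_add (by fun_prop) (by fun_prop),
    pd_add (by fun_prop) (by fun_prop)]
  simp only [pd_con2 ht]
  simp only [bilinForm, map_smul, LinearMap.smul_apply, smul_eq_mul]
  ring

theorem contDiffOn_metric (hU : IsOpen U) (hL : ContDiffOn ℝ ∞ L U) (M N : RIdx n m) :
    ContDiffOn ℝ ∞ (fun y => metric L y M N) U := by
  have h := Complex.reCLM.contDiff.comp_contDiffOn
    (contDiffOn_bilinForm (contDiffOn_tens2 hU hL) (Pi.single M (1 : ℂ)) (Pi.single N (1 : ℂ)))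
  refine h.congr fun y hy => ?_
  simp only [Function.comp_apply, Complex.reCLM_apply]
  rw [← metric_eq hU hL hy, Complex.ofReal_re]

theorem pd_metric (hU : IsOpen U) (hL : ContDiffOn ℝ ∞ L U) (hx : x ∈ U) (P M N : RIdx n m) :
    ((pd (fun y => metric L y M N) P x : ℝ) : ℂ)
      = bilinForm (tens3 L x P) (Pi.single M (1 : ℂ)) (Pi.single N (1 : ℂ)) := by
  rw [← pd_ofReal (differentiableAt_of_contDiffOn hU (contDiffOn_metric hU hL M N) hx),
    pd_congr hU hx (fun y hy => metric_eq hU hL hy M N), pd_bilinForm]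
  · simp only [pd_tens2 hU hL hx]
  · exact fun M N => differentiableAt_of_contDiffOn hU (contDiffOn_tens2 hU hL M N) hx

/-- The metric as a bilinear form on algebra-valued vectors. -/
theorem con2_metric (hU : IsOpen U) (hL : ContDiffOn ℝ ∞ L U) (hx : x ∈ U)
    (X Y : RIdx n m → G) :
    con2 (fun M N => (metric L x M N : ℂ)) X Y = bilinForm (tens2 L x) X Y := by
  simp only [metric_eq hU hL hx, con2_bilinForm_single]

theorem con3_pd_metric (hU : IsOpen U) (hL : ContDiffOn ℝ ∞ L U) (hx : x ∈ U)
    (v X Y : RIdx n m → G) :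
    con3 (fun P M N => ((pd (fun y => metric L y M N) P x : ℝ) : ℂ)) v X Y
      = metricForm (tens3 L x) v X Y := by
  simp only [con3_eq_mul_con2, pd_metric hU hL hx, con2_bilinForm_single, metricForm_eq]

end MetricFormula

/-! ### Alternating tensors -/

section Alternating

variable {ι : Type} [Fintype ι] [DecidableEq ι] {G : Type} [Ring G] [Algebra ℂ G]

theorem con2_transpose {X Y : ι → G} (h : AntiComm X Y) (t : ι → ι → ℂ) :
    con2 (fun M N => t N M) X Y = -con2 t Y X := by
  rw [con2_apply, con2_apply, Finset.sum_comm, ← Finset.sum_neg_distrib]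
  refine Finset.sum_congr rfl fun M _ => ?_
  rw [← Finset.sum_neg_distrib]
  exact Finset.sum_congr rfl fun N _ => by rw [h, smul_neg]

theorem con3_transpose23 {Y Z : ι → G} (h : AntiComm Y Z) (t : ι → ι → ι → ℂ) (X : ι → G) :
    con3 (fun M N K => t M K N) X Y Z = -con3 t X Z Y := by
  rw [con3_eq_mul_con2, con3_eq_mul_con2, ← Finset.sum_neg_distrib]
  exact Finset.sum_congr rfl fun M _ => by rw [con2_transpose h, mul_neg]

theorem con3_transpose12 {X Y : ι → G} (h : AntiComm X Y) (t : ι → ι → ι → ℂ) (Z : ι → G) :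
    con3 (fun M N K => t N M K) X Y Z = -con3 t Y X Z := by
  rw [con3_apply, con3_apply, Finset.sum_comm, ← Finset.sum_neg_distrib]
  refine Finset.sum_congr rfl fun N _ => ?_
  rw [← Finset.sum_neg_distrib]
  refine Finset.sum_congr rfl fun M _ => ?_
  rw [← Finset.sum_neg_distrib]
  refine Finset.sum_congr rfl fun K _ => ?_
  rw [← mul_assoc, h, neg_mul, mul_assoc, smul_neg]

theorem con3_transpose23_comm (t : ι → ι → ι → ℂ) (X Y Z : ι → ℂ) :
    con3 (fun M N K => t M K N) X Y Z = con3 t X Z Y := by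
  rw [con3_apply, con3_apply]
  refine Finset.sum_congr rfl fun M _ => ?_
  rw [Finset.sum_comm]
  exact Finset.sum_congr rfl fun M _ => Finset.sum_congr rfl fun N _ => by rw [mul_comm (Y _)]

theorem con3_transpose12_comm (t : ι → ι → ι → ℂ) (X Y Z : ι → ℂ) :
    con3 (fun M N K => t N M K) X Y Z = con3 t Y X Z := by
  rw [con3_apply, con3_apply, Finset.sum_comm]
  exact Finset.sum_congr rfl fun M _ => Finset.sum_congr rfl fun N _ =>
    Finset.sum_congr rfl fun K _ => by rw [mul_left_comm]

/-- Cyclic permutation of the indices. -/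
theorem con3_cycle {X Y Z : ι → G} (hXY : AntiComm X Y) (hXZ : AntiComm X Z)
    (t : ι → ι → ι → ℂ) : con3 (fun M N K => t N K M) X Y Z = con3 t Y Z X := by
  rw [con3_transpose12 hXY (fun M N K => t M K N), con3_transpose23 hXZ, neg_neg]

theorem con3_cycle' {X Y Z : ι → G} (hXZ : AntiComm X Z) (hYZ : AntiComm Y Z)
    (t : ι → ι → ι → ℂ) : con3 (fun M N K => t K M N) X Y Z = con3 t Z X Y := by
  rw [con3_transpose23 hYZ (fun M N K => t N M K), con3_transpose12 hXZ, neg_neg]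

/-- The antisymmetric part of a tensor with three indices. -/
def alt3 (t : ι → ι → ι → ℂ) (M N K : ι) : ℂ :=
  (1 / 6) * (t M N K + t N K M + t K M N - t N M K - t M K N - t K N M)

/-- Antisymmetry of a complex tensor with three indices. -/
structure IsAlt3 (t : ι → ι → ι → ℂ) : Prop where
  swap12 : ∀ M N K, t M N K = -t N M K
  swap23 : ∀ M N K, t M N K = -t M K N

theorem isAlt3_alt3 (t : ι → ι → ι → ℂ) : IsAlt3 (alt3 t) :=
  ⟨fun M N K => by simp only [alt3]; ring, fun M N K => by simp only [alt3]; ring⟩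

/-- Permuting odd vectors costs the sign of the permutation, which is the sign in `alt3`; hence all
six orders enter with a plus. -/
theorem con3_alt3 {X Y Z : ι → G} (hXY : AntiComm X Y) (hXZ : AntiComm X Z) (hYZ : AntiComm Y Z)
    (t : ι → ι → ι → ℂ) :
    con3 (alt3 t) X Y Z = (1 / 6 : ℂ) • (con3 t X Y Z + con3 t Y Z X + con3 t Z X Y
      + con3 t Y X Z + con3 t X Z Y + con3 t Z Y X) := by
  have h : con3 (fun M N K => t K N M) X Y Z = -con3 t Z Y X := by
    rw [con3_transpose12 hXY (fun M N K => t K M N), con3_cycle' hYZ hXZ]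
  unfold alt3
  rw [con3_smul_tensor, con3_sub_tensor, con3_sub_tensor, con3_sub_tensor, con3_add_tensor,
    con3_add_tensor, con3_cycle hXY hXZ t, con3_cycle' hXZ hYZ t, con3_transpose12 hXY t,
    con3_transpose23 hYZ t, h]
  simp only [sub_neg_eq_add]

theorem leftD_con2_gen {s : ι → ι → ℂ} (hs : ∀ M N, s M N = -s N M) (N : ι) :
    leftD N (con2 s (gen : ι → Gr ι) gen) = (2 : ℂ) • ∑ C, s N C • gen C := by
  simp only [con2_apply, map_sum, map_smul, gen_eq, leftD_ι_mul, leftD_ι]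
  simp only [smul_sub, Finset.sum_sub_distrib, two_smul]
  rw [sub_eq_add_neg]
  congr 1
  · rw [Finset.sum_eq_single N]
    · simp
    · intro M _ h
      simp [Pi.single_apply, h.symm]
    · simp
  · rw [Finset.sum_comm, Finset.sum_eq_single N]
    · simp only [Pi.single_eq_same, map_one, mul_one, ← Finset.sum_neg_distrib]
      exact Finset.sum_congr rfl fun M _ => by rw [hs M N, neg_smul, neg_neg]
    · intro M _ h
      simp [Pi.single_apply, h.symm]
    · simp

/-- By antisymmetry each of the three slots contributes the same term, since the sign of passing
earlier odd factors is undone by permuting the index to the front. -/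
theorem leftD_con3_gen {t : ι → ι → ι → ℂ} (ht : IsAlt3 t) (M : ι) :
    leftD M (con3 t (gen : ι → Gr ι) gen gen) = (3 : ℂ) • con2 (t M) gen gen := by
  have h1 : ∀ A, leftD M (gen A * con2 (t A) (gen : ι → Gr ι) gen)
      = (Pi.single A 1 : ι → ℂ) M • con2 (t A) (gen : ι → Gr ι) gen
        - gen A * ((2 : ℂ) • ∑ C, t A M C • gen C) := by
    intro A
    rw [gen_eq A, leftD_ι_mul, leftD_con2_gen (ht.swap23 A)]
  rw [con3_eq_mul_con2, map_sum]
  simp only [h1, Finset.sum_sub_distrib]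
  rw [Finset.sum_eq_single M]
  · have h2 : ∑ A, gen A * ((2 : ℂ) • ∑ C, t A M C • (gen C : Gr ι))
        = -(2 : ℂ) • con2 (t M) gen gen := by
      simp only [con2_apply, Finset.smul_sum, Finset.mul_sum, mul_smul_comm]
      exact Finset.sum_congr rfl fun A _ => Finset.sum_congr rfl fun C _ => by
        rw [ht.swap12 A M C]; module
    rw [h2, Pi.single_eq_same]
    module
  · intro A _ h
    simp [Pi.single_apply, h.symm]
  · simp

/-- An alternating tensor is determined by its contraction with odd generators. -/
theorem IsAlt3.ext {s t : ι → ι → ι → ℂ} (hs : IsAlt3 s) (ht : IsAlt3 t)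
    (h : con3 s (gen : ι → Gr ι) gen gen = con3 t gen gen gen) (M N K : ι) :
    s M N K = t M N K := by
  -- The three derivatives strip one index each, with factors `3`, `2` and `1`, and leave a scalar
  -- of the algebra.
  have key : ∀ {r : ι → ι → ι → ℂ}, IsAlt3 r →
      leftD K (leftD N (leftD M (con3 r (gen : ι → Gr ι) gen gen)))
        = algebraMap ℂ (Gr ι) (6 * r M N K) := by
    intro r hr
    rw [leftD_con3_gen hr, map_smul, leftD_con2_gen (hr.swap23 M)]
    simp only [map_smul, map_sum, gen_eq, leftD_ι]
    rw [Finset.sum_eq_single K]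
    · rw [Pi.single_eq_same, Algebra.algebraMap_eq_smul_one, Algebra.algebraMap_eq_smul_one]
      module
    · intro A _ hA
      simp [Pi.single_apply, hA.symm]
    · simp
  have h6 := (key hs).symm.trans ((congrArg (fun z => leftD K (leftD N (leftD M z))) h).trans
    (key ht))
  have h7 := ExteriorAlgebra.algebraMap_leftInverse (R := ℂ) (ι → ℂ) |>.injective h6
  exact mul_left_cancel₀ (by norm_num) h7

theorem antiComm_gen : AntiComm (gen : ι → Gr ι) gen := fun _ _ => ι_mul_ι_swap _ _

end Alternating

/-! ### The exterior derivative of the fundamental forms -/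

section Bismut

variable {ι : Type} [Fintype ι] [DecidableEq ι] {U : Set (ι → ℝ)} {g I : (ι → ℝ) → Matrix ι ι ℝ}
  {x : ι → ℝ}

/-- The exterior derivative of the 2-form `I_{MN}`. -/
def dLowered (g I : (ι → ℝ) → Matrix ι ι ℝ) (x : ι → ℝ) (P Q R : ι) : ℝ :=
  pd (fun y => lowered g I y Q R) P x + pd (fun y => lowered g I y R P) Q x
    + pd (fun y => lowered g I y P Q) R x

theorem christoffel_symm (hU : IsOpen U) (hx : x ∈ U) (hg : ∀ y ∈ U, ∀ M N, g y M N = g y N M)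
    (S P Q : ι) : christoffel g x S P Q = christoffel g x S Q P := by
  simp only [christoffel]
  congr 1
  refine Finset.sum_congr rfl fun T _ => ?_
  rw [pd_congr hU hx (fun y hy => hg y hy P Q) T]
  ring

/-- The Christoffel symbols drop out of the antisymmetrized covariant derivative. -/
theorem nablaI_cyclic (hU : IsOpen U) (hx : x ∈ U) (hg : ∀ y ∈ U, ∀ M N, g y M N = g y N M)
    (hI : ∀ M N, lowered g I x M N = -lowered g I x N M) (P Q R : ι) :
    nablaI g I x P Q R + nablaI g I x Q R P + nablaI g I x R P Q = dLowered g I x P Q R := by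
  have h : ∀ A B C : ι, ∑ S, christoffel g x S A B * lowered g I x S C
      = -∑ S, christoffel g x S B A * lowered g I x C S := by
    intro A B C
    rw [← Finset.sum_neg_distrib]
    exact Finset.sum_congr rfl fun S _ => by
      rw [christoffel_symm hU hx hg S A B, hI S C, mul_neg]
  simp only [nablaI, dLowered]
  rw [h P Q R, h Q R P, h R P Q]
  ring

theorem bismut_eq (hU : IsOpen U) (hx : x ∈ U) (hg : ∀ y ∈ U, ∀ M N, g y M N = g y N M)
    (hI : ∀ M N, lowered g I x M N = -lowered g I x N M) (M N K : ι) :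
    (bismut g I x M N K : ℂ) = con3 (fun P Q R => (dLowered g I x P Q R : ℂ))
      ((I x).map (fun r : ℝ => (r : ℂ)) M) ((I x).map (fun r : ℝ => (r : ℂ)) N)
      ((I x).map (fun r : ℝ => (r : ℂ)) K) := by
  simp only [bismut, nablaI_cyclic hU hx hg hI, con3_apply]
  push_cast
  refine Finset.sum_congr rfl fun P _ => Finset.sum_congr rfl fun Q _ =>
    Finset.sum_congr rfl fun R _ => ?_
  simp only [Matrix.map_apply, smul_eq_mul]
  ring

theorem isAlt3_dLowered (hU : IsOpen U) (hx : x ∈ U)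
    (hI : ∀ y ∈ U, ∀ M N, lowered g I y M N = -lowered g I y N M) :
    IsAlt3 fun P Q R => (dLowered g I x P Q R : ℂ) := by
  have h : ∀ A B C, pd (fun y => lowered g I y A B) C x = -pd (fun y => lowered g I y B A) C x := by
    intro A B C
    rw [pd_congr hU hx (fun y hy => hI y hy A B) C]
    simp only [pd, fderiv_fun_neg, neg_apply]
  refine ⟨fun P Q R => ?_, fun P Q R => ?_⟩ <;>
  · simp only [dLowered]
    rw [h Q R, h R P, h P Q]
    push_cast
    ring

theorem IsAlt3.con3_rows {t : ι → ι → ι → ℂ} (ht : IsAlt3 t) (J : Matrix ι ι ℂ) :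
    IsAlt3 fun M N K => con3 t (J M) (J N) (J K) := by
  have h12 : (fun M N K => t N M K) = fun M N K => (-1) * t M N K := by
    ext M N K; rw [ht.swap12]; ring
  have h23 : (fun M N K => t M K N) = fun M N K => (-1) * t M N K := by
    ext M N K; rw [ht.swap23]; ring
  refine ⟨fun M N K => ?_, fun M N K => ?_⟩
  · rw [← con3_transpose12_comm, h12, con3_smul_tensor]; simp
  · rw [← con3_transpose23_comm, h23, con3_smul_tensor]; simp

end Bismut

/-! ### The Clifford triple and the metric -/

section Clifford

variable {n m : ℕ} {G : Type} [Ring G] [Algebra ℂ G] {U : Set (Pt n m)} {L : Pt n m → ℝ}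
  {x : Pt n m}

theorem JT_zero : (JT 0 : Matrix (RIdx n m) (RIdx n m) ℂ) = 1 := JB_zero_add_JB_four

theorem JT_succ (p : Fin 3) (x : Pt n m) :
    (JT p.succ : Matrix (RIdx n m) (RIdx n m) ℂ)
      = (cliffordTriple p x).map (fun r : ℝ => (r : ℂ)) := by
  rw [← JB_add_JB_eq_clifford]
  fin_cases p <;> rfl

theorem JT_anticomm (p q : Fin 3) :
    (JT p.succ * JT q.succ + JT q.succ * JT p.succ : Matrix (RIdx n m) (RIdx n m) ℂ)
      = if p = q then (-2 : ℂ) • 1 else 0 := by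
  rw [← JB_zero_add_JB_four]
  fin_cases p <;> fin_cases q <;>
    simp [JT, mul_add, add_mul, JB_mul_JB, JBSgn, JBIdx] <;> module

theorem clifford_anticomm (p q : Fin 3) (x : Pt n m) :
    cliffordTriple p x * cliffordTriple q x + cliffordTriple q x * cliffordTriple p x
      = if p = q then -2 else 0 := by
  have h := JT_anticomm (n := n) (m := m) p q
  rw [JT_succ p x, JT_succ q x] at h
  have hinj : Function.Injective (fun A : Matrix (RIdx n m) (RIdx n m) ℝ =>
      Complex.ofRealHom.mapMatrix A) := fun A B hAB => by
    ext M N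
    exact Complex.ofReal_injective (congrFun (congrFun hAB M) N)
  apply hinj
  have e : ∀ A : Matrix (RIdx n m) (RIdx n m) ℝ,
      A.map (fun r : ℝ => (r : ℂ)) = Complex.ofRealHom.mapMatrix A := fun _ => rfl
  rw [e, e] at h
  simp only [map_add, map_mul]
  rw [h]
  split_ifs
  · rw [map_neg, map_ofNat, neg_smul, ← Nat.cast_ofNat (R := ℂ), Nat.cast_smul_eq_nsmul]
    simp
  · simp

theorem act_JT_act_JT (p : Fin 3) (X : RIdx n m → G) :
    act (JT p.succ) (act (JT p.succ) X) = -X := by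
  have h := JT_anticomm (n := n) (m := m) p p
  rw [if_pos rfl, ← two_smul ℂ, neg_smul, ← smul_neg] at h
  have h2 := smul_right_injective _ (two_ne_zero (α := ℂ)) h
  rw [act_act, h2, act_neg_left, act_one]

theorem JB_seven_ne_zero (hm : 0 < m) : (JB 7 : Matrix (RIdx n m) (RIdx n m) ℂ) ≠ 0 := by
  intro h
  have h1 := congrFun (congrFun h (Sum.inr ⟨0, hm⟩, 0)) (Sum.inr ⟨0, hm⟩, 3)
  change -(blk mirInd (quatC 3) _ _) = 0 at h1
  simp [blk, mirInd, quatC] at h1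

theorem JB_three_ne_zero (hn : 0 < n) : (JB 3 : Matrix (RIdx n m) (RIdx n m) ℂ) ≠ 0 := by
  intro h
  have h1 : blk (n := n) (m := m) ordInd (quatC 3) (Sum.inl ⟨0, hn⟩, 0) (Sum.inl ⟨0, hn⟩, 3) = 0 :=
    congrFun (congrFun h (Sum.inl ⟨0, hn⟩, 0)) (Sum.inl ⟨0, hn⟩, 3)
  simp [blk, ordInd, quatC] at h1

/-- The product of the first two structures is `JB 3 - JB 7`, with opposite signs in the two
sectors. The quaternion relation for the triple would force `JB 7 = 0`, and for its negative `JB 3 =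
0`; each is excluded because the sector in question is not empty. -/
theorem clifford_not_quaternionic (hn : 0 < n) (hm : 0 < m) (x : Pt n m) :
    ¬ IsQuaternionic (fun p => cliffordTriple (n := n) (m := m) p x)
      ∧ ¬ IsQuaternionic (fun p => -cliffordTriple (n := n) (m := m) p x) := by
  have e : ∀ A : Matrix (RIdx n m) (RIdx n m) ℝ,
      Complex.ofRealHom.mapMatrix A = A.map (fun r : ℝ => (r : ℂ)) := fun _ => rfl
  have h12 : (JT 1 * JT 2 : Matrix (RIdx n m) (RIdx n m) ℂ) = JB 3 - JB 7 := by
    simp [JT, mul_add, add_mul, JB_mul_JB, JBSgn, JBIdx, sub_eq_add_neg]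
  constructor <;> intro h
  · have h1 := congrArg Complex.ofRealHom.mapMatrix (h 0).2.1
    rw [map_mul, e, e, e, ← JT_succ, ← JT_succ, ← JT_succ] at h1
    change JT 1 * JT 2 = JB 3 + JB 7 at h1
    rw [h12] at h1
    exact JB_seven_ne_zero (n := n) hm (eq_zero_of_eq_neg (by simpa [sub_eq_add_neg] using h1.symm))
  · have h1 := congrArg Complex.ofRealHom.mapMatrix (h 0).2.1
    rw [map_mul, map_neg, map_neg, map_neg, neg_mul_neg, e, e, e, ← JT_succ, ← JT_succ,
      ← JT_succ] at h1
    change JT 1 * JT 2 = -(JB 3 + JB 7) at h1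
    rw [h12] at h1
    exact JB_three_ne_zero (m := m) hn
      (eq_zero_of_eq_neg (by simpa [sub_eq_add_neg, add_comm] using h1))

/-- Multiplication by a structure permutes the four matrices of each sector up to sign, so the sum
of equal rotations is invariant under it. Together with `J² = -1` this is antisymmetry. -/
theorem bilinForm_JT (t : RIdx n m → RIdx n m → ℂ) (p : Fin 3) (X Y : RIdx n m → G) :
    bilinForm t (act (JT p.succ) X) Y = -bilinForm t X (act (JT p.succ) Y) := by
  fin_cases p <;>
  · simp [bilinForm, JT, act_add_left, act_JB_act_JB, JBSgn, JBIdx]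
    module

theorem bilinForm_comm {t : RIdx n m → RIdx n m → ℂ} (ht : ∀ M N, t M N = t N M)
    {X : RIdx n m → G} (hX : Central X) (Y : RIdx n m → G) :
    bilinForm t X Y = bilinForm t Y X := by
  simp only [bilinForm]
  rw [con2_comm ht (hX.act (JB 0)), con2_comm ht (hX.act (JB 1)), con2_comm ht (hX.act (JB 2)),
    con2_comm ht (hX.act (JB 3)), con2_comm ht (hX.act (JB 4)), con2_comm ht (hX.act (JB 5)),
    con2_comm ht (hX.act (JB 6)), con2_comm ht (hX.act (JB 7))]

theorem metric_symm (hU : IsOpen U) (hL : ContDiffOn ℝ ∞ L U) (hx : x ∈ U) (M N : RIdx n m) :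
    metric L x M N = metric L x N M := by
  apply Complex.ofReal_injective
  rw [metric_eq hU hL hx, metric_eq hU hL hx,
    bilinForm_comm (tens2_comm hU hL hx) (central_of_comm _)]

theorem lowered_eq (hU : IsOpen U) (hL : ContDiffOn ℝ ∞ L U) (hx : x ∈ U) (p : Fin 3)
    (M N : RIdx n m) :
    (lowered (metric L) (cliffordTriple p) x M N : ℂ)
      = bilinForm (tens2 L x) (JT p.succ M) (Pi.single N (1 : ℂ)) := by
  rw [← con2_metric hU hL hx, con2_apply, lowered, JT_succ p x]
  push_cast
  refine Finset.sum_congr rfl fun K _ => ?_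
  rw [Finset.sum_eq_single N]
  · simp [mul_comm]
  · intro S _ h
    simp [h]
  · simp

theorem lowered_antisymm (hU : IsOpen U) (hL : ContDiffOn ℝ ∞ L U) (hx : x ∈ U) (p : Fin 3)
    (M N : RIdx n m) :
    lowered (metric L) (cliffordTriple p) x M N = -lowered (metric L) (cliffordTriple p) x N M := by
  apply Complex.ofReal_injective
  rw [Complex.ofReal_neg, lowered_eq hU hL hx, lowered_eq hU hL hx,
    ← act_single (JT p.succ) M, bilinForm_JT,
    bilinForm_comm (tens2_comm hU hL hx) (central_of_comm _), act_single]

theorem pd_lowered (hU : IsOpen U) (hL : ContDiffOn ℝ ∞ L U) (hx : x ∈ U) (p : Fin 3)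
    (P M N : RIdx n m) :
    ((pd (fun y => lowered (metric L) (cliffordTriple p) y M N) P x : ℝ) : ℂ)
      = bilinForm (tens3 L x P) (JT p.succ M) (Pi.single N (1 : ℂ)) := by
  have hs : ContDiffOn ℝ ∞ (fun y => lowered (metric L) (cliffordTriple p) y M N) U := by
    simp only [lowered]
    exact ContDiffOn.sum fun K _ => contDiffOn_const.mul (contDiffOn_metric hU hL K N)
  rw [← pd_ofReal (differentiableAt_of_contDiffOn hU hs hx),
    pd_congr hU hx (fun y hy => lowered_eq hU hL hy p M N), pd_bilinForm]
  · simp only [pd_tens2 hU hL hx]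
  · exact fun M N => differentiableAt_of_contDiffOn hU (contDiffOn_tens2 hU hL M N) hx

theorem con2_bilinForm_row (t : RIdx n m → RIdx n m → ℂ) (J : Matrix (RIdx n m) (RIdx n m) ℂ)
    (X Y : RIdx n m → G) :
    con2 (fun M N => bilinForm t (J M) (Pi.single N (1 : ℂ))) X Y = bilinForm t (act J X) Y := by
  simp only [← con2_bilinForm_single t (J _), ← con2_bilinForm_single t (act J X)]
  have h : ∀ N : RIdx n m, (1 : Matrix (RIdx n m) (RIdx n m) ℂ) N = Pi.single N 1 := fun N => by
    ext K
    simp [Matrix.one_apply, Pi.single_apply, eq_comm]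
  conv_rhs => rw [← act_one Y, con2_act]
  simp only [h]

theorem con3_dLowered (hU : IsOpen U) (hL : ContDiffOn ℝ ∞ L U) (hx : x ∈ U) (p : Fin 3)
    {X Y Z : RIdx n m → G} (hXY : AntiComm X Y) (hXZ : AntiComm X Z) (hYZ : AntiComm Y Z) :
    con3 (fun P Q R => (dLowered (metric L) (cliffordTriple p) x P Q R : ℂ)) X Y Z
      = metricForm (tens3 L x) X (act (JT p.succ) Y) Z
        + metricForm (tens3 L x) Y (act (JT p.succ) Z) X
        + metricForm (tens3 L x) Z (act (JT p.succ) X) Y := by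
  have key : ∀ A B C : RIdx n m → G,
      con3 (fun P M N => bilinForm (tens3 L x P) (JT p.succ M) (Pi.single N (1 : ℂ))) A B C
        = metricForm (tens3 L x) A (act (JT p.succ) B) C := by
    intro A B C
    rw [con3_eq_mul_con2, metricForm_eq]
    simp only [con2_bilinForm_row]
  simp only [dLowered, Complex.ofReal_add, pd_lowered hU hL hx]
  rw [con3_add_tensor, con3_add_tensor, key, con3_cycle hXY hXZ
    (fun P M N => bilinForm (tens3 L x P) (JT p.succ M) (Pi.single N (1 : ℂ))), key,
    con3_cycle' hXZ hYZ
    (fun P M N => bilinForm (tens3 L x P) (JT p.succ M) (Pi.single N (1 : ℂ))), key]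

theorem bismut_eq_rows (hU : IsOpen U) (hL : ContDiffOn ℝ ∞ L U) (hx : x ∈ U) (p : Fin 3)
    (M N K : RIdx n m) :
    (bismut (metric L) (cliffordTriple p) x M N K : ℂ)
      = con3 (fun P Q R => (dLowered (metric L) (cliffordTriple p) x P Q R : ℂ))
        (JT p.succ M) (JT p.succ N) (JT p.succ K) := by
  rw [bismut_eq hU hx (fun y hy => metric_symm hU hL hy) (lowered_antisymm hU hL hx p),
    ← JT_succ p x]

theorem isAlt3_bismut (hU : IsOpen U) (hL : ContDiffOn ℝ ∞ L U) (hx : x ∈ U) (p : Fin 3) :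
    IsAlt3 fun M N K => (bismut (metric L) (cliffordTriple p) x M N K : ℂ) := by
  simp only [bismut_eq_rows hU hL hx]
  exact (isAlt3_dLowered hU hx fun y hy => lowered_antisymm hU hL hy p).con3_rows _

/-- The Bismut torsion contracted with odd vectors. -/
theorem con3_bismut (hU : IsOpen U) (hL : ContDiffOn ℝ ∞ L U) (hx : x ∈ U) (p : Fin 3)
    {X Y Z : RIdx n m → G} (hXY : AntiComm X Y) (hXZ : AntiComm X Z) (hYZ : AntiComm Y Z) :
    con3 (fun M N K => (bismut (metric L) (cliffordTriple p) x M N K : ℂ)) X Y Z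
      = -(metricForm (tens3 L x) (act (JT p.succ) X) Y (act (JT p.succ) Z)
        + metricForm (tens3 L x) (act (JT p.succ) Y) Z (act (JT p.succ) X)
        + metricForm (tens3 L x) (act (JT p.succ) Z) X (act (JT p.succ) Y)) := by
  simp only [bismut_eq_rows hU hL hx]
  rw [← con3_act, con3_dLowered hU hL hx p (hXY.act _ _) (hXZ.act _ _) (hYZ.act _ _)]
  simp only [act_JT_act_JT]
  simp only [metricForm, map_neg, LinearMap.neg_apply]
  module

end Clifford

/-! ### The torsion -/

section Torsion

variable {n m : ℕ} {G : Type} [Ring G] [Algebra ℂ G] {U : Set (Pt n m)} {L : Pt n m → ℝ}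
  {x : Pt n m}

theorem con3_cubicForm_single (T : RIdx n m → RIdx n m → RIdx n m → ℂ) (a : Fin 4)
    (X Y Z : RIdx n m → G) :
    con3 (fun M N K => cubicForm T a (Pi.single M (1 : ℂ)) (Pi.single N (1 : ℂ))
      (Pi.single K (1 : ℂ))) X Y Z = cubicForm T a X Y Z := by
  simp only [cubicForm, act_single, con3_act, smul_eq_mul, con3_smul_tensor, con3_add_tensor]

theorem JT_real (a : Fin 4) (M N : RIdx n m) : (starRingEnd ℂ) (JT a M N) = JT a M N := by
  have h := fun i j : Fin 8 => (map_add (starRingEnd ℂ) _ _).trans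
    (congrArg₂ (· + ·) (JB_real i M N) (JB_real j M N))
  fin_cases a
  exacts [h 0 4, h 1 5, h 2 6, h 3 7]

theorem cubicForm_single_imag {T : RIdx n m → RIdx n m → RIdx n m → ℂ}
    (hT : ∀ M N K, (starRingEnd ℂ) (T M N K) = T M N K) (M N K : RIdx n m) :
    (starRingEnd ℂ) (cubicForm T 0 (Pi.single M (1 : ℂ)) (Pi.single N (1 : ℂ))
      (Pi.single K (1 : ℂ))) = -cubicForm T 0 (Pi.single M (1 : ℂ)) (Pi.single N (1 : ℂ))
      (Pi.single K (1 : ℂ)) := by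
  simp only [cubicForm, act_single, smul_eq_mul, map_mul, map_add, star_con3 hT, JB_real, JT_real,
    map_div₀, map_ofNat, Complex.conj_I, Matrix.cons_val_zero, map_one]
  ring

/-- The totally antisymmetric torsion `C_{MNK}`. -/
def torsion (L : Pt n m → ℝ) (x : Pt n m) (M N K : RIdx n m) : ℝ :=
  -- The factor `6i` is dictated by the supercharge `Q`: the coefficient `i / 12` times `6i` is `-1
  -- / 2`, the coefficient of its cubic part.
  (alt3 (fun M N K => 6 * Complex.I * cubicForm (tens3 L x) 0 (Pi.single M (1 : ℂ))
    (Pi.single N (1 : ℂ)) (Pi.single K (1 : ℂ))) M N K).re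

theorem torsion_eq (L : Pt n m → ℝ) (x : Pt n m) (M N K : RIdx n m) :
    (torsion L x M N K : ℂ) = alt3 (fun M N K => 6 * Complex.I * cubicForm (tens3 L x) 0
      (Pi.single M (1 : ℂ)) (Pi.single N (1 : ℂ)) (Pi.single K (1 : ℂ))) M N K := by
  refine Complex.conj_eq_iff_re.1 ?_
  have h := cubicForm_single_imag (T := tens3 L x) tens3_real
  simp only [alt3, map_mul, map_sub, map_add, h, map_div₀, map_one, map_ofNat, Complex.conj_I]
  ring

theorem isAlt3_torsion (L : Pt n m → ℝ) (x : Pt n m) :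
    IsAlt3 fun M N K => (torsion L x M N K : ℂ) := by
  simp only [torsion_eq]
  exact isAlt3_alt3 _

theorem con3_torsion (L : Pt n m → ℝ) (x : Pt n m) {X Y Z : RIdx n m → G} (hXY : AntiComm X Y)
    (hXZ : AntiComm X Z) (hYZ : AntiComm Y Z) :
    con3 (fun M N K => (torsion L x M N K : ℂ)) X Y Z = Complex.I •
      (cubicForm (tens3 L x) 0 X Y Z + cubicForm (tens3 L x) 0 Y Z X
        + cubicForm (tens3 L x) 0 Z X Y + cubicForm (tens3 L x) 0 Y X Z
        + cubicForm (tens3 L x) 0 X Z Y + cubicForm (tens3 L x) 0 Z Y X) := by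
  simp only [torsion_eq]
  rw [con3_alt3 hXY hXZ hYZ]
  simp only [con3_smul_tensor, con3_cubicForm_single]
  module

theorem contDiffOn_cubicForm {T : Pt n m → RIdx n m → RIdx n m → RIdx n m → ℂ}
    (hT : ∀ M N K, ContDiffOn ℝ ∞ (fun y => T y M N K) U) (a : Fin 4) (X Y Z : RIdx n m → ℂ) :
    ContDiffOn ℝ ∞ (fun y => cubicForm (T y) a X Y Z) U := by
  have h := contDiffOn_con3 hT
  exact (((h _ _ _).const_smul _).add ((((h _ _ _).add (h _ _ _)).add (h _ _ _)).add
    (h _ _ _))).const_smul (Complex.I / 2)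

theorem contDiffOn_torsion (hU : IsOpen U) (hL : ContDiffOn ℝ ∞ L U) (M N K : RIdx n m) :
    ContDiffOn ℝ ∞ (fun y => torsion L y M N K) U := by
  have h := fun A B C : RIdx n m => contDiffOn_const (c := 6 * Complex.I).mul
    (contDiffOn_cubicForm (contDiffOn_tens3 hU hL) 0 (Pi.single A (1 : ℂ)) (Pi.single B (1 : ℂ))
      (Pi.single C (1 : ℂ)))
  refine Complex.reCLM.contDiff.comp_contDiffOn (contDiffOn_const.mul ?_)
  exact (((((h M N K).add (h N K M)).add (h K M N)).sub (h N M K)).sub (h M K N)).sub (h K N M)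

end Torsion

/-! ### The holomorphic torsion -/

section HolomorphicTorsion

variable {n m : ℕ} {G : Type} [Ring G] [Algebra ℂ G] {U : Set (Pt n m)} {L : Pt n m → ℝ}
  {x : Pt n m}

/-- Contractions with three odd vectors, as an antisymmetric array. -/
theorem exists_array_cubic {T : RIdx n m → RIdx n m → RIdx n m → ℂ} (hT : IsSym3 T)
    {Ψ : RIdx n m → G} (hΨ : AntiComm Ψ Ψ) :
    ∃ u : ℕ → ℕ → ℕ → G,
      (∀ i j k : Fin 8, con3 T (act (JB i) Ψ) (act (JB j) Ψ) (act (JB k) Ψ) = u i j k) ∧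
      (∀ i j k, j < i → u i j k = -u j i k) ∧ (∀ i j k, k < j → u i j k = -u i k j) ∧
      (∀ i k, u i i k = 0) ∧ ∀ i j, u i j j = 0 :=
  ⟨fun i j k => con3 T (act (JB (Fin.ofNat 8 i)) Ψ) (act (JB (Fin.ofNat 8 j)) Ψ)
      (act (JB (Fin.ofNat 8 k)) Ψ), fun i j k => by simp,
    fun _ _ _ _ => con3_swap12 hT.swap12 (hΨ.act _ _) _,
    fun _ _ _ _ => con3_swap23 hT.swap23 (hΨ.act _ _) _,
    fun _ _ => con3_JB_self12 hT hΨ _ _, fun _ _ => con3_JB_self23 hT hΨ _ _⟩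

/-- The ordinary and the mirror factor of the `(2,0)`-form that generates the holomorphic torsion of
the complex structure with index `p`, and their conjugates. -/
def holOrd (p : Fin 3) : Matrix (RIdx n m) (RIdx n m) ℂ :=
  JB (![2, 3, 1] p) + Complex.I • JB (![3, 1, 2] p)
def holMir (p : Fin 3) : Matrix (RIdx n m) (RIdx n m) ℂ :=
  JB (![6, 7, 5] p) - Complex.I • JB (![7, 5, 6] p)
def holOrdBar (p : Fin 3) : Matrix (RIdx n m) (RIdx n m) ℂ :=
  JB (![2, 3, 1] p) - Complex.I • JB (![3, 1, 2] p)
def holMirBar (p : Fin 3) : Matrix (RIdx n m) (RIdx n m) ℂ :=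
  JB (![6, 7, 5] p) + Complex.I • JB (![7, 5, 6] p)

theorem star_add_I_smul_JB (i j : Fin 8) (M : RIdx n m) :
    (fun N => (starRingEnd ℂ) ((JB i + Complex.I • JB j : Matrix (RIdx n m) (RIdx n m) ℂ) M N))
      = (JB i - Complex.I • JB j : Matrix (RIdx n m) (RIdx n m) ℂ) M := by
  ext N
  rw [Matrix.add_apply, Matrix.smul_apply, Matrix.sub_apply, Matrix.smul_apply, map_add,
    smul_eq_mul, map_mul, JB_real, JB_real, Complex.conj_I]
  ring

theorem star_sub_I_smul_JB (i j : Fin 8) (M : RIdx n m) :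
    (fun N => (starRingEnd ℂ) ((JB i - Complex.I • JB j : Matrix (RIdx n m) (RIdx n m) ℂ) M N))
      = (JB i + Complex.I • JB j : Matrix (RIdx n m) (RIdx n m) ℂ) M := by
  ext N
  rw [Matrix.add_apply, Matrix.smul_apply, Matrix.sub_apply, Matrix.smul_apply, map_sub,
    smul_eq_mul, map_mul, JB_real, JB_real, Complex.conj_I]
  ring

/-- The rows of the matrix are thus `(1,0)` covectors of `I^p`. With the same relation for `holMir`,
it gives `twoForm` its type `(2,0)`. -/
theorem JT_mul_holOrd (p : Fin 3) :
    (JT p.succ * holOrd p : Matrix (RIdx n m) (RIdx n m) ℂ) = -Complex.I • holOrd p := by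
  fin_cases p <;>
  · simp [JT, holOrd, add_mul, mul_add, JB_mul_JB, JBSgn, JBIdx, smul_smul]
    try abel

theorem JT_mul_holMir (p : Fin 3) :
    (JT p.succ * holMir p : Matrix (RIdx n m) (RIdx n m) ℂ) = -Complex.I • holMir p := by
  fin_cases p <;>
  · simp [JT, holMir, add_mul, mul_sub, smul_sub, JB_mul_JB, JBSgn, JBIdx, smul_smul]
    try abel

/-- The antisymmetric 2-form `-½ (t(a_M, b_N) - t(a_N, b_M))`. -/
def twoForm (t : RIdx n m → RIdx n m → ℂ) (a b : Matrix (RIdx n m) (RIdx n m) ℂ)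
    (M N : RIdx n m) : ℂ :=
  -(1 / 2) * (con2 t (a M) (b N) - con2 t (a N) (b M))

theorem twoForm_antisymm (t : RIdx n m → RIdx n m → ℂ) (a b : Matrix (RIdx n m) (RIdx n m) ℂ)
    (M N : RIdx n m) : twoForm t a b M N = -twoForm t a b N M := by
  simp only [twoForm]
  ring

theorem sum_mul_con2_left (t : RIdx n m → RIdx n m → ℂ) (J a : Matrix (RIdx n m) (RIdx n m) ℂ)
    (M : RIdx n m) (Y : RIdx n m → ℂ) :
    ∑ K, J M K * con2 t (a K) Y = con2 t ((J * a) M) Y := by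
  have h : (J * a) M = ∑ K, J M K • a K := by
    ext N
    simp [Matrix.mul_apply]
  simp only [h, map_sum, map_smul, LinearMap.sum_apply, LinearMap.smul_apply, smul_eq_mul]

theorem sum_mul_con2_right (t : RIdx n m → RIdx n m → ℂ) (J a : Matrix (RIdx n m) (RIdx n m) ℂ)
    (M : RIdx n m) (X : RIdx n m → ℂ) :
    ∑ K, J M K * con2 t X (a K) = con2 t X ((J * a) M) := by
  have h : (J * a) M = ∑ K, J M K • a K := by
    ext N
    simp [Matrix.mul_apply]
  simp only [h, map_sum, map_smul, smul_eq_mul]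

theorem sum_mul_twoForm (t : RIdx n m → RIdx n m → ℂ) {J a b : Matrix (RIdx n m) (RIdx n m) ℂ}
    {c : ℂ} (ha : J * a = c • a) (hb : J * b = c • b) (M N : RIdx n m) :
    ∑ K, J M K * twoForm t a b K N = c * twoForm t a b M N := by
  have h : ∀ K, J M K * twoForm t a b K N = -(1 / 2) * (J M K * con2 t (a K) (b N))
      - -(1 / 2) * (J M K * con2 t (a N) (b K)) := fun K => by simp only [twoForm]; ring
  simp only [h, Finset.sum_sub_distrib, ← Finset.mul_sum, sum_mul_con2_left, sum_mul_con2_right,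
    ha, hb]
  have e1 : (c • a) M = c • a M := rfl
  have e2 : (c • b) M = c • b M := rfl
  simp only [e1, e2, map_smul, LinearMap.smul_apply, smul_eq_mul, twoForm]
  ring

/-- The exterior derivative of `twoForm`, in terms of the derivative of its coefficients. -/
def extTwoForm (T : RIdx n m → RIdx n m → RIdx n m → ℂ) (a b : Matrix (RIdx n m) (RIdx n m) ℂ)
    (M N K : RIdx n m) : ℂ :=
  twoForm (T M) a b N K + twoForm (T N) a b K M + twoForm (T K) a b M N

theorem isAlt3_extTwoForm (T : RIdx n m → RIdx n m → RIdx n m → ℂ)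
    (a b : Matrix (RIdx n m) (RIdx n m) ℂ) : IsAlt3 (extTwoForm T a b) := by
  refine ⟨fun M N K => ?_, fun M N K => ?_⟩ <;>
  · simp only [extTwoForm]
    rw [twoForm_antisymm _ _ _ N K, twoForm_antisymm _ _ _ K M, twoForm_antisymm _ _ _ M N]
    ring

/-- The two terms of `twoForm` contribute equally on an odd vector, which cancels the factor `1 /
2`, and so do the three cyclic terms of the exterior derivative; hence the coefficient `-3`. -/
theorem con3_extTwoForm (T : RIdx n m → RIdx n m → RIdx n m → ℂ)
    (a b : Matrix (RIdx n m) (RIdx n m) ℂ) {X : RIdx n m → G} (hX : AntiComm X X) :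
    con3 (extTwoForm T a b) X X X = (-3 : ℂ) • con3 T X (act a X) (act b X) := by
  have key : con3 (fun M N K => twoForm (T M) a b N K) X X X = -con3 T X (act a X) (act b X) := by
    have h : ∀ M, con2 (twoForm (T M) a b) X X = -con2 (T M) (act a X) (act b X) := by
      intro M
      have : twoForm (T M) a b = fun N K => -(1 / 2) * (con2 (T M) (a N) (b K)
          - con2 (T M) (a K) (b N)) := rfl
      rw [this, con2_smul_tensor, con2_sub_tensor, con2_act,
        con2_transpose hX (fun N K => con2 (T M) (a N) (b K))]
      module
    rw [con3_eq_mul_con2, con3_eq_mul_con2, ← Finset.sum_neg_distrib]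
    exact Finset.sum_congr rfl fun M _ => by rw [h, mul_neg]
  have e : extTwoForm T a b = fun M N K => (fun M N K => twoForm (T M) a b N K) M N K
      + (fun M N K => twoForm (T M) a b N K) N K M
      + (fun M N K => twoForm (T M) a b N K) K M N := rfl
  rw [e, con3_add_tensor, con3_add_tensor,
    con3_cycle hX hX (fun M N K => twoForm (T M) a b N K),
    con3_cycle' hX hX (fun M N K => twoForm (T M) a b N K), key]
  module

/-- The rows of a matrix, conjugated. -/
theorem star_con3_extTwoForm {T : RIdx n m → RIdx n m → RIdx n m → ℂ}
    (hT : ∀ M N K, (starRingEnd ℂ) (T M N K) = T M N K)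
    {a b P a' b' P' : Matrix (RIdx n m) (RIdx n m) ℂ}
    (ha : ∀ M, (fun N => (starRingEnd ℂ) (a M N)) = a' M)
    (hb : ∀ M, (fun N => (starRingEnd ℂ) (b M N)) = b' M)
    (hP : ∀ M, (fun N => (starRingEnd ℂ) (P M N)) = P' M) (M N K : RIdx n m) :
    (starRingEnd ℂ) (con3 (extTwoForm T a b) (P M) (P N) (P K))
      = con3 (extTwoForm T a' b') (P' M) (P' N) (P' K) := by
  have h2 : ∀ A B C, (starRingEnd ℂ) (twoForm (T A) a b B C) = twoForm (T A) a' b' B C := by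
    intro A B C
    simp only [twoForm, map_mul, map_neg, map_sub, star_con2 (hT A), ha, hb, map_div₀, map_one,
      map_ofNat]
  have h3 : ∀ A B C, (starRingEnd ℂ) (extTwoForm T a b A B C) = extTwoForm T a' b' A B C := by
    intro A B C
    simp only [extTwoForm, map_add, h2]
  have hP' : ∀ A B, (starRingEnd ℂ) (P A B) = P' A B := fun A B => congrFun (hP A) B
  simp only [con3_apply, map_sum, smul_eq_mul, map_mul, h3, hP']

set_option maxHeartbeats 1600000 in
/-- The difference of the torsion and of the Bismut torsion, contracted with odd vectors. -/
theorem cubicForm_sub_metricForm {T : RIdx n m → RIdx n m → RIdx n m → ℂ} (hT : IsSym3 T)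
    {Ψ : RIdx n m → G} (hΨ : AntiComm Ψ Ψ) (p : Fin 3) :
    (6 * Complex.I) • cubicForm T 0 Ψ Ψ Ψ
        + (3 : ℂ) • metricForm T (act (JT p.succ) Ψ) Ψ (act (JT p.succ) Ψ)
      = (-3 : ℂ) • con3 T (act ((1 / 2 : ℂ) • (1 + Complex.I • JT p.succ)) Ψ) (act (holOrd p) Ψ)
          (act (holMir p) Ψ)
        + (-3 : ℂ) • con3 T (act ((1 / 2 : ℂ) • (1 - Complex.I • JT p.succ)) Ψ)
          (act (holOrdBar p) Ψ) (act (holMirBar p) Ψ) := by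
  obtain ⟨u, hu, s12, s23, z12, z23⟩ := exists_array_cubic hT hΨ
  rw [← JB_zero_add_JB_four]
  fin_cases p <;>
  · simp [cubicForm, metricForm, JT, holOrd, holMir, holOrdBar, holMirBar, act_add_left,
      act_sub_left, act_smul_left, act_JB_act_JB, JBSgn, JBIdx]
    simp only [hu]
    simp (discharger := decide) only [Fin.isValue, Fin.coe_ofNat_eq_mod, Nat.reduceMod, s12, s23,
      z12, z23, neg_zero, neg_neg]
    simp only [smul_add, smul_sub, smul_neg, smul_smul, smul_zero]
    match_scalars <;> ring_nf <;> simp [Complex.I_sq]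

theorem pd_twoForm {t : Pt n m → RIdx n m → RIdx n m → ℂ}
    (ht : ∀ M N, DifferentiableAt ℝ (fun y => t y M N) x) (a b : Matrix (RIdx n m) (RIdx n m) ℂ)
    (P M N : RIdx n m) :
    pd (fun y => twoForm (t y) a b M N) P x
      = twoForm (fun M N => pd (fun y => t y M N) P x) a b M N := by
  have hd : ∀ Z W : RIdx n m → ℂ, DifferentiableAt ℝ (fun y => con2 (t y) Z W) x := fun Z W => by
    simp only [con2_apply, smul_eq_mul]
    exact DifferentiableAt.fun_sum fun M _ => DifferentiableAt.fun_sum fun N _ =>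
      (ht M N).mul_const _
  have h : ∀ y, twoForm (t y) a b M N
      = con2 (t y) (-(1 / 2 : ℂ) • a M) (b N) + con2 (t y) ((1 / 2 : ℂ) • a N) (b M) := fun y => by
    simp only [twoForm, map_smul, LinearMap.smul_apply, smul_eq_mul]
    ring
  simp only [h]
  rw [pd_add (hd _ _) (hd _ _), pd_con2 ht, pd_con2 ht]
  simp only [twoForm, map_smul, LinearMap.smul_apply, smul_eq_mul]
  ring

/-- The holomorphic torsion of the complex structure with index `p`. -/
def holTorsion (L : Pt n m → ℝ) (p : Fin 3) (x : Pt n m) (M N K : RIdx n m) : ℝ :=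
  torsion L x M N K - bismut (metric L) (cliffordTriple p) x M N K

theorem IsAlt3.add {ι : Type} {s t : ι → ι → ι → ℂ} (hs : IsAlt3 s) (ht : IsAlt3 t) :
    IsAlt3 fun M N K => s M N K + t M N K :=
  ⟨fun M N K => by rw [hs.swap12, ht.swap12, neg_add],
    fun M N K => by rw [hs.swap23, ht.swap23, neg_add]⟩

theorem isAlt3_holTorsion (hU : IsOpen U) (hL : ContDiffOn ℝ ∞ L U) (hx : x ∈ U) (p : Fin 3) :
    IsAlt3 fun M N K => (holTorsion L p x M N K : ℂ) := by
  have h1 := isAlt3_torsion L x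
  have h2 := isAlt3_bismut hU hL hx p
  refine ⟨fun M N K => ?_, fun M N K => ?_⟩
  · have e1 := h1.swap12 M N K
    have e2 := h2.swap12 M N K
    simp only [holTorsion, Complex.ofReal_sub] at e1 e2 ⊢
    rw [e1, e2]
    ring
  · have e1 := h1.swap23 M N K
    have e2 := h2.swap23 M N K
    simp only [holTorsion, Complex.ofReal_sub] at e1 e2 ⊢
    rw [e1, e2]
    ring

theorem con3_holTorsion (hU : IsOpen U) (hL : ContDiffOn ℝ ∞ L U) (hx : x ∈ U) (p : Fin 3)
    {Ψ : RIdx n m → G} (hΨ : AntiComm Ψ Ψ) :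
    con3 (fun M N K => (holTorsion L p x M N K : ℂ)) Ψ Ψ Ψ
      = (6 * Complex.I) • cubicForm (tens3 L x) 0 Ψ Ψ Ψ
        + (3 : ℂ) • metricForm (tens3 L x) (act (JT p.succ) Ψ) Ψ (act (JT p.succ) Ψ) := by
  simp only [holTorsion, Complex.ofReal_sub]
  rw [con3_sub_tensor, con3_torsion L x hΨ hΨ hΨ, con3_bismut hU hL hx p hΨ hΨ hΨ]
  module

/-- As `holTorsion` is defined as a difference, the decomposition of `C` is automatic and the
content lies here. The potential is the Hessian of `L` with an ordinary index rotated by `holOrd`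
and a mirror index rotated by `holMir`. All tensors involved are alternating, so it suffices to
compare them on odd generators, where the claim becomes `cubicForm_sub_metricForm`. -/
theorem holTorsion_exact (hU : IsOpen U) (hL : ContDiffOn ℝ ∞ L U) (p : Fin 3) :
    IsExactHolomorphicPlusConj U (cliffordTriple p) (holTorsion L p) := by
  refine ⟨fun y => twoForm (tens2 L y) (holOrd p) (holMir p), fun M N => ?_,
    fun x _ => ⟨fun M N => twoForm_antisymm _ _ _ M N, fun M N => ?_⟩, fun x hx M N K => ?_⟩
  · have h := contDiffOn_con2 (contDiffOn_tens2 hU hL)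
    exact contDiffOn_const.mul ((h _ _).sub (h _ _))
  · rw [← sum_mul_twoForm (tens2 L x) (JT_mul_holOrd p) (JT_mul_holMir p), JT_succ p x]
    rfl
  · have hP : projHol (cliffordTriple p x) = (1 / 2 : ℂ) • (1 + Complex.I • JT p.succ) := by
      rw [projHol, JT_succ p x]
    set P : Matrix (RIdx n m) (RIdx n m) ℂ := (1 / 2 : ℂ) • (1 + Complex.I • JT p.succ) with hPdef
    set P' : Matrix (RIdx n m) (RIdx n m) ℂ := (1 / 2 : ℂ) • (1 - Complex.I • JT p.succ) with hPdef'
    -- The rows already have type `(1,0)`. In the `(3,0)` part of `dβ` the projector therefore acts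
    -- only on the index of the derivative.
    have hPa : P * holOrd p = holOrd p := by
      rw [hPdef, smul_mul_assoc, add_mul, smul_mul_assoc, JT_mul_holOrd, one_mul, smul_smul]
      simp only [mul_neg, Complex.I_mul_I, neg_neg]
      module
    have hPb : P * holMir p = holMir p := by
      rw [hPdef, smul_mul_assoc, add_mul, smul_mul_assoc, JT_mul_holMir, one_mul, smul_smul]
      simp only [mul_neg, Complex.I_mul_I, neg_neg]
      module
    have hstarP : ∀ A, (fun B => (starRingEnd ℂ) (P A B)) = P' A := by
      intro A
      ext B
      have h1 : (starRingEnd ℂ) ((1 : Matrix (RIdx n m) (RIdx n m) ℂ) A B)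
          = (1 : Matrix (RIdx n m) (RIdx n m) ℂ) A B := by
        rw [Matrix.one_apply]
        split_ifs <;> simp
      simp only [hPdef, hPdef', Matrix.smul_apply, Matrix.add_apply, Matrix.sub_apply, smul_eq_mul,
        map_mul, map_add, map_sub, h1, JT_real, Complex.conj_I, map_div₀, map_one, map_ofNat]
      ring
    have hstara : ∀ A : RIdx n m, (fun B => (starRingEnd ℂ) (holOrd p A B)) = holOrdBar p A :=
      star_add_I_smul_JB _ _
    have hstarb : ∀ A : RIdx n m, (fun B => (starRingEnd ℂ) (holMir p A B)) = holMirBar p A :=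
      star_sub_I_smul_JB _ _
    have hbar : ∀ {a a' : Matrix (RIdx n m) (RIdx n m) ℂ},
        (∀ A, (fun B => (starRingEnd ℂ) (a A B)) = a' A) → P * a = a → P' * a' = a' := by
      intro a a' ha h
      ext A B
      have h1 := congrArg (starRingEnd ℂ) (congrFun (congrFun h A) B)
      have e1 : ∀ C D, (starRingEnd ℂ) (a C D) = a' C D := fun C D => congrFun (ha C) D
      have e2 : ∀ C D, (starRingEnd ℂ) (P C D) = P' C D := fun C D => congrFun (hstarP C) D
      simpa only [Matrix.mul_apply, map_sum, map_mul, e1, e2] using h1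
    have hdel : ∀ A B C, delHol (cliffordTriple p)
        (fun y => twoForm (tens2 L y) (holOrd p) (holMir p)) x A B C
        = con3 (extTwoForm (tens3 L x) (holOrd p) (holMir p)) (P A) (P B) (P C) := by
      intro A B C
      have hd : ∀ M N, DifferentiableAt ℝ (fun y => tens2 L y M N) x := fun M N =>
        differentiableAt_of_contDiffOn hU (contDiffOn_tens2 hU hL M N) hx
      simp only [delHol, hP, extD, pd_twoForm hd, pd_tens2 hU hL hx, con3_apply, extTwoForm,
        smul_eq_mul]
      refine Finset.sum_congr rfl fun _ _ => Finset.sum_congr rfl fun _ _ =>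
        Finset.sum_congr rfl fun _ _ => ?_
      ring
    rw [hdel, star_con3_extTwoForm tens3_real hstara hstarb hstarP]
    have h1 := (isAlt3_extTwoForm (tens3 L x) (holOrd p) (holMir p)).con3_rows P
    have h2 := (isAlt3_extTwoForm (tens3 L x) (holOrdBar p) (holMirBar p)).con3_rows P'
    -- Both sides are alternating, so an equality of components follows from a single equality in
    -- the Grassmann algebra.
    refine IsAlt3.ext (isAlt3_holTorsion hU hL hx p)
      (t := fun M N K => con3 (extTwoForm (tens3 L x) (holOrd p) (holMir p)) (P M) (P N) (P K)
        + con3 (extTwoForm (tens3 L x) (holOrdBar p) (holMirBar p)) (P' M) (P' N) (P' K))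
      (h1.add h2) ?_ M N K
    have hΨ := antiComm_gen (ι := RIdx n m)
    rw [con3_holTorsion hU hL hx p hΨ, con3_add_tensor, ← con3_act, ← con3_act,
      con3_extTwoForm _ _ _ (hΨ.act P P), con3_extTwoForm _ _ _ (hΨ.act P' P'), act_act, act_act,
      act_act, act_act, hPa, hPb, hbar hstara hPa, hbar hstarb hPb,
      cubicForm_sub_metricForm (isSym3_tens3 hU hL hx) hΨ]

end HolomorphicTorsion

/-! ### Assembly of the bi-HKT structure. -/

section BiHKTStructure

variable {n m : ℕ} {U : Set (Pt n m)} {L : Pt n m → ℝ}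

theorem isAlternating3_of_isAlt3 {ι : Type} {t : ι → ι → ι → ℝ}
    (h : IsAlt3 fun M N K => (t M N K : ℂ)) : IsAlternating3 t := fun M N K =>
  ⟨Complex.ofReal_injective (by rw [Complex.ofReal_neg]; exact h.swap12 M N K),
    Complex.ofReal_injective (by rw [Complex.ofReal_neg]; exact h.swap23 M N K)⟩

theorem pd_clifford (p : Fin 3) (M N P : RIdx n m) (x : Pt n m) :
    pd (fun y => cliffordTriple p y M N) P x = 0 := by
  simp only [pd, cliffordTriple]
  simp

theorem isBiHKT (hn : 0 < n) (hm : 0 < m) (hU : IsOpen U) (hL : ContDiffOn ℝ ∞ L U)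
    (hg : ∀ x ∈ U, (metric L x).PosDef) :
    IsBiHKT U (metric L) cliffordTriple (torsion L) (holTorsion L) where
  metric_smooth := contDiffOn_metric hU hL
  metric_posDef := hg
  complexStructure p :=
    { smooth := fun _ _ => contDiffOn_const
      antisymm := fun x hx => lowered_antisymm hU hL hx p
      square := fun x _ => by
        have h := clifford_anticomm p p x
        rw [if_pos rfl, ← two_mul] at h
        have h2 : (2 : ℝ) • (cliffordTriple p x * cliffordTriple p x) = (2 : ℝ) • (-1) := by
          rw [two_smul, two_smul, ← two_mul, h]
          norm_num
        exact smul_right_injective _ (two_ne_zero (α := ℝ)) h2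
      -- The components of the structures are constant, so every derivative in the integrability
      -- condition vanishes.
      integrable := fun x _ M N P => by simp only [pd_clifford, sub_zero, mul_zero,
        Finset.sum_const_zero] }
  clifford x _ p q := clifford_anticomm p q x
  not_quaternionic x _ := clifford_not_quaternionic hn hm x
  torsion_smooth := contDiffOn_torsion hU hL
  torsion_alternating x _ := isAlternating3_of_isAlt3 (isAlt3_torsion L x)
  hol_alternating p x hx := isAlternating3_of_isAlt3 (isAlt3_holTorsion hU hL hx p)
  decomposition p x _ M N K := by simp [holTorsion]
  hol_exact := holTorsion_exact hU hL

end BiHKTStructure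

/-! ### Vielbeins -/

section Vielbein

variable {ι : Type} [Fintype ι] [DecidableEq ι] {U : Set (ι → ℝ)} {g e : (ι → ℝ) → Matrix ι ι ℝ}
  {x : ι → ℝ}

theorem contDiffOn_det {A : (ι → ℝ) → Matrix ι ι ℝ}
    (hA : ∀ M N, ContDiffOn ℝ ∞ (fun y => A y M N) U) :
    ContDiffOn ℝ ∞ (fun y => (A y).det) U := by
  simp only [Matrix.det_apply]
  exact ContDiffOn.sum fun σ _ => (contDiffOn_prod fun i _ => hA (σ i) i).const_smul _

theorem contDiffOn_inv {A : (ι → ℝ) → Matrix ι ι ℝ}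
    (hA : ∀ M N, ContDiffOn ℝ ∞ (fun y => A y M N) U) (hdet : ∀ y ∈ U, (A y).det ≠ 0) (M N : ι) :
    ContDiffOn ℝ ∞ (fun y => (A y)⁻¹ M N) U := by
  have h : ContDiffOn ℝ ∞ (fun y => ((A y).det)⁻¹ * (A y).adjugate M N) U := by
    refine ((contDiffOn_det hA).inv hdet).mul ?_
    simp only [Matrix.adjugate_apply]
    refine contDiffOn_det fun P Q => ?_
    by_cases hP : P = N
    · subst hP
      simp only [Matrix.updateRow_self]
      exact contDiffOn_const
    · simp only [Matrix.updateRow_ne hP]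
      exact hA P Q
  refine h.congr fun y _ => ?_
  rw [Matrix.inv_def, Matrix.smul_apply, Ring.inverse_eq_inv', smul_eq_mul]

theorem IsVielbein.det_ne_zero (he : IsVielbein U g e) (hg : ∀ x ∈ U, (g x).PosDef) (hx : x ∈ U) :
    (e x).det ≠ 0 := by
  intro h
  have h1 := congrArg Matrix.det (he.orthonormal x hx)
  rw [Matrix.det_mul, Matrix.det_transpose, h, mul_zero] at h1
  exact (hg x hx).det_pos.ne h1

theorem IsVielbein.inv_mul (he : IsVielbein U g e) (hg : ∀ x ∈ U, (g x).PosDef) (hx : x ∈ U) :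
    (e x)⁻¹ * e x = 1 :=
  Matrix.nonsing_inv_mul _ (isUnit_iff_ne_zero.2 (he.det_ne_zero hg hx))

theorem IsVielbein.mul_inv (he : IsVielbein U g e) (hg : ∀ x ∈ U, (g x).PosDef) (hx : x ∈ U) :
    e x * (e x)⁻¹ = 1 :=
  Matrix.mul_nonsing_inv _ (isUnit_iff_ne_zero.2 (he.det_ne_zero hg hx))

theorem IsVielbein.metric_mul_inv (he : IsVielbein U g e) (hg : ∀ x ∈ U, (g x).PosDef)
    (hx : x ∈ U) : g x * (e x)⁻¹ = (e x).transpose := by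
  rw [← he.orthonormal x hx, Matrix.mul_assoc, he.mul_inv hg hx, Matrix.mul_one]

theorem IsVielbein.contDiffOn_inv (he : IsVielbein U g e) (hg : ∀ x ∈ U, (g x).PosDef) (M N : ι) :
    ContDiffOn ℝ ∞ (fun y => (e y)⁻¹ M N) U :=
  BiHKT.contDiffOn_inv he.smooth (fun _ hy => he.det_ne_zero hg hy) M N

theorem pd_mul {f h : (ι → ℝ) → ℝ} (hf : DifferentiableAt ℝ f x) (hh : DifferentiableAt ℝ h x)
    (M : ι) : pd (fun y => f y * h y) M x = pd f M x * h x + f x * pd h M x := by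
  simp only [pd, fderiv_fun_mul hf hh, add_apply, smul_apply, smul_eq_mul]
  ring

/-- The derivative of the inverse vielbein. -/
theorem IsVielbein.pd_inv_mul (hU : IsOpen U) (he : IsVielbein U g e) (hg : ∀ x ∈ U, (g x).PosDef)
    (hx : x ∈ U) (M S K : ι) :
    ∑ B, pd (fun y => (e y)⁻¹ S B) M x * e x B K
      = -∑ B, (e x)⁻¹ S B * pd (fun y => e y B K) M x := by
  have hd1 := fun B => differentiableAt_of_contDiffOn hU (he.contDiffOn_inv hg S B) hx
  have hd2 := fun B => differentiableAt_of_contDiffOn hU (he.smooth B K) hx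
  have h : pd (fun y => ∑ B, (e y)⁻¹ S B * e y B K) M x = 0 := by
    rw [pd_congr (h := fun _ => (1 : Matrix ι ι ℝ) S K) hU hx]
    · simp [pd]
    · intro y hy
      rw [← he.inv_mul hg hy, Matrix.mul_apply]
  rw [pd_sum _ fun B _ => (hd1 B).fun_mul (hd2 B)] at h
  simp only [pd_mul (hd1 _) (hd2 _), Finset.sum_add_distrib] at h
  linarith

theorem IsVielbein.pd_inv (hU : IsOpen U) (he : IsVielbein U g e) (hg : ∀ x ∈ U, (g x).PosDef)
    (hx : x ∈ U) (M S A : ι) :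
    pd (fun y => (e y)⁻¹ S A) M x
      = -∑ B, (e x)⁻¹ S B * ∑ K, pd (fun y => e y B K) M x * (e x)⁻¹ K A := by
  have h1 : ∀ B, ∑ K, e x B K * (e x)⁻¹ K A = (1 : Matrix ι ι ℝ) B A := fun B => by
    rw [← he.mul_inv hg hx, Matrix.mul_apply]
  have h2 : ∑ K, (∑ B, pd (fun y => (e y)⁻¹ S B) M x * e x B K) * (e x)⁻¹ K A
      = pd (fun y => (e y)⁻¹ S A) M x := by
    simp only [Finset.sum_mul]
    rw [Finset.sum_comm]
    simp only [mul_assoc, ← Finset.mul_sum, h1]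
    rw [Finset.sum_eq_single A]
    · simp
    · intro B _ hB
      simp [hB]
    · simp
  rw [← h2]
  simp only [he.pd_inv_mul hU hg hx, neg_mul, Finset.sum_mul, Finset.mul_sum,
    Finset.sum_neg_distrib]
  rw [Finset.sum_comm]
  congr 1
  exact Finset.sum_congr rfl fun B _ => Finset.sum_congr rfl fun K _ => by ring

theorem sum_metric_christoffel (hdet : (g x).det ≠ 0) (N M K : ι) :
    ∑ S, g x N S * christoffel g x S M K
      = (1 / 2) * (pd (fun y => g y N K) M x + pd (fun y => g y N M) K x
        - pd (fun y => g y M K) N x) := by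
  have h1 : ∀ T, ∑ S, g x N S * (g x)⁻¹ S T = (1 : Matrix ι ι ℝ) N T := fun T => by
    rw [← Matrix.mul_nonsing_inv _ (isUnit_iff_ne_zero.2 hdet), Matrix.mul_apply]
  simp only [christoffel, Finset.mul_sum]
  rw [Finset.sum_comm]
  have h2 : ∀ T, ∑ S, g x N S * (1 / 2 * ((g x)⁻¹ S T * (pd (fun y => g y T K) M x
      + pd (fun y => g y T M) K x - pd (fun y => g y M K) T x)))
      = (1 : Matrix ι ι ℝ) N T * (1 / 2 * (pd (fun y => g y T K) M x
      + pd (fun y => g y T M) K x - pd (fun y => g y M K) T x)) := by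
    intro T
    rw [← h1, Finset.sum_mul]
    exact Finset.sum_congr rfl fun S _ => by ring
  simp only [h2]
  rw [Finset.sum_eq_single N]
  · simp
  · intro T _ hT
    simp [hT.symm]
  · simp

/-- The frame indices contract to `g` and to the unit matrix, the derivative of the inverse frame is
traded for one of the frame, and lowering turns the Christoffel symbols into derivatives of `g`. The
vielbein survives only in the first term, which is the difference between the momenta `P` and `Π`.
-/
theorem spinConnection_eq (hU : IsOpen U) (he : IsVielbein U g e) (hg : ∀ x ∈ U, (g x).PosDef)
    (hx : x ∈ U) (M N K : ι) :
    spinConnection g e x M N K = -(∑ A, e x A N * pd (fun y => e y A K) M x)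
      + (1 / 2) * (pd (fun y => g y N K) M x + pd (fun y => g y N M) K x
        - pd (fun y => g y M K) N x) := by
  have hgS : ∀ S, ∑ A, e x A N * e x A S = g x N S := fun S => by
    rw [← he.orthonormal x hx, Matrix.mul_apply]
    rfl
  have hgA : ∀ B, ∑ S, g x N S * (e x)⁻¹ S B = e x B N := fun B => by
    rw [← Matrix.mul_apply, he.metric_mul_inv hg hx]
    rfl
  have h1 : ∀ Q, ∑ B, (e x)⁻¹ Q B * e x B K = (1 : Matrix ι ι ℝ) Q K := fun Q => by
    rw [← he.inv_mul hg hx, Matrix.mul_apply]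
  have step : spinConnection g e x M N K
      = ∑ S, g x N S * ∑ B, (pd (fun y => (e y)⁻¹ S B) M x
        + ∑ Q, christoffel g x S M Q * (e x)⁻¹ Q B) * e x B K := by
    simp only [spinConnection, ← hgS, Finset.sum_mul, Finset.mul_sum]
    rw [Finset.sum_comm]
    conv_lhs => enter [2, B]; rw [Finset.sum_comm]
    rw [Finset.sum_comm]
    refine Finset.sum_congr rfl fun S _ => ?_
    rw [Finset.sum_comm]
    conv_rhs => rw [Finset.sum_comm]
    refine Finset.sum_congr rfl fun A _ => Finset.sum_congr rfl fun B _ => ?_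
    ring
  have h2 : ∀ S, ∑ B, (∑ Q, christoffel g x S M Q * (e x)⁻¹ Q B) * e x B K
      = christoffel g x S M K := by
    intro S
    simp only [Finset.sum_mul]
    rw [Finset.sum_comm]
    simp only [mul_assoc, ← Finset.mul_sum, h1]
    rw [Finset.sum_eq_single K]
    · simp
    · intro Q _ hQ
      simp [hQ]
    · simp
  rw [step]
  simp only [add_mul, Finset.sum_add_distrib, h2, he.pd_inv_mul hU hg hx, mul_add,
    sum_metric_christoffel (hg x hx).det_pos.ne', mul_neg, Finset.sum_neg_distrib]
  congr 2
  simp only [Finset.mul_sum, ← mul_assoc]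
  rw [Finset.sum_comm]
  simp only [← Finset.sum_mul, hgA]

end Vielbein

/-! ### Real supercharges -/

section RealCharges

variable {n m : ℕ} {U : Set (Pt n m)} {L : Pt n m → ℝ}
  {e : Pt n m → Matrix (RIdx n m) (RIdx n m) ℝ} {z : Phase n m}

theorem fermion_eq_ι (e : Pt n m → Matrix (RIdx n m) (RIdx n m) ℝ) (z : Phase n m)
    (M : RIdx n m) :
    fermion e z M = ExteriorAlgebra.ι ℂ (fun A => ((e z.1)⁻¹ M A : ℂ)) :=
  (ι_eq_sum_gen _).symm

theorem antiComm_fermion (e : Pt n m → Matrix (RIdx n m) (RIdx n m) ℝ) (z : Phase n m) :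
    AntiComm (fermion e z) (fermion e z) := fun M N => by
  rw [fermion_eq_ι, fermion_eq_ι, ι_mul_ι_swap]

theorem quadratic_eq (e : Pt n m → Matrix (RIdx n m) (RIdx n m) ℝ) (z : Phase n m)
    (t : RIdx n m → RIdx n m → ℝ) :
    quadratic e z t = con2 (fun M N => (t M N : ℂ)) (fermion e z) (fermion e z) := rfl

/-- The covariant momentum in terms of the momenta at fixed `Ψ^M`. -/
theorem momP_sub_spinConnection (hU : IsOpen U) (hL : ContDiffOn ℝ ∞ L U)
    (hg : ∀ x ∈ U, (metric L x).PosDef) (he : IsVielbein U (metric L) e) (hz : z.1 ∈ U)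
    (M : RIdx n m) :
    momP z M - (Complex.I / 2) • quadratic e z (spinConnection (metric L) e z.1 M)
      = momPi e z M + (Complex.I / 2) • con2 (fun K N =>
        ((pd (fun y => metric L y N M) K z.1 : ℝ) : ℂ)) (fermion e z) (fermion e z) := by
  have hΨ := antiComm_fermion e z
  have hs : ∀ N K, metric L z.1 N K = metric L z.1 K N := metric_symm hU hL hz
  have hpd : ∀ N K P, pd (fun y => metric L y N K) P z.1 = pd (fun y => metric L y K N) P z.1 :=
    fun N K P => pd_congr hU hz (fun y hy => metric_symm hU hL hy N K) P
  -- The derivative of the metric along `M` is symmetric in the indices contracted with odd vectors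
  -- and drops out. The other two terms of the Christoffel part become equal and double.
  have h0 : con2 (fun N K => ((pd (fun y => metric L y N K) M z.1 : ℝ) : ℂ)) (fermion e z)
      (fermion e z) = 0 := eq_zero_of_eq_neg (con2_swap (fun N K => by rw [hpd]) hΨ)
  have h1 : con2 (fun N K => ((pd (fun y => metric L y N M) K z.1 : ℝ) : ℂ)) (fermion e z)
      (fermion e z) = -con2 (fun K N => ((pd (fun y => metric L y N M) K z.1 : ℝ) : ℂ))
      (fermion e z) (fermion e z) :=
    con2_transpose hΨ (fun K N => ((pd (fun y => metric L y N M) K z.1 : ℝ) : ℂ))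
  have h2 : con2 (fun N K => ((pd (fun y => metric L y M K) N z.1 : ℝ) : ℂ)) (fermion e z)
      (fermion e z) = con2 (fun K N => ((pd (fun y => metric L y N M) K z.1 : ℝ) : ℂ))
      (fermion e z) (fermion e z) := by
    simp only [hpd M]
  have h3 : quadratic e z (spinConnection (metric L) e z.1 M)
      = -con2 (fun N K => ((∑ A, e z.1 A N * pd (fun y => e y A K) M z.1 : ℝ) : ℂ)) (fermion e z)
          (fermion e z)
        - con2 (fun K N => ((pd (fun y => metric L y N M) K z.1 : ℝ) : ℂ)) (fermion e z)
          (fermion e z) := by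
    have e1 : (fun N K => ((spinConnection (metric L) e z.1 M N K : ℝ) : ℂ))
        = fun N K => (-1 : ℂ) * ((∑ A, e z.1 A N * pd (fun y => e y A K) M z.1 : ℝ) : ℂ)
          + (1 / 2 : ℂ) * (((pd (fun y => metric L y N K) M z.1 : ℝ) : ℂ)
            + ((pd (fun y => metric L y N M) K z.1 : ℝ) : ℂ)
            - ((pd (fun y => metric L y M K) N z.1 : ℝ) : ℂ)) := by
      ext N K
      rw [spinConnection_eq hU he hg hz]
      push_cast
      ring
    rw [quadratic_eq, e1, con2_add_tensor, con2_smul_tensor, con2_smul_tensor, con2_sub_tensor,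
      con2_add_tensor, h0, h1, h2]
    module
  have h4 : momPi e z M = momP z M + (Complex.I / 2) •
      con2 (fun N K => ((∑ A, e z.1 A N * pd (fun y => e y A K) M z.1 : ℝ) : ℂ)) (fermion e z)
          (fermion e z) := rfl
  rw [h3, h4]
  module

variable {G : Type} [Ring G] [Algebra ℂ G]

theorem metricForm_self_eq_zero {T : RIdx n m → RIdx n m → RIdx n m → ℂ} (hT : IsSym3 T)
    {Ψ : RIdx n m → G} (hΨ : AntiComm Ψ Ψ) : metricForm T Ψ Ψ Ψ = 0 := by
  simp only [metricForm, con3_JB_self23 hT hΨ]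
  simp

set_option maxHeartbeats 1600000 in
/-- The fermion-cubic part of the supercharge of a complex structure. -/
theorem cubicForm_succ {T : RIdx n m → RIdx n m → RIdx n m → ℂ} (hT : IsSym3 T)
    {Ψ : RIdx n m → G} (hΨ : AntiComm Ψ Ψ) (p : Fin 3) :
    (Complex.I / 2) • metricForm T Ψ Ψ (act (JT p.succ) Ψ)
      + (Complex.I / 3) • (metricForm T (act (JT p.succ) (act (JT p.succ) Ψ)) Ψ (act (JT p.succ) Ψ)
        + metricForm T (act (JT p.succ) Ψ) Ψ (act (JT p.succ) (act (JT p.succ) Ψ))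
        + metricForm T (act (JT p.succ) Ψ) (act (JT p.succ) Ψ) (act (JT p.succ) Ψ))
      - (1 / 6 : ℂ) • (cubicForm T 0 (act (JT p.succ) Ψ) Ψ Ψ + cubicForm T 0 Ψ (act (JT p.succ) Ψ) Ψ
        + cubicForm T 0 Ψ Ψ (act (JT p.succ) Ψ))
      = -(1 / 2 : ℂ) • cubicForm T p.succ Ψ Ψ Ψ := by
  obtain ⟨u, hu, s12, s23, z12, z23⟩ := exists_array_cubic hT hΨ
  -- An unrotated vector is split into its two sectors, so that every slot carries one of the eight
  -- labels before sorting.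
  have h0 : Ψ = act (JB 0) Ψ + act (JB 4) Ψ := by
    rw [← act_add_left, JB_zero_add_JB_four, act_one]
  have hz : metricForm T (act (JT p.succ) Ψ) (act (JT p.succ) Ψ) (act (JT p.succ) Ψ) = 0 :=
    metricForm_self_eq_zero hT (hΨ.act _ _)
  have h5 : ∀ Y Z : RIdx n m → G, metricForm T Ψ Y Z
      = metricForm T (act (JB 0) Ψ) Y Z + metricForm T (act (JB 4) Ψ) Y Z := by
    intro Y Z
    conv_lhs => rw [h0]
    simp only [metricForm, map_add, LinearMap.add_apply]
    module
  rw [hz, h5, act_JT_act_JT]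
  have h6 : ∀ Y Z : RIdx n m → G, metricForm T (-Ψ) Y Z
      = -(metricForm T (act (JB 0) Ψ) Y Z + metricForm T (act (JB 4) Ψ) Y Z) := by
    intro Y Z
    rw [← h5]
    simp only [metricForm, map_neg, LinearMap.neg_apply]
    module
  rw [h6]
  fin_cases p <;>
  · simp [cubicForm, metricForm, JT, act_add_left, act_sub_left, act_smul_left, act_JB_act_JB,
      JBSgn, JBIdx]
    simp only [hu]
    simp (discharger := decide) only [Fin.isValue, Fin.coe_ofNat_eq_mod, Nat.reduceMod, s12, s23,
      z12, z23, neg_zero, neg_neg]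
    module

/-- The supercharge, with momenta at fixed `Ψ^M`. -/
def superCharge (L : Pt n m → ℝ) (e : Pt n m → Matrix (RIdx n m) (RIdx n m) ℝ) (a : Fin 4) :
    Obs n m := fun z =>
  ∑ M, act (JT a) (fermion e z) M * momPi e z M
    - (1 / 2 : ℂ) • cubicForm (tens3 L z.1) a (fermion e z) (fermion e z) (fermion e z)

theorem sum_mul_pd_metric (hU : IsOpen U) (hL : ContDiffOn ℝ ∞ L U) {x : Pt n m} (hx : x ∈ U)
    {Y Ψ : RIdx n m → G} (hY : AntiComm Y Ψ) :
    ∑ M, Y M * con2 (fun K N => ((pd (fun y => metric L y N M) K x : ℝ) : ℂ)) Ψ Ψ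
      = metricForm (tens3 L x) Ψ Ψ Y := by
  rw [← con3_pd_metric hU hL hx, ← con3_cycle hY hY, con3_eq_mul_con2]

/-- After this reduction the vielbein enters the supercharges only through `Ψ^M` and `Π_M`;
connection and torsions are absorbed in the cubic form. Reality, the complex combinations and the
algebra are all proved for `superCharge`. -/
theorem realCharges_eq (hU : IsOpen U) (hL : ContDiffOn ℝ ∞ L U)
    (hg : ∀ x ∈ U, (metric L x).PosDef) (he : IsVielbein U (metric L) e) (hz : z.1 ∈ U)
    (a : Fin 4) :
    realCharges L e (torsion L) (holTorsion L) a z = superCharge L e a z := by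
  have hΨ := antiComm_fermion e z
  have hT := isSym3_tens3 hU hL hz
  refine Fin.cases ?_ (fun p => ?_) a
  · change chargeQ e (metric L) (torsion L) z = _
    simp only [chargeQ, momP_sub_spinConnection hU hL hg he hz]
    simp only [mul_add, mul_smul_comm,
      Finset.sum_add_distrib, ← Finset.smul_sum, sum_mul_pd_metric hU hL hz hΨ, quadratic_eq]
    rw [← con3_eq_mul_con2 (fun M N K => (torsion L z.1 M N K : ℂ)), con3_torsion L z.1 hΨ hΨ hΨ,
      metricForm_self_eq_zero hT hΨ, superCharge, JT_zero, act_one]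
    -- On equal arguments the six permutations in the contraction of `C` agree, whence the factor
    -- `6`; with `i · i / 12` this gives `-1 / 2`.
    have : (Complex.I / 12) • Complex.I • (6 : ℂ) • cubicForm (tens3 L z.1) 0 (fermion e z)
        (fermion e z) (fermion e z) = -(1 / 2 : ℂ) • cubicForm (tens3 L z.1) 0 (fermion e z)
        (fermion e z) (fermion e z) := by
      rw [smul_smul, smul_smul]
      congr 1
      rw [div_mul_eq_mul_div, Complex.I_mul_I]
      norm_num
    rw [smul_zero, add_zero, sub_eq_add_neg, ← neg_smul, ← this]
    module
  · change chargeQI e (metric L) (cliffordTriple p) (holTorsion L p) z = _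
    have hY : ∀ f : RIdx n m → Gr (RIdx n m), ∑ S, ∑ M, (cliffordTriple p z.1 S M : ℂ) •
        (fermion e z S * f M) = ∑ M, act (JT p.succ) (fermion e z) M * f M := by
      intro f
      rw [Finset.sum_comm]
      refine Finset.sum_congr rfl fun M _ => ?_
      simp only [act_apply, JT_succ p z.1, Matrix.map_apply, Finset.sum_mul, smul_mul_assoc]
    have hYΨ : AntiComm (act (JT p.succ) (fermion e z)) (fermion e z) := by
      have := hΨ.act (JT p.succ) 1
      rwa [act_one] at this
    simp only [chargeQI, momP_sub_spinConnection hU hL hg he hz, hY]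
    simp only [mul_add, mul_sub, mul_smul_comm, Finset.sum_add_distrib, Finset.sum_sub_distrib,
      ← Finset.smul_sum, sum_mul_pd_metric hU hL hz hYΨ, quadratic_eq]
    rw [← con3_eq_mul_con2 (fun M N K => (bismut (metric L) (cliffordTriple p) z.1 M N K : ℂ)),
      ← con3_eq_mul_con2 (fun M N K => (holTorsion L p z.1 M N K : ℂ))]
    simp only [holTorsion, Complex.ofReal_sub]
    rw [con3_sub_tensor, con3_torsion L z.1 hYΨ hYΨ hΨ, con3_bismut hU hL hz p hYΨ hYΨ hΨ,
      superCharge]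
    have hS : (1 / 2 : ℂ) • cubicForm (tens3 L z.1) p.succ (fermion e z) (fermion e z) (fermion e z)
        = -(-(1 / 2 : ℂ) • cubicForm (tens3 L z.1) p.succ (fermion e z) (fermion e z)
          (fermion e z)) := by module
    rw [hS, ← cubicForm_succ hT hΨ p]
    have hI : ∀ w : Gr (RIdx n m), (Complex.I / 12) • Complex.I • w = -(1 / 12 : ℂ) • w := by
      intro w
      rw [smul_smul]
      congr 1
      rw [div_mul_eq_mul_div, Complex.I_mul_I]
      norm_num
    rw [smul_sub, hI]
    module

/-! ### Reality -/

theorem isRealLinear_fermion (e : Pt n m → Matrix (RIdx n m) (RIdx n m) ℝ) (z : Phase n m)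
    (M : RIdx n m) : IsRealLinear (fermion e z M) := ⟨fun A => (e z.1)⁻¹ M A, rfl⟩

theorem IsRealLinear.sum_smul {κ ι : Type} [Fintype κ] [DecidableEq κ] [Fintype ι] {X : ι → Gr κ}
    (hX : ∀ M, IsRealLinear (X M)) (c : ι → ℂ) (hc : ∀ M, (starRingEnd ℂ) (c M) = c M) :
    IsRealLinear (∑ M, c M • X M) := by
  choose v hv using hX
  refine ⟨fun k => ∑ M, (c M).re * v M k, ?_⟩
  have hc' : ∀ M, c M = ((c M).re : ℂ) := fun M => (Complex.conj_eq_iff_re.1 (hc M)).symm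
  simp only [hv, Finset.smul_sum, smul_smul]
  rw [Finset.sum_comm]
  refine Finset.sum_congr rfl fun k _ => ?_
  rw [← Finset.sum_smul]
  congr 1
  push_cast
  exact Finset.sum_congr rfl fun M _ => by rw [← hc' M]

theorem isRealLinear_act_JT (e : Pt n m → Matrix (RIdx n m) (RIdx n m) ℝ) (z : Phase n m)
    (a : Fin 4) (M : RIdx n m) : IsRealLinear (act (JT a) (fermion e z) M) :=
  IsRealLinear.sum_smul (isRealLinear_fermion e z) _ fun S => JT_real a S M

theorem isRealLinear_act_JB (e : Pt n m → Matrix (RIdx n m) (RIdx n m) ℝ) (z : Phase n m)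
    (i : Fin 8) (M : RIdx n m) : IsRealLinear (act (JB i) (fermion e z) M) :=
  IsRealLinear.sum_smul (isRealLinear_fermion e z) _ fun S => JB_real i S M

theorem grConj_con3 {κ ι : Type} [Fintype κ] [DecidableEq κ] [Fintype ι] [DecidableEq ι]
    {X Y Z : ι → Gr κ} (hX : ∀ M, IsRealLinear (X M)) (hY : ∀ M, IsRealLinear (Y M))
    (hZ : ∀ M, IsRealLinear (Z M)) {T : ι → ι → ι → ℂ}
    (hT : ∀ M N K, (starRingEnd ℂ) (T M N K) = T M N K) :
    grConj (con3 T X Y Z) = -con3 T X Y Z := by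
  simp only [con3_apply, grConj_sum, grConj_smul, hT, grConj_cubic (hX _) (hY _) (hZ _), smul_neg,
    Finset.sum_neg_distrib]

/-- Each cubic term is a product of three real odd factors with an imaginary coefficient.
Conjugating the coefficient and reversing three odd factors each give a sign, and the two signs
cancel. -/
theorem grConj_superCharge (L : Pt n m → ℝ) (e : Pt n m → Matrix (RIdx n m) (RIdx n m) ℝ)
    (a : Fin 4) (z : Phase n m) : grConj (superCharge L e a z) = superCharge L e a z := by
  have hJT := isRealLinear_act_JT e z
  have hJB := isRealLinear_act_JB e z
  have hΨ := isRealLinear_fermion e z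
  have h3 : grConj (cubicForm (tens3 L z.1) a (fermion e z) (fermion e z) (fermion e z))
      = cubicForm (tens3 L z.1) a (fermion e z) (fermion e z) (fermion e z) := by
    have hs : (starRingEnd ℂ) (![1, -1, -1, -1] a : ℂ) = ![1, -1, -1, -1] a := by
      fin_cases a <;> simp
    simp only [cubicForm, grConj_smul, grConj_add, grConj_con3 (hJT _) (hJT _) (hJT _) tens3_real,
      grConj_con3 (hJT _) (hJB _) (hJB _) tens3_real, map_div₀, Complex.conj_I, map_ofNat, hs]
    module
  have hP : ∀ M, grConj (act (JT a) (fermion e z) M * momPi e z M)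
      = act (JT a) (fermion e z) M * momPi e z M := by
    intro M
    have e1 : act (JT a) (fermion e z) M * momPi e z M = (z.2 M : ℂ) • act (JT a) (fermion e z) M
        + (Complex.I / 2) • ∑ N, ∑ K,
          ((∑ A, e z.1 A N * pd (fun y => e y A K) M z.1 : ℝ) : ℂ) •
            (act (JT a) (fermion e z) M * (fermion e z N * fermion e z K)) := by
      simp only [momPi, momP, mul_add, mul_smul_comm, Finset.mul_sum,
        Algebra.algebraMap_eq_smul_one, mul_one]
    rw [e1]
    simp only [grConj_add, grConj_smul, grConj_sum, (hJT a M).grConj, Complex.conj_ofReal,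
      grConj_cubic (hJT a M) (hΨ _) (hΨ _), map_div₀, Complex.conj_I, map_ofNat, smul_neg,
      Finset.sum_neg_distrib]
    module
  simp only [superCharge, sub_eq_add_neg, ← neg_smul, grConj_add, grConj_smul, grConj_sum, hP, h3,
    map_neg, map_div₀, map_one, map_ofNat]

end RealCharges

/-! ### Complex supercharges -/

section ComplexCharges

variable {n m : ℕ} {G : Type} [Ring G] [Algebra ℂ G] {U : Set (Pt n m)} {L : Pt n m → ℝ}

/-- The functionals act on different indices of the third derivatives and hence commute. This moves
the external complex derivative inside `Δ`, as the sector lemmas require. -/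
theorem lapT_coholo (T : RIdx n m → RIdx n m → RIdx n m → ℂ) (F H : Flavor n m) (i j : Fin 2)
    (K : CIdx n m) :
    coholo (fun P => lapT (T P) F H i j) K
      = lapT (fun M N => coholo (fun P => T P M N) K) F H i j := by
  fin_cases i <;> fin_cases j <;> simp [lapT, eps, coholo, coantiholo] <;> ring

theorem lapT_coantiholo (T : RIdx n m → RIdx n m → RIdx n m → ℂ) (F H : Flavor n m) (i j : Fin 2)
    (K : CIdx n m) :
    coantiholo (fun P => lapT (T P) F H i j) K
      = lapT (fun M N => coantiholo (fun P => T P M N) K) F H i j := by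
  fin_cases i <;> fin_cases j <;> simp [lapT, eps, coholo, coantiholo] <;> ring

theorem con2_coholo (T : RIdx n m → RIdx n m → RIdx n m → ℂ) (X Y : RIdx n m → G) (K : CIdx n m) :
    con2 (fun M N => coholo (fun P => T P M N) K) X Y = coholo (fun P => con2 (T P) X Y) K := by
  simp only [coholo, smul_eq_mul, con2_smul_tensor, con2_add_tensor]

theorem con2_coantiholo (T : RIdx n m → RIdx n m → RIdx n m → ℂ) (X Y : RIdx n m → G)
    (K : CIdx n m) :
    con2 (fun M N => coantiholo (fun P => T P M N) K) X Y
      = coantiholo (fun P => con2 (T P) X Y) K := by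
  simp only [coantiholo, smul_eq_mul, con2_smul_tensor, con2_sub_tensor]

theorem coholo_add (A B : RIdx n m → G) (K : CIdx n m) :
    coholo (fun P => A P + B P) K = coholo A K + coholo B K := by
  simp only [coholo]
  module

theorem coholo_sub (A B : RIdx n m → G) (K : CIdx n m) :
    coholo (fun P => A P - B P) K = coholo A K - coholo B K := by
  simp only [coholo]
  module

theorem coholo_neg (A : RIdx n m → G) (K : CIdx n m) :
    coholo (fun P => -A P) K = -coholo A K := by
  simp only [coholo]
  module

theorem coholo_smul (c : ℂ) (A : RIdx n m → G) (K : CIdx n m) :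
    coholo (fun P => c • A P) K = c • coholo A K := by
  simp only [coholo]
  module

theorem coantiholo_add (A B : RIdx n m → G) (K : CIdx n m) :
    coantiholo (fun P => A P + B P) K = coantiholo A K + coantiholo B K := by
  simp only [coantiholo]
  module

theorem coantiholo_sub (A B : RIdx n m → G) (K : CIdx n m) :
    coantiholo (fun P => A P - B P) K = coantiholo A K - coantiholo B K := by
  simp only [coantiholo]
  module

theorem coantiholo_neg (A : RIdx n m → G) (K : CIdx n m) :
    coantiholo (fun P => -A P) K = -coantiholo A K := by
  simp only [coantiholo]
  module

theorem coantiholo_smul (c : ℂ) (A : RIdx n m → G) (K : CIdx n m) :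
    coantiholo (fun P => c • A P) K = c • coantiholo A K := by
  simp only [coantiholo]
  module

theorem pd_hOrd (hU : IsOpen U) (hL : ContDiffOn ℝ ∞ L U) {x : Pt n m} (hx : x ∈ U) (a b : Fin n)
    (i j : Fin 2) (P : RIdx n m) :
    pd (hOrd L a b i j) P x = lapT (tens3 L x P) (Sum.inl a) (Sum.inl b) i j :=
  pd_lap hU hL hx _ _ i j P

theorem pd_hMir (hU : IsOpen U) (hL : ContDiffOn ℝ ∞ L U) {x : Pt n m} (hx : x ∈ U) (a b : Fin m)
    (i j : Fin 2) (P : RIdx n m) :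
    pd (hMir L a b i j) P x = -lapT (tens3 L x P) (Sum.inr a) (Sum.inr b) i j := by
  rw [← pd_lap hU hL hx]
  have : hMir L a b i j = fun y => -lap L (Sum.inr a) (Sum.inr b) i j y := rfl
  rw [this]
  simp only [pd, fderiv_fun_neg, neg_apply]

section Terms

variable {e : Pt n m → Matrix (RIdx n m) (RIdx n m) ℝ} {z : Phase n m}

/-- This and the seven statements after it convert the fermion bilinears of the complex supercharges
into contractions of third derivatives with the projectors `CB`, leaving one complex index free for
the outer pairing. -/
theorem ordMixed_dC (hU : IsOpen U) (hL : ContDiffOn ℝ ∞ L U) (hz : z.1 ∈ U) (K : CIdx n m) :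
    ordMixed L e z (dC K) = coholo (fun P =>
      con2 (tens3 L z.1 P) (act (CB 0) (fermion e z)) (act (CB 1) (fermion e z))
        + con2 (tens3 L z.1 P) (act (CB 3) (fermion e z)) (act (CB 2) (fermion e z))) K := by
  have h := ord_mixedTerm (fermion e z) (fun M N => coholo (fun P => tens3 L z.1 P M N) K)
    (h := hOrd L) (D := fun f => dC K f z.1) (fun b c k l => by
      simp only [dC, pd_hOrd hU hL hz, lapT_coholo]) (fermion e z)
  refine Eq.trans h ?_
  simp only [con2_coholo, coholo_add, coholo_sub, coholo_neg]

theorem ordMixed_dCbar (hU : IsOpen U) (hL : ContDiffOn ℝ ∞ L U) (hz : z.1 ∈ U) (K : CIdx n m) :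
    ordMixed L e z (dCbar K) = coantiholo (fun P =>
      con2 (tens3 L z.1 P) (act (CB 0) (fermion e z)) (act (CB 1) (fermion e z))
        + con2 (tens3 L z.1 P) (act (CB 3) (fermion e z)) (act (CB 2) (fermion e z))) K := by
  have h := ord_mixedTerm (fermion e z) (fun M N => coantiholo (fun P => tens3 L z.1 P M N) K)
    (h := hOrd L) (D := fun f => dCbar K f z.1) (fun b c k l => by
      simp only [dCbar, pd_hOrd hU hL hz, lapT_coantiholo]) (fermion e z)
  refine Eq.trans h ?_
  simp only [con2_coantiholo, coantiholo_add, coantiholo_sub, coantiholo_neg]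

theorem mirMixed_dC (hU : IsOpen U) (hL : ContDiffOn ℝ ∞ L U) (hz : z.1 ∈ U) (K : CIdx n m) :
    mirMixed L e z (dC K) = coholo (fun P =>
      -con2 (tens3 L z.1 P) (act (CB 4) (fermion e z)) (act (CB 5) (fermion e z))
        - con2 (tens3 L z.1 P) (act (CB 6) (fermion e z)) (act (CB 7) (fermion e z))) K := by
  have h := mir_mixedTerm (fermion e z) (fun M N => coholo (fun P => tens3 L z.1 P M N) K)
    (h := hMir L) (D := fun f => dC K f z.1) (fun b c k l => by
      simp only [dC, pd_hMir hU hL hz, coholo_neg, lapT_coholo]) (fermion e z)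
  refine Eq.trans h ?_
  simp only [con2_coholo, coholo_add, coholo_sub, coholo_neg]

theorem mirMixed_dCbar (hU : IsOpen U) (hL : ContDiffOn ℝ ∞ L U) (hz : z.1 ∈ U) (K : CIdx n m) :
    mirMixed L e z (dCbar K) = coantiholo (fun P =>
      -con2 (tens3 L z.1 P) (act (CB 4) (fermion e z)) (act (CB 5) (fermion e z))
        - con2 (tens3 L z.1 P) (act (CB 6) (fermion e z)) (act (CB 7) (fermion e z))) K := by
  have h := mir_mixedTerm (fermion e z) (fun M N => coantiholo (fun P => tens3 L z.1 P M N) K)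
    (h := hMir L) (D := fun f => dCbar K f z.1) (fun b c k l => by
      simp only [dCbar, pd_hMir hU hL hz, coantiholo_neg, lapT_coantiholo]) (fermion e z)
  refine Eq.trans h ?_
  simp only [con2_coantiholo, coantiholo_add, coantiholo_sub, coantiholo_neg]

theorem ordHol_dCbar (hU : IsOpen U) (hL : ContDiffOn ℝ ∞ L U) (hz : z.1 ∈ U) (K : CIdx n m) :
    ordHol L e z (dCbar K) = coantiholo (fun P =>
      con2 (tens3 L z.1 P) (act (CB 3) (fermion e z)) (act (CB 0) (fermion e z))
        - con2 (tens3 L z.1 P) (act (CB 0) (fermion e z)) (act (CB 3) (fermion e z))) K := by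
  have h := ord_holTerm (fermion e z) (fun M N => coantiholo (fun P => tens3 L z.1 P M N) K)
    (h := hOrd L) (D := fun f => dCbar K f z.1) (fun b c k l => by
      simp only [dCbar, pd_hOrd hU hL hz, lapT_coantiholo])
  refine Eq.trans h ?_
  simp only [con2_coantiholo, coantiholo_add, coantiholo_sub, coantiholo_neg]

theorem mirHol_dCbar (hU : IsOpen U) (hL : ContDiffOn ℝ ∞ L U) (hz : z.1 ∈ U) (K : CIdx n m) :
    mirHol L e z (dCbar K) = coantiholo (fun P =>
      con2 (tens3 L z.1 P) (act (CB 6) (fermion e z)) (act (CB 4) (fermion e z))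
        - con2 (tens3 L z.1 P) (act (CB 4) (fermion e z)) (act (CB 6) (fermion e z))) K := by
  have h := mir_holTerm (fermion e z) (fun M N => coantiholo (fun P => tens3 L z.1 P M N) K)
    (h := hMir L) (D := fun f => dCbar K f z.1) (fun b c k l => by
      simp only [dCbar, pd_hMir hU hL hz, coantiholo_neg, lapT_coantiholo])
  refine Eq.trans h ?_
  simp only [con2_coantiholo, coantiholo_add, coantiholo_sub, coantiholo_neg]

theorem ordAntihol_dC (hU : IsOpen U) (hL : ContDiffOn ℝ ∞ L U) (hz : z.1 ∈ U) (K : CIdx n m) :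
    ordAntihol L e z (dC K) = coholo (fun P =>
      con2 (tens3 L z.1 P) (act (CB 1) (fermion e z)) (act (CB 2) (fermion e z))
        - con2 (tens3 L z.1 P) (act (CB 2) (fermion e z)) (act (CB 1) (fermion e z))) K := by
  have h := ord_antiholTerm (fermion e z) (fun M N => coholo (fun P => tens3 L z.1 P M N) K)
    (h := hOrd L) (D := fun f => dC K f z.1) (fun b c k l => by
      simp only [dC, pd_hOrd hU hL hz, lapT_coholo])
  refine Eq.trans h ?_
  simp only [con2_coholo, coholo_add, coholo_sub, coholo_neg]

theorem mirAntihol_dC (hU : IsOpen U) (hL : ContDiffOn ℝ ∞ L U) (hz : z.1 ∈ U) (K : CIdx n m) :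
    mirAntihol L e z (dC K) = coholo (fun P =>
      con2 (tens3 L z.1 P) (act (CB 5) (fermion e z)) (act (CB 7) (fermion e z))
        - con2 (tens3 L z.1 P) (act (CB 7) (fermion e z)) (act (CB 5) (fermion e z))) K := by
  have h := mir_antiholTerm (fermion e z) (fun M N => coholo (fun P => tens3 L z.1 P M N) K)
    (h := hMir L) (D := fun f => dC K f z.1) (fun b c k l => by
      simp only [dC, pd_hMir hU hL hz, coholo_neg, lapT_coholo])
  refine Eq.trans h ?_
  simp only [con2_coholo, coholo_add, coholo_sub, coholo_neg]

end Terms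

section Sums

variable (X A B C W : RIdx n m → G) (c d f : ℂ)

theorem eps_eps_sum {φ : Type} [Fintype φ] (u v : φ → Fin 2 → G) :
    ∑ a, ∑ l, ∑ i, eps l i • (u a l * ∑ j, eps i j • v a j) = -∑ a, ∑ l, u a l * v a l := by
  simp [eps, Finset.sum_add_distrib]

/-- This is the shape of a bracket in `S`: `A` stands for the momentum, `B` and `C` for the mixed
terms of the two sectors, `W` for the term with an antisymmetric symbol. The mirror and conjugate
versions differ by the projectors and the sign of the last term. -/
theorem ord_sum_holo :
    ∑ a : Fin n, ∑ i, holo X (Sum.inl a, i) * (coholo A (Sum.inl a, i)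
        + c • coholo B (Sum.inl a, i) + d • coholo C (Sum.inl a, i)
        + f • ∑ j, eps i j • coantiholo W (Sum.inl a, j))
      = ∑ M, act (CB 0) X M * (A M + c • B M + d • C M)
        - f • ∑ M, act (CB 3) X M * W M := by
  have h1 := (ord_pairing X fun M => A M + c • B M + d • C M).1
  have h2 := (ord_pairing X W).2.2.1
  simp only [act_neg_left, Pi.neg_apply, neg_mul, Finset.sum_neg_distrib] at h2
  rw [← h1, sub_eq_add_neg, ← smul_neg, ← h2]
  simp only [coholo_add, coholo_smul, mul_add, Finset.sum_add_distrib, mul_smul_comm,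
    Finset.mul_sum, Finset.smul_sum]

theorem mir_sum_holo :
    ∑ a : Fin m, ∑ i, holo X (Sum.inr a, i) * (coholo A (Sum.inr a, i)
        + c • coholo B (Sum.inr a, i) + d • coholo C (Sum.inr a, i)
        + f • ∑ j, eps i j • coantiholo W (Sum.inr a, j))
      = ∑ M, act (CB 4) X M * (A M + c • B M + d • C M)
        + f • ∑ M, act (CB 6) X M * W M := by
  have h1 := (mir_pairing X fun M => A M + c • B M + d • C M).1
  have h2 := (mir_pairing X W).2.2.1
  rw [← h1, ← h2]
  simp only [coholo_add, coholo_smul, mul_add, Finset.sum_add_distrib, mul_smul_comm,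
    Finset.mul_sum, Finset.smul_sum]

theorem ord_sum_antiholo :
    ∑ a : Fin n, ∑ i, antiholo X (Sum.inl a, i) * (coantiholo A (Sum.inl a, i)
        + c • coantiholo B (Sum.inl a, i) + d • coantiholo C (Sum.inl a, i)
        + f • ∑ j, eps i j • coholo W (Sum.inl a, j))
      = ∑ M, act (CB 1) X M * (A M + c • B M + d • C M)
        - f • ∑ M, act (CB 2) X M * W M := by
  have h1 := (ord_pairing X fun M => A M + c • B M + d • C M).2.1
  have h2 := (ord_pairing X W).2.2.2
  simp only [act_neg_left, Pi.neg_apply, neg_mul, Finset.sum_neg_distrib] at h2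
  rw [← h1, sub_eq_add_neg, ← smul_neg, ← h2]
  simp only [coantiholo_add, coantiholo_smul, mul_add, Finset.sum_add_distrib, mul_smul_comm,
    Finset.mul_sum, Finset.smul_sum]

theorem mir_sum_antiholo :
    ∑ a : Fin m, ∑ i, antiholo X (Sum.inr a, i) * (coantiholo A (Sum.inr a, i)
        + c • coantiholo B (Sum.inr a, i) + d • coantiholo C (Sum.inr a, i)
        + f • ∑ j, eps i j • coholo W (Sum.inr a, j))
      = ∑ M, act (CB 5) X M * (A M + c • B M + d • C M)
        + f • ∑ M, act (CB 7) X M * W M := by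
  have h1 := (mir_pairing X fun M => A M + c • B M + d • C M).2.1
  have h2 := (mir_pairing X W).2.2.2
  rw [← h1, ← h2]
  simp only [coantiholo_add, coantiholo_smul, mul_add, Finset.sum_add_distrib, mul_smul_comm,
    Finset.mul_sum, Finset.smul_sum]

/-- In `R` a symbol `ε` stands outside the bracket. It rotates the pairing of the first three terms,
while in the last term it meets the inner symbol and `ε² = -1` restores a plain pairing. -/
theorem ord_eps_sum_holo :
    ∑ a : Fin n, ∑ l, ∑ i, eps l i • (holo X (Sum.inl a, l) * (coantiholo A (Sum.inl a, i)
        + c • coantiholo B (Sum.inl a, i) + d • coantiholo C (Sum.inl a, i)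
        + f • ∑ j, eps i j • coholo W (Sum.inl a, j)))
      = -(∑ M, act (CB 3) X M * (A M + c • B M + d • C M))
        - f • ∑ M, act (CB 0) X M * W M := by
  have h1 := (ord_pairing X fun M => A M + c • B M + d • C M).2.2.1
  have h2 := (ord_pairing X W).1
  have h3 := eps_eps_sum (fun a l => holo X (Sum.inl a, l)) fun (a : Fin n) j =>
    coholo W (Sum.inl a, j)
  simp only [act_neg_left, Pi.neg_apply, neg_mul, Finset.sum_neg_distrib] at h1
  rw [← h1, ← h2, sub_eq_add_neg, ← smul_neg, ← h3]
  simp only [coantiholo_add, coantiholo_smul, mul_add, Finset.sum_add_distrib, mul_smul_comm,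
    Finset.smul_sum, smul_add]
  congr 1
  exact Finset.sum_congr rfl fun _ _ => Finset.sum_congr rfl fun _ _ =>
    Finset.sum_congr rfl fun _ _ => by
    rw [← Finset.smul_sum, mul_smul_comm, smul_comm]

theorem mir_eps_sum_antiholo :
    ∑ a : Fin m, ∑ l, ∑ i, eps l i • (antiholo X (Sum.inr a, l) * (coholo A (Sum.inr a, i)
        + c • coholo B (Sum.inr a, i) + d • coholo C (Sum.inr a, i)
        + f • ∑ j, eps i j • coantiholo W (Sum.inr a, j)))
      = (∑ M, act (CB 7) X M * (A M + c • B M + d • C M))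
        - f • ∑ M, act (CB 5) X M * W M := by
  have h1 := (mir_pairing X fun M => A M + c • B M + d • C M).2.2.2
  have h2 := (mir_pairing X W).2.1
  have h3 := eps_eps_sum (fun a l => antiholo X (Sum.inr a, l)) fun (a : Fin m) j =>
    coantiholo W (Sum.inr a, j)
  rw [← h1, ← h2, sub_eq_add_neg, ← smul_neg, ← h3]
  simp only [coholo_add, coholo_smul, mul_add, Finset.sum_add_distrib, mul_smul_comm,
    Finset.smul_sum, smul_add]
  congr 1
  exact Finset.sum_congr rfl fun _ _ => Finset.sum_congr rfl fun _ _ =>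
    Finset.sum_congr rfl fun _ _ => by
    rw [← Finset.smul_sum, mul_smul_comm, smul_comm]

theorem ord_eps_sum_antiholo :
    ∑ a : Fin n, ∑ l, ∑ i, eps l i • (antiholo X (Sum.inl a, l) * (coholo A (Sum.inl a, i)
        + c • coholo B (Sum.inl a, i) + d • coholo C (Sum.inl a, i)
        + f • ∑ j, eps i j • coantiholo W (Sum.inl a, j)))
      = -(∑ M, act (CB 2) X M * (A M + c • B M + d • C M))
        - f • ∑ M, act (CB 1) X M * W M := by
  have h1 := (ord_pairing X fun M => A M + c • B M + d • C M).2.2.2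
  have h2 := (ord_pairing X W).2.1
  have h3 := eps_eps_sum (fun a l => antiholo X (Sum.inl a, l)) fun (a : Fin n) j =>
    coantiholo W (Sum.inl a, j)
  simp only [act_neg_left, Pi.neg_apply, neg_mul, Finset.sum_neg_distrib] at h1
  rw [← h1, ← h2, sub_eq_add_neg, ← smul_neg, ← h3]
  simp only [coholo_add, coholo_smul, mul_add, Finset.sum_add_distrib, mul_smul_comm,
    Finset.smul_sum, smul_add]
  congr 1
  exact Finset.sum_congr rfl fun _ _ => Finset.sum_congr rfl fun _ _ =>
    Finset.sum_congr rfl fun _ _ => by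
    rw [← Finset.smul_sum, mul_smul_comm, smul_comm]

theorem mir_eps_sum_holo :
    ∑ a : Fin m, ∑ l, ∑ i, eps l i • (holo X (Sum.inr a, l) * (coantiholo A (Sum.inr a, i)
        + c • coantiholo B (Sum.inr a, i) + d • coantiholo C (Sum.inr a, i)
        + f • ∑ j, eps i j • coholo W (Sum.inr a, j)))
      = (∑ M, act (CB 6) X M * (A M + c • B M + d • C M))
        - f • ∑ M, act (CB 4) X M * W M := by
  have h1 := (mir_pairing X fun M => A M + c • B M + d • C M).2.2.1
  have h2 := (mir_pairing X W).1
  have h3 := eps_eps_sum (fun a l => holo X (Sum.inr a, l)) fun (a : Fin m) j =>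
    coholo W (Sum.inr a, j)
  rw [← h1, ← h2, sub_eq_add_neg, ← smul_neg, ← h3]
  simp only [coantiholo_add, coantiholo_smul, mul_add, Finset.sum_add_distrib, mul_smul_comm,
    Finset.smul_sum, smul_add]
  congr 1
  exact Finset.sum_congr rfl fun _ _ => Finset.sum_congr rfl fun _ _ =>
    Finset.sum_congr rfl fun _ _ => by
    rw [← Finset.smul_sum, mul_smul_comm, smul_comm]

end Sums

end ComplexCharges

/-! ### The complex supercharges as combinations of the real ones. -/

section ComplexChargesReal

variable {n m : ℕ} {U : Set (Pt n m)} {L : Pt n m → ℝ}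
  {e : Pt n m → Matrix (RIdx n m) (RIdx n m) ℝ} {z : Phase n m}

/-- The pairing of a vector with the covector `V`. -/
def pairing {ι G : Type} [Fintype ι] [Ring G] [Algebra ℂ G] (V : ι → G) : (ι → G) →ₗ[ℂ] G :=
  ∑ M, LinearMap.mulRight ℂ (V M) ∘ₗ LinearMap.proj M

theorem pairing_apply {ι G : Type} [Fintype ι] [Ring G] [Algebra ℂ G] (V X : ι → G) :
    pairing V X = ∑ M, X M * V M := by
  simp [pairing]

theorem sqrt_two_mul_sqrt_two : (Real.sqrt 2 : ℂ) * (Real.sqrt 2 : ℂ) = 2 := by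
  rw [← Complex.ofReal_mul, Real.mul_self_sqrt (by norm_num)]
  norm_num

theorem sqrt_two_mul_sqrt_two_mul (c : ℂ) :
    (Real.sqrt 2 : ℂ) * ((Real.sqrt 2 : ℂ) * c) = 2 * c := by
  rw [← mul_assoc, sqrt_two_mul_sqrt_two]

set_option maxHeartbeats 3200000 in
-- Once components are replaced by projectors, both sides consist of a linear functional of rotated
-- fermions, coming from the momenta, and of cubic contractions. Expanding the projectors in `JB`
-- and sorting labels leaves a comparison of coefficients, as for the other three charges.
theorem sqrt_two_smul_chargeS (hU : IsOpen U) (hL : ContDiffOn ℝ ∞ L U) (hz : z.1 ∈ U) :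
    (Real.sqrt 2 : ℂ) • chargeS L e z = superCharge L e 0 z - Complex.I • superCharge L e 1 z := by
  obtain ⟨u, hu, s12, s23, z12, z23⟩ :=
    exists_array_cubic (isSym3_tens3 hU hL hz) (antiComm_fermion e z)
  simp only [chargeS, psi, chi, sub_eq_add_neg, ← neg_smul,
    ordMixed_dC hU hL hz, mirMixed_dC hU hL hz, mirHol_dCbar hU hL hz, ordHol_dCbar hU hL hz]
  rw [ord_sum_holo, mir_sum_holo]
  simp only [mul_add, mul_sub, mul_neg, mul_smul_comm, Finset.sum_add_distrib,
    Finset.sum_sub_distrib, Finset.sum_neg_distrib, ← Finset.smul_sum,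
    ← con3_eq_mul_con2 (tens3 L z.1), ← pairing_apply, superCharge]
  simp only [smul_add, smul_sub, smul_smul, neg_mul, mul_neg, sqrt_two_mul_sqrt_two,
    sqrt_two_mul_sqrt_two_mul]
  -- Only the linearity of the pairing with the momenta matters from here on.
  generalize pairing (momPi e z) = ℓ
  generalize fermion e z = Ψ at *
  simp [CB, cubicForm, JT, act_add_left, act_sub_left, act_smul_left]
  simp only [hu]
  simp (discharger := decide) only [Fin.isValue, Fin.coe_ofNat_eq_mod, Nat.reduceMod, s12, s23,
    z12, z23, neg_zero, neg_neg]
  match_scalars <;> ring_nf <;> simp [Complex.I_sq] <;> ring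

set_option maxHeartbeats 3200000 in
theorem sqrt_two_smul_chargeSbar (hU : IsOpen U) (hL : ContDiffOn ℝ ∞ L U) (hz : z.1 ∈ U) :
    (Real.sqrt 2 : ℂ) • chargeSbar L e z
      = superCharge L e 0 z + Complex.I • superCharge L e 1 z := by
  obtain ⟨u, hu, s12, s23, z12, z23⟩ :=
    exists_array_cubic (isSym3_tens3 hU hL hz) (antiComm_fermion e z)
  simp only [chargeSbar, psiBar, chiBar, sub_eq_add_neg, ← neg_smul,
    ordMixed_dCbar hU hL hz, mirMixed_dCbar hU hL hz, mirAntihol_dC hU hL hz,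
    ordAntihol_dC hU hL hz]
  rw [ord_sum_antiholo, mir_sum_antiholo]
  simp only [mul_add, mul_sub, mul_neg, mul_smul_comm, Finset.sum_add_distrib,
    Finset.sum_sub_distrib, Finset.sum_neg_distrib, ← Finset.smul_sum,
    ← con3_eq_mul_con2 (tens3 L z.1), ← pairing_apply, superCharge]
  simp only [smul_add, smul_sub, smul_smul, neg_mul, mul_neg, sqrt_two_mul_sqrt_two,
    sqrt_two_mul_sqrt_two_mul]
  generalize pairing (momPi e z) = ℓ
  generalize fermion e z = Ψ at *
  simp [CB, cubicForm, JT, act_add_left, act_sub_left, act_smul_left]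
  simp only [hu]
  simp (discharger := decide) only [Fin.isValue, Fin.coe_ofNat_eq_mod, Nat.reduceMod, s12, s23,
    z12, z23, neg_zero, neg_neg]
  match_scalars <;> ring_nf <;> simp [Complex.I_sq] <;> ring

set_option maxHeartbeats 3200000 in
theorem sqrt_two_smul_chargeR (hU : IsOpen U) (hL : ContDiffOn ℝ ∞ L U) (hz : z.1 ∈ U) :
    (Real.sqrt 2 : ℂ) • chargeR L e z = -superCharge L e 2 z + Complex.I • superCharge L e 3 z := by
  obtain ⟨u, hu, s12, s23, z12, z23⟩ :=
    exists_array_cubic (isSym3_tens3 hU hL hz) (antiComm_fermion e z)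
  simp only [chargeR, psi, chiBar, sub_eq_add_neg, ← neg_smul,
    ordMixed_dCbar hU hL hz, mirMixed_dCbar hU hL hz, mirAntihol_dC hU hL hz, ordMixed_dC hU hL hz,
    mirMixed_dC hU hL hz, ordHol_dCbar hU hL hz]
  rw [ord_eps_sum_holo, mir_eps_sum_antiholo]
  simp only [mul_add, mul_sub, mul_neg, mul_smul_comm, Finset.sum_add_distrib,
    Finset.sum_sub_distrib, Finset.sum_neg_distrib, ← Finset.smul_sum,
    ← con3_eq_mul_con2 (tens3 L z.1), ← pairing_apply, superCharge]
  simp only [smul_add, smul_sub, smul_smul, neg_mul, mul_neg, sqrt_two_mul_sqrt_two,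
    sqrt_two_mul_sqrt_two_mul]
  generalize pairing (momPi e z) = ℓ
  generalize fermion e z = Ψ at *
  simp [CB, cubicForm, JT, act_add_left, act_sub_left, act_smul_left]
  simp only [hu]
  simp (discharger := decide) only [Fin.isValue, Fin.coe_ofNat_eq_mod, Nat.reduceMod, s12, s23,
    z12, z23, neg_zero, neg_neg]
  match_scalars <;> ring_nf <;> simp [Complex.I_sq] <;> ring

set_option maxHeartbeats 3200000 in
theorem sqrt_two_smul_chargeRbar (hU : IsOpen U) (hL : ContDiffOn ℝ ∞ L U) (hz : z.1 ∈ U) :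
    (Real.sqrt 2 : ℂ) • chargeRbar L e z
      = -superCharge L e 2 z - Complex.I • superCharge L e 3 z := by
  obtain ⟨u, hu, s12, s23, z12, z23⟩ :=
    exists_array_cubic (isSym3_tens3 hU hL hz) (antiComm_fermion e z)
  simp only [chargeRbar, psiBar, chi, sub_eq_add_neg, ← neg_smul,
    ordMixed_dC hU hL hz, mirMixed_dC hU hL hz, mirHol_dCbar hU hL hz, ordMixed_dCbar hU hL hz,
    mirMixed_dCbar hU hL hz, ordAntihol_dC hU hL hz]
  rw [ord_eps_sum_antiholo, mir_eps_sum_holo]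
  simp only [mul_add, mul_sub, mul_neg, mul_smul_comm, Finset.sum_add_distrib,
    Finset.sum_sub_distrib, Finset.sum_neg_distrib, ← Finset.smul_sum,
    ← con3_eq_mul_con2 (tens3 L z.1), ← pairing_apply, superCharge]
  simp only [smul_add, smul_sub, smul_smul, neg_mul, mul_neg, sqrt_two_mul_sqrt_two,
    sqrt_two_mul_sqrt_two_mul]
  generalize pairing (momPi e z) = ℓ
  generalize fermion e z = Ψ at *
  simp [CB, cubicForm, JT, act_add_left, act_sub_left, act_smul_left]
  simp only [hu]
  simp (discharger := decide) only [Fin.isValue, Fin.coe_ofNat_eq_mod, Nat.reduceMod, s12, s23,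
    z12, z23, neg_zero, neg_neg]
  match_scalars <;> ring_nf <;> simp [Complex.I_sq] <;> ring

end ComplexChargesReal

/-! ### Derivations acting on contractions -/

section LinearVectors

variable {κ ι : Type} [Fintype κ] [DecidableEq κ] [Fintype ι] [DecidableEq ι]

/-- The components of `X` are linear in the generators. -/
def IsLin (X : ι → Gr κ) : Prop := ∀ M, ∃ v, X M = ExteriorAlgebra.ι ℂ v

theorem IsLin.antiComm {X Y : ι → Gr κ} (hX : IsLin X) (hY : IsLin Y) : AntiComm X Y :=
  fun M N => by
    obtain ⟨v, hv⟩ := hX M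
    obtain ⟨w, hw⟩ := hY N
    rw [hv, hw, ι_mul_ι_swap]

theorem IsLin.sum_smul {X : ι → Gr κ} (hX : IsLin X) (c : ι → ℂ) :
    ∃ v, ∑ M, c M • X M = ExteriorAlgebra.ι ℂ v := by
  choose v hv using hX
  exact ⟨∑ M, c M • v M, by simp only [hv, map_sum, map_smul]⟩

theorem IsLin.act {X : ι → Gr κ} (hX : IsLin X) (J : Matrix ι ι ℂ) : IsLin (act J X) :=
  fun _ => hX.sum_smul _

/-- The components of the derivative of a vector. -/
def dVec (A : κ) (X : ι → Gr κ) : ι → Gr κ := fun M => leftD A (X M)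

theorem dVec_act (A : κ) (J : Matrix ι ι ℂ) (X : ι → Gr κ) :
    dVec A (act J X) = act J (dVec A X) := by
  ext M
  simp only [dVec, act_apply, map_sum, map_smul]

theorem IsLin.central_dVec {X : ι → Gr κ} (hX : IsLin X) (A : κ) : Central (dVec A X) :=
  fun M y => by
    obtain ⟨v, hv⟩ := hX M
    rw [dVec, hv, leftD_ι]
    exact Algebra.commutes _ _

theorem IsLin.leftD_mul {X : ι → Gr κ} (hX : IsLin X) (A : κ) (M : ι) (r : Gr κ) :
    leftD A (X M * r) = dVec A X M * r - X M * leftD A r := by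
  obtain ⟨v, hv⟩ := hX M
  rw [dVec, hv, leftD_ι_mul, leftD_ι, Algebra.algebraMap_eq_smul_one, smul_mul_assoc, one_mul]

theorem IsLin.leftD_con2 {X Y : ι → Gr κ} (hX : IsLin X) (A : κ) (t : ι → ι → ℂ) :
    leftD A (con2 t X Y) = con2 t (dVec A X) Y - con2 t X (dVec A Y) := by
  simp only [con2_apply, map_sum, map_smul, hX.leftD_mul, smul_sub, Finset.sum_sub_distrib]
  rfl

theorem IsLin.leftD_con3 {X Y Z : ι → Gr κ} (hX : IsLin X) (hY : IsLin Y) (A : κ)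
    (t : ι → ι → ι → ℂ) :
    leftD A (con3 t X Y Z)
      = con3 t (dVec A X) Y Z - con3 t X (dVec A Y) Z + con3 t X Y (dVec A Z) := by
  simp only [con3_eq_mul_con2, map_sum, hX.leftD_mul, hY.leftD_con2, mul_sub,
    Finset.sum_sub_distrib]
  abel

/-- The sign between left and right derivatives of a cubic monomial is trivial, so in the bracket
the right derivative of a supercharge may be replaced by the left one. -/
theorem IsLin.rightD_con3 {X Y Z : ι → Gr κ} (hX : IsLin X) (hY : IsLin Y) (hZ : IsLin Z) (A : κ)
    (t : ι → ι → ι → ℂ) : rightD A (con3 t X Y Z) = leftD A (con3 t X Y Z) := by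
  rw [← rightDLin_apply]
  simp only [con3_apply, map_sum, map_smul]
  refine Finset.sum_congr rfl fun M _ => Finset.sum_congr rfl fun N _ =>
    Finset.sum_congr rfl fun K _ => ?_
  obtain ⟨u, hu⟩ := hX M
  obtain ⟨v, hv⟩ := hY N
  obtain ⟨w, hw⟩ := hZ K
  rw [hu, hv, hw, rightDLin_apply, rightD_cubic]

theorem HasGrDeriv.con3 {X Y Z : ℝ → ι → Gr κ} {X' Y' Z' : ι → Gr κ} {t : ℝ → ι → ι → ι → ℂ}
    {t' : ι → ι → ι → ℂ} (ht : ∀ M N K, HasDerivAt (fun s => t s M N K) (t' M N K) 0)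
    (hX : ∀ M, HasGrDeriv (fun s => X s M) (X' M)) (hY : ∀ M, HasGrDeriv (fun s => Y s M) (Y' M))
    (hZ : ∀ M, HasGrDeriv (fun s => Z s M) (Z' M)) :
    HasGrDeriv (fun s => con3 (t s) (X s) (Y s) (Z s))
      (con3 t' (X 0) (Y 0) (Z 0) + (con3 (t 0) X' (Y 0) (Z 0) + con3 (t 0) (X 0) Y' (Z 0)
        + con3 (t 0) (X 0) (Y 0) Z')) := by
  simp only [con3_apply]
  have h := HasGrDeriv.sum Finset.univ fun M _ => HasGrDeriv.sum Finset.univ fun N _ =>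
    HasGrDeriv.sum Finset.univ fun K _ => (((hX M).mul ((hY N).mul (hZ K))).smul (ht M N K))
  convert h using 1
  simp only [mul_add, smul_add, Finset.sum_add_distrib, add_assoc]

theorem HasGrDeriv.sum_smul {X : ℝ → ι → Gr κ} {X' : ι → Gr κ} (c : ι → ℂ)
    (hX : ∀ M, HasGrDeriv (fun s => X s M) (X' M)) :
    HasGrDeriv (fun s => ∑ M, c M • X s M) (∑ M, c M • X' M) := by
  have h := HasGrDeriv.sum Finset.univ fun M _ => (hX M).smul (hasDerivAt_const (0 : ℝ) (c M))
  simpa using h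

end LinearVectors

/-! ### The bracket of odd observables, abstractly -/

section AbstractBracket

variable {κ ι α : Type} [Fintype κ] [DecidableEq κ] [Fintype ι] [DecidableEq ι] [Fintype α]

/-- The sums that build up the bracket of two supercharges with coordinate derivatives
`(i/2) Y^N (w_M w_N + h_{MN}) - s_M / 2 - w_{MB} D_B` and odd derivatives
`D_B = u_B - i Y^N w_{NB}`. -/
theorem bracket_sum {Y Y' : ι → Gr κ} {w : ι → α → Gr κ} {h : ι → ι → Gr κ} {u u' : α → Gr κ}
    {s s' : ι → Gr κ} (hY : IsLin Y) (hY' : IsLin Y') (hw : ∀ A, IsLin fun M => w M A)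
    (hh : ∀ M N, h M N = h N M) (hhc : ∀ M N y, h M N * y = y * h M N)
    (hu : ∀ A y, u A * y = y * u A)
    (hs : ∀ M v, s M * ExteriorAlgebra.ι ℂ v = -(ExteriorAlgebra.ι ℂ v * s M)) :
    (∑ M, (((Complex.I / 2) • ∑ N, Y N * (∑ A, w M A * w N A + h M N) - (1 / 2 : ℂ) • s M
          - ∑ B, w M B * (u B - Complex.I • ∑ N, Y N * w N B)) * Y' M
        - Y M * ((Complex.I / 2) • ∑ N, Y' N * (∑ A, w M A * w N A + h M N) - (1 / 2 : ℂ) • s' M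
          - ∑ B, w M B * (u' B - Complex.I • ∑ N, Y' N * w N B))))
      - Complex.I • ∑ A, (u A - Complex.I • ∑ N, Y N * w N A)
        * (u' A - Complex.I • ∑ N, Y' N * w N A)
      = -Complex.I • ∑ A, u A * u' A
        + (1 / 2 : ℂ) • (∑ M, Y' M * s M + ∑ M, Y M * s' M) := by
  obtain ⟨W, hW⟩ : ∃ W : α → Gr κ, ∀ A, ∑ N, Y N * w N A = W A := ⟨_, fun _ => rfl⟩
  obtain ⟨W', hW'⟩ : ∃ W : α → Gr κ, ∀ A, ∑ N, Y' N * w N A = W A := ⟨_, fun _ => rfl⟩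
  have comm2 : ∀ (X Z : ι → Gr κ), IsLin X → IsLin Z → ∀ M N y,
      X M * Z N * y = y * (X M * Z N) := by
    intro X Z hX hZ M N y
    obtain ⟨a, ha⟩ := hX M
    obtain ⟨b, hb⟩ := hZ N
    rw [ha, hb, ι_mul_ι_central]
  have hWc : ∀ A y, W A * y = y * W A := fun A y => by
    simp only [← hW, Finset.sum_mul, Finset.mul_sum]
    exact Finset.sum_congr rfl fun N _ => comm2 _ _ hY (hw A) N N y
  have hWc' : ∀ A y, W' A * y = y * W' A := fun A y => by
    simp only [← hW', Finset.sum_mul, Finset.mul_sum]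
    exact Finset.sum_congr rfl fun N _ => comm2 _ _ hY' (hw A) N N y
  have hwY : ∀ M B, w M B * Y' M = -(Y' M * w M B) := fun M B => (hw B).antiComm hY' M M
  have hww : ∀ M N A B y, w M A * w N B * y = y * (w M A * w N B) := by
    intro M N A B y
    obtain ⟨a, ha : w M A = _⟩ := hw A M
    obtain ⟨b, hb : w N B = _⟩ := hw B N
    rw [ha, hb, ι_mul_ι_central]
  -- the derivative of the first observable is odd
  have hodd : ∀ M, ((Complex.I / 2) • ∑ N, Y N * (∑ A, w M A * w N A + h M N) - (1 / 2 : ℂ) • s M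
      - ∑ B, w M B * (u B - Complex.I • W B)) * Y' M
      = -(Y' M * ((Complex.I / 2) • ∑ N, Y N * (∑ A, w M A * w N A + h M N) - (1 / 2 : ℂ) • s M
      - ∑ B, w M B * (u B - Complex.I • W B))) := by
    intro M
    have e1 : (∑ N, Y N * (∑ A, w M A * w N A + h M N)) * Y' M
        = -(Y' M * ∑ N, Y N * (∑ A, w M A * w N A + h M N)) := by
      simp only [Finset.sum_mul, Finset.mul_sum, ← Finset.sum_neg_distrib]
      refine Finset.sum_congr rfl fun N _ => ?_
      have : (∑ A, w M A * w N A + h M N) * Y' M = Y' M * (∑ A, w M A * w N A + h M N) := by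
        rw [add_mul, mul_add, hhc, Finset.sum_mul, Finset.mul_sum]
        simp only [hww]
      rw [mul_assoc, this, ← mul_assoc, hY.antiComm hY', neg_mul, mul_assoc]
    have e2 : s M * Y' M = -(Y' M * s M) := by
      obtain ⟨v, hv⟩ := hY' M
      rw [hv, hs]
    have e3 : (∑ B, w M B * (u B - Complex.I • W B)) * Y' M
        = -(Y' M * ∑ B, w M B * (u B - Complex.I • W B)) := by
      simp only [Finset.sum_mul, Finset.mul_sum, ← Finset.sum_neg_distrib]
      refine Finset.sum_congr rfl fun B _ => ?_
      have : (u B - Complex.I • W B) * Y' M = Y' M * (u B - Complex.I • W B) := by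
        rw [sub_mul, mul_sub, hu, smul_mul_assoc, hWc, mul_smul_comm]
      rw [mul_assoc, this, ← mul_assoc, hwY, neg_mul, mul_assoc]
    rw [sub_mul, sub_mul, smul_mul_assoc, smul_mul_assoc, e1, e2, e3, mul_sub, mul_sub,
      mul_smul_comm, mul_smul_comm]
    module
  -- Both halves of the commutator-like sum have this shape with the roles of the charges exchanged.
  -- The minus sign in the first sum comes from moving `X N` past the odd `w M A`.
  have expand : ∀ {Z X : ι → Gr κ} {v : α → Gr κ} {r : ι → Gr κ}, IsLin Z → IsLin X →
      ∑ M, Z M * ((Complex.I / 2) • ∑ N, X N * (∑ A, w M A * w N A + h M N) - (1 / 2 : ℂ) • r M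
        - ∑ B, w M B * (v B - Complex.I • ∑ N, X N * w N B))
      = (Complex.I / 2) • (-(∑ A, (∑ M, Z M * w M A) * ∑ N, X N * w N A)
          + ∑ M, ∑ N, Z M * X N * h M N) - (1 / 2 : ℂ) • ∑ M, Z M * r M
        - ∑ B, (∑ M, Z M * w M B) * (v B - Complex.I • ∑ N, X N * w N B) := by
    intro Z X v r hZ hX
    have e1 : ∑ M, Z M * ∑ N, X N * (∑ A, w M A * w N A + h M N)
        = -(∑ A, (∑ M, Z M * w M A) * ∑ N, X N * w N A) + ∑ M, ∑ N, Z M * X N * h M N := by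
      simp only [mul_add, Finset.sum_add_distrib, Finset.mul_sum, Finset.sum_mul, mul_assoc]
      congr 1
      rw [← Finset.sum_neg_distrib]
      conv_lhs => enter [2, M]; rw [Finset.sum_comm]
      rw [Finset.sum_comm]
      refine Finset.sum_congr rfl fun A _ => ?_
      rw [← Finset.sum_neg_distrib]
      rw [Finset.sum_comm]
      refine Finset.sum_congr rfl fun M _ => ?_
      rw [← Finset.sum_neg_distrib]
      refine Finset.sum_congr rfl fun N _ => ?_
      rw [← mul_assoc (X _), hX.antiComm (hw A), neg_mul, mul_neg, mul_assoc]
    have e2 : ∑ M, Z M * ∑ B, w M B * (v B - Complex.I • ∑ N, X N * w N B)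
        = ∑ B, (∑ M, Z M * w M B) * (v B - Complex.I • ∑ N, X N * w N B) := by
      simp only [Finset.mul_sum (s := (Finset.univ : Finset α)), Finset.sum_mul]
      rw [Finset.sum_comm]
      simp only [mul_assoc]
    simp only [mul_sub, Finset.sum_sub_distrib, mul_smul_comm, ← Finset.smul_sum] at e1 e2 ⊢
    rw [e1, e2]
  -- The second derivatives of the frame are symmetric in the two target indices, while `Y` and `Y'`
  -- anticommute; their contributions cancel.
  have hsym : ∑ M, ∑ N, Y' M * Y N * h M N + ∑ M, ∑ N, Y M * Y' N * h M N = 0 := by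
    have : ∑ M, ∑ N, Y M * Y' N * h M N = -∑ M, ∑ N, Y' M * Y N * h M N := by
      rw [Finset.sum_comm, ← Finset.sum_neg_distrib]
      refine Finset.sum_congr rfl fun M _ => ?_
      rw [← Finset.sum_neg_distrib]
      exact Finset.sum_congr rfl fun N _ => by rw [hY.antiComm hY', hh, neg_mul]
    rw [this, add_neg_cancel]
  have eY := expand (v := u) (r := s) hY' hY
  have eY' := expand (v := u') (r := s') hY hY'
  simp only [hW, hW'] at eY eY' ⊢
  simp only [hodd]
  rw [Finset.sum_sub_distrib, Finset.sum_neg_distrib, eY, eY']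
  -- All remaining frame terms are sums of `W W'`, `u W'` and `W u'`. The coordinate part and the
  -- odd part of the bracket contribute them with opposite coefficients.
  have c1 : ∑ B, W' B * (u B - Complex.I • W B)
      = ∑ A, u A * W' A - Complex.I • ∑ A, W A * W' A := by
    simp only [mul_sub, mul_smul_comm, Finset.sum_sub_distrib, Finset.smul_sum, ← hWc', hu]
  have c2 : ∑ B, W B * (u' B - Complex.I • W' B)
      = ∑ A, W A * u' A - Complex.I • ∑ A, W A * W' A := by
    simp only [mul_sub, mul_smul_comm, Finset.sum_sub_distrib, Finset.smul_sum]
  have c3 : ∑ A, (u A - Complex.I • W A) * (u' A - Complex.I • W' A)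
      = ∑ A, u A * u' A - Complex.I • ∑ A, u A * W' A - Complex.I • ∑ A, W A * u' A
        - ∑ A, W A * W' A := by
    simp only [sub_mul, mul_sub, mul_smul_comm, smul_mul_assoc, Finset.sum_sub_distrib,
      Finset.smul_sum, smul_sub, smul_smul, Complex.I_mul_I, neg_smul, one_smul,
      Finset.sum_neg_distrib]
    abel
  have c4 : ∑ A, W' A * W A = ∑ A, W A * W' A := Finset.sum_congr rfl fun A _ => hWc' A _
  rw [c1, c2, c3, c4, ← neg_eq_of_add_eq_zero_right hsym]
  match_scalars <;> ring_nf <;> simp [Complex.I_sq]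

end AbstractBracket

/-! ### Derivatives of the supercharges with respect to the fermions -/

section OddDerivatives

variable {κ : Type} [Fintype κ] [DecidableEq κ] {n m : ℕ}
variable {T : RIdx n m → RIdx n m → RIdx n m → ℂ} {Ψ : RIdx n m → Gr κ}

theorem IsLin.leftD_cubicForm (hΨ : IsLin Ψ) (A : κ) (a : Fin 4) :
    leftD A (cubicForm T a Ψ Ψ Ψ) = cubicForm T a (dVec A Ψ) Ψ Ψ - cubicForm T a Ψ (dVec A Ψ) Ψ
      + cubicForm T a Ψ Ψ (dVec A Ψ) := by
  simp only [cubicForm, map_smul, map_add, (hΨ.act _).leftD_con3 (hΨ.act _), dVec_act]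
  module

theorem IsLin.leftD_gaugeForm {Y : RIdx n m → Gr κ} (hY : IsLin Y) (hΨ : IsLin Ψ) (A : κ) :
    leftD A (gaugeForm T Y Ψ Ψ) = gaugeForm T (dVec A Y) Ψ Ψ - gaugeForm T Y (dVec A Ψ) Ψ
      + gaugeForm T Y Ψ (dVec A Ψ) := by
  simp only [gaugeForm, map_smul, map_add, map_sub, (hY.act _).leftD_con3 (hΨ.act _), dVec_act]
  module

/-- The derivative of the cubic part of a supercharge in terms of the gauge potential. -/
theorem half_leftD_cubicForm (hT : IsSym3 T) (hΨ : IsLin Ψ) (A : κ) (a : Fin 4) :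
    (1 / 2 : ℂ) • leftD A (cubicForm T a Ψ Ψ Ψ)
      = gaugeForm T (act (JT a) (dVec A Ψ)) Ψ Ψ
        + (Complex.I / 2) • metricForm T (act (JT a) Ψ) (dVec A Ψ) Ψ := by
  have h1 := cubicForm_derivative hT (hΨ.antiComm hΨ) (hΨ.central_dVec A) a
  have h2 := congrArg (leftD A) (gaugeForm_self hT (hΨ.antiComm hΨ) a)
  rw [map_smul, (hΨ.act _).leftD_gaugeForm hΨ, dVec_act] at h2
  rw [← hΨ.leftD_cubicForm] at h1
  -- The regrouping isolates the derivative of `gaugeForm_self`, worth `3 / 2` of the derivative of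
  -- the cubic form, and the vanishing combination of `cubicForm_derivative`; subtracting one
  -- derivative leaves the factor `1 / 2`.
  have h3 : gaugeForm T (act (JT a) (dVec A Ψ)) Ψ Ψ
      + (Complex.I / 2) • metricForm T (act (JT a) Ψ) (dVec A Ψ) Ψ
      = (gaugeForm T (act (JT a) (dVec A Ψ)) Ψ Ψ - gaugeForm T (act (JT a) Ψ) (dVec A Ψ) Ψ
        + gaugeForm T (act (JT a) Ψ) Ψ (dVec A Ψ))
        + (leftD A (cubicForm T a Ψ Ψ Ψ) + gaugeForm T (act (JT a) Ψ) (dVec A Ψ) Ψ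
          - gaugeForm T (act (JT a) Ψ) Ψ (dVec A Ψ)
          + (Complex.I / 2) • metricForm T (act (JT a) Ψ) (dVec A Ψ) Ψ)
        - leftD A (cubicForm T a Ψ Ψ Ψ) := by module
  rw [h3, h2, h1]
  module

theorem con3_single_left {G ι : Type} [Ring G] [Algebra ℂ G] [Fintype ι] [DecidableEq ι]
    (T : ι → ι → ι → ℂ) (J : Matrix ι ι ℂ) (v X Y : ι → G) :
    ∑ N, v N * con3 T (act J (Pi.single N (1 : G))) X Y = con3 T (act J v) X Y := by
  simp only [con3_eq_mul_con2, act_apply, Finset.mul_sum, Finset.sum_mul]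
  rw [Finset.sum_comm]
  refine Finset.sum_congr rfl fun M _ => Finset.sum_congr rfl fun N _ => ?_
  rw [Finset.sum_eq_single N (fun S _ hS => by simp [hS]) (by simp)]
  simp

theorem con2_sum_outer {G ι α : Type} [Ring G] [Algebra ℂ G] [Fintype ι] [Fintype α]
    (c d : α → ι → ℂ) (X Y : ι → G) :
    con2 (fun K P => ∑ B, c B K * d B P) X Y = ∑ B, (∑ K, c B K • X K) * ∑ P, d B P • Y P := by
  simp only [con2_apply, Finset.sum_mul_sum, smul_mul_smul_comm, Finset.sum_smul]
  rw [Finset.sum_comm (γ := α)]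
  refine Finset.sum_congr rfl fun K _ => ?_
  rw [Finset.sum_comm]

theorem gaugeForm_eq_sum {G : Type} [Ring G] [Algebra ℂ G] (v X Y : RIdx n m → G) :
    ∑ N, v N * gaugeForm T (Pi.single N (1 : G)) X Y = gaugeForm T v X Y := by
  simp only [gaugeForm, mul_smul_comm, mul_add, mul_sub, ← Finset.smul_sum, Finset.sum_add_distrib,
    Finset.sum_sub_distrib, con3_single_left]

end OddDerivatives

/-! ### Odd derivatives of the momenta and of the supercharges. -/

section Fermions

variable {n m : ℕ} {L : Pt n m → ℝ} {U : Set (Pt n m)} {z : Phase n m}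
variable {e : Pt n m → Matrix (RIdx n m) (RIdx n m) ℝ}

theorem isLin_fermion (e : Pt n m → Matrix (RIdx n m) (RIdx n m) ℝ) (z : Phase n m) :
    IsLin (fermion e z) := fun M => ⟨_, fermion_eq_ι e z M⟩

theorem dVec_fermion (A M : RIdx n m) :
    dVec A (fermion e z) M = algebraMap ℂ _ ((e z.1)⁻¹ M A : ℂ) := by
  rw [dVec, fermion_eq_ι, leftD_ι]

/-- `∂_M e^A_L Ψ^L`. -/
def frameVelocity (e : Pt n m → Matrix (RIdx n m) (RIdx n m) ℝ) (z : Phase n m) (M A : RIdx n m) :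
    Gr (RIdx n m) :=
  ∑ K, ((pd (fun y => e y A K) M z.1 : ℝ) : ℂ) • fermion e z K

theorem isLin_frameVelocity (A : RIdx n m) : IsLin fun M => frameVelocity e z M A :=
  fun _ => (isLin_fermion e z).sum_smul _

theorem sum_vielbein_fermion (hg : ∀ x ∈ U, (metric L x).PosDef) (he : IsVielbein U (metric L) e)
    (hz : z.1 ∈ U) (A : RIdx n m) : ∑ K, (e z.1 A K : ℂ) • fermion e z K = gen A := by
  simp only [fermion, Finset.smul_sum, smul_smul]
  rw [Finset.sum_comm]
  simp only [← Finset.sum_smul]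
  have h : ∀ B, ∑ K, (e z.1 A K : ℂ) * ((e z.1)⁻¹ K B : ℂ) = if A = B then 1 else 0 := fun B => by
    have := congrFun (congrFun (he.mul_inv hg hz) A) B
    rw [Matrix.mul_apply, Matrix.one_apply] at this
    simp only [← Complex.ofReal_mul, ← Complex.ofReal_sum, this]
    split_ifs <;> simp
  simp [h]

theorem momPi_eq (hg : ∀ x ∈ U, (metric L x).PosDef) (he : IsVielbein U (metric L) e)
    (hz : z.1 ∈ U) (N : RIdx n m) :
    momPi e z N = momP z N + (Complex.I / 2) • ∑ A, gen A * frameVelocity e z N A := by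
  rw [momPi]
  congr 2
  simp only [← sum_vielbein_fermion hg he hz, frameVelocity, Complex.ofReal_sum,
    Complex.ofReal_mul]
  exact con2_sum_outer _ _ _ _

theorem pd_metric_vielbein (hU : IsOpen U) (he : IsVielbein U (metric L) e) (hz : z.1 ∈ U)
    (N K P : RIdx n m) :
    pd (fun y => metric L y K P) N z.1
      = ∑ A, (pd (fun y => e y A K) N z.1 * e z.1 A P
        + e z.1 A K * pd (fun y => e y A P) N z.1) := by
  have hd : ∀ A M, DifferentiableAt ℝ (fun y => e y A M) z.1 := fun A M =>
    differentiableAt_of_contDiffOn hU (he.smooth A M) hz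
  rw [pd_congr (h := fun y => ∑ A, e y A K * e y A P) hU hz (fun y hy => by
    rw [← he.orthonormal y hy, Matrix.mul_apply]; rfl),
    pd_sum _ fun A _ => (hd A K).fun_mul (hd A P)]
  exact Finset.sum_congr rfl fun A _ => pd_mul (hd A K) (hd A P) N

/-- The Leibniz rule produces the difference of two frame terms, whose sum is the derivative of `g`,
as seen by differentiating `eᵀ e = g`. Eliminating one of them doubles the other and leaves a
correction by the metric alone. -/
theorem leftD_momPi (hU : IsOpen U) (hL : ContDiffOn ℝ ∞ L U)
    (hg : ∀ x ∈ U, (metric L x).PosDef) (he : IsVielbein U (metric L) e) (hz : z.1 ∈ U)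
    (A N : RIdx n m) :
    leftD A (momPi e z N) = Complex.I • frameVelocity e z N A
      - (Complex.I / 2) • bilinForm (tens3 L z.1 N) (dVec A (fermion e z)) (fermion e z) := by
  have hcon : bilinForm (tens3 L z.1 N) (dVec A (fermion e z)) (fermion e z)
      = ∑ B, (leftD A (frameVelocity e z N B) * gen B
        + leftD A (gen B) * frameVelocity e z N B) := by
    rw [← con2_bilinForm_single]
    simp only [← pd_metric hU hL hz, pd_metric_vielbein hU he hz, Finset.sum_add_distrib,
      Complex.ofReal_add, Complex.ofReal_sum, Complex.ofReal_mul]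
    rw [con2_add_tensor, con2_sum_outer, con2_sum_outer]
    simp only [← sum_vielbein_fermion hg he hz, frameVelocity, map_sum, map_smul, dVec]
  have hgen : ∀ B, leftD A (gen B : Gr (RIdx n m)) = if B = A then 1 else 0 := fun B => by
    rw [gen_eq, leftD_ι]
    split_ifs with h
    · simp [h]
    · simp [Ne.symm h]
  have hw : ∀ B, leftD A (gen B * frameVelocity e z N B)
      = leftD A (gen B) * frameVelocity e z N B - leftD A (frameVelocity e z N B) * gen B := by
    intro B
    obtain ⟨v, hv : frameVelocity e z N B = _⟩ := isLin_frameVelocity (e := e) (z := z) B N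
    rw [hv, gen_eq, leftD_ι_mul, leftD_ι, leftD_ι, Algebra.commutes, Algebra.commutes,
      Algebra.algebraMap_eq_smul_one, Algebra.algebraMap_eq_smul_one]
    simp
  rw [hcon, momPi_eq hg he hz, map_add, momP, leftD_algebraMap, map_smul, map_sum]
  simp only [hw, Finset.sum_sub_distrib, Finset.sum_add_distrib]
  have : ∑ B, leftD A (gen B) * frameVelocity e z N B = frameVelocity e z N A := by simp [hgen]
  rw [this]
  module

/-- The kinetic momentum `Π_N - A_{NKL} Ψ^K Ψ^L`. -/
def kinMom (L : Pt n m → ℝ) (e : Pt n m → Matrix (RIdx n m) (RIdx n m) ℝ) (z : Phase n m)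
    (N : RIdx n m) : Gr (RIdx n m) :=
  momPi e z N - gaugeForm (tens3 L z.1) (Pi.single N 1) (fermion e z) (fermion e z)

/-- The derivative of the cubic part supplies both missing pieces: its gauge term completes `Π` to
the kinetic momentum, and its metric term cancels the one from `leftD_momPi`. -/
theorem leftD_superCharge (hU : IsOpen U) (hL : ContDiffOn ℝ ∞ L U)
    (hg : ∀ x ∈ U, (metric L x).PosDef) (he : IsVielbein U (metric L) e) (hz : z.1 ∈ U)
    (a : Fin 4) (A : RIdx n m) :
    leftD A (superCharge L e a z)
      = ∑ N, act (JT a) (dVec A (fermion e z)) N * kinMom L e z N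
        - Complex.I • ∑ N, act (JT a) (fermion e z) N * frameVelocity e z N A := by
  have hΨ := isLin_fermion e z
  rw [superCharge, map_sub, map_smul, half_leftD_cubicForm (isSym3_tens3 hU hL hz) hΨ, map_sum,
    metricForm_eq, ← gaugeForm_eq_sum]
  simp only [(hΨ.act _).leftD_mul, leftD_momPi hU hL hg he hz, kinMom, mul_sub, mul_smul_comm,
    Finset.sum_sub_distrib, ← Finset.smul_sum, dVec_act]
  abel

end Fermions

/-! ### Derivatives of the supercharges along the target -/

section CubicObservables

variable {κ ι : Type} [Fintype κ] [DecidableEq κ] [Fintype ι] [DecidableEq ι]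

/-- If the odd vector moves by `-w_B ∂_B`, then so does an observable that is the sum of a linear
and a cubic form, up to the derivative of the coefficients of the latter. -/
theorem hasGrDeriv_linear_add_cubic {X : ℝ → ι → Gr κ} {w : κ → Gr κ} (hw : IsLin w)
    (hX₀ : IsLin (X 0)) (hX : ∀ M, HasGrDeriv (fun t => X t M) (-∑ B, w B * dVec B (X 0) M))
    (c : ι → ℂ) (J : Matrix ι ι ℂ) {τ : ℝ → ι → ι → ι → ℂ} {τ' : ι → ι → ι → ℂ}
    (hτ : ∀ M N K, HasDerivAt (fun t => τ t M N K) (τ' M N K) 0) :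
    HasGrDeriv (fun t => ∑ N, c N • act J (X t) N + con3 (τ t) (X t) (X t) (X t))
      (con3 τ' (X 0) (X 0) (X 0)
        - ∑ B, w B * leftD B (∑ N, c N • act J (X 0) N + con3 (τ 0) (X 0) (X 0) (X 0))) := by
  have hswap : ∀ B (y : ι → Gr κ), Central y → ∀ M N, X 0 M * (w B * y N)
      = -(w B * (X 0 M * y N)) := by
    intro B y hy M N
    obtain ⟨a, ha⟩ := hw B
    obtain ⟨b, hb⟩ := hX₀ M
    rw [← mul_assoc, ← mul_assoc, ha, hb, ι_mul_ι_swap, neg_mul]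
  have h1 : HasGrDeriv (fun t => ∑ N, c N • act J (X t) N)
      (-∑ B, w B * leftD B (∑ N, c N • act J (X 0) N)) := by
    convert HasGrDeriv.sum_smul c (X := fun t => act J (X t))
      (X' := act J fun M => -∑ B, w B * dVec B (X 0) M)
      (fun N => HasGrDeriv.sum_smul (X := X) _ hX) using 1
    simp only [act_apply, map_sum, map_smul, dVec, Finset.mul_sum, mul_smul_comm, Finset.smul_sum,
      smul_neg, Finset.sum_neg_distrib]
    rw [Finset.sum_comm]
    congr 1
    refine Finset.sum_congr rfl fun N _ => ?_
    rw [Finset.sum_comm]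
  have h3 := HasGrDeriv.con3 hτ hX hX hX
  have e : (fun M => -∑ B, w B * dVec B (X 0) M) = -∑ B, fun M => w B * dVec B (X 0) M := by
    ext M
    simp
  have c1 : ∀ B, con3 (τ 0) (fun M => w B * dVec B (X 0) M) (X 0) (X 0)
      = w B * con3 (τ 0) (dVec B (X 0)) (X 0) (X 0) := fun B => by
    simp only [con3_eq_mul_con2, Finset.mul_sum, mul_assoc]
  -- Taking the odd `w B` out of the second slot passes one odd factor and out of the third slot
  -- two. These are the signs of the Leibniz rule for an odd derivative.
  have c2 : ∀ B, con3 (τ 0) (X 0) (fun M => w B * dVec B (X 0) M) (X 0)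
      = -(w B * con3 (τ 0) (X 0) (dVec B (X 0)) (X 0)) := fun B => by
    simp only [con3_apply, Finset.mul_sum, mul_smul_comm, ← Finset.sum_neg_distrib, ← smul_neg]
    refine Finset.sum_congr rfl fun M _ => Finset.sum_congr rfl fun N _ =>
      Finset.sum_congr rfl fun K _ => ?_
    rw [← mul_assoc, hswap B _ (hX₀.central_dVec B), neg_mul]
    simp only [mul_assoc]
  have c3 : ∀ B, con3 (τ 0) (X 0) (X 0) (fun M => w B * dVec B (X 0) M)
      = w B * con3 (τ 0) (X 0) (X 0) (dVec B (X 0)) := fun B => by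
    simp only [con3_apply, Finset.mul_sum, mul_smul_comm]
    refine Finset.sum_congr rfl fun M _ => Finset.sum_congr rfl fun N _ =>
      Finset.sum_congr rfl fun K _ => ?_
    rw [hswap B _ (hX₀.central_dVec B), mul_neg]
    congr 1
    obtain ⟨a, ha⟩ := hw B
    obtain ⟨b, hb⟩ := hX₀ M
    rw [← mul_assoc, ← mul_assoc, ha, hb, ι_mul_ι_swap]
    simp only [neg_mul, neg_neg, mul_assoc]
  convert h1.add h3 using 1
  simp only [map_add, hX₀.leftD_con3 hX₀, mul_add, mul_sub, Finset.sum_add_distrib, e, map_neg,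
    map_sum, LinearMap.neg_apply, LinearMap.sum_apply, c1, c2, c3, Finset.sum_neg_distrib,
    Finset.sum_sub_distrib]
  abel

theorem IsLin.con3_odd {X Y Z : ι → Gr κ} (hX : IsLin X) (hY : IsLin Y) (hZ : IsLin Z)
    (t : ι → ι → ι → ℂ) (v : κ → ℂ) :
    con3 t X Y Z * ExteriorAlgebra.ι ℂ v = -(ExteriorAlgebra.ι ℂ v * con3 t X Y Z) := by
  simp only [con3_apply, Finset.sum_mul, Finset.mul_sum, smul_mul_assoc, mul_smul_comm,
    ← Finset.sum_neg_distrib, ← smul_neg]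
  refine Finset.sum_congr rfl fun M _ => Finset.sum_congr rfl fun N _ =>
    Finset.sum_congr rfl fun K _ => ?_
  obtain ⟨a, ha⟩ := hX M
  obtain ⟨b, hb⟩ := hY N
  obtain ⟨c, hc⟩ := hZ K
  rw [ha, hb, hc, mul_assoc, ← ι_mul_ι_central b c (ExteriorAlgebra.ι ℂ v), ← mul_assoc,
    ι_mul_ι_swap a v]
  simp only [neg_mul, mul_assoc]

theorem hasDerivAt_line {f : (ι → ℝ) → ℂ} {x : ι → ℝ} (hf : DifferentiableAt ℝ f x) (M : ι) :
    HasDerivAt (fun t : ℝ => f (x + t • Pi.single M 1)) (pd f M x) 0 := by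
  have h1 : HasDerivAt (fun t : ℝ => x + t • (Pi.single M 1 : ι → ℝ)) (Pi.single M 1) 0 := by
    simpa using ((hasDerivAt_id (0 : ℝ)).smul_const (Pi.single M 1 : ι → ℝ)).const_add x
  have h2 : HasFDerivAt f (fderiv ℝ f x) (x + (0 : ℝ) • Pi.single M 1) := by
    simpa using hf.hasFDerivAt
  exact h2.comp_hasDerivAt 0 h1

theorem con3_mul_matrix (J : Matrix ι ι ℂ) (E : ι → ι → ι → ℂ) (X Y Z : ι → Gr κ) :
    con3 (fun S K P => ∑ N, J S N * E N K P) X Y Z = ∑ N, act J X N * con2 (E N) Y Z := by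
  simp only [con3_eq_mul_con2, act_apply, Finset.sum_mul]
  rw [Finset.sum_comm]
  refine Finset.sum_congr rfl fun S _ => ?_
  rw [con2_sum_tensor, Finset.mul_sum]
  simp only [smul_mul_assoc, mul_smul_comm]

end CubicObservables

section TargetDerivatives

variable {n m : ℕ} {L : Pt n m → ℝ} {U : Set (Pt n m)} {z : Phase n m}
variable {e : Pt n m → Matrix (RIdx n m) (RIdx n m) ℝ}

/-- The derivative of the inverse matrix is `-e⁻¹ (∂e) e⁻¹`. At fixed `Ψ^A` the fermions `Ψ^K`
therefore move by the derivation `-w_B ∂_B`, with `w` the frame velocity. -/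
theorem sum_frameVelocity_mul (hU : IsOpen U) (hg : ∀ x ∈ U, (metric L x).PosDef)
    (he : IsVielbein U (metric L) e) (hz : z.1 ∈ U) (M K : RIdx n m) :
    -∑ B, frameVelocity e z M B * dVec B (fermion e z) K
      = ∑ A, ((pd (fun y => (e y)⁻¹ K A) M z.1 : ℝ) : ℂ) • gen A := by
  have hB : ∀ B, frameVelocity e z M B * dVec B (fermion e z) K
      = ∑ A, (((e z.1)⁻¹ K B * ∑ S, pd (fun y => e y B S) M z.1 * (e z.1)⁻¹ S A : ℝ) : ℂ)
        • gen A := by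
    intro B
    rw [dVec_fermion, ← Algebra.commutes, ← Algebra.smul_def, frameVelocity, Finset.smul_sum]
    simp only [fermion, Finset.smul_sum, smul_smul, Complex.ofReal_mul, Complex.ofReal_sum,
      Finset.mul_sum, Finset.sum_smul]
    exact Finset.sum_comm
  simp only [hB, he.pd_inv hU hg hz, Complex.ofReal_neg, neg_smul, Finset.sum_neg_distrib,
    Complex.ofReal_sum, Finset.sum_smul]
  rw [Finset.sum_comm]

theorem hasDerivAt_ofReal_line {f : Pt n m → ℝ} {x : Pt n m} (hf : DifferentiableAt ℝ f x)
    (M : RIdx n m) :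
    HasDerivAt (fun t : ℝ => (f (x + t • Pi.single M 1) : ℂ)) ((pd f M x : ℝ) : ℂ) 0 := by
  rw [← pd_ofReal hf]
  exact hasDerivAt_line (f := fun y => (f y : ℂ)) (Complex.ofRealCLM.differentiableAt.comp _ hf) M

theorem hasGrDeriv_fermion (hU : IsOpen U) (hg : ∀ x ∈ U, (metric L x).PosDef)
    (he : IsVielbein U (metric L) e) (hz : z.1 ∈ U) (M K : RIdx n m) :
    HasGrDeriv (fun t => fermion e (z.1 + t • Pi.single M 1, z.2) K)
      (-∑ B, frameVelocity e z M B * dVec B (fermion e z) K) := by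
  have h := HasGrDeriv.sum Finset.univ fun A _ => (hasGrDeriv_const (gen A)).smul
    (hasDerivAt_ofReal_line (differentiableAt_of_contDiffOn hU (he.contDiffOn_inv hg K A) hz) M)
  simp only [smul_zero, add_zero] at h
  rw [sum_frameVelocity_mul hU hg he hz]
  exact h

/-- The coefficients of the part of a supercharge that is cubic in the fermions. -/
def cubicTensor (L : Pt n m → ℝ) (e : Pt n m → Matrix (RIdx n m) (RIdx n m) ℝ) (a : Fin 4)
    (x : Pt n m) (S K P : RIdx n m) : ℂ :=
  (Complex.I / 2) * ∑ N, JT a S N * ∑ A, (e x A K : ℂ) * ((pd (fun y => e y A P) N x : ℝ) : ℂ)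
    - (1 / 2) * cubicForm (tens3 L x) a (Pi.single S (1 : ℂ)) (Pi.single K (1 : ℂ))
      (Pi.single P (1 : ℂ))

theorem superCharge_eq (L : Pt n m → ℝ) (e : Pt n m → Matrix (RIdx n m) (RIdx n m) ℝ) (a : Fin 4)
    (z : Phase n m) :
    superCharge L e a z = ∑ N, (z.2 N : ℂ) • act (JT a) (fermion e z) N
      + con3 (cubicTensor L e a z.1) (fermion e z) (fermion e z) (fermion e z) := by
  unfold cubicTensor
  rw [con3_sub_tensor, con3_smul_tensor, con3_smul_tensor, con3_mul_matrix, con3_cubicForm_single]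
  simp only [superCharge, momPi, momP, mul_add, mul_smul_comm, Finset.sum_add_distrib,
    ← Finset.smul_sum, Algebra.algebraMap_eq_smul_one, mul_one, Complex.ofReal_sum,
    Complex.ofReal_mul, con2_apply]
  abel

theorem rightD_superCharge (L : Pt n m → ℝ) (e : Pt n m → Matrix (RIdx n m) (RIdx n m) ℝ)
    (a : Fin 4) (z : Phase n m) (A : RIdx n m) :
    rightD A (superCharge L e a z) = leftD A (superCharge L e a z) := by
  have hΨ := isLin_fermion e z
  rw [superCharge_eq, map_add, ← rightDLin_apply, map_add, rightDLin_apply A (con3 _ _ _ _),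
    hΨ.rightD_con3 hΨ hΨ, map_sum, map_sum]
  congr 1
  refine Finset.sum_congr rfl fun N _ => ?_
  obtain ⟨v, hv⟩ := hΨ.act (JT a) N
  rw [hv, map_smul, map_smul, rightDLin_apply, rightD_ι, leftD_ι]

theorem dP_superCharge (L : Pt n m → ℝ) (e : Pt n m → Matrix (RIdx n m) (RIdx n m) ℝ)
    (a : Fin 4) (z : Phase n m) (M : RIdx n m) :
    dP (superCharge L e a) M z = act (JT a) (fermion e z) M := by
  refine HasGrDeriv.grDeriv ?_
  have hf : ∀ t : ℝ, fermion e (z.1, z.2 + t • Pi.single M 1) = fermion e z := fun _ => rfl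
  simp only [superCharge_eq, hf]
  have hc : ∀ N, HasDerivAt (fun t : ℝ => (((z.2 + t • (Pi.single M 1 : Pt n m)) N : ℝ) : ℂ))
      (((Pi.single M 1 : Pt n m) N : ℝ) : ℂ) 0 := fun N => by
    have := ((hasDerivAt_id (0 : ℝ)).mul_const ((Pi.single M 1 : Pt n m) N)).const_add (z.2 N)
    simpa using this.ofReal_comp
  have h := (HasGrDeriv.sum Finset.univ fun N _ =>
    (hasGrDeriv_const (act (JT a) (fermion e z) N)).smul (hc N)).add
      (hasGrDeriv_const (con3 (cubicTensor L e a z.1) (fermion e z) (fermion e z) (fermion e z)))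
  convert h using 1
  simp only [smul_zero, add_zero]
  rw [Finset.sum_eq_single M (fun N _ hN => by simp [hN]) (by simp)]
  simp

theorem hasDerivAt_cubicForm {T : ℝ → RIdx n m → RIdx n m → RIdx n m → ℂ}
    {T' : RIdx n m → RIdx n m → RIdx n m → ℂ}
    (hT : ∀ M N K, HasDerivAt (fun t => T t M N K) (T' M N K) 0)
    (a : Fin 4) (X Y Z : RIdx n m → ℂ) :
    HasDerivAt (fun t => cubicForm (T t) a X Y Z) (cubicForm T' a X Y Z) 0 := by
  have h : ∀ X Y Z : RIdx n m → ℂ, HasDerivAt (fun t => con3 (T t) X Y Z) (con3 T' X Y Z) 0 := by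
    intro X Y Z
    simp only [con3_apply, smul_eq_mul]
    exact HasDerivAt.fun_sum fun M _ => HasDerivAt.fun_sum fun N _ => HasDerivAt.fun_sum fun K _ =>
      (hT M N K).mul_const _
  simp only [cubicForm, smul_eq_mul]
  exact (((h _ _ _).const_mul _).fun_add ((((h _ _ _).fun_add (h _ _ _)).fun_add (h _ _ _)).fun_add
    (h _ _ _))).const_mul (Complex.I / 2)

/-- `e^A_K (∂_M ∂_N e^A_P) Ψ^K Ψ^P`. -/
def frameAcceleration (e : Pt n m → Matrix (RIdx n m) (RIdx n m) ℝ) (z : Phase n m)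
    (M N : RIdx n m) : Gr (RIdx n m) :=
  ∑ A, gen A * ∑ P, ((pd (fun y => pd (fun y => e y A P) N y) M z.1 : ℝ) : ℂ) • fermion e z P

/-- The motion of the fermions acts on the whole charge as the derivation `-w_B ∂_B`. The explicit
dependence of the cubic coefficients on the point adds the derivatives of the frame and, from
`cubicForm`, the fourth derivatives of `L`. -/
theorem dX_superCharge (hU : IsOpen U) (hL : ContDiffOn ℝ ∞ L U)
    (hg : ∀ x ∈ U, (metric L x).PosDef) (he : IsVielbein U (metric L) e) (hz : z.1 ∈ U)
    (a : Fin 4) (M : RIdx n m) :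
    HasGrDeriv (fun t => superCharge L e a (z.1 + t • Pi.single M 1, z.2))
      ((Complex.I / 2) • ∑ N, act (JT a) (fermion e z) N *
          (∑ A, frameVelocity e z M A * frameVelocity e z N A + frameAcceleration e z M N)
        - (1 / 2 : ℂ) • cubicForm (tens4 L z.1 M) a (fermion e z) (fermion e z) (fermion e z)
        - ∑ B, frameVelocity e z M B * leftD B (superCharge L e a z)) := by
  have hde : ∀ A K, DifferentiableAt ℝ (fun y => e y A K) z.1 := fun A K =>
    differentiableAt_of_contDiffOn hU (he.smooth A K) hz
  have hdde : ∀ A K N, DifferentiableAt ℝ (fun y => pd (fun y => e y A K) N y) z.1 := fun A K N =>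
    differentiableAt_of_contDiffOn hU (contDiffOn_pd hU (he.smooth A K) N) hz
  have hz0 : z.1 + (0 : ℝ) • (Pi.single M 1 : Pt n m) = z.1 := by simp
  have hτ : ∀ S K P, HasDerivAt (fun t : ℝ => cubicTensor L e a (z.1 + t • Pi.single M 1) S K P)
      ((Complex.I / 2) * ∑ N, JT a S N * ∑ A,
          (((pd (fun y => e y A K) M z.1 : ℝ) : ℂ) * ((pd (fun y => e y A P) N z.1 : ℝ) : ℂ)
            + (e z.1 A K : ℂ) * ((pd (fun y => pd (fun y => e y A P) N y) M z.1 : ℝ) : ℂ))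
        - (1 / 2) * cubicForm (tens4 L z.1 M) a (Pi.single S (1 : ℂ)) (Pi.single K (1 : ℂ))
          (Pi.single P (1 : ℂ))) 0 := by
    intro S K P
    refine HasDerivAt.sub (HasDerivAt.const_mul _ (HasDerivAt.fun_sum fun N _ =>
      HasDerivAt.const_mul _ (HasDerivAt.fun_sum fun A _ => ?_)))
      (HasDerivAt.const_mul _ (hasDerivAt_cubicForm (fun N K P => ?_) a _ _ _))
    · simpa [hz0] using (hasDerivAt_ofReal_line (hde A K) M).fun_mul
        (hasDerivAt_ofReal_line (hdde A P N) M)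
    · rw [← pd_tens3 hU hL hz]
      exact hasDerivAt_line (differentiableAt_of_contDiffOn hU (contDiffOn_tens3 hU hL N K P) hz) M
  have hX := hasGrDeriv_fermion hU hg he hz M
  have h0 : fermion e (z.1 + (0 : ℝ) • Pi.single M 1, z.2) = fermion e z := by rw [hz0]
  have h := hasGrDeriv_linear_add_cubic (X := fun t => fermion e (z.1 + t • Pi.single M 1, z.2))
    (w := frameVelocity e z M) (fun A => isLin_frameVelocity (e := e) (z := z) A M)
    (by rw [h0]; exact isLin_fermion e z) (by rw [h0]; exact hX) (fun N => (z.2 N : ℂ)) (JT a) hτ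
  simp only [h0, hz0] at h
  simp only [superCharge_eq]
  convert h using 1
  congr 1
  rw [con3_sub_tensor, con3_smul_tensor, con3_smul_tensor, con3_cubicForm_single, con3_mul_matrix]
  congr 2
  refine Finset.sum_congr rfl fun N _ => ?_
  congr 1
  simp only [Finset.sum_add_distrib]
  rw [con2_add_tensor, con2_sum_outer, con2_sum_outer]
  simp only [sum_vielbein_fermion hg he hz]
  rfl

end TargetDerivatives

/-! ### The supersymmetry algebra -/

section Algebra

variable {n m : ℕ} {L : Pt n m → ℝ} {U : Set (Pt n m)} {z : Phase n m}
variable {e : Pt n m → Matrix (RIdx n m) (RIdx n m) ℝ}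

/-- The coefficients `A_{MNK}` of the Lagrangian. -/
def gaugeCoeff (L : Pt n m → ℝ) (x : Pt n m) (M N K : RIdx n m) : ℂ :=
  gaugeForm (tens3 L x) (Pi.single M (1 : ℂ)) (Pi.single N (1 : ℂ)) (Pi.single K (1 : ℂ))

/-- The coefficients `F_{MNKL}` of the Lagrangian. -/
def quarticCoeff (L : Pt n m → ℝ) (x : Pt n m) (M N K P : RIdx n m) : ℂ :=
  -(1 / 4) * con4 (tens4 L x) (JT 0 M) (JT 1 N) (JT 2 K) (JT 3 P)

theorem con3_gaugeCoeff {G : Type} [Ring G] [_root_.Algebra ℂ G] (x : Pt n m)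
    (X Y Z : RIdx n m → G) : con3 (gaugeCoeff L x) X Y Z = gaugeForm (tens3 L x) X Y Z := by
  unfold gaugeCoeff
  simp only [gaugeForm, act_single, con3_act, smul_eq_mul, con3_smul_tensor, con3_add_tensor,
    con3_sub_tensor]

theorem con2_gaugeCoeff {G : Type} [Ring G] [_root_.Algebra ℂ G] (x : Pt n m) (M : RIdx n m)
    (Y Z : RIdx n m → G) :
    con2 (gaugeCoeff L x M) Y Z = gaugeForm (tens3 L x) (Pi.single M 1) Y Z := by
  rw [← con3_gaugeCoeff, con3_eq_mul_con2, Finset.sum_eq_single M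
    (fun N _ hN => by simp [hN]) (by simp)]
  simp

theorem con4_quarticCoeff {G : Type} [Ring G] [_root_.Algebra ℂ G] (x : Pt n m)
    (X Y Z W : RIdx n m → G) : con4 (quarticCoeff L x) X Y Z W
      = -(1 / 4 : ℂ) • con4 (tens4 L x) (act (JT 0) X) (act (JT 1) Y) (act (JT 2) Z)
        (act (JT 3) W) := by
  rw [con4_apply, con4_act, con4_apply]
  simp only [Finset.smul_sum, smul_smul]
  rfl

theorem hamiltonian_eq (L : Pt n m → ℝ) (e : Pt n m → Matrix (RIdx n m) (RIdx n m) ℝ)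
    (z : Phase n m) :
    hamiltonian (metric L) (gaugeCoeff L) (quarticCoeff L) e z
      = (1 / 2 : ℂ) • con2 (fun M N => ((metric L z.1)⁻¹ M N : ℂ)) (kinMom L e z) (kinMom L e z)
        - (1 / 4 : ℂ) • con4 (tens4 L z.1) (act (JT 0) (fermion e z)) (act (JT 1) (fermion e z))
          (act (JT 2) (fermion e z)) (act (JT 3) (fermion e z)) := by
  rw [sub_eq_add_neg, ← neg_smul, ← con4_quarticCoeff, con4_apply]
  have hkin : kinMom L e z = fun M => momPi e z M
      - con2 (gaugeCoeff L z.1 M) (fermion e z) (fermion e z) := by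
    ext M
    rw [kinMom, con2_gaugeCoeff]
  simp only [hamiltonian, mul_assoc, hkin]
  rfl

theorem frameAcceleration_comm (hU : IsOpen U) (he : IsVielbein U (metric L) e) (hz : z.1 ∈ U)
    (M N : RIdx n m) : frameAcceleration e z M N = frameAcceleration e z N M := by
  simp only [frameAcceleration, pd_comm hU (he.smooth _ _) hz M N]

theorem frameAcceleration_central (M N : RIdx n m) (y : Gr (RIdx n m)) :
    frameAcceleration e z M N * y = y * frameAcceleration e z M N := by
  rw [frameAcceleration, Finset.sum_mul, Finset.mul_sum]
  refine Finset.sum_congr rfl fun A _ => ?_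
  obtain ⟨v, hv⟩ := (isLin_fermion e z).sum_smul
    (fun P => ((pd (fun y => pd (fun y => e y A P) N y) M z.1 : ℝ) : ℂ))
  rw [hv, gen_eq, ι_mul_ι_central]

theorem con2_central {κ ι : Type} [Fintype κ] [DecidableEq κ] [Fintype ι] {X Y : ι → Gr κ}
    (hX : IsLin X) (hY : IsLin Y) (t : ι → ι → ℂ) (y : Gr κ) : con2 t X Y * y = y * con2 t X Y := by
  simp only [con2_apply, Finset.sum_mul, Finset.mul_sum, smul_mul_assoc, mul_smul_comm]
  refine Finset.sum_congr rfl fun M _ => Finset.sum_congr rfl fun N _ => ?_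
  obtain ⟨v, hv⟩ := hX M
  obtain ⟨w, hw⟩ := hY N
  rw [hv, hw, ι_mul_ι_central]

theorem kinMom_central : Central (kinMom L e z) := fun M y => by
  have hΨ := isLin_fermion e z
  rw [kinMom, ← con2_gaugeCoeff, sub_mul, mul_sub, con2_central hΨ hΨ, momPi, momP, add_mul,
    mul_add, Algebra.commutes, smul_mul_assoc, mul_smul_comm]
  congr 3
  exact con2_central hΨ hΨ _ y

theorem IsLin.cubicForm_odd {κ : Type} [Fintype κ] [DecidableEq κ] {Ψ : RIdx n m → Gr κ}
    (hΨ : IsLin Ψ) (T : RIdx n m → RIdx n m → RIdx n m → ℂ) (a : Fin 4) (v : κ → ℂ) :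
    cubicForm T a Ψ Ψ Ψ * ExteriorAlgebra.ι ℂ v
      = -(ExteriorAlgebra.ι ℂ v * cubicForm T a Ψ Ψ Ψ) := by
  simp only [cubicForm, smul_mul_assoc, mul_smul_comm, add_mul, mul_add,
    (hΨ.act _).con3_odd (hΨ.act _) (hΨ.act _)]
  module

/-- The inverse metric in the frame of the kinetic momenta rotated by `J_a` and `J_b`. -/
theorem rotated_inverse_metric (hU : IsOpen U) (hL : ContDiffOn ℝ ∞ L U)
    (hg : ∀ x ∈ U, (metric L x).PosDef) {x : Pt n m} (hx : x ∈ U) (a b : Fin 4) :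
    (JT a).transpose * ((metric L x)⁻¹).map (fun r : ℝ => (r : ℂ)) * JT b
      + (JT b).transpose * ((metric L x)⁻¹).map (fun r : ℝ => (r : ℂ)) * JT a
      = if a = b then (2 : ℂ) • ((metric L x)⁻¹).map (fun r : ℝ => (r : ℂ)) else 0 := by
  set γ : Matrix (RIdx n m) (RIdx n m) ℂ := ((metric L x)⁻¹).map (fun r : ℝ => (r : ℂ)) with hγ
  have hdet : IsUnit (metric L x).det := isUnit_iff_ne_zero.2 (hg x hx).det_pos.ne'
  -- Antisymmetry of `I^p` with respect to `g` passes to the inverse metric. The symmetrized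
  -- products below then reduce to the Clifford relations.
  have hJ : ∀ p : Fin 3, (JT p.succ).transpose * γ = -(γ * JT p.succ) := by
    intro p
    have h1 : cliffordTriple p x * metric L x = -(metric L x * (cliffordTriple p x).transpose) := by
      ext M N
      have := lowered_antisymm hU hL hx p M N
      simp only [lowered] at this
      rw [Matrix.neg_apply, Matrix.mul_apply, Matrix.mul_apply, this]
      congr 1
      exact Finset.sum_congr rfl fun K _ => by
        rw [Matrix.transpose_apply, metric_symm hU hL hx, mul_comm]
    have h2 : (cliffordTriple p x).transpose * (metric L x)⁻¹
        = -((metric L x)⁻¹ * cliffordTriple p x) := by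
      calc (cliffordTriple p x).transpose * (metric L x)⁻¹
          = (metric L x)⁻¹ * (metric L x * (cliffordTriple p x).transpose) * (metric L x)⁻¹ := by
            rw [← mul_assoc, Matrix.nonsing_inv_mul _ hdet, one_mul]
        _ = _ := by
            rw [← neg_neg (metric L x * _), ← h1, mul_neg, neg_mul, mul_assoc, mul_assoc,
              Matrix.mul_nonsing_inv _ hdet, mul_one]
    have h3 := congrArg (fun A : Matrix (RIdx n m) (RIdx n m) ℝ => Complex.ofRealHom.mapMatrix A) h2
    simp only [map_mul, map_neg] at h3
    rw [JT_succ p x, hγ]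
    exact h3
  have h0 : (JT 0 : Matrix (RIdx n m) (RIdx n m) ℂ).transpose = 1 := by
    rw [JT_zero, Matrix.transpose_one]
  refine Fin.cases ?_ (fun p => ?_) a <;> refine Fin.cases ?_ (fun q => ?_) b
  · rw [h0, JT_zero, if_pos rfl, one_mul, mul_one, two_smul]
  · rw [h0, JT_zero, if_neg (Fin.succ_ne_zero q).symm, one_mul, mul_one, hJ, add_neg_cancel]
  · rw [h0, JT_zero, if_neg (Fin.succ_ne_zero p), one_mul, mul_one, hJ, neg_add_cancel]
  · rw [hJ, hJ, neg_mul, neg_mul, mul_assoc, mul_assoc, ← neg_add, ← mul_add, JT_anticomm]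
    simp only [Fin.succ_inj]
    split_ifs
    · rw [mul_smul_comm, mul_one, neg_smul, neg_neg]
    · rw [mul_zero, neg_zero]

theorem con2_mul_transpose {G ι : Type} [Ring G] [_root_.Algebra ℂ G] [Fintype ι]
    (P Q : Matrix ι ι ℂ) (X Y : ι → G) :
    con2 (fun M N => (P * Q.transpose) M N) X Y = ∑ A, (∑ N, P N A • X N) * ∑ N, Q N A • Y N := by
  rw [← con2_sum_outer (fun A N => P N A) fun A N => Q N A]
  simp only [con2_apply, Matrix.mul_apply, Matrix.transpose_apply]

/-- Summing over the flat index turns `e⁻¹ (e⁻¹)ᵀ` into the inverse metric, rotated by `J_a` and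
`J_b`. The kinetic momenta commute, so only the part symmetric in `a` and `b` is seen, and
`rotated_inverse_metric` evaluates it. -/
theorem sum_kinetic (hU : IsOpen U) (hL : ContDiffOn ℝ ∞ L U)
    (hg : ∀ x ∈ U, (metric L x).PosDef) (he : IsVielbein U (metric L) e) (hz : z.1 ∈ U)
    (a b : Fin 4) :
    ∑ A, (∑ N, act (JT a) (dVec A (fermion e z)) N * kinMom L e z N)
        * (∑ N, act (JT b) (dVec A (fermion e z)) N * kinMom L e z N)
      = if a = b then con2 (fun M N => ((metric L z.1)⁻¹ M N : ℂ)) (kinMom L e z) (kinMom L e z)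
        else 0 := by
  set γ : Matrix (RIdx n m) (RIdx n m) ℂ := ((metric L z.1)⁻¹).map (fun r : ℝ => (r : ℂ)) with hγ
  set ε : Matrix (RIdx n m) (RIdx n m) ℂ := ((e z.1)⁻¹).map (fun r : ℝ => (r : ℂ)) with hε
  have hinv : ε * ε.transpose = γ := by
    have h : (e z.1)⁻¹ * ((e z.1)⁻¹).transpose = (metric L z.1)⁻¹ := by
      rw [← he.orthonormal z.1 hz, Matrix.mul_inv_rev, Matrix.transpose_nonsing_inv]
    have h3 := congrArg (fun A : Matrix (RIdx n m) (RIdx n m) ℝ => Complex.ofRealHom.mapMatrix A) h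
    simp only [map_mul] at h3
    exact h3
  have hc : ∀ (a : Fin 4) A N, act (JT a) (dVec A (fermion e z)) N * kinMom L e z N
      = ((JT a : Matrix (RIdx n m) (RIdx n m) ℂ).transpose * ε) N A • kinMom L e z N := by
    intro a A N
    simp only [act_apply, dVec_fermion, Matrix.mul_apply, Matrix.transpose_apply, Finset.sum_mul,
      Finset.sum_smul, smul_mul_assoc, mul_smul]
    exact Finset.sum_congr rfl fun S _ => by rw [← Algebra.smul_def]; rfl
  have key : ∀ a b : Fin 4, ∑ A, (∑ N, act (JT a) (dVec A (fermion e z)) N * kinMom L e z N)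
        * (∑ N, act (JT b) (dVec A (fermion e z)) N * kinMom L e z N)
      = con2 (fun M N => ((JT a).transpose * γ * JT b : Matrix (RIdx n m) (RIdx n m) ℂ) M N)
          (kinMom L e z) (kinMom L e z) := by
    intro a b
    simp only [hc]
    rw [← con2_mul_transpose, Matrix.transpose_mul, Matrix.transpose_transpose, ← hinv]
    simp only [mul_assoc]
  have hsymm : ∑ A, (∑ N, act (JT a) (dVec A (fermion e z)) N * kinMom L e z N)
        * (∑ N, act (JT b) (dVec A (fermion e z)) N * kinMom L e z N)
      = ∑ A, (∑ N, act (JT b) (dVec A (fermion e z)) N * kinMom L e z N)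
        * (∑ N, act (JT a) (dVec A (fermion e z)) N * kinMom L e z N) := by
    refine Finset.sum_congr rfl fun A _ => ?_
    simp only [hc, Finset.sum_mul_sum, smul_mul_smul_comm]
    rw [Finset.sum_comm]
    refine Finset.sum_congr rfl fun M _ => Finset.sum_congr rfl fun N _ => ?_
    rw [kinMom_central, mul_comm]
  have hadd := congrArg
    (fun t : Matrix (RIdx n m) (RIdx n m) ℂ =>
      con2 (fun M N => t M N) (kinMom L e z) (kinMom L e z))
    (rotated_inverse_metric hU hL hg hz a b)
  have h2 : (2 : ℂ) • ∑ A, (∑ N, act (JT a) (dVec A (fermion e z)) N * kinMom L e z N)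
        * (∑ N, act (JT b) (dVec A (fermion e z)) N * kinMom L e z N)
      = con2 (fun M N => ((JT a).transpose * γ * JT b : Matrix (RIdx n m) (RIdx n m) ℂ) M N)
          (kinMom L e z) (kinMom L e z)
        + con2 (fun M N => ((JT b).transpose * γ * JT a : Matrix (RIdx n m) (RIdx n m) ℂ) M N)
          (kinMom L e z) (kinMom L e z) := by
    rw [two_smul, ← key a b, ← key b a, hsymm]
  rw [← con2_add_tensor] at h2
  have h3 := h2.trans hadd
  -- The symmetrization counted the sum twice; the factor `2` is cancelled.
  refine smul_right_injective _ (two_ne_zero : (2 : ℂ) ≠ 0) (h3.trans ?_)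
  split_ifs
  · exact con2_smul_tensor 2 γ (kinMom L e z) (kinMom L e z)
  · simp only [con2_apply, Matrix.zero_apply, zero_smul, Finset.sum_const_zero, smul_zero]

/-- The supersymmetry algebra. -/
theorem bracket_realCharges (hU : IsOpen U) (hL : ContDiffOn ℝ ∞ L U)
    (hg : ∀ x ∈ U, (metric L x).PosDef) (he : IsVielbein U (metric L) e) (hz : z.1 ∈ U)
    (a b : Fin 4) :
    bracket (realCharges L e (torsion L) (holTorsion L) a)
        (realCharges L e (torsion L) (holTorsion L) b) z
      = if a = b then
          (-2 * Complex.I) • hamiltonian (metric L) (gaugeCoeff L) (quarticCoeff L) e z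
        else 0 := by
  have hΨ := isLin_fermion e z
  have hdX : ∀ a M, dX (realCharges L e (torsion L) (holTorsion L) a) M z = _ := fun a M =>
    -- The reduced form of the charge is available only over `U`. Since `U` is open it holds along a
    -- short piece of the coordinate line, which suffices for a derivative at `0`.
    ((dX_superCharge hU hL hg he hz a M).congr (by
      have hc : Continuous fun t : ℝ => z.1 + t • (Pi.single M 1 : Pt n m) := by fun_prop
      have h0 : z.1 + (0 : ℝ) • (Pi.single M 1 : Pt n m) ∈ U := by simpa using hz
      filter_upwards [hc.continuousAt.eventually_mem (hU.mem_nhds h0)] with t ht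
      exact realCharges_eq hU hL hg he (z := (z.1 + t • Pi.single M 1, z.2)) ht a)).grDeriv
  have hdP : ∀ a M, dP (realCharges L e (torsion L) (holTorsion L) a) M z
      = act (JT a) (fermion e z) M := fun a M => by
    rw [← dP_superCharge L e a z M, dP, dP]
    congr 1
    ext t
    exact realCharges_eq hU hL hg he (z := (z.1, z.2 + t • Pi.single M 1)) hz a
  rw [bracket]
  simp only [hdX, hdP, realCharges_eq hU hL hg he hz, rightD_superCharge,
    leftD_superCharge hU hL hg he hz]
  -- Here `Y` and `Y'` are the rotated fermions, `w` and `h` the first and second derivatives of the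
  -- frame, `u` the frame components of the kinetic momentum and `s` the cubic form in fourth
  -- derivatives.
  rw [bracket_sum (hΨ.act _) (hΨ.act _) isLin_frameVelocity
    (frameAcceleration_comm hU he hz) frameAcceleration_central
    (fun A y => ?_) (fun M v => hΨ.cubicForm_odd _ _ v), sum_kinetic hU hL hg he hz,
    add_comm (∑ M, _ * _), cubicForm_anticomm (isSym4_tens4 hU hL hz) (hΨ.antiComm hΨ)]
  · split_ifs
    · rw [hamiltonian_eq]
      -- The coefficients `-i` and `i / 2` of the two surviving terms are `-2i` times `1 / 2` and
      -- `-1 / 4`.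
      simp only [smul_sub, smul_smul]
      rw [sub_eq_add_neg, ← neg_smul]
      congr 2 <;> ring
    · simp
  · rw [Finset.sum_mul, Finset.mul_sum]
    refine Finset.sum_congr rfl fun N _ => ?_
    rw [mul_assoc, kinMom_central, ← mul_assoc, ((hΨ.central_dVec A).act _), mul_assoc]

end Algebra

/-! ### The graded Leibniz rule -/

section GradedLeibniz

variable {κ ι : Type} [Fintype κ] [DecidableEq κ] [Fintype ι] [DecidableEq ι]

/-- The parity involution of the Grassmann algebra. -/
def parity : Gr κ →ₐ[ℂ] Gr κ := CliffordAlgebra.involute (Q := (0 : QuadraticForm ℂ (κ → ℂ)))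

theorem parity_ι (v : κ → ℂ) : parity (ExteriorAlgebra.ι ℂ v) = -ExteriorAlgebra.ι ℂ v :=
  CliffordAlgebra.involute_ι (Q := (0 : QuadraticForm ℂ (κ → ℂ))) v

theorem gr_induction {P : Gr κ → Prop} (h₀ : ∀ r : ℂ, P (algebraMap ℂ _ r))
    (h₁ : ∀ x y, P x → P y → P (x + y)) (h₂ : ∀ x v, P x → P (ExteriorAlgebra.ι ℂ v * x))
    (x : Gr κ) :
    P x :=
  CliffordAlgebra.left_induction (Q := (0 : QuadraticForm ℂ (κ → ℂ))) h₀ h₁ h₂ x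

theorem mul_ι_eq (x : Gr κ) (v : κ → ℂ) :
    ExteriorAlgebra.ι ℂ v * x = parity x * ExteriorAlgebra.ι ℂ v := by
  induction x using gr_induction with
  | h₀ r =>
    rw [AlgHom.commutes, Algebra.commutes]
  | h₁ x y hx hy =>
    rw [mul_add, hx, hy, map_add, add_mul]
  | h₂ x w hx =>
    rw [← mul_assoc, ι_mul_ι_swap, neg_mul, mul_assoc, hx, map_mul, parity_ι, neg_mul, neg_mul,
      mul_assoc]

theorem leftD_mul (k : κ) (x y : Gr κ) :
    leftD k (x * y) = leftD k x * y + parity x * leftD k y := by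
  induction x using gr_induction with
  | h₀ r =>
    rw [leftD_algebraMap, zero_mul, zero_add, AlgHom.commutes, ← Algebra.smul_def, map_smul,
      ← Algebra.smul_def]
  | h₁ x x' hx hx' =>
    rw [add_mul, map_add, hx, hx', map_add, map_add, add_mul, add_mul]
    abel
  | h₂ x v hx =>
    rw [mul_assoc, leftD_ι_mul, hx, leftD_ι_mul, map_mul, parity_ι, mul_add, sub_mul,
      smul_mul_assoc, neg_mul, neg_mul, mul_assoc, mul_assoc]
    abel

theorem parity_leftD (k : κ) (x : Gr κ) : parity (leftD k x) = -leftD k (parity x) := by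
  induction x using gr_induction with
  | h₀ r =>
    rw [AlgHom.commutes, leftD_algebraMap, map_zero, neg_zero]
  | h₁ x y hx hy =>
    rw [map_add, map_add, hx, hy, map_add, map_add, neg_add]
  | h₂ x v hx =>
    rw [leftD_ι_mul, map_sub, map_smul, map_mul, parity_ι, hx, map_mul, parity_ι, neg_mul, neg_mul,
      map_neg, leftD_ι_mul, mul_neg]
    abel

theorem leftD_anticomm (j k : κ) (x : Gr κ) : leftD j (leftD k x) = -leftD k (leftD j x) :=
  CliffordAlgebra.contractLeft_comm (Q := (0 : QuadraticForm ℂ (κ → ℂ))) (LinearMap.proj j)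
    (LinearMap.proj k) x

/-- The components of `X` are even. -/
def IsEven (X : ι → Gr κ) : Prop := ∀ M, parity (X M) = X M

/-- The components of `X` are odd. -/
def IsOdd (X : ι → Gr κ) : Prop := ∀ M, parity (X M) = -X M

theorem IsEven.central {X : ι → Gr κ} (hX : IsEven X) : Central X := fun M y =>
  (mul_comm_of_ι (fun v => by rw [mul_ι_eq, hX]) y).symm

section Contractions

variable {X Y Z W : ι → Gr κ} (k : κ)

theorem IsEven.leftD_con2 (hX : IsEven X) (t : ι → ι → ℂ) :
    leftD k (con2 t X Y) = con2 t (BiHKT.dVec k X) Y + con2 t X (BiHKT.dVec k Y) := by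
  simp only [con2_apply, map_sum, map_smul, leftD_mul, hX _, smul_add, Finset.sum_add_distrib]
  rfl

theorem IsEven.sum_leftD (hX : IsEven X) (r : ι → Gr κ) :
    leftD k (∑ M, X M * r M) = ∑ M, BiHKT.dVec k X M * r M + ∑ M, X M * leftD k (r M) := by
  simp only [map_sum, leftD_mul, hX _, Finset.sum_add_distrib]
  rfl

end Contractions

end GradedLeibniz

/-! ### Setting generators to zero -/

section Restriction

variable {κ ι : Type} [Fintype κ] [DecidableEq κ] [Fintype ι] [DecidableEq ι]

/-- The homomorphism of the Grassmann algebra that sets one generator to zero. -/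
def setZero (k : κ) : Gr κ →ₐ[ℂ] Gr κ :=
  ExteriorAlgebra.map (LinearMap.id - (LinearMap.single ℂ (fun _ => ℂ) k) ∘ₗ LinearMap.proj k)

theorem setZero_ι (k : κ) (v : κ → ℂ) :
    setZero k (ExteriorAlgebra.ι ℂ v) = ExteriorAlgebra.ι ℂ v - v k • gen k := by
  rw [setZero, ExteriorAlgebra.map_apply_ι, gen_eq, ← map_smul, ← map_sub]
  congr 1
  ext j
  simp [Pi.single_apply]

theorem setZero_gen_self (k : κ) : setZero k (gen k) = 0 := by
  rw [gen_eq, setZero_ι, gen_eq, Pi.single_eq_same, one_smul, sub_self]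

theorem setZero_gen_of_ne {j k : κ} (h : j ≠ k) : setZero k (gen j) = gen j := by
  rw [gen_eq, setZero_ι, Pi.single_eq_of_ne h.symm, zero_smul, sub_zero]

/-- Taylor's formula in one odd variable. -/
theorem setZero_add (k : κ) (x : Gr κ) : setZero k x + gen k * leftD k x = x := by
  induction x using gr_induction with
  | h₀ r =>
    rw [AlgHom.commutes, leftD_algebraMap, mul_zero, add_zero]
  | h₁ x y hx hy =>
    rw [map_add, map_add, mul_add, add_add_add_comm, hx, hy]
  | h₂ x v hx =>
    have hgg : (gen k * gen k : Gr κ) = 0 := ExteriorAlgebra.ι_sq_zero _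
    have h := eq_sub_of_add_eq hx
    rw [map_mul, setZero_ι, h, leftD_ι_mul]
    simp only [sub_mul, mul_sub, smul_mul_assoc, mul_smul_comm]
    rw [← mul_assoc (gen k) (gen k), hgg, zero_mul, ← mul_assoc (gen k) (ExteriorAlgebra.ι ℂ v),
      gen_eq, ι_mul_ι_swap, neg_mul, mul_assoc, smul_zero]
    abel

theorem setZero_eq_self {k : κ} {x : Gr κ} (h : leftD k x = 0) : setZero k x = x := by
  have := setZero_add k x
  rwa [h, mul_zero, add_zero] at this

end Restriction

/-! ### The chain rule for a Taylor polynomial of even elements -/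

section TaylorPolynomial

variable {κ ι : Type} [Fintype κ] [DecidableEq κ] [Fintype ι] [DecidableEq ι]

/-- Contraction of coefficients in a ring with one vector. -/
def coe1 {G : Type} [Ring G] (F : ι → G) (X : ι → G) : G := ∑ M, X M * F M

/-- Contraction of coefficients in a ring with two vectors. -/
def coe2 {G : Type} [Ring G] (F : ι → ι → G) (X Y : ι → G) : G := ∑ M, X M * coe1 (F M) Y

/-- Contraction of coefficients in a ring with three vectors. -/
def coe3 {G : Type} [Ring G] (F : ι → ι → ι → G) (X Y Z : ι → G) : G := ∑ M, X M * coe2 (F M) Y Z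

/-- Contraction of coefficients in a ring with four vectors. -/
def coe4 {G : Type} [Ring G] (F : ι → ι → ι → ι → G) (X Y Z W : ι → G) : G :=
  ∑ M, X M * coe3 (F M) Y Z W

/-- The parity involution, applied to a vector. -/
def pVec (X : ι → Gr κ) : ι → Gr κ := fun M => parity (X M)

theorem pVec_dVec (k : κ) (X : ι → Gr κ) : pVec (dVec k X) = -dVec k (pVec X) := by
  ext M; simp [pVec, dVec, parity_leftD]

theorem dVec_neg (k : κ) (X : ι → Gr κ) : dVec k (-X) = -dVec k X := by
  ext M; simp [dVec]

section Negation

variable {G : Type} [Ring G] (X Y Z W : ι → G)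

theorem coe2_neg_left (F : ι → ι → G) : coe2 F (-X) Y = -coe2 F X Y := by simp [coe2]
theorem coe3_neg_left (F : ι → ι → ι → G) : coe3 F (-X) Y Z = -coe3 F X Y Z := by simp [coe3]
theorem coe3_neg_mid (F : ι → ι → ι → G) : coe3 F X (-Y) Z = -coe3 F X Y Z := by
  simp [coe3, coe2_neg_left]
theorem coe4_neg_1 (F : ι → ι → ι → ι → G) : coe4 F (-X) Y Z W = -coe4 F X Y Z W := by simp [coe4]
theorem coe4_neg_2 (F : ι → ι → ι → ι → G) : coe4 F X (-Y) Z W = -coe4 F X Y Z W := by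
  simp [coe4, coe3_neg_left]
theorem coe4_neg_3 (F : ι → ι → ι → ι → G) : coe4 F X Y (-Z) W = -coe4 F X Y Z W := by
  simp [coe4, coe3_neg_mid]

end Negation

section ChainRule

variable {N X Y Z : ι → Gr κ} {F₀ : Gr κ} {F₁ : ι → Gr κ} {F₂ : ι → ι → Gr κ}
  {F₃ : ι → ι → ι → Gr κ} {F₄ : ι → ι → ι → ι → Gr κ}

/-- Nothing is used about the coefficients except that each differentiates into the next contracted
with the derivative of `N`. The involution `pVec` records the signs of passing earlier factors. -/
theorem leftD_coe1 (h₁ : ∀ k M, leftD k (F₁ M) = coe1 (F₂ M) (dVec k N)) (k : κ) :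
    leftD k (coe1 F₁ X) = coe1 F₁ (dVec k X) + coe2 F₂ (pVec X) (dVec k N) := by
  simp only [coe1, coe2, map_sum, leftD_mul, Finset.sum_add_distrib, h₁]
  rfl

theorem leftD_coe2 (h₂ : ∀ k M N', leftD k (F₂ M N') = coe1 (F₃ M N') (dVec k N)) (k : κ) :
    leftD k (coe2 F₂ X Y) = coe2 F₂ (dVec k X) Y + coe2 F₂ (pVec X) (dVec k Y)
      + coe3 F₃ (pVec X) (pVec Y) (dVec k N) := by
  simp only [coe2, coe3, map_sum, leftD_mul, Finset.sum_add_distrib, leftD_coe1 (h₂ · _ ·), mul_add,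
    add_assoc]
  rfl

theorem leftD_coe3 (h₃ : ∀ k M N' K, leftD k (F₃ M N' K) = coe1 (F₄ M N' K) (dVec k N)) (k : κ) :
    leftD k (coe3 F₃ X Y Z) = coe3 F₃ (dVec k X) Y Z + coe3 F₃ (pVec X) (dVec k Y) Z
      + coe3 F₃ (pVec X) (pVec Y) (dVec k Z) + coe4 F₄ (pVec X) (pVec Y) (pVec Z) (dVec k N) := by
  simp only [coe3, coe4, map_sum, leftD_mul, Finset.sum_add_distrib, leftD_coe2 (h₃ · _ · ·),
    mul_add, add_assoc]
  rfl

/-- The fourth derivative of a composite function of an even vector `N`. -/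
theorem leftD_chain (hN : IsEven N) (h₀ : ∀ k, leftD k F₀ = coe1 F₁ (dVec k N))
    (h₁ : ∀ k M, leftD k (F₁ M) = coe1 (F₂ M) (dVec k N))
    (h₂ : ∀ k M N', leftD k (F₂ M N') = coe1 (F₃ M N') (dVec k N))
    (h₃ : ∀ k M N' K, leftD k (F₃ M N' K) = coe1 (F₄ M N' K) (dVec k N)) (a b c d : κ) :
    leftD a (leftD b (leftD c (leftD d F₀)))
      = coe1 F₁ (dVec a (dVec b (dVec c (dVec d N))))
        + (-coe2 F₂ (dVec b (dVec c (dVec d N))) (dVec a N)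
          + coe2 F₂ (dVec a (dVec c (dVec d N))) (dVec b N)
          - coe2 F₂ (dVec a (dVec b (dVec d N))) (dVec c N)
          - coe2 F₂ (dVec d N) (dVec a (dVec b (dVec c N)))
          + coe2 F₂ (dVec c (dVec d N)) (dVec a (dVec b N))
          - coe2 F₂ (dVec b (dVec d N)) (dVec a (dVec c N))
          + coe2 F₂ (dVec a (dVec d N)) (dVec b (dVec c N)))
        + (-coe3 F₃ (dVec c (dVec d N)) (dVec b N) (dVec a N)
          + coe3 F₃ (dVec b (dVec d N)) (dVec c N) (dVec a N)
          - coe3 F₃ (dVec d N) (dVec b (dVec c N)) (dVec a N)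
          - coe3 F₃ (dVec a (dVec d N)) (dVec c N) (dVec b N)
          + coe3 F₃ (dVec d N) (dVec a (dVec c N)) (dVec b N)
          - coe3 F₃ (dVec d N) (dVec c N) (dVec a (dVec b N)))
        + coe4 F₄ (dVec d N) (dVec c N) (dVec b N) (dVec a N) := by
  -- Since `N` is even, signs arise only from its derivatives, each of which reverses the parity.
  have hp : pVec N = N := funext hN
  simp only [h₀, leftD_coe1 h₁, leftD_coe2 h₂, leftD_coe3 h₃, map_add, map_neg, pVec_dVec, hp,
    dVec_neg, coe2_neg_left, coe3_neg_left, coe3_neg_mid, coe4_neg_1, coe4_neg_2,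
    coe4_neg_3, neg_neg]
  abel

end ChainRule

section Polynomial

variable {N : ι → Gr κ} {t₁ : ι → ℂ} {t₂ : ι → ι → ℂ} {t₃ : ι → ι → ι → ℂ}
  {t₄ : ι → ι → ι → ι → ℂ}

/-- The Taylor polynomial of degree four and its derivatives. -/
def taylor0 (t₀ : ℂ) (t₁ : ι → ℂ) (t₂ : ι → ι → ℂ) (t₃ : ι → ι → ι → ℂ) (t₄ : ι → ι → ι → ι → ℂ)
    (N : ι → Gr κ) : Gr κ :=
  algebraMap ℂ _ t₀ + ∑ M, t₁ M • N M + (1 / 2 : ℂ) • con2 t₂ N N + (1 / 6 : ℂ) • con3 t₃ N N N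
    + (1 / 24 : ℂ) • con4 t₄ N N N N
def taylor1 (t₁ : ι → ℂ) (t₂ : ι → ι → ℂ) (t₃ : ι → ι → ι → ℂ) (t₄ : ι → ι → ι → ι → ℂ)
    (N : ι → Gr κ) (M : ι) : Gr κ :=
  algebraMap ℂ _ (t₁ M) + ∑ K, t₂ M K • N K + (1 / 2 : ℂ) • con2 (t₃ M) N N
    + (1 / 6 : ℂ) • con3 (t₄ M) N N N
def taylor2 (t₂ : ι → ι → ℂ) (t₃ : ι → ι → ι → ℂ) (t₄ : ι → ι → ι → ι → ℂ) (N : ι → Gr κ)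
    (M K : ι) : Gr κ :=
  algebraMap ℂ _ (t₂ M K) + ∑ P, t₃ M K P • N P + (1 / 2 : ℂ) • con2 (t₄ M K) N N
def taylor3 (t₃ : ι → ι → ι → ℂ) (t₄ : ι → ι → ι → ι → ℂ) (N : ι → Gr κ) (M K P : ι) : Gr κ :=
  algebraMap ℂ _ (t₃ M K P) + ∑ Q, t₄ M K P Q • N Q

theorem IsEven.leftD_con2_self (hN : IsEven N) (ht : ∀ M K, t₂ M K = t₂ K M) (k : κ) :
    leftD k (con2 t₂ N N) = (2 : ℂ) • con2 t₂ (BiHKT.dVec k N) N := by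
  rw [hN.leftD_con2, con2_comm ht hN.central, two_smul]

theorem IsEven.leftD_con3_self (hN : IsEven N) (ht : IsSym3 t₃) (k : κ) :
    leftD k (con3 t₃ N N N) = (3 : ℂ) • con3 t₃ (BiHKT.dVec k N) N N := by
  rw [con3_eq_mul_con2, hN.sum_leftD, ← con3_eq_mul_con2]
  simp only [hN.leftD_con2_self (fun K P => ht.swap23 _ K P), mul_smul_comm, ← Finset.smul_sum]
  rw [← con3_eq_mul_con2, con3_comm12 ht.swap12 hN.central]
  module

theorem IsEven.leftD_con4_self (hN : IsEven N) (ht : IsSym4 t₄) (k : κ) :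
    leftD k (con4 t₄ N N N N) = (4 : ℂ) • con4 t₄ (BiHKT.dVec k N) N N N := by
  have hcomm : con4 t₄ N (BiHKT.dVec k N) N N = con4 t₄ (BiHKT.dVec k N) N N N := by
    rw [con4_apply, con4_apply, Finset.sum_comm]
    refine Finset.sum_congr rfl fun M _ => Finset.sum_congr rfl fun K _ => Finset.sum_congr rfl
      fun P _ => Finset.sum_congr rfl fun Q _ => ?_
    rw [ht.swap12, ← mul_assoc, hN.central, mul_assoc]
  rw [con4_eq_mul_con3, hN.sum_leftD, ← con4_eq_mul_con3]
  simp only [hN.leftD_con3_self (ht.isSym3 _), mul_smul_comm, ← Finset.smul_sum]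
  rw [← con4_eq_mul_con3, hcomm]
  module

theorem con3_eq_sum {X Y Z : ι → Gr κ} : con3 t₃ X Y Z = ∑ M, X M * con2 (t₃ M) Y Z :=
  con3_eq_mul_con2 _ _ _ _

theorem con2_eq_sum {X Y : ι → Gr κ} : con2 t₂ X Y = ∑ M, X M * ∑ K, t₂ M K • Y K := by
  simp only [con2_apply, Finset.mul_sum, mul_smul_comm]

theorem leftD_linear (t : ι → ℂ) (k : κ) :
    leftD k (∑ M, t M • N M) = ∑ M, dVec k N M * algebraMap ℂ _ (t M) := by
  simp only [map_sum, map_smul, ← Algebra.commutes, ← Algebra.smul_def]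
  rfl

/-- The coefficients are symmetric and the components of `N` commute, so a term of degree `k` yields
`k` equal derivatives; the inverse factorials shift accordingly. -/
theorem leftD_taylor0 (hN : IsEven N) (t₀ : ℂ) (h₂ : ∀ M K, t₂ M K = t₂ K M) (h₃ : IsSym3 t₃)
    (h₄ : IsSym4 t₄) (k : κ) :
    leftD k (taylor0 t₀ t₁ t₂ t₃ t₄ N) = coe1 (taylor1 t₁ t₂ t₃ t₄ N) (dVec k N) := by
  simp only [taylor0, taylor1, coe1, map_add, map_smul, leftD_algebraMap, leftD_linear,
    hN.leftD_con2_self h₂, hN.leftD_con3_self h₃, hN.leftD_con4_self h₄, mul_add, mul_smul_comm,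
    Finset.sum_add_distrib, ← Finset.smul_sum, ← con2_eq_sum, ← con3_eq_sum, ← con4_eq_mul_con3]
  module

theorem leftD_taylor1 (hN : IsEven N) (h₃ : IsSym3 t₃) (h₄ : IsSym4 t₄) (k : κ) (M : ι) :
    leftD k (taylor1 t₁ t₂ t₃ t₄ N M) = coe1 (taylor2 t₂ t₃ t₄ N M) (dVec k N) := by
  simp only [taylor2, taylor1, coe1, map_add, map_smul, leftD_algebraMap, leftD_linear,
    hN.leftD_con2_self (h₃.swap23 M), hN.leftD_con3_self (h₄.isSym3 M), mul_add, mul_smul_comm,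
    Finset.sum_add_distrib, ← Finset.smul_sum, ← con2_eq_sum, ← con3_eq_sum]
  module

theorem leftD_taylor2 (hN : IsEven N) (h₄ : IsSym4 t₄) (k : κ) (M K : ι) :
    leftD k (taylor2 t₂ t₃ t₄ N M K) = coe1 (taylor3 t₃ t₄ N M K) (dVec k N) := by
  simp only [taylor2, taylor3, coe1, map_add, map_smul, leftD_algebraMap, leftD_linear,
    hN.leftD_con2_self (h₄.swap34 M K), mul_add, mul_smul_comm,
    Finset.sum_add_distrib, ← Finset.smul_sum, ← con2_eq_sum]
  module

theorem leftD_taylor3 (k : κ) (M K P : ι) :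
    leftD k (taylor3 t₃ t₄ N M K P) = coe1 (fun Q => algebraMap ℂ _ (t₄ M K P Q)) (dVec k N) := by
  simp only [taylor3, coe1, map_add, leftD_algebraMap, leftD_linear, zero_add]

section Body

variable {ρ : Gr κ →ₐ[ℂ] Gr κ} {X Y Z W : ι → Gr κ}

/-- Any homomorphism that kills `N` evaluates the polynomial at the base point and returns the bare
derivative of `L`. -/
theorem map_taylor1 (hρ : ∀ M, ρ (N M) = 0) (M : ι) :
    ρ (taylor1 t₁ t₂ t₃ t₄ N M) = algebraMap ℂ _ (t₁ M) := by
  simp [taylor1, con2_apply, con3_apply, hρ]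

theorem map_taylor2 (hρ : ∀ M, ρ (N M) = 0) (M K : ι) :
    ρ (taylor2 t₂ t₃ t₄ N M K) = algebraMap ℂ _ (t₂ M K) := by
  simp [taylor2, con2_apply, hρ]

theorem map_taylor3 (hρ : ∀ M, ρ (N M) = 0) (M K P : ι) :
    ρ (taylor3 t₃ t₄ N M K P) = algebraMap ℂ _ (t₃ M K P) := by
  simp [taylor3, hρ]

theorem map_coe1 (hρ : ∀ M, ρ (N M) = 0) :
    ρ (coe1 (taylor1 t₁ t₂ t₃ t₄ N) X) = ∑ M, t₁ M • ρ (X M) := by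
  simp only [coe1, map_sum, map_mul, map_taylor1 hρ, ← Algebra.commutes, ← Algebra.smul_def]

theorem map_coe2 (hρ : ∀ M, ρ (N M) = 0) :
    ρ (coe2 (taylor2 t₂ t₃ t₄ N) X Y) = con2 t₂ (fun M => ρ (X M)) fun M => ρ (Y M) := by
  simp only [coe1, coe2, map_sum, map_mul, map_taylor2 hρ, ← Algebra.commutes, ← Algebra.smul_def,
    Finset.mul_sum, mul_smul_comm, con2_apply]

theorem map_coe3 (hρ : ∀ M, ρ (N M) = 0) : ρ (coe3 (taylor3 t₃ t₄ N) X Y Z)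
    = con3 t₃ (fun M => ρ (X M)) (fun M => ρ (Y M)) fun M => ρ (Z M) := by
  simp only [coe1, coe2, coe3, map_sum, map_mul, map_taylor3 hρ, ← Algebra.commutes,
    ← Algebra.smul_def, Finset.mul_sum, mul_smul_comm, con3_apply]

theorem map_coe4 : ρ (coe4 (fun M K P Q => algebraMap ℂ _ (t₄ M K P Q)) X Y Z W)
    = con4 t₄ (fun M => ρ (X M)) (fun M => ρ (Y M)) (fun M => ρ (Z M)) fun M => ρ (W M) := by
  simp only [coe1, coe2, coe3, coe4, map_sum, map_mul, map_smul, AlgHom.commutes,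
    ← Algebra.commutes, ← Algebra.smul_def, Finset.mul_sum, mul_smul_comm, con4_apply]

end Body

end Polynomial

end TaylorPolynomial

/-! ### The Taylor polynomial of the prepotential -/

section Prepotential

variable {ι : Type} [Fintype ι] [DecidableEq ι] {U : Set (ι → ℝ)} {L : (ι → ℝ) → ℝ} {x : ι → ℝ}

/-- The partial derivative in the directions `s`. -/
def partials (L : (ι → ℝ) → ℝ) (k : ℕ) (s : Fin k → ι) (x : ι → ℝ) : ℝ :=
  iteratedFDeriv ℝ k L x fun j => Pi.single (s j) 1

/-- Evaluation on fixed directions is continuous and linear, so it passes through the derivative.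
The added direction becomes the outermost one, the same order as in `tens1` to `tens4`. -/
theorem partials_succ (hU : IsOpen U) (hL : ContDiffOn ℝ ∞ L U) (hx : x ∈ U) (k : ℕ) (M : ι)
    (s : Fin k → ι) : partials L (k + 1) (Fin.cons M s) x = pd (fun y => partials L k s y) M x := by
  have hd : DifferentiableAt ℝ (iteratedFDeriv ℝ k L) x := by
    have h : ContDiffAt ℝ ∞ L x := hL.contDiffAt (hU.mem_nhds hx)
    exact h.differentiableAt_iteratedFDeriv (by exact_mod_cast ENat.natCast_lt_top k)
  rw [partials, iteratedFDeriv_succ_apply_left, pd]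
  have h := ((ContinuousMultilinearMap.apply ℝ (fun _ : Fin k => ι → ℝ) ℝ
    fun j => Pi.single (s j) 1).hasFDerivAt.comp x hd.hasFDerivAt).fderiv
  exact (DFunLike.congr_fun h (Pi.single M 1)).symm

/-- Sums over multi-indices of a product of ring elements, one index at a time. -/
theorem sum_ofFn_succ {G : Type} [Ring G] [Algebra ℂ G] (k : ℕ) (t : (Fin (k + 1) → ι) → ℂ)
    (N : ι → G) :
    ∑ s : Fin (k + 1) → ι, t s • (List.ofFn fun j => N (s j)).prod
      = ∑ M, N M * ∑ s : Fin k → ι, t (Fin.cons M s) • (List.ofFn fun j => N (s j)).prod := by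
  rw [← (Fin.consEquiv fun _ => ι).sum_comp, Fintype.sum_prod_type]
  refine Finset.sum_congr rfl fun M _ => ?_
  rw [Finset.mul_sum]
  refine Finset.sum_congr rfl fun s _ => ?_
  rw [List.ofFn_succ, List.prod_cons, mul_smul_comm]
  rfl

end Prepotential

section Superfields

variable {n m : ℕ} {U : Set (Pt n m)} {L : Pt n m → ℝ} {x : Pt n m}

/-- The nilpotent part of the superfields. -/
def sfSoul (x v w : Pt n m) (M : RIdx n m) : SGr n m := sfReal x v w M - algebraMap ℂ _ (x M : ℂ)

theorem superPrepotential_eq (hU : IsOpen U) (hL : ContDiffOn ℝ ∞ L U) (hx : x ∈ U)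
    (v w : Pt n m) :
    superPrepotential L x v w = taylor0 (L x) (tens1 L x) (tens2 L x) (tens3 L x) (tens4 L x)
      (sfSoul x v w) := by
  have p1 : ∀ y ∈ U, ∀ s : Fin 0 → RIdx n m, ∀ M, partials L 1 (Fin.cons M s) y = pd L M y := by
    intro y hy s M
    rw [partials_succ hU hL hy]
    rfl
  have p2 : ∀ y ∈ U, ∀ s : Fin 0 → RIdx n m, ∀ M N,
      partials L 2 (Fin.cons M (Fin.cons N s)) y = pd (fun y => pd L N y) M y := by
    intro y hy s M N
    rw [partials_succ hU hL hy]
    exact pd_congr hU hy (fun y hy => p1 y hy s N) M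
  have p3 : ∀ y ∈ U, ∀ s : Fin 0 → RIdx n m, ∀ M N K,
      partials L 3 (Fin.cons M (Fin.cons N (Fin.cons K s))) y
        = pd (fun y => pd (fun y => pd L K y) N y) M y := by
    intro y hy s M N K
    rw [partials_succ hU hL hy]
    exact pd_congr hU hy (fun y hy => p2 y hy s N K) M
  have p4 : ∀ y ∈ U, ∀ s : Fin 0 → RIdx n m, ∀ M N K P,
      partials L 4 (Fin.cons M (Fin.cons N (Fin.cons K (Fin.cons P s)))) y
        = pd (fun y => pd (fun y => pd (fun y => pd L P y) K y) N y) M y := by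
    intro y hy s M N K P
    rw [partials_succ hU hL hy]
    exact pd_congr hU hy (fun y hy => p3 y hy s N K P) M
  have hsum : superPrepotential L x v w = ∑ k ∈ Finset.range 5, (1 / (k.factorial : ℂ)) •
      ∑ s : Fin k → RIdx n m, (partials L k s x : ℂ) •
        (List.ofFn fun j => sfSoul x v w (s j)).prod :=
    rfl
  rw [hsum]
  simp only [Finset.sum_range_succ, Finset.sum_range_zero, zero_add]
  simp only [sum_ofFn_succ (ι := RIdx n m), p1 x hx, p2 x hx, p3 x hx, p4 x hx]
  simp only [Finset.univ_unique, Finset.sum_singleton, List.ofFn_zero, List.prod_nil,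
    Finset.mul_sum, mul_smul_comm, mul_one]
  have h0 : ∀ s : Fin 0 → RIdx n m, partials L 0 s x = L x := fun s => iteratedFDeriv_zero_apply _
  have e0 : (1 / ((0).factorial : ℂ)) = 1 := by norm_num [Nat.factorial]
  have e1 : (1 / ((1).factorial : ℂ)) = 1 := by norm_num [Nat.factorial]
  have e2 : (1 / ((2).factorial : ℂ)) = 1 / 2 := by norm_num [Nat.factorial]
  have e3 : (1 / ((3).factorial : ℂ)) = 1 / 6 := by norm_num [Nat.factorial]
  have e4 : (1 / ((4).factorial : ℂ)) = 1 / 24 := by norm_num [Nat.factorial]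
  simp only [taylor0, con2_apply, con3_apply, con4_apply, e0, e1, e2, e3, e4, one_smul, h0,
    Algebra.algebraMap_eq_smul_one]
  rfl

end Superfields

/-! ### The superfields in components -/

section ActionOfBlocks

variable {n m : ℕ} {G : Type} [Ring G] [Algebra ℂ G] (X : RIdx n m → G)

theorem act_JB_inl (a : Fin n) (j : Fin 4) :
    act (JB 0) X (Sum.inl a, j) = X (Sum.inl a, j) ∧
    act (JB 1) X (Sum.inl a, j) = ![X (Sum.inl a, 1), -X (Sum.inl a, 0), X (Sum.inl a, 3),
      -X (Sum.inl a, 2)] j ∧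
    act (JB 2) X (Sum.inl a, j) = ![-X (Sum.inl a, 2), X (Sum.inl a, 3), X (Sum.inl a, 0),
      -X (Sum.inl a, 1)] j ∧
    act (JB 3) X (Sum.inl a, j) = ![-X (Sum.inl a, 3), -X (Sum.inl a, 2), X (Sum.inl a, 1),
      X (Sum.inl a, 0)] j ∧
    act (JB 4) X (Sum.inl a, j) = 0 ∧ act (JB 5) X (Sum.inl a, j) = 0 ∧
    act (JB 6) X (Sum.inl a, j) = 0 ∧ act (JB 7) X (Sum.inl a, j) = 0 := by
  fin_cases j <;>
    simp [JB, act_neg_left, act_blk_apply, ordInd, mirInd, quatC, Fin.sum_univ_four]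

theorem act_JB_inr (a : Fin m) (j : Fin 4) :
    act (JB 0) X (Sum.inr a, j) = 0 ∧ act (JB 1) X (Sum.inr a, j) = 0 ∧
    act (JB 2) X (Sum.inr a, j) = 0 ∧ act (JB 3) X (Sum.inr a, j) = 0 ∧
    act (JB 4) X (Sum.inr a, j) = X (Sum.inr a, j) ∧
    act (JB 5) X (Sum.inr a, j) = ![-X (Sum.inr a, 1), X (Sum.inr a, 0), -X (Sum.inr a, 3),
      X (Sum.inr a, 2)] j ∧
    act (JB 6) X (Sum.inr a, j) = ![X (Sum.inr a, 2), -X (Sum.inr a, 3), -X (Sum.inr a, 0),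
      X (Sum.inr a, 1)] j ∧
    act (JB 7) X (Sum.inr a, j) = ![X (Sum.inr a, 3), X (Sum.inr a, 2), -X (Sum.inr a, 1),
      -X (Sum.inr a, 0)] j := by
  fin_cases j <;>
    simp [JB, act_neg_left, act_blk_apply, ordInd, mirInd, quatC, Fin.sum_univ_four]

end ActionOfBlocks

section Components

variable {n m : ℕ}

theorem leftD_theta_mul (k) (y : SGr n m) :
    leftD k (theta * y) = (if k = Sum.inl 0 then y else 0) - theta * leftD k y := by
  rw [theta, gen_eq, leftD_ι_mul, Pi.single_apply]
  split_ifs <;> simp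

theorem leftD_thetaBar_mul (k) (y : SGr n m) :
    leftD k (thetaBar * y) = (if k = Sum.inl 1 then y else 0) - thetaBar * leftD k y := by
  rw [thetaBar, gen_eq, leftD_ι_mul, Pi.single_apply]
  split_ifs <;> simp

theorem leftD_eta_mul (k) (y : SGr n m) :
    leftD k (eta * y) = (if k = Sum.inl 2 then y else 0) - eta * leftD k y := by
  rw [eta, gen_eq, leftD_ι_mul, Pi.single_apply]
  split_ifs <;> simp

theorem leftD_etaBar_mul (k) (y : SGr n m) :
    leftD k (etaBar * y) = (if k = Sum.inl 3 then y else 0) - etaBar * leftD k y := by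
  rw [etaBar, gen_eq, leftD_ι_mul, Pi.single_apply]
  split_ifs <;> simp

theorem leftD_inl_gen_inr (i : Fin 4) (k : RIdx n m ⊕ RIdx n m) :
    leftD (Sum.inl i) (gen (Sum.inr k) : SGr n m) = 0 := by
  rw [gen_eq, leftD_ι, Pi.single_apply]
  simp

theorem gen_mul_gen (j k : Fin 4 ⊕ (RIdx n m ⊕ RIdx n m)) :
    (gen j * gen k : SGr n m) = -(gen k * gen j) := ι_mul_ι_swap _ _

theorem gen_mul_gen_mul (j k : Fin 4 ⊕ (RIdx n m ⊕ RIdx n m)) (y : SGr n m) :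
    gen j * (gen k * y) = -(gen k * (gen j * y)) := by
  rw [← mul_assoc, gen_mul_gen, neg_mul, mul_assoc]

theorem gen_mul_self_mul (j : Fin 4 ⊕ (RIdx n m ⊕ RIdx n m)) (y : SGr n m) :
    gen j * (gen j * y) = 0 := by
  rw [← mul_assoc, show gen j * gen j = (0 : SGr n m) from ExteriorAlgebra.ι_sq_zero _, zero_mul]

/-- A vector of complex numbers in the Grassmann algebra. -/
def scal (v : Pt n m) (M : RIdx n m) : SGr n m := algebraMap ℂ _ (v M : ℂ)

/-- The expansion of a vector in the odd coordinates of superspace. -/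
structure Expansion (n m : ℕ) where
  (t T e E tT te tE Te TE eE tTe tTE teE TeE tTeE : RIdx n m → SGr n m)

def Expansion.eval (c : Expansion n m) (M : RIdx n m) : SGr n m :=
  theta * c.t M + thetaBar * c.T M + eta * c.e M + etaBar * c.E M
    + theta * (thetaBar * c.tT M) + theta * (eta * c.te M) + theta * (etaBar * c.tE M)
    + thetaBar * (eta * c.Te M) + thetaBar * (etaBar * c.TE M) + eta * (etaBar * c.eE M)
    + theta * (thetaBar * (eta * c.tTe M)) + theta * (thetaBar * (etaBar * c.tTE M))
    + theta * (eta * (etaBar * c.teE M)) + thetaBar * (eta * (etaBar * c.TeE M))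
    + theta * (thetaBar * (eta * (etaBar * c.tTeE M)))

/-- The components of the superfields. -/
def sfComponents (v w : Pt n m) : Expansion n m where
  t := (Real.sqrt 2 / 2 : ℂ) • act (JT 0 - Complex.I • JT 1) xi
  T := -(Real.sqrt 2 / 2 : ℂ) • act (JT 0 + Complex.I • JT 1) xi
  e := -(Real.sqrt 2 / 2 : ℂ) • act (JT 2 + Complex.I • JT 3) xi
  E := (Real.sqrt 2 / 2 : ℂ) • act (JT 2 - Complex.I • JT 3) xi
  tT := -act (JT 1) (scal v)
  te := act (Complex.I • JB 2 - JB 3) (scal v)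
  tE := -act (Complex.I • JB 6 + JB 7) (scal v)
  Te := -act (Complex.I • JB 6 - JB 7) (scal v)
  TE := act (Complex.I • JB 2 + JB 3) (scal v)
  eE := -act (JB 1 - JB 5) (scal v)
  tTe := (Real.sqrt 2 / 2 : ℂ) • act (Complex.I • (JB 2 - JB 6) - (JB 3 - JB 7)) xiDot
  tTE := (Real.sqrt 2 / 2 : ℂ) • act (Complex.I • (JB 2 - JB 6) + (JB 3 - JB 7)) xiDot
  teE := -(Real.sqrt 2 / 2 : ℂ) • act (Complex.I • (JB 0 - JB 4) + (JB 1 - JB 5)) xiDot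
  TeE := -(Real.sqrt 2 / 2 : ℂ) • act (Complex.I • (JB 0 - JB 4) - (JB 1 - JB 5)) xiDot
  tTeE := -act (JB 0 - JB 4) (scal w)

theorem algebraMap_holo (v : Pt n m) (K : CIdx n m) :
    algebraMap ℂ (SGr n m) (holo (cplx v) K) = holo (scal v) K := by
  simp only [holo, cplx, scal, map_sub, smul_eq_mul, map_mul, Algebra.smul_def]

theorem algebraMap_antiholo (v : Pt n m) (K : CIdx n m) :
    algebraMap ℂ (SGr n m) (antiholo (cplx v) K) = antiholo (scal v) K := by
  simp only [antiholo, cplx, scal, map_add, smul_eq_mul, map_mul, Algebra.smul_def]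

theorem smul_mul_mul_algebraMap (c z : ℂ) (x y : SGr n m) :
    (c * z) • (x * y) = c • (x * (y * algebraMap ℂ _ z)) := by
  rw [← Algebra.commutes, ← Algebra.smul_def, mul_smul_comm, smul_smul]

theorem chiral_eq (x v : Pt n m) (ψ : SGr n m) (K : CIdx n m) :
    chiral (holo (cplx x) K) ψ (holo (cplx v) K) = holo (scal x) K
      + (Real.sqrt 2 : ℂ) • (theta * ψ) - Complex.I • (theta * (thetaBar * holo (scal v) K)) := by
  rw [chiral, smul_mul_mul_algebraMap, algebraMap_holo, algebraMap_holo]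

theorem antichiral_eq (x v : Pt n m) (ψ : SGr n m) (K : CIdx n m) :
    antichiral (antiholo (cplx x) K) ψ (antiholo (cplx v) K) = antiholo (scal x) K
      - (Real.sqrt 2 : ℂ) • (thetaBar * ψ)
      + Complex.I • (theta * (thetaBar * antiholo (scal v) K)) := by
  rw [antichiral, smul_mul_mul_algebraMap, algebraMap_antiholo, algebraMap_antiholo]

theorem leftD_scal (k) (v : Pt n m) (M : RIdx n m) : leftD k (scal v M) = 0 := leftD_algebraMap _ _

theorem leftD_holo {k} {y : RIdx n m → SGr n m} (hy : ∀ M, leftD k (y M) = 0) (K : CIdx n m) :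
    leftD k (holo y K) = 0 := by
  simp only [holo, map_sub, map_smul, hy, smul_zero, sub_zero]

theorem leftD_antiholo {k} {y : RIdx n m → SGr n m} (hy : ∀ M, leftD k (y M) = 0) (K : CIdx n m) :
    leftD k (antiholo y K) = 0 := by
  simp only [antiholo, map_add, map_smul, hy, smul_zero, add_zero]

theorem theta_mul_theta_mul (y : SGr n m) : theta * (theta * y) = 0 := gen_mul_self_mul _ _

theorem thetaBar_mul_thetaBar_mul (y : SGr n m) : thetaBar * (thetaBar * y) = 0 :=
  gen_mul_self_mul _ _

theorem thetaBar_mul_theta_mul (y : SGr n m) :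
    thetaBar * (theta * y) = -(theta * (thetaBar * y)) := gen_mul_gen_mul _ _ _

/-- The velocity term doubles: the derivative in `θ` of `-i θ θ̄ ż` and the term `-i θ̄ ∂_t` each
give `-i θ̄ ż`. -/
theorem sfDV_eq (x v w : Pt n m) (K : CIdx n m) :
    sfDV x v w K = (Real.sqrt 2 : ℂ) • holo xi K
      - (2 * Complex.I) • (thetaBar * holo (scal v) K)
      + (Real.sqrt 2 * Complex.I : ℂ) • (theta * (thetaBar * holo xiDot K)) := by
  have hx : ∀ M : RIdx n m, leftD (Sum.inl 0) (xi M) = 0 := fun M => leftD_inl_gen_inr _ _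
  rw [sfDV, sfV, sfVdot, chiral_eq, chiral_eq]
  simp only [map_add, map_sub, map_smul, leftD_theta_mul, leftD_thetaBar_mul, leftD_holo hx,
    leftD_holo (leftD_scal _ _), mul_zero, sub_zero, if_true, mul_add, mul_sub, mul_smul_comm,
    thetaBar_mul_theta_mul, thetaBar_mul_thetaBar_mul, reduceCtorEq, Sum.inl.injEq, if_false,
    zero_ne_one, mul_neg, neg_zero]
  module

theorem sfDbarVbar_eq (x v w : Pt n m) (K : CIdx n m) :
    sfDbarVbar x v w K = (Real.sqrt 2 : ℂ) • antiholo xi K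
      + (2 * Complex.I) • (theta * antiholo (scal v) K)
      - (Real.sqrt 2 * Complex.I : ℂ) • (theta * (thetaBar * antiholo xiDot K)) := by
  have hx : ∀ M : RIdx n m, leftD (Sum.inl 1) (xi M) = 0 := fun M => leftD_inl_gen_inr _ _
  rw [sfDbarVbar, sfVbar, sfVbarDot, antichiral_eq, antichiral_eq]
  simp only [map_add, map_sub, map_smul, leftD_theta_mul, leftD_thetaBar_mul, leftD_antiholo hx,
    leftD_antiholo (leftD_scal _ _), mul_zero, sub_zero, if_true, mul_add, mul_sub, mul_smul_comm,
    theta_mul_theta_mul, reduceCtorEq, Sum.inl.injEq, if_false,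
    one_ne_zero, mul_neg, neg_zero, zero_sub, smul_neg]
  module

set_option maxHeartbeats 4000000 in
-- Once the odd coordinates are put in the order `θ, θ̄, η, η̄`, the real components of the
-- superfields can be compared slot by slot in each sector. This is where the superfields acquire
-- the uniform description by `JB`.
theorem sfSoul_eq (x v w : Pt n m) : sfSoul x v w = (sfComponents v w).eval := by
  have o2 : ∀ y : SGr n m, eta * (theta * y) = -(theta * (eta * y)) := gen_mul_gen_mul _ _
  have o3 : ∀ y : SGr n m, etaBar * (theta * y) = -(theta * (etaBar * y)) := gen_mul_gen_mul _ _
  have o4 : ∀ y : SGr n m, eta * (thetaBar * y) = -(thetaBar * (eta * y)) := gen_mul_gen_mul _ _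
  have o5 : ∀ y : SGr n m, etaBar * (thetaBar * y) = -(thetaBar * (etaBar * y)) :=
    gen_mul_gen_mul _ _
  have hx : ∀ M, algebraMap ℂ (SGr n m) (x M : ℂ) = scal x M := fun _ => rfl
  have e00 : eps 0 0 = 0 := by simp [eps]
  have e01 : eps 0 1 = 1 := by simp [eps]
  have e10 : eps 1 0 = -1 := by simp [eps]
  have e11 : eps 1 1 = 0 := by simp [eps]
  have r0 : ∀ F : Flavor n m, reSlot (F, 0) = (F, 2) := fun _ => rfl
  have r1 : ∀ F : Flavor n m, reSlot (F, 1) = (F, 0) := fun _ => rfl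
  have i0 : ∀ F : Flavor n m, imSlot (F, 0) = (F, 3) := fun _ => rfl
  have i1 : ∀ F : Flavor n m, imSlot (F, 1) = (F, 1) := fun _ => rfl
  ext M
  obtain ⟨a | a, j⟩ := M
  · have hs : ((sector (Sum.inl a : Flavor n m) : ℝ) : ℂ) = 1 := by simp [sector]
    obtain ⟨a0, a1, a2, a3, a4, a5, a6, a7⟩ := act_JB_inl (xi : RIdx n m → SGr n m) a j
    obtain ⟨b0, b1, b2, b3, b4, b5, b6, b7⟩ := act_JB_inl (xiDot : RIdx n m → SGr n m) a j
    obtain ⟨c0, c1, c2, c3, c4, c5, c6, c7⟩ := act_JB_inl (scal v) a j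
    obtain ⟨d0, d1, d2, d3, d4, d5, d6, d7⟩ := act_JB_inl (scal w) a j
    simp only [Expansion.eval, sfComponents, JT, Matrix.cons_val, act_add_left, act_sub_left,
      act_smul_left, Pi.smul_apply, Pi.add_apply, Pi.sub_apply, Pi.neg_apply, a0, a1, a2, a3, a4,
      a5, a6, a7, b0, b1, b2, b3, b4, b5, b6, b7, c0, c1, c2, c3, c4, c5, c6, c7, d0, d1, d2, d3,
      d4, d5, d6, d7]
    clear a0 a1 a2 a3 a4 a5 a6 a7 b0 b1 b2 b3 b4 b5 b6 b7 c0 c1 c2 c3 c4 c5 c6 c7 d0 d1 d2 d3 d4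
      d5 d6 d7
    rw [sfSoul, hx]
    simp only [sfReal, sfZ, sfZbar, sfDV_eq, sfDbarVbar_eq, Fin.sum_univ_two, e00, e01, e10, e11]
    simp only [sfV, sfVbar, sfVdot, sfVbarDot, chiral_eq, antichiral_eq]
    simp only [holo, antiholo, r0, r1, i0, i1, hs]
    fin_cases j <;>
    · simp only [Fin.zero_eta, Fin.mk_one, Fin.reduceFinMk, Fin.isValue, Matrix.cons_val, mul_assoc,
        mul_add, mul_sub, mul_neg, mul_zero, add_zero, zero_add, sub_zero, mul_smul_comm,
        smul_zero, neg_smul, zero_smul, neg_zero, o2, o3, o4, o5]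
      match_scalars <;> ring_nf <;>
        (try simp only [Complex.I_sq, Complex.I_pow_three, Complex.I_pow_four]) <;> try ring_nf
  · have hs : ((sector (Sum.inr a : Flavor n m) : ℝ) : ℂ) = -1 := by simp [sector]
    obtain ⟨a0, a1, a2, a3, a4, a5, a6, a7⟩ := act_JB_inr (xi : RIdx n m → SGr n m) a j
    obtain ⟨b0, b1, b2, b3, b4, b5, b6, b7⟩ := act_JB_inr (xiDot : RIdx n m → SGr n m) a j
    obtain ⟨c0, c1, c2, c3, c4, c5, c6, c7⟩ := act_JB_inr (scal v) a j
    obtain ⟨d0, d1, d2, d3, d4, d5, d6, d7⟩ := act_JB_inr (scal w) a j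
    simp only [Expansion.eval, sfComponents, JT, Matrix.cons_val, act_add_left, act_sub_left,
      act_smul_left, Pi.smul_apply, Pi.add_apply, Pi.sub_apply, Pi.neg_apply, a0, a1, a2, a3, a4,
      a5, a6, a7, b0, b1, b2, b3, b4, b5, b6, b7, c0, c1, c2, c3, c4, c5, c6, c7, d0, d1, d2, d3,
      d4, d5, d6, d7]
    clear a0 a1 a2 a3 a4 a5 a6 a7 b0 b1 b2 b3 b4 b5 b6 b7 c0 c1 c2 c3 c4 c5 c6 c7 d0 d1 d2 d3 d4
      d5 d6 d7
    rw [sfSoul, hx]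
    simp only [sfReal, sfZ, sfZbar, sfDV_eq, sfDbarVbar_eq, Fin.sum_univ_two, e00, e01, e10, e11]
    simp only [sfV, sfVbar, sfVdot, sfVbarDot, chiral_eq, antichiral_eq]
    simp only [holo, antiholo, r0, r1, i0, i1, hs]
    fin_cases j <;>
    · simp only [Fin.zero_eta, Fin.mk_one, Fin.reduceFinMk, Fin.isValue, Matrix.cons_val, mul_assoc,
        mul_add, mul_sub, mul_neg, mul_zero, add_zero, zero_add, sub_zero, mul_smul_comm,
        smul_zero, neg_smul, zero_smul, neg_zero, o2, o3, o4, o5]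
      match_scalars <;> ring_nf <;>
        (try simp only [Complex.I_sq, Complex.I_pow_three, Complex.I_pow_four]) <;> try ring_nf

end Components

/-! ### The Berezin integral of the prepotential -/

section Berezin

variable {n m : ℕ}

/-- Setting the odd coordinates of superspace to zero. -/
def body : SGr n m →ₐ[ℂ] SGr n m :=
  (setZero (Sum.inl 0)).comp ((setZero (Sum.inl 1)).comp
    ((setZero (Sum.inl 2)).comp (setZero (Sum.inl 3))))

theorem body_gen_inl (i : Fin 4) : body (gen (Sum.inl i) : SGr n m) = 0 := by
  have h : ∀ {i j : Fin 4}, i ≠ j →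
      setZero (Sum.inl j) (gen (Sum.inl i) : SGr n m) = gen (Sum.inl i) := fun hij =>
    setZero_gen_of_ne (by simpa using hij)
  fin_cases i <;> simp [body, h, setZero_gen_self]

theorem body_eq_self {y : SGr n m} (h : ∀ i : Fin 4, leftD (Sum.inl i) y = 0) : body y = y := by
  simp only [body, AlgHom.comp_apply, setZero_eq_self (h _)]

/-- The four odd derivatives anticommute and square to zero, so the integral no longer depends on
the odd coordinates. These may be set to zero at once, which removes the nilpotent part of the
superfields from the Taylor coefficients. -/
theorem body_berezin (F : SGr n m) : body (berezin F) = berezin F := by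
  refine body_eq_self fun i => ?_
  rw [berezin]
  fin_cases i
  · exact leftD_leftD _ _
  · change leftD (Sum.inl 1) _ = 0
    rw [leftD_anticomm, leftD_leftD, map_zero, neg_zero]
  · change leftD (Sum.inl 2) _ = 0
    rw [leftD_anticomm, leftD_anticomm (Sum.inl 2) (Sum.inl 1), leftD_leftD]
    simp
  · change leftD (Sum.inl 3) _ = 0
    rw [leftD_anticomm, leftD_anticomm (Sum.inl 3) (Sum.inl 1),
      leftD_anticomm (Sum.inl 3) (Sum.inl 2), leftD_leftD]
    simp

/-- The coefficients of an even superfield: they do not depend on the odd coordinates. -/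
structure Expansion.IsEven (c : Expansion n m) : Prop where
  free : ∀ X ∈ [c.t, c.T, c.e, c.E, c.tT, c.te, c.tE, c.Te, c.TE, c.eE, c.tTe, c.tTE, c.teE, c.TeE,
    c.tTeE], ∀ i M, leftD (Sum.inl i) (X M) = 0
  odd : ∀ X ∈ [c.t, c.T, c.e, c.E, c.tTe, c.tTE, c.teE, c.TeE], IsOdd X
  even : ∀ X ∈ [c.tT, c.te, c.tE, c.Te, c.TE, c.eE, c.tTeE], BiHKT.IsEven X

theorem Expansion.IsEven.isEven_eval {c : Expansion n m} (hc : c.IsEven) :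
    BiHKT.IsEven c.eval := fun M => by
  have p0 : parity (theta : SGr n m) = -theta := parity_ι _
  have p1 : parity (thetaBar : SGr n m) = -thetaBar := parity_ι _
  have p2 : parity (eta : SGr n m) = -eta := parity_ι _
  have p3 : parity (etaBar : SGr n m) = -etaBar := parity_ι _
  have ho := hc.odd
  have he := hc.even
  simp only [List.forall_mem_cons, IsOdd, BiHKT.IsEven, List.not_mem_nil, false_imp_iff,
    implies_true, and_true] at ho he
  obtain ⟨h1, h2, h3, h4, h5, h6, h7, h8⟩ := ho
  obtain ⟨e1, e2, e3, e4, e5, e6, e7⟩ := he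
  simp only [Expansion.eval, map_add, map_mul, p0, p1, p2, p3, h1, h2, h3, h4, h5, h6, h7, h8, e1,
    e2, e3, e4, e5, e6, e7, neg_mul, mul_neg, neg_neg]

variable {c : Expansion n m}

/-- A `k`-fold derivative meets the odd coordinates in reversed order and gives the sign
`(-1)^(k(k-1)/2)`: plus for one and four derivatives, minus for two and three. -/
theorem Expansion.IsEven.body_dVec (hc : c.IsEven) :
    ((fun M => body (dVec (Sum.inl 0) c.eval M)) = c.t ∧
    (fun M => body (dVec (Sum.inl 1) c.eval M)) = c.T ∧
    (fun M => body (dVec (Sum.inl 2) c.eval M)) = c.e ∧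
    (fun M => body (dVec (Sum.inl 3) c.eval M)) = c.E) ∧
    ((fun M => body (dVec (Sum.inl 0) (dVec (Sum.inl 1) c.eval) M)) = -c.tT ∧
    (fun M => body (dVec (Sum.inl 0) (dVec (Sum.inl 2) c.eval) M)) = -c.te ∧
    (fun M => body (dVec (Sum.inl 0) (dVec (Sum.inl 3) c.eval) M)) = -c.tE ∧
    (fun M => body (dVec (Sum.inl 1) (dVec (Sum.inl 2) c.eval) M)) = -c.Te ∧
    (fun M => body (dVec (Sum.inl 1) (dVec (Sum.inl 3) c.eval) M)) = -c.TE ∧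
    (fun M => body (dVec (Sum.inl 2) (dVec (Sum.inl 3) c.eval) M)) = -c.eE) ∧
    ((fun M => body (dVec (Sum.inl 0) (dVec (Sum.inl 1) (dVec (Sum.inl 2) c.eval)) M)) = -c.tTe ∧
    (fun M => body (dVec (Sum.inl 0) (dVec (Sum.inl 1) (dVec (Sum.inl 3) c.eval)) M)) = -c.tTE ∧
    (fun M => body (dVec (Sum.inl 0) (dVec (Sum.inl 2) (dVec (Sum.inl 3) c.eval)) M)) = -c.teE ∧
    (fun M => body (dVec (Sum.inl 1) (dVec (Sum.inl 2) (dVec (Sum.inl 3) c.eval)) M)) = -c.TeE) ∧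
    (fun M => body (dVec (Sum.inl 0) (dVec (Sum.inl 1) (dVec (Sum.inl 2)
      (dVec (Sum.inl 3) c.eval))) M)) = c.tTeE ∧
    ∀ M, body (c.eval M) = 0 := by
  have p0 : body (theta : SGr n m) = 0 := body_gen_inl _
  have p1 : body (thetaBar : SGr n m) = 0 := body_gen_inl _
  have p2 : body (eta : SGr n m) = 0 := body_gen_inl _
  have p3 : body (etaBar : SGr n m) = 0 := body_gen_inl _
  have hf := hc.free
  simp only [List.forall_mem_cons, List.not_mem_nil, false_imp_iff, implies_true, and_true] at hf
  obtain ⟨h1, h2, h3, h4, h5, h6, h7, h8, h9, h10, h11, h12, h13, h14, h15⟩ := hf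
  have hb : ∀ {X : RIdx n m → SGr n m}, (∀ i M, leftD (Sum.inl i) (X M) = 0) → ∀ M,
      body (X M) = X M := fun h M => body_eq_self fun i => h i M
  refine ⟨⟨?_, ?_, ?_, ?_⟩, ⟨?_, ?_, ?_, ?_, ?_, ?_⟩, ⟨?_, ?_, ?_, ?_⟩, ?_, fun M => ?_⟩
  all_goals first | ext M | skip
  all_goals
    simp only [dVec, Expansion.eval, map_add, map_sub, map_neg, map_mul, leftD_theta_mul,
      leftD_thetaBar_mul, leftD_eta_mul, leftD_etaBar_mul, Sum.inl.injEq, Fin.isValue, Fin.reduceEq,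
      if_true, if_false, h1, h2, h3, h4, h5, h6, h7, h8, h9, h10, h11, h12, h13, h14, h15, mul_zero,
      zero_mul, sub_zero, zero_sub, add_zero, zero_add, neg_zero, neg_neg, map_zero, p0, p1, p2, p3,
      hb h1, hb h2, hb h3, hb h4, hb h5, hb h6, hb h7, hb h8, hb h9, hb h10, hb h11, hb h12,
      hb h13, hb h14, hb h15, Pi.neg_apply]

end Berezin

/-! ### The component Lagrangian -/

section ComponentParity

variable {κ ι : Type} [Fintype κ] [DecidableEq κ] [Fintype ι] [DecidableEq ι] {X : ι → Gr κ}

theorem IsOdd.smul_act (hX : IsOdd X) (r : ℂ) (J : Matrix ι ι ℂ) : IsOdd (r • act J X) :=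
    fun M => by
  simp only [Pi.smul_apply, act_apply, map_smul, map_sum, hX _, smul_neg, Finset.sum_neg_distrib]

theorem IsEven.act (hX : IsEven X) (J : Matrix ι ι ℂ) : IsEven (act J X) := fun M => by
  simp only [act_apply, map_smul, map_sum, hX _]

theorem IsEven.neg (hX : IsEven X) : IsEven (-X) := fun M => by
  rw [Pi.neg_apply, map_neg, hX]

theorem leftD_smul_act {k : κ} (hX : ∀ M, leftD k (X M) = 0) (r : ℂ) (J : Matrix ι ι ℂ) (M : ι) :
    leftD k ((r • act J X) M) = 0 := by
  simp only [Pi.smul_apply, act_apply, map_smul, map_sum, hX, smul_zero, Finset.sum_const_zero]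

theorem leftD_act {k : κ} (hX : ∀ M, leftD k (X M) = 0) (J : Matrix ι ι ℂ) (M : ι) :
    leftD k (act J X M) = 0 := by
  simp only [act_apply, map_smul, map_sum, hX, smul_zero, Finset.sum_const_zero]

theorem leftD_neg_act {k : κ} (hX : ∀ M, leftD k (X M) = 0) (J : Matrix ι ι ℂ) (M : ι) :
    leftD k ((-act J X) M) = 0 := by
  rw [Pi.neg_apply, map_neg, leftD_act hX, neg_zero]

end ComponentParity

/-! ### The Berezin integral in components. -/

section Lagrangian

variable {n m : ℕ} {U : Set (Pt n m)} {L : Pt n m → ℝ} {x : Pt n m}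

theorem isEven_sfComponents (v w : Pt n m) : (sfComponents v w).IsEven := by
  have hx : ∀ (i : Fin 4) M, leftD (Sum.inl i) (xi M : SGr n m) = 0 := fun i M =>
    leftD_inl_gen_inr i (Sum.inl M)
  have hx' : ∀ (i : Fin 4) M, leftD (Sum.inl i) (xiDot M : SGr n m) = 0 := fun i M =>
    leftD_inl_gen_inr i (Sum.inr M)
  have ho : IsOdd (xi : RIdx n m → SGr n m) := fun M => parity_ι _
  have ho' : IsOdd (xiDot : RIdx n m → SGr n m) := fun M => parity_ι _
  have he : ∀ v : Pt n m, IsEven (scal v) := fun v M => AlgHom.commutes _ _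
  constructor
  · simp only [List.forall_mem_cons, List.not_mem_nil, false_imp_iff, implies_true, and_true,
      sfComponents]
    exact ⟨fun i => leftD_smul_act (hx i) _ _, fun i => leftD_smul_act (hx i) _ _,
      fun i => leftD_smul_act (hx i) _ _, fun i => leftD_smul_act (hx i) _ _,
      fun i => leftD_neg_act (leftD_scal _ v) _, fun i => leftD_act (leftD_scal _ v) _,
      fun i => leftD_neg_act (leftD_scal _ v) _, fun i => leftD_neg_act (leftD_scal _ v) _,
      fun i => leftD_act (leftD_scal _ v) _, fun i => leftD_neg_act (leftD_scal _ v) _,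
      fun i => leftD_smul_act (hx' i) _ _, fun i => leftD_smul_act (hx' i) _ _,
      fun i => leftD_smul_act (hx' i) _ _, fun i => leftD_smul_act (hx' i) _ _,
      fun i => leftD_neg_act (leftD_scal _ w) _⟩
  · simp only [List.forall_mem_cons, List.not_mem_nil, false_imp_iff, implies_true, and_true,
      sfComponents]
    exact ⟨ho.smul_act _ _, ho.smul_act _ _, ho.smul_act _ _, ho.smul_act _ _, ho'.smul_act _ _,
      ho'.smul_act _ _, ho'.smul_act _ _, ho'.smul_act _ _⟩
  · simp only [List.forall_mem_cons, List.not_mem_nil, false_imp_iff, implies_true, and_true,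
      sfComponents]
    exact ⟨((he v).act _).neg, (he v).act _, ((he v).act _).neg, ((he v).act _).neg, (he v).act _,
      ((he v).act _).neg, ((he w).act _).neg⟩

/-- The terms correspond to the partitions of the four odd derivatives into blocks: one with a
single block, seven with two, six with three and one with four. The order of the derivative of `L`
is the number of blocks. -/
theorem berezin_superPrepotential (hU : IsOpen U) (hL : ContDiffOn ℝ ∞ L U) (hx : x ∈ U)
    (v w : Pt n m) {c : Expansion n m} (hc : c = sfComponents v w) :
    berezin (superPrepotential L x v w) = ∑ M, tens1 L x M • c.tTeE M
      + (con2 (tens2 L x) c.TeE c.t - con2 (tens2 L x) c.teE c.T + con2 (tens2 L x) c.tTE c.e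
        + con2 (tens2 L x) c.E c.tTe)
      + (con2 (tens2 L x) c.eE c.tT - con2 (tens2 L x) c.TE c.te + con2 (tens2 L x) c.tE c.Te)
      + (con3 (tens3 L x) c.eE c.T c.t - con3 (tens3 L x) c.TE c.e c.t
        + con3 (tens3 L x) c.E c.Te c.t + con3 (tens3 L x) c.tE c.e c.T
        - con3 (tens3 L x) c.E c.te c.T + con3 (tens3 L x) c.E c.e c.tT)
      + con4 (tens4 L x) c.E c.e c.T c.t := by
  have hce : c.IsEven := hc ▸ isEven_sfComponents v w
  have hN := hce.isEven_eval
  have h2 := tens2_comm hU hL hx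
  have h3 := isSym3_tens3 hU hL hx
  have h4 := isSym4_tens4 hU hL hx
  obtain ⟨⟨a0, a1, a2, a3⟩, ⟨b1, b2, b3, b4, b5, b6⟩, ⟨c1, c2, c3, c4⟩, d, hρ⟩ := hce.body_dVec
  rw [← body_berezin, berezin, superPrepotential_eq hU hL hx, sfSoul_eq, ← hc,
    leftD_chain hN (leftD_taylor0 hN _ h2 h3 h4) (leftD_taylor1 hN h3 h4) (leftD_taylor2 hN h4)
      leftD_taylor3]
  simp only [map_add, map_sub, map_neg, map_coe1 hρ, map_coe2 hρ, map_coe3 hρ, map_coe4, a0, a1, a2,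
    a3, b1, b2, b3, b4, b5, b6, c1, c2, c3, c4, LinearMap.neg_apply, neg_neg]
  have d' := congrFun d
  simp only [d']
  abel

end Lagrangian

/-! ### Algebraic identities behind the component Lagrangian. -/

section Identities

variable {n m : ℕ} {G : Type} [Ring G] [Algebra ℂ G]

/-- In each pair the repeated rotations vanish and the two cross terms agree; with `r² = 1 / 2` the
pairs give `-i` and `i`, whose product is `1`. Reordering the labels `2, 3, 0, 1` is an even
permutation. -/
theorem con4_rotated {T : RIdx n m → RIdx n m → RIdx n m → RIdx n m → ℂ} (hT : IsSym4 T)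
    {Ψ : RIdx n m → G} (hΨ : AntiComm Ψ Ψ) {r : ℂ} (hr : r * r = 1 / 2) :
    con4 T (r • act (JT 2 - Complex.I • JT 3) Ψ) (-r • act (JT 2 + Complex.I • JT 3) Ψ)
        (-r • act (JT 0 + Complex.I • JT 1) Ψ) (r • act (JT 0 - Complex.I • JT 1) Ψ)
      = con4 T (act (JT 0) Ψ) (act (JT 1) Ψ) (act (JT 2) Ψ) (act (JT 3) Ψ) := by
  have h := fun a b => hΨ.act (JT a) (JT b)
  have front : ∀ Z W, con4 T (r • act (JT 2 - Complex.I • JT 3) Ψ)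
      (-r • act (JT 2 + Complex.I • JT 3) Ψ) Z W
      = (-Complex.I) • con4 T (act (JT 2) Ψ) (act (JT 3) Ψ) Z W := fun Z W => by
    rw [sub_eq_add_neg, ← neg_smul]
    simp only [act_add_left, act_smul_left, map_smul, map_add, LinearMap.smul_apply,
      LinearMap.add_apply,
      con4_swap12 hT.swap12 (h 3 2), eq_zero_of_eq_neg (con4_swap12 hT.swap12 (h 2 2) Z W),
      eq_zero_of_eq_neg (con4_swap12 hT.swap12 (h 3 3) Z W)]
    match_scalars
    linear_combination (-2 * Complex.I) * hr
  have back : ∀ X Y, con4 T X Y (-r • act (JT 0 + Complex.I • JT 1) Ψ)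
      (r • act (JT 0 - Complex.I • JT 1) Ψ)
      = Complex.I • con4 T X Y (act (JT 0) Ψ) (act (JT 1) Ψ) := fun X Y => by
    rw [sub_eq_add_neg, ← neg_smul]
    simp only [act_add_left, act_smul_left, map_smul, map_add, LinearMap.smul_apply,
      LinearMap.add_apply,
      con4_swap34 hT.swap34 (h 1 0), eq_zero_of_eq_neg (con4_swap34 hT.swap34 (h 0 0) X Y),
      eq_zero_of_eq_neg (con4_swap34 hT.swap34 (h 1 1) X Y)]
    match_scalars
    linear_combination (2 * Complex.I) * hr
  rw [front, back, con4_swap23 hT.swap23 (h 3 0), con4_swap12 hT.swap12 (h 2 0),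
    con4_swap34 hT.swap34 (h 3 1), con4_swap23 hT.swap23 (h 2 1), smul_smul, neg_mul,
    Complex.I_mul_I]
  simp only [neg_neg, one_smul]

end Identities

section Identities

variable {n m : ℕ} {G : Type} [Ring G] [Algebra ℂ G]
variable {T : RIdx n m → RIdx n m → RIdx n m → ℂ} {t : RIdx n m → RIdx n m → ℂ}
variable {Ψ Φ y : RIdx n m → G} {r : ℂ}

set_option maxHeartbeats 4000000 in
/-- The terms of the superfield Lagrangian with one velocity and two fermions. -/
theorem lagrangian_gauge (hT : IsSym3 T) (hΨ : AntiComm Ψ Ψ) (hy : Central y)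
    (hr : r * r = 1 / 2) :
    con3 T (-act (JB 1 - JB 5) y) (-r • act (JT 0 + Complex.I • JT 1) Ψ)
        (r • act (JT 0 - Complex.I • JT 1) Ψ)
      - con3 T (act (Complex.I • JB 2 + JB 3) y) (-r • act (JT 2 + Complex.I • JT 3) Ψ)
        (r • act (JT 0 - Complex.I • JT 1) Ψ)
      + con3 T (r • act (JT 2 - Complex.I • JT 3) Ψ) (-act (Complex.I • JB 6 - JB 7) y)
        (r • act (JT 0 - Complex.I • JT 1) Ψ)
      + con3 T (-act (Complex.I • JB 6 + JB 7) y) (-r • act (JT 2 + Complex.I • JT 3) Ψ)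
        (-r • act (JT 0 + Complex.I • JT 1) Ψ)
      - con3 T (r • act (JT 2 - Complex.I • JT 3) Ψ) (act (Complex.I • JB 2 - JB 3) y)
        (-r • act (JT 0 + Complex.I • JT 1) Ψ)
      + con3 T (r • act (JT 2 - Complex.I • JT 3) Ψ) (-r • act (JT 2 + Complex.I • JT 3) Ψ)
        (-act (JT 1) y)
      = (4 : ℂ) • gaugeForm T y Ψ Ψ
        - Complex.I • (con3 T y (act (JB 0) Ψ) (act (JB 4) Ψ)
          + con3 T y (act (JB 1) Ψ) (act (JB 5) Ψ) + con3 T y (act (JB 2) Ψ) (act (JB 6) Ψ)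
          + con3 T y (act (JB 3) Ψ) (act (JB 7) Ψ)) := by
  obtain ⟨u, hu, sort, self⟩ := exists_array_even hT hΨ y
  -- The boundary terms contain the unrotated velocity, which is split into sectors to receive
  -- labels.
  have hy0 : ∀ X Z, con3 T y X Z = con3 T (act (JB 0) y) X Z + con3 T (act (JB 4) y) X Z := by
    intro X Z
    rw [← LinearMap.add_apply, ← LinearMap.add_apply, ← map_add, ← act_add_left,
      JB_zero_add_JB_four, act_one]
  have hr' : ∀ z : G, r • r • z = (1 / 2 : ℂ) • z := fun z => by rw [smul_smul, hr]
  simp only [hy0, gaugeForm, JT, Matrix.cons_val, act_add_left, act_sub_left, act_smul_left,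
    map_smul, neg_smul, LinearMap.smul_apply, map_neg, LinearMap.neg_apply, smul_neg, neg_neg, hr']
  simp [act_add_left, act_sub_left, act_smul_left]
  simp only [con3_JB_front2 hT hy, con3_JB_front3 hT hy, hu]
  simp (discharger := decide) only [Fin.isValue, Fin.coe_ofNat_eq_mod, Nat.reduceMod, sort, self]
  match_scalars <;> ring_nf <;> (try simp only [Complex.I_sq, Complex.I_pow_three]) <;> try ring_nf

/-- The terms of the superfield Lagrangian with two velocities. -/
theorem lagrangian_kinetic (ht : ∀ M N, t M N = t N M) (hy : Central y) :
    con2 t (-act (JB 1 - JB 5) y) (-act (JT 1) y)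
      - con2 t (act (Complex.I • JB 2 + JB 3) y) (act (Complex.I • JB 2 - JB 3) y)
      + con2 t (-act (Complex.I • JB 6 + JB 7) y) (-act (Complex.I • JB 6 - JB 7) y)
      = (2 : ℂ) • bilinForm t y y - con2 t y (act (JB 0 - JB 4) y) := by
  have comm : ∀ {i j : Fin 8}, j < i → con2 t (act (JB i) y) (act (JB j) y)
      = con2 t (act (JB j) y) (act (JB i) y) := fun _ => con2_comm ht (hy.act _)
  have hy0 : ∀ Z, con2 t y Z = con2 t (act (JB 0) y) Z + con2 t (act (JB 4) y) Z := by
    intro Z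
    rw [← LinearMap.add_apply, ← map_add, ← act_add_left, JB_zero_add_JB_four, act_one]
  rw [hy0]
  simp [bilinForm, JT, act_add_left, act_sub_left, act_smul_left]
  simp (discharger := decide) only [comm]
  match_scalars <;> ring_nf <;> simp only [Complex.I_sq, neg_neg]

set_option maxHeartbeats 1000000 in
/-- The terms of the superfield Lagrangian with a fermion and the velocity of a fermion. -/
theorem lagrangian_fermion (ht : ∀ M N, t M N = t N M) (hΦ : AntiComm Φ Ψ)
    (hr : r * r = 1 / 2) :
    con2 t (-r • act (Complex.I • (JB 0 - JB 4) - (JB 1 - JB 5)) Φ)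
        (r • act (JT 0 - Complex.I • JT 1) Ψ)
      - con2 t (-r • act (Complex.I • (JB 0 - JB 4) + (JB 1 - JB 5)) Φ)
        (-r • act (JT 0 + Complex.I • JT 1) Ψ)
      + con2 t (r • act (Complex.I • (JB 2 - JB 6) + (JB 3 - JB 7)) Φ)
        (-r • act (JT 2 + Complex.I • JT 3) Ψ)
      + con2 t (r • act (JT 2 - Complex.I • JT 3) Ψ)
        (r • act (Complex.I • (JB 2 - JB 6) - (JB 3 - JB 7)) Φ)
      = (2 * Complex.I) • bilinForm t Ψ Φ
        - Complex.I • (con2 t (act (JB 0) Φ) (act (JB 4) Ψ) + con2 t (act (JB 1) Φ) (act (JB 5) Ψ)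
          + con2 t (act (JB 2) Φ) (act (JB 6) Ψ) + con2 t (act (JB 3) Φ) (act (JB 7) Ψ)
          + (con2 t (act (JB 0) Ψ) (act (JB 4) Φ) + con2 t (act (JB 1) Ψ) (act (JB 5) Φ)
          + con2 t (act (JB 2) Ψ) (act (JB 6) Φ) + con2 t (act (JB 3) Ψ) (act (JB 7) Φ))) := by
  have swap : ∀ i j : Fin 8, con2 t (act (JB i) Φ) (act (JB j) Ψ)
      = -con2 t (act (JB j) Ψ) (act (JB i) Φ) := fun i j => con2_swap ht (hΦ.act _ _)
  have hr' : ∀ z : G, r • r • z = (1 / 2 : ℂ) • z := fun z => by rw [smul_smul, hr]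
  simp only [bilinForm, JT, Matrix.cons_val, act_add_left, act_sub_left, act_smul_left, map_smul,
    neg_smul, LinearMap.smul_apply, map_neg, LinearMap.neg_apply, smul_neg, neg_neg, hr']
  simp
  simp only [swap]
  match_scalars <;> ring_nf

end Identities

/-! ### The boundary function and the component form. -/

section ComponentForm

variable {n m : ℕ} {U : Set (Pt n m)} {L : Pt n m → ℝ} {x : Pt n m}

/-- The bilinear form that couples the two sectors in the total derivative. -/
def mixedForm {G : Type} [Ring G] [Algebra ℂ G] (t : RIdx n m → RIdx n m → ℂ)
    (X Y : RIdx n m → G) : G :=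
  con2 t (act (JB 0) X) (act (JB 4) Y) + con2 t (act (JB 1) X) (act (JB 5) Y)
    + con2 t (act (JB 2) X) (act (JB 6) Y) + con2 t (act (JB 3) X) (act (JB 7) Y)

/-- The function under the total derivative: the term linear in the velocities. -/
def boundaryOne (L : Pt n m → ℝ) (x : Pt n m) (M : RIdx n m) : ℂ :=
  ∑ S, -(1 / 4) * (JB 0 - JB 4 : Matrix (RIdx n m) (RIdx n m) ℂ) M S * tens1 L x S

/-- The function under the total derivative: the term bilinear in the fermions. -/
def boundaryTwo (L : Pt n m → ℝ) (x : Pt n m) (M N : RIdx n m) : ℂ :=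
  -(Complex.I / 4) * mixedForm (tens2 L x) (Pi.single M (1 : ℂ)) (Pi.single N (1 : ℂ))

theorem con2_mixedForm_single {G : Type} [Ring G] [Algebra ℂ G] (t : RIdx n m → RIdx n m → ℂ)
    (c : ℂ) (X Y : RIdx n m → G) :
    con2 (fun M N => c * mixedForm t (Pi.single M (1 : ℂ)) (Pi.single N (1 : ℂ))) X Y
      = c • mixedForm t X Y := by
  simp only [mixedForm, act_single, con2_act, con2_smul_tensor, con2_add_tensor]

theorem con2_boundaryTwo {G : Type} [Ring G] [Algebra ℂ G] (x : Pt n m) (X Y : RIdx n m → G) :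
    con2 (boundaryTwo L x) X Y = -(Complex.I / 4) • mixedForm (tens2 L x) X Y :=
  con2_mixedForm_single _ _ X Y

theorem contDiffOn_mixedForm {t : Pt n m → RIdx n m → RIdx n m → ℂ}
    (ht : ∀ M N, ContDiffOn ℝ ∞ (fun y => t y M N) U) (X Y : RIdx n m → ℂ) :
    ContDiffOn ℝ ∞ (fun y => mixedForm (t y) X Y) U :=
  (((contDiffOn_con2 ht _ _).add (contDiffOn_con2 ht _ _)).add (contDiffOn_con2 ht _ _)).add
    (contDiffOn_con2 ht _ _)

theorem contDiffOn_boundaryOne (hU : IsOpen U) (hL : ContDiffOn ℝ ∞ L U) (M : RIdx n m) :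
    ContDiffOn ℝ ∞ (fun y => boundaryOne L y M) U :=
  ContDiffOn.sum fun S _ => contDiffOn_const.mul (contDiffOn_tens1 hU hL S)

theorem contDiffOn_boundaryTwo (hU : IsOpen U) (hL : ContDiffOn ℝ ∞ L U) (M N : RIdx n m) :
    ContDiffOn ℝ ∞ (fun y => boundaryTwo L y M N) U :=
  contDiffOn_const.mul (contDiffOn_mixedForm (contDiffOn_tens2 hU hL) _ _)

theorem pd_boundaryOne (hU : IsOpen U) (hL : ContDiffOn ℝ ∞ L U) (hx : x ∈ U) (M N : RIdx n m) :
    pd (fun y => boundaryOne L y M) N x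
      = ∑ S, -(1 / 4) * (JB 0 - JB 4 : Matrix (RIdx n m) (RIdx n m) ℂ) M S * tens2 L x N S := by
  have h : ∀ S, DifferentiableAt ℝ (fun y => tens1 L y S) x := fun S =>
    differentiableAt_of_contDiffOn hU (contDiffOn_tens1 hU hL S) hx
  unfold boundaryOne
  rw [pd_sum _ fun S _ => (h S).const_mul _]
  exact Finset.sum_congr rfl fun S _ => by rw [pd_const_smul (h S), pd_tens1 hU hL hx]

theorem pd_boundaryTwo (hU : IsOpen U) (hL : ContDiffOn ℝ ∞ L U) (hx : x ∈ U)
    (M N K : RIdx n m) :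
    pd (fun y => boundaryTwo L y M N) K x
      = -(Complex.I / 4) * mixedForm (tens3 L x K) (Pi.single M (1 : ℂ)) (Pi.single N (1 : ℂ)) := by
  have h2 := contDiffOn_tens2 hU hL
  have h : ∀ X Y, DifferentiableAt ℝ (fun y => con2 (tens2 L y) X Y) x := fun X Y =>
    differentiableAt_of_contDiffOn hU (contDiffOn_con2 h2 X Y) hx
  have hd : ∀ M N, DifferentiableAt ℝ (fun y => tens2 L y M N) x := fun M N =>
    differentiableAt_of_contDiffOn hU (h2 M N) hx
  unfold boundaryTwo
  rw [pd_const_smul (differentiableAt_of_contDiffOn hU (contDiffOn_mixedForm h2 _ _) hx)]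
  unfold mixedForm
  rw [pd_add (((h _ _).fun_add (h _ _)).fun_add (h _ _)) (h _ _),
    pd_add ((h _ _).fun_add (h _ _)) (h _ _), pd_add (h _ _) (h _ _)]
  simp only [pd_con2 hd, pd_tens2 hU hL hx]

theorem act_scal (J : Matrix (RIdx n m) (RIdx n m) ℂ) (v : Pt n m) (M : RIdx n m) :
    act J (scal v) M = algebraMap ℂ (SGr n m) (∑ S, J S M * v S) := by
  simp only [act_apply, scal, map_sum, map_mul, Algebra.smul_def]

theorem con2_scal (t : RIdx n m → RIdx n m → ℂ) (v w : Pt n m) :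
    con2 t (scal v) (scal w) = algebraMap ℂ (SGr n m) (∑ M, ∑ N, t M N * v M * w N) := by
  simp only [con2_apply, scal, map_sum, map_mul, Algebra.smul_def, mul_assoc]

theorem con3_scal (t : RIdx n m → RIdx n m → RIdx n m → ℂ) (v : Pt n m) (Y Z : RIdx n m → SGr n m) :
    con3 t (scal v) Y Z = ∑ M, ∑ N, ∑ K, ((v M : ℂ) * t M N K) • (Y N * Z K) := by
  simp only [con3_eq_mul_con2, con2_apply, scal, ← Algebra.smul_def, Finset.smul_sum, smul_smul]

theorem componentLagrangian_eq (hU : IsOpen U) (hL : ContDiffOn ℝ ∞ L U) (hx : x ∈ U)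
    (v : Pt n m) :
    componentLagrangian (metric L) (gaugeCoeff L) (quarticCoeff L) x v
      = (1 / 2 : ℂ) • bilinForm (tens2 L x) (scal v) (scal v)
        + (Complex.I / 2) • bilinForm (tens2 L x) xi xiDot
        + gaugeForm (tens3 L x) (scal v) xi xi
        + (1 / 4 : ℂ) • con4 (tens4 L x) (act (JT 0) xi) (act (JT 1) xi) (act (JT 2) xi)
          (act (JT 3) xi) := by
  rw [← con2_metric hU hL hx, ← con2_metric hU hL hx, ← con3_gaugeCoeff, con2_scal, con3_scal,
    componentLagrangian, map_mul, ← Algebra.smul_def, sub_eq_add_neg]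
  congr 1
  rw [← neg_neg ((1 / 4 : ℂ) • _), ← neg_smul, ← con4_quarticCoeff, con4_apply]
  simp only [mul_assoc]

/-- The first function is chosen to reproduce the only acceleration in the Berezin integral, that of
the top component. The second collects the intersectoral terms left over in `lagrangian_gauge` and
`lagrangian_fermion`. -/
theorem totalDerivative_boundary (hU : IsOpen U) (hL : ContDiffOn ℝ ∞ L U) (hx : x ∈ U)
    (v w : Pt n m) :
    totalDerivative (boundaryOne L) (boundaryTwo L) x v w
      = -(1 / 4 : ℂ) • con2 (tens2 L x) (scal v) (act (JB 0 - JB 4) (scal v))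
        - (1 / 4 : ℂ) • ∑ M, tens1 L x M • act (JB 0 - JB 4) (scal w) M
        - (Complex.I / 4) • (con3 (tens3 L x) (scal v) (act (JB 0) xi) (act (JB 4) xi)
          + con3 (tens3 L x) (scal v) (act (JB 1) xi) (act (JB 5) xi)
          + con3 (tens3 L x) (scal v) (act (JB 2) xi) (act (JB 6) xi)
          + con3 (tens3 L x) (scal v) (act (JB 3) xi) (act (JB 7) xi))
        - (Complex.I / 4) • (mixedForm (tens2 L x) xiDot xi + mixedForm (tens2 L x) xi xiDot) := by
  have e1 : algebraMap ℂ (SGr n m) (∑ M, ∑ N, pd (fun y => boundaryOne L y M) N x * v N * v M)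
      = -(1 / 4 : ℂ) • con2 (tens2 L x) (scal v) (act (JB 0 - JB 4) (scal v)) := by
    simp only [con2_apply, act_scal, pd_boundaryOne hU hL hx, scal, ← map_mul, Algebra.smul_def,
      ← map_sum]
    congr 1
    simp only [Finset.mul_sum, Finset.sum_mul]
    rw [Finset.sum_comm]
    refine Finset.sum_congr rfl fun N _ => ?_
    rw [Finset.sum_comm]
    exact Finset.sum_congr rfl fun S _ => Finset.sum_congr rfl fun M _ => by ring
  have e2 : algebraMap ℂ (SGr n m) (∑ M, boundaryOne L x M * w M)
      = -((1 / 4 : ℂ) • ∑ M, tens1 L x M • act (JB 0 - JB 4) (scal w) M) := by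
    simp only [act_scal, boundaryOne, Algebra.smul_def, ← map_mul, ← map_sum, ← map_neg]
    congr 1
    simp only [Finset.mul_sum, Finset.sum_mul, ← Finset.sum_neg_distrib]
    rw [Finset.sum_comm]
    exact Finset.sum_congr rfl fun S _ => Finset.sum_congr rfl fun M _ => by ring
  have e3 : ∑ M, ∑ N, (∑ K, pd (fun y => boundaryTwo L y M N) K x * v K) • (xi M * xi N : SGr n m)
      = -((Complex.I / 4) • (con3 (tens3 L x) (scal v) (act (JB 0) xi) (act (JB 4) xi)
          + con3 (tens3 L x) (scal v) (act (JB 1) xi) (act (JB 5) xi)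
          + con3 (tens3 L x) (scal v) (act (JB 2) xi) (act (JB 6) xi)
          + con3 (tens3 L x) (scal v) (act (JB 3) xi) (act (JB 7) xi))) := by
    have h : ∀ K, con2 (fun M N => pd (fun y => boundaryTwo L y M N) K x) xi xi
        = -(Complex.I / 4) • mixedForm (tens3 L x K) (xi : RIdx n m → SGr n m) xi := fun K => by
      simp only [pd_boundaryTwo hU hL hx, con2_mixedForm_single]
    rw [← con2_apply]
    simp only [mul_comm _ (v _ : ℂ), con2_sum_tensor, h, con3_eq_mul_con2, scal, mixedForm,
      ← Algebra.smul_def, smul_add, Finset.sum_add_distrib, Finset.smul_sum, neg_smul, smul_neg,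
      Finset.sum_neg_distrib, neg_add, smul_comm (Complex.I / 4)]
  have e4 : ∑ M, ∑ N, boundaryTwo L x M N • (xiDot M * xi N + xi M * xiDot N : SGr n m)
      = -((Complex.I / 4) • (mixedForm (tens2 L x) xiDot xi + mixedForm (tens2 L x) xi xiDot)) := by
    simp only [smul_add, Finset.sum_add_distrib, ← con2_apply, con2_boundaryTwo, neg_smul, neg_add]
  rw [totalDerivative, map_add, e1, e2, e3, e4]
  abel

/-- The terms separate by their content of velocities, accelerations and fermions. Each group is one
of the preceding identities, and what they leave besides the component Lagrangian is the total
derivative; the factor `1 / 4` of the action then normalizes `A` and `F`. -/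
theorem hasComponentForm (hU : IsOpen U) (hL : ContDiffOn ℝ ∞ L U) :
    HasComponentForm U L (gaugeCoeff L) (quarticCoeff L) := by
  refine ⟨boundaryOne L, boundaryTwo L, contDiffOn_boundaryOne hU hL,
    contDiffOn_boundaryTwo hU hL, fun x hx v w => ?_⟩
  -- The number `√2 / 2` is the weight of the fermions in the components of the real superfields,
  -- and only its square enters the Lagrangian.
  have hr : (Real.sqrt 2 / 2 : ℂ) * (Real.sqrt 2 / 2) = 1 / 2 := by
    have h : (Real.sqrt 2 : ℂ) * Real.sqrt 2 = 2 := by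
      exact_mod_cast Real.mul_self_sqrt zero_le_two
    linear_combination h / 4
  have hξ : AntiComm (xi : RIdx n m → SGr n m) xi :=
    IsLin.antiComm (fun M => ⟨_, rfl⟩) (fun M => ⟨_, rfl⟩)
  have hξ' : AntiComm (xiDot : RIdx n m → SGr n m) xi :=
    IsLin.antiComm (fun M => ⟨_, rfl⟩) (fun M => ⟨_, rfl⟩)
  have hv : Central (scal v) := fun M y => Algebra.commutes _ _
  rw [componentLagrangian_eq hU hL hx, totalDerivative_boundary hU hL hx, superLagrangian,
    berezin_superPrepotential hU hL hx v w rfl]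
  simp only [sfComponents]
  rw [lagrangian_gauge (isSym3_tens3 hU hL hx) hξ hv hr,
    lagrangian_kinetic (tens2_comm hU hL hx) hv,
    lagrangian_fermion (tens2_comm hU hL hx) hξ' hr, con4_rotated (isSym4_tens4 hU hL hx) hξ hr]
  simp only [Pi.neg_apply, smul_neg, Finset.sum_neg_distrib, mixedForm]
  module

end ComponentForm

end BiHKT

end

theorem theorem1 (n m : ℕ) (hn : 0 < n) (hm : 0 < m)
    (U : Set (BiHKT.Pt n m)) (hU : IsOpen U)
    (L : BiHKT.Pt n m → ℝ) (hL : ContDiffOn ℝ ∞ L U)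
    (hg : ∀ x ∈ U, (BiHKT.metric L x).PosDef) :
    ∃ (C : BiHKT.Pt n m → BiHKT.RIdx n m → BiHKT.RIdx n m → BiHKT.RIdx n m → ℝ)
      (H : Fin 3 → BiHKT.Pt n m → BiHKT.RIdx n m → BiHKT.RIdx n m → BiHKT.RIdx n m → ℝ)
      (A : BiHKT.Pt n m → BiHKT.RIdx n m → BiHKT.RIdx n m → BiHKT.RIdx n m → ℂ)
      (F : BiHKT.Pt n m →
        BiHKT.RIdx n m → BiHKT.RIdx n m → BiHKT.RIdx n m → BiHKT.RIdx n m → ℂ),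
      -- the target is a bi-HKT manifold
      BiHKT.IsBiHKT U (BiHKT.metric L) BiHKT.cliffordTriple C H ∧
      -- the component form of the superfield action
      BiHKT.HasComponentForm U L A F ∧
      ∀ e, BiHKT.IsVielbein U (BiHKT.metric L) e →
        -- the four supercharges are real
        (∀ a, ∀ z : BiHKT.Phase n m, z.1 ∈ U →
          BiHKT.grConj (BiHKT.realCharges L e C H a z) = BiHKT.realCharges L e C H a z) ∧
        -- they are equivalent to the complex supercharges
        (∀ z : BiHKT.Phase n m, z.1 ∈ U →
          (Real.sqrt 2 : ℂ) • BiHKT.chargeS L e z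
            = BiHKT.realCharges L e C H 0 z - Complex.I • BiHKT.realCharges L e C H 1 z ∧
          (Real.sqrt 2 : ℂ) • BiHKT.chargeSbar L e z
            = BiHKT.realCharges L e C H 0 z + Complex.I • BiHKT.realCharges L e C H 1 z ∧
          (Real.sqrt 2 : ℂ) • BiHKT.chargeR L e z
            = -BiHKT.realCharges L e C H 2 z + Complex.I • BiHKT.realCharges L e C H 3 z ∧
          (Real.sqrt 2 : ℂ) • BiHKT.chargeRbar L e z
            = -BiHKT.realCharges L e C H 2 z - Complex.I • BiHKT.realCharges L e C H 3 z) ∧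
        -- the `N = 4` supersymmetry algebra, with the Hamiltonian of the model
        ∀ a b, ∀ z : BiHKT.Phase n m, z.1 ∈ U →
          BiHKT.bracket (BiHKT.realCharges L e C H a) (BiHKT.realCharges L e C H b) z
            = if a = b then
                (-2 * Complex.I) • BiHKT.hamiltonian (BiHKT.metric L) A F e z
              else 0 := by
  -- The witnesses are built from `L` alone and are fixed before any vielbein is chosen.
  refine ⟨BiHKT.torsion L, BiHKT.holTorsion L, BiHKT.gaugeCoeff L, BiHKT.quarticCoeff L,
    BiHKT.isBiHKT hn hm hU hL hg, BiHKT.hasComponentForm hU hL, fun e he =>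
    ⟨fun a z hz => ?_, fun z hz => ?_,
      fun a b z hz => BiHKT.bracket_realCharges hU hL hg he hz a b⟩⟩
  · rw [BiHKT.realCharges_eq hU hL hg he hz]
    exact BiHKT.grConj_superCharge L e a z
  · simp only [BiHKT.realCharges_eq hU hL hg he hz]
    exact ⟨BiHKT.sqrt_two_smul_chargeS hU hL hz, BiHKT.sqrt_two_smul_chargeSbar hU hL hz,
      BiHKT.sqrt_two_smul_chargeR hU hL hz, BiHKT.sqrt_two_smul_chargeRbar hU hL hz⟩
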